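/- Let $b>0$. For $0<b\le 1$ consider in $\mathbb C$ the angle $|\arg z|\le \pi b$; for arbitrary $b>0$ consider the same angle on the helical Riemann surface (the universal covering of $\mathbb C\setminus\{0\}$). A wedge-shaped region is a bounded simply connected open subset $\Omega$ of the open angle whose boundary consists of a simple curve $\Gamma$ that connects the two sides of the angle (its end points lie on the sides, different from the vertex $0$; between the end points it lies in the open angle and is regular of class $C^2$), is symmetric in the real axis, and of the segments of the two sides from $0$ to the end points of $\Gamma$. Say that $\Omega$ solves the Hele-Shaw problem with killing condition on the sides of the angle if there is a function $\Phi$, harmonic in $\Omega$, $C^2$ up to $\Gamma$ (end points excluded), continuous up to the boundary except at $0$, such that $\Phi=0$ on $\Gamma$ and on the sides, $\Phi\sim-\mathrm{Re}(z^{-1/(2b)})$ as $z\to 0$ in $\Omega$, and the infinitesimal deformation of $\Gamma$ by the normal derivative of $\Phi$ is homothetic, i.e. for some constant $c$ one has $\partial\Phi/\partial n=c\,\langle z,n\rangle$ at every point $z\in\Gamma$ other than the end points, where $n$ is the outward unit normal. Let $S=\{\zeta:\ 0<|\zeta|<1,\ |\arg\zeta|<\pi b\}$ (on the Riemann surface if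 $b>1$), and let $$f(\zeta)=\zeta\,F\!\left(-\tfrac12,\,2b,\,2b+\tfrac32;\,-\zeta^{1/b}\right),\qquad F(\alpha,\beta,\gamma;z)=\sum_{n\ge0}z^n\prod_{j=0}^{n-1}\frac{(\alpha+j)(\beta+j)}{(1+j)(\gamma+j)} .$$ By a conformal map of the sector onto a region $\Omega$ we mean a holomorphic bijection $S\to\Omega$ that extends continuously to the closed sector, maps the straight sides bijectively onto the straight sides, and satisfies $\varphi(0)=0$, $\varphi'(0)>0$. Then, in the plane for $0<b\le1$ and on the Riemann surface for every $b>0$: 1. For every $r>0$ the region $r f(S)$ solves the problem. 2. Conversely, for every region $\Omega$ that solves the problem there is an $r>0$ such that $rf$ is the one and only conformal map of the sector onto $\Omega$. In particular $\Omega=rf(S)$, so the solution is unique up to scaling. 3. With $D=\zeta\,\frac{d}{d\zeta}$, the function $f$ satisfies on $S$ the differential equation $$D^2f+\frac1{2b}\,\frac{1-\zeta^{1/b}}{1+\zeta^{1/b}}\,Df=\Bigl(1+\frac1{2b}\Bigr)f,$$ and it is the only solution of the form $\zeta\,g(\zeta^{1/b})$ with $g$ holomorphic in the unit disk and $g(0)=1$.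 -/

import Mathlib

open Complex Set Filter Topology InnerProductSpace Asymptotics

noncomputable section

/-! ### The explicit map -/

/-- `F(-1/2, 2b, 2b + 3/2; -w)`, where `F` is the Gauss hypergeometric series. -/
def hypFactor (b : ℝ) (w : ℂ) : ℂ :=
  ordinaryHypergeometric (-1 / 2 : ℂ) (2 * b : ℂ) (2 * b + 3 / 2 : ℂ) (-w)

/-- `f(ζ) = ζ F(-1/2, 2b, 2b + 3/2; -ζ^{1/b})`, with the principal power. -/
def wedgeMap (b : ℝ) (ζ : ℂ) : ℂ :=
  ζ * hypFactor b (ζ ^ (1 / b : ℂ))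

/-- The operator `D = ζ d/dζ`. -/
def eulerD (f : ℂ → ℂ) (ζ : ℂ) : ℂ := ζ * deriv f ζ

/-! ### The problem in the plane (`0 < b ≤ 1`) -/

/-- The open angle `|arg z| < πb` with vertex `0`. -/
def openAngle (b : ℝ) : Set ℂ := {z | z ≠ 0 ∧ |z.arg| < Real.pi * b}

/-- The open circular sector `0 < |ζ| < 1`, `|arg ζ| < πb`. -/
def openSector (b : ℝ) : Set ℂ := {ζ | ζ ≠ 0 ∧ ‖ζ‖ < 1 ∧ |ζ.arg| < Real.pi * b}

/-- The closed circular sector `|ζ| ≤ 1`, `|arg ζ| ≤ πb`. -/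
def closedSector (b : ℝ) : Set ℂ := {ζ | ‖ζ‖ ≤ 1 ∧ |ζ.arg| ≤ Real.pi * b}

/-- The ray `{r e^{iθ} : r ≥ 0}`. -/
def rayAt (θ : ℝ) : Set ℂ := {z | ∃ r : ℝ, 0 ≤ r ∧ z = r * exp (θ * I)}

/-- `n` is the outward unit normal at the point `γ t` of the curve `γ`,
which bounds the region `Ω` near that point. -/
def IsOutwardUnitNormal (Ω : Set ℂ) (γ : ℝ → ℂ) (t : ℝ) (n : ℂ) : Prop :=
  ‖n‖ = 1 ∧ inner ℝ (deriv γ t) n = 0 ∧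
    ∀ᶠ ε : ℝ in 𝓝[>] 0, γ t - ε * n ∈ Ω ∧ γ t + ε * n ∉ Ω

/-- `Ω` is a wedge-shaped region bounded by the sides of the angle `|arg z| ≤ πb` and by a
simple curve `γ : [0, 1] → ℂ` (twice continuously differentiable and regular between its
endpoints) that connects the two sides and is symmetric in the real axis. -/
structure IsWedgeRegion (b : ℝ) (γ : ℝ → ℂ) (Ω : Set ℂ) : Prop where
  continuousOn : ContinuousOn γ (Icc 0 1)
  injOn : InjOn γ (Ioo 0 1)
  mapsTo : MapsTo γ (Ioo 0 1) (openAngle b)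
  contDiffOn : ContDiffOn ℝ 2 γ (Ioo 0 1)
  regular : ∀ t ∈ Ioo (0 : ℝ) 1, deriv γ t ≠ 0
  symmetric : (starRingEnd ℂ) '' (γ '' Icc 0 1) = γ '' Icc 0 1
  isOpen : IsOpen Ω
  isBounded : Bornology.IsBounded Ω
  isSimplyConnected : IsSimplyConnected Ω
  subset : Ω ⊆ openAngle b
  /-- The curve ends on the sides, at distance `a` from the vertex; the boundary of `Ω` consists
  of the curve and of the segments of the two sides between the vertex and these end points. -/
  boundary : ∃ a : ℝ, 0 < a ∧
    γ 0 = a * exp (((-(Real.pi * b) : ℝ) : ℂ) * I) ∧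
    γ 1 = a * exp (((Real.pi * b : ℝ) : ℂ) * I) ∧
    frontier Ω = γ '' Icc 0 1 ∪
      {z | ∃ r : ℝ, 0 ≤ r ∧ r ≤ a ∧ (z = r * exp (((-(Real.pi * b) : ℝ) : ℂ) * I) ∨
        z = r * exp (((Real.pi * b : ℝ) : ℂ) * I))}

/-- `Φ` is the potential of the wedge-shaped region `Ω`: harmonic in `Ω`, twice continuously
differentiable up to the open curve, continuous up to the boundary except at the vertex and zero
there, and `Φ ∼ -Re (z^{-1/(2b)})` near the vertex. -/
structure IsWedgePotential (b : ℝ) (γ : ℝ → ℂ) (Ω : Set ℂ) (Φ : ℂ → ℝ) : Prop where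
  harmonic : HarmonicOnNhd Φ Ω
  contDiffOn : ContDiffOn ℝ 2 Φ (Ω ∪ γ '' Ioo 0 1)
  continuousOn : ContinuousOn Φ (closure Ω \ {0})
  eq_zero : ∀ z ∈ frontier Ω, z ≠ 0 → Φ z = 0
  near_vertex : IsEquivalent (𝓝[Ω] 0) Φ (fun z => -(z ^ (-1 / (2 * b) : ℂ)).re)

/-- The region `Ω` solves the Hele-Shaw problem with the killing condition on the sides of the
angle `|arg z| ≤ πb`: the normal velocity `∂Φ/∂n` of the curve is that of a dilation,
i.e. `∂Φ/∂n = c ⟨z, n⟩` with a constant `c`. -/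
def SolvesKillingProblem (b : ℝ) (Ω : Set ℂ) : Prop :=
  ∃ (γ : ℝ → ℂ) (Φ : ℂ → ℝ) (c : ℝ),
    IsWedgeRegion b γ Ω ∧ IsWedgePotential b γ Ω Φ ∧
    ∀ t ∈ Ioo (0 : ℝ) 1, ∃ n : ℂ, IsOutwardUnitNormal Ω γ t n ∧
      fderivWithin ℝ Φ (Ω ∪ γ '' Ioo 0 1) (γ t) n = c * inner ℝ (γ t) n

/-- `φ` is a conformal map of the circular sector onto `Ω` (extended continuously to the closed
sector) that maps the straight sides bijectively onto the straight sides,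
with `φ(0) = 0` and `φ'(0) > 0`. -/
structure IsSectorConformalMap (b : ℝ) (φ : ℂ → ℂ) (Ω : Set ℂ) : Prop where
  differentiableOn : DifferentiableOn ℂ φ (openSector b)
  bijOn : BijOn φ (openSector b) Ω
  continuousOn : ContinuousOn φ (closedSector b)
  upper : BijOn φ (frontier (openSector b) ∩ rayAt (Real.pi * b))
    (frontier Ω ∩ rayAt (Real.pi * b))
  lower : BijOn φ (frontier (openSector b) ∩ rayAt (-(Real.pi * b)))
    (frontier Ω ∩ rayAt (-(Real.pi * b)))
  map_zero : φ 0 = 0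
  deriv_zero_pos : ∃ l : ℝ, 0 < l ∧ Tendsto (fun ζ => φ ζ / ζ) (𝓝[openSector b] 0) (𝓝 (l : ℂ))

/-! ### The problem on the helical Riemann surface (every `b > 0`)

A point `z` of the universal covering of `ℂ \ {0}` is given by its logarithm `ℓ = log z ∈ ℂ`;
the projection to the plane is `ℓ ↦ exp ℓ`, the angle `|arg z| ≤ πb` is the strip `|Im ℓ| ≤ πb`,
its vertex is the end `Re ℓ → -∞`, and `D = z d/dz` is `d/dℓ`. Harmonicity does not depend on
which of the coordinates `ℓ` and `z = exp ℓ` is used. -/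

/-- The open angle, in the logarithmic coordinate. -/
def logAngle (b : ℝ) : Set ℂ := {ℓ | |ℓ.im| < Real.pi * b}

/-- The open circular sector, in the logarithmic coordinate. -/
def logSector (b : ℝ) : Set ℂ := {ℓ | ℓ.re < 0 ∧ |ℓ.im| < Real.pi * b}

/-- The closed circular sector without its vertex, in the logarithmic coordinate. -/
def closedLogSector (b : ℝ) : Set ℂ := {ℓ | ℓ.re ≤ 0 ∧ |ℓ.im| ≤ Real.pi * b}

/-- The ray `arg z = θ`, in the logarithmic coordinate. -/
def logRayAt (θ : ℝ) : Set ℂ := {ℓ | ℓ.im = θ}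

/-- The lift of `f(ζ) = ζ F(-1/2, 2b, 2b + 3/2; -ζ^{1/b})` to logarithmic coordinates
`ℓ = log ζ`, `log f`. -/
def logWedgeMap (b : ℝ) (ℓ : ℂ) : ℂ := ℓ + log (hypFactor b (exp (ℓ / b)))

/-- `Ω` is a wedge-shaped region on the surface, bounded by the sides of the angle
`|arg z| ≤ πb` and by a simple curve `γ` that connects them (see `IsWedgeRegion`). -/
structure IsLogWedgeRegion (b : ℝ) (γ : ℝ → ℂ) (Ω : Set ℂ) : Prop where
  continuousOn : ContinuousOn γ (Icc 0 1)
  injOn : InjOn γ (Ioo 0 1)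
  mapsTo : MapsTo γ (Ioo 0 1) (logAngle b)
  contDiffOn : ContDiffOn ℝ 2 γ (Ioo 0 1)
  regular : ∀ t ∈ Ioo (0 : ℝ) 1, deriv γ t ≠ 0
  symmetric : (starRingEnd ℂ) '' (γ '' Icc 0 1) = γ '' Icc 0 1
  isOpen : IsOpen Ω
  /-- The projection of `Ω` to the plane is bounded. -/
  isBounded : ∃ M : ℝ, ∀ ℓ ∈ Ω, ‖exp ℓ‖ ≤ M
  isSimplyConnected : IsSimplyConnected Ω
  subset : Ω ⊆ logAngle b
  boundary : ∃ x : ℝ,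
    γ 0 = x - ((Real.pi * b : ℝ) : ℂ) * I ∧
    γ 1 = x + ((Real.pi * b : ℝ) : ℂ) * I ∧
    frontier Ω = γ '' Icc 0 1 ∪ {ℓ | ℓ.re ≤ x ∧ |ℓ.im| = Real.pi * b}

/-- `Φ` is the potential of the wedge-shaped region `Ω` on the surface
(see `IsWedgePotential`). -/
structure IsLogWedgePotential (b : ℝ) (γ : ℝ → ℂ) (Ω : Set ℂ) (Φ : ℂ → ℝ) : Prop where
  harmonic : HarmonicOnNhd Φ Ω
  contDiffOn : ContDiffOn ℝ 2 Φ (Ω ∪ γ '' Ioo 0 1)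
  continuousOn : ContinuousOn Φ (closure Ω)
  eq_zero : ∀ ℓ ∈ frontier Ω, Φ ℓ = 0
  near_vertex : IsEquivalent (comap re atBot ⊓ 𝓟 Ω) Φ (fun ℓ => -(exp (-ℓ / (2 * b))).re)

/-- The region `Ω` on the surface solves the Hele-Shaw problem with the killing condition on the
sides of the angle `|arg z| ≤ πb`. If `ν` is the unit normal in the coordinate `ℓ`, then
at the point `z = exp ℓ` the unit normal in the coordinate `z` is `n = (z / |z|) ν`,
and `∂Φ/∂n = |z|⁻¹ ∂Φ/∂ν`; the condition is again `∂Φ/∂n = c ⟨z, n⟩`. -/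
def SolvesLogKillingProblem (b : ℝ) (Ω : Set ℂ) : Prop :=
  ∃ (γ : ℝ → ℂ) (Φ : ℂ → ℝ) (c : ℝ),
    IsLogWedgeRegion b γ Ω ∧ IsLogWedgePotential b γ Ω Φ ∧
    ∀ t ∈ Ioo (0 : ℝ) 1, ∃ ν : ℂ, IsOutwardUnitNormal Ω γ t ν ∧
      ‖exp (γ t)‖⁻¹ * fderivWithin ℝ Φ (Ω ∪ γ '' Ioo 0 1) (γ t) ν =
        c * inner ℝ (exp (γ t)) (exp (γ t) / ‖exp (γ t)‖ * ν)

/-- `φ` is, in logarithmic coordinates, a conformal map `f` of the circular sector onto the region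
`Ω` on the surface that maps the straight sides bijectively onto the straight sides,
with `f(0) = 0` and `f'(0) = e^μ > 0`. -/
structure IsLogSectorConformalMap (b : ℝ) (φ : ℂ → ℂ) (Ω : Set ℂ) : Prop where
  differentiableOn : DifferentiableOn ℂ φ (logSector b)
  bijOn : BijOn φ (logSector b) Ω
  continuousOn : ContinuousOn φ (closedLogSector b)
  upper : BijOn φ (frontier (logSector b) ∩ logRayAt (Real.pi * b))
    (frontier Ω ∩ logRayAt (Real.pi * b))
  lower : BijOn φ (frontier (logSector b) ∩ logRayAt (-(Real.pi * b)))
    (frontier Ω ∩ logRayAt (-(Real.pi * b)))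
  vertex : ∃ μ : ℝ, Tendsto (fun ℓ => φ ℓ - ℓ) (comap re atBot ⊓ 𝓟 (logSector b)) (𝓝 (μ : ℂ))

/-! ### The differential equation -/

/-- `D²f + (1/2b) ((1 - ζ^{1/b})/(1 + ζ^{1/b})) Df = (1 + 1/2b) f` on the open sector. -/
def SatisfiesWedgeODE (b : ℝ) (f : ℂ → ℂ) : Prop :=
  ∀ ζ ∈ openSector b,
    eulerD (eulerD f) ζ +
        1 / (2 * b) * ((1 - ζ ^ (1 / b : ℂ)) / (1 + ζ ^ (1 / b : ℂ))) * eulerD f ζ =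
      (1 + 1 / (2 * b)) * f ζ

/-- The same equation for a function `G(ℓ) = f(exp ℓ)` on the sector in the logarithmic
coordinate, where `D = d/dℓ`. -/
def SatisfiesLogWedgeODE (b : ℝ) (G : ℂ → ℂ) : Prop :=
  ∀ ℓ ∈ logSector b,
    deriv (deriv G) ℓ +
        1 / (2 * b) * ((1 - exp (ℓ / b)) / (1 + exp (ℓ / b))) * deriv G ℓ =
      (1 + 1 / (2 * b)) * G ℓ

end

noncomputable section

open Metric (ball closedBall mem_ball isOpen_ball ball_mem_nhds eventually_nhds_iff_ball mem_ball_self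
  ball_subset_ball ball_subset_closedBall closedBall_mem_nhds nonempty_ball mem_closedBall)
open Function (invFunOn invFunOn_mem invFunOn_eq comp_apply)
open Real (norm_eq_abs pi_pos exp_pos norm_of_nonneg exp_lt_exp exp_le_exp tendsto_exp_atBot
  add_one_le_exp log_lt_iff_lt_exp log_nonneg log_le_log cos_pos_of_mem_Ioo)
open scoped Real ComplexConjugate
variable {b : ℝ} (hb : 0 < b) (μ : ℝ) {l w : ℂ} {Ω : Set ℂ} {γ : ℝ → ℂ} {Φ : ℂ → ℝ} {P : ℂ → ℂ}

/-! ### Maximum principle, gradient and Hopf estimates -/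

/-! Everything is done in the logarithmic coordinate `ℓ = log z`. There the angle is a strip, the
sector is a convex half-strip, and `b` is unrestricted. The planar statements for `b ≤ 1` are
transported by `exp`; the delicate case is `b = 1`, where both sides of the strip project to the
negative axis.

Direct part. Put `w = e^{ℓ/b}` and `f = e^ℓ g(w)`. Then `1 - g` is a power series in `-w` with
positive coefficients `c_n`, and the hypergeometric recursion makes `Σ (n+1+b) c_n` telescope to at
most `b` (`sum_hypCoeff`). This rearranges to `|w g'(w)| < b Re g(w)` on the closed disk away from
`w = -1` (`norm_hypEuler_lt`), so `(log f)'` has positive real part on the half-strip. By convexity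
`log f` is injective up to the boundary (`re_slope_logWedgeMap_pos`), and the sides are preserved
because `g` is real and positive for real `w` in `[-1, 1]`. Euler's integral continues `g` across
the circle, so all is analytic up to the arc. The half-strip carries the potential `-Re(ζ^{-1/2b} -
ζ^{1/2b})`. Transplanting it turns the dilation law into `Re(conj f · Df) = K cos(θ/2b)` on the arc.
The differential equation gives the left side a first order linear equation whose solutions are the
multiples of this cosine (`arc_quotient_const`).

Converse. Let `-P` be an analytic function on the given region with real part `Φ`. Since `Re P`
vanishes on the boundary and `Re P ∼ Re e^{-ℓ/2b}` at the vertex, `P` maps the region bijectively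
onto the right half-plane (`IsUniformizer.bijOn`); let `λ` be its inverse. On the free boundary the
dilation law says that `e^{2 Re λ} Re λ'` is constant. Differentiating along the imaginary axis
shows that `q = λ'' + λ'²`, which is `F''/F` for `F = e^λ`, is real there. On the images of the
straight sides `q` is real because `Im λ` is constant. So `q` reflects to an analytic function off
two points `iA₁`, `iA₂`. Boundary limits of `λ` exist also at these points, and Cauchy estimates
then exclude double poles. At infinity `λ = -2b log W + o(1)` as `Re W → ∞`, while the bounded
imaginary part of `λ` gives `q = O(W⁻²)`. By Liouville `q = 2b(2b+1)/((W - iA₁)(W - iA₂))`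
(`coefficient_eq`).

Pulling this back by an affine copy of `ζ^{-1/2b} - ζ^{1/2b}` gives precisely the Riccati equation
of `log f`. A Wronskian, which is constant and tends to `0` at the vertex, shows that both solutions
differ by a constant, which is real because the region fills the strip near the vertex
(`IsWedgeSolution.exists_eq_image`).

Uniqueness of the conformal map. Seen through the model map, a competitor is an automorphism of the
right half-plane. Its behaviour at the vertex and equality in Schwarz–Pick make it `W ↦ κW + iτ`.
Matching both corners, which sit at `±2i`, forces `κ = 1` and `τ = 0`
(`eq_self_of_side_conditions`). -/

theorem re_nonpos_of_frontier {U : Set ℂ} (hU : IsOpen U) {F : ℂ → ℂ} (hF : DifferentiableOn ℂ F U)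
    (hb : ∀ ε : ℝ, 0 < ε → Bornology.IsBounded {z | z ∈ U ∧ ε ≤ (F z).re})
    (hf : ∀ p ∈ frontier U, ∀ ε : ℝ, 0 < ε → ∀ᶠ z in 𝓝[U] p, (F z).re < ε) :
    ∀ z ∈ U, (F z).re ≤ 0 := by
  intro z0 hz0; by_contra! hpos; set ε := (F z0).re / 2 with hε
  have hε0 : 0 < ε := by positivity
  have hcont : ContinuousOn (fun z => (F z).re) U :=
    Complex.continuous_re.comp_continuousOn hF.continuousOn
  have hVo : IsOpen (U ∩ (fun z => (F z).re) ⁻¹' Ioi ε) := hcont.isOpen_inter_preimage hU isOpen_Ioi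
  -- The closure of this superlevel set stays inside `U`, because `Re F < ε` near every frontier
  -- point of `U`. So the maximum modulus principle applies to `exp ∘ F` on `V`, whose frontier
  -- values have modulus at most `e^ε`, while `Re F z0 = 2ε`.
  set V := U ∩ (fun z => (F z).re) ⁻¹' Ioi ε with hV
  have hclV : ∀ p ∈ closure V, p ∈ U ∧ ε ≤ (F p).re := by
    intro p hp
    have hpU : p ∈ U := by
      by_contra hpU
      have hpf : p ∈ frontier U := by
        rw [hU.frontier_eq]; exact ⟨closure_mono inter_subset_left hp, hpU⟩
      have h2 : (𝓝[V] p).NeBot := mem_closure_iff_nhdsWithin_neBot.1 hp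
      have h3 : ∀ᶠ z in 𝓝[V] p, (F z).re < ε := (hf p hpf ε hε0).filter_mono (nhdsWithin_mono _
        inter_subset_left)
      obtain ⟨z, hz1, hz2⟩ := (h3.and self_mem_nhdsWithin).exists
      exact absurd hz1 (not_lt.2 (le_of_lt hz2.2))
    refine ⟨hpU, ?_⟩; have h2 : (𝓝[V] p).NeBot := mem_closure_iff_nhdsWithin_neBot.1 hp
    have h3 : Tendsto (fun z => (F z).re) (𝓝[V] p) (𝓝 (F p).re) :=
      (hcont p hpU).mono_left (nhdsWithin_mono _ inter_subset_left)
    refine ge_of_tendsto h3 ?_; filter_upwards [self_mem_nhdsWithin] with z hz using le_of_lt hz.2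
  have hd : DiffContOnCl ℂ (fun z => exp (F z)) V := by
    apply DifferentiableOn.diffContOnCl; exact (hF.mono fun p hp => (hclV p hp).1).cexp
  have hz₀V : z0 ∈ V := ⟨hz0, by grind⟩
  have := Complex.norm_le_of_forall_mem_frontier_norm_le ((hb ε hε0).subset fun z hz => ⟨hz.1,
    le_of_lt hz.2⟩) hd (C := rexp ε) (fun p hp => by
    rw [hVo.frontier_eq] at hp; have h2 : ¬ (ε < (F p).re) := fun h => hp.2 ⟨(hclV p hp.1).1, h⟩
    rw [norm_exp]
    grind) (subset_closure hz₀V)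
  rw [norm_exp, exp_le_exp] at this; linarith

/-- Borel–Carathéodory for `g - g c`, whose real part is below any `M > 2S`. On the half-radius disk
it gives `|g z - g c| ≤ (4M/ρ)|z - c|`, and letting `M` decrease to `2S` produces the `8`. -/
theorem norm_deriv_le_of_abs_re_le {g : ℂ → ℂ} {c : ℂ} {ρ S : ℝ} (hρ : 0 < ρ)
    (hg : DifferentiableOn ℂ g (ball c ρ))
    (hS : ∀ z ∈ ball c ρ, |(g z).re| ≤ S) : ‖deriv g c‖ ≤ 8 * S / ρ := by
  have hS0 : 0 ≤ S := (abs_nonneg _).trans (hS c (mem_ball_self hρ))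
  have key : ∀ M : ℝ, 2 * S < M → ‖deriv g c‖ ≤ 4 * M / ρ := by
    intro M hM
    have hM0 : 0 < M := by linarith
    have hmaps : MapsTo (fun z => c + z) (ball 0 ρ) (ball c ρ) := by
      intro z hz; simp_all
    have hh : DifferentiableOn ℂ (fun z => g (c + z) - g c) (ball 0 ρ) := by fun_prop
    have hbound : ∀ z ∈ ball (0 : ℂ) ρ, ‖g (c + z) - g c‖ ≤ 2 * M * ‖z‖ / (ρ - ‖z‖) := by
      intro z hz
      refine Complex.borelCaratheodory_zero hM0 hh ?_ hρ hz (by simp)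
      intro w hw; have h1 := abs_le.1 (hS _ (hmaps hw))
      have h2 := abs_le.1 (hS c (mem_ball_self hρ)); simp only [mem_ofPred_eq, sub_re]; linarith
    refine norm_deriv_le_of_lip' (by positivity) ?_
    filter_upwards [ball_mem_nhds c (half_pos hρ)] with z hz
    have hz' : ‖z - c‖ < ρ / 2 := by simpa [dist_eq_norm] using hz
    have h1 := hbound (z - c) (by simp only [mem_ball, dist_zero_right]; linarith)
    simp only [add_sub_cancel] at h1; refine h1.trans ?_
    rw [div_mul_eq_mul_div, div_le_div_iff₀ (by linarith) hρ]
    nlinarith [norm_nonneg (z - c), mul_nonneg hM0.le (norm_nonneg (z - c))]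
  have h1 : Tendsto (fun M : ℝ => 4 * M / ρ) (𝓝[>] (2 * S)) (𝓝 (4 * (2 * S) / ρ)) := by
    have : Continuous (fun M : ℝ => 4 * M / ρ) := by fun_prop
    exact (this.tendsto _).mono_left nhdsWithin_le_nhds
  have h2 := ge_of_tendsto h1 (by filter_upwards [self_mem_nhdsWithin] with M hM using key M hM)
  grind

/-- Hopf-type lower bound for a holomorphic function with positive real part on a disk. -/
theorem re_lower_bound_of_ball {c : ℂ} {R : ℝ}
    (hP : DifferentiableOn ℂ P (ball c R)) (hpos : ∀ z ∈ ball c R, 0 < (P z).re)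
    {z : ℂ} (hz : z ∈ ball c R) :
    (P c).re * (1 - ‖z - c‖ / R) / 4 ≤ (P z).re := by
  have hR : 0 < R := nonempty_ball.1 ⟨z, hz⟩
  have hc : 0 < (P c).re := hpos c (mem_ball_self hR)
  have hne : ∀ w ∈ ball c R, P w + conj (P c) ≠ 0 := by
    intro w hw h
    have := congrArg re h
    simp at this
    linarith [hpos w hw]
  have key : ∀ p q : ℂ, ‖p + conj q‖ ^ 2 - ‖p - q‖ ^ 2 = 4 * p.re * q.re := by
    intro p q
    simp only [Complex.sq_norm, normSq_apply, add_re, add_im, sub_re, sub_im, conj_re, conj_im]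
    ring
  -- Schwarz lemma after the Cayley transform centred at `P c`. The identity `key` then converts the
  -- distance of the transform from the unit circle into a lower bound for `Re P z`.
  have hmaps : MapsTo (fun w => (P w - P c) / (P w + conj (P c))) (ball c R)
      (closedBall ((P c - P c) / (P c + conj (P c))) 1) := by
    intro w hw
    simp only [sub_self, zero_div, mem_closedBall, dist_zero_right, norm_div]
    have h0 : 0 < ‖P w + conj (P c)‖ := norm_pos_iff.2 (hne w hw)
    rw [div_le_one h0]
    have := key (P w) (P c)
    have h2 : 0 < 4 * (P w).re * (P c).re := by simp_all
    exact le_of_lt (lt_of_pow_lt_pow_left₀ 2 h0.le (by linarith))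
  have hdiff : DifferentiableOn ℂ (fun w => (P w - P c) / (P w + conj (P c)))
      (ball c R) :=
    (hP.sub_const _).div (hP.add_const _) hne
  have h1 := Complex.dist_le_div_mul_dist_of_mapsTo_ball hdiff hmaps hz
  simp only [sub_self, zero_div, dist_eq_norm, sub_zero, norm_div] at h1
  set t := ‖z - c‖ / R with ht
  have ht0 : 0 ≤ t := by positivity
  have ht1 : t < 1 := by rw [ht, div_lt_one hR]; exact (by simpa [dist_eq_norm] using hz)
  set N := ‖P z + conj (P c)‖ with hN
  have h2 : ‖P z - P c‖ ≤ t * N := by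
    have : ‖P z - P c‖ / N ≤ t := by grind
    rwa [div_le_iff₀ (norm_pos_iff.2 (hne z hz))] at this
  have h3 := key (P z) (P c)
  have h4 : (P c).re ≤ N := by
    calc (P c).re ≤ (P z + conj (P c)).re := by simp; exact (hpos z hz).le
      _ ≤ N := re_le_norm _
  have h5 : ‖P z - P c‖ ^ 2 ≤ t ^ 2 * N ^ 2 := by
    rw [← mul_pow]; exact pow_le_pow_left₀ (norm_nonneg _) h2 2
  have h6 : (1 - t) * (P c).re ^ 2 ≤ 4 * (P z).re * (P c).re := by
    have h8 : (1 - t) * (P c).re ^ 2 ≤ (1 - t ^ 2) * N ^ 2 := by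
      apply mul_le_mul _ (pow_le_pow_left₀ hc.le h4 2) (by positivity) (by nlinarith)
      nlinarith
    nlinarith
  nlinarith

/-- A function that is holomorphic near an imaginary point `a` except at `a`, and which is bounded
    by
the inverse square of the distance to the imaginary axis, has at most a double pole at `a`. -/
theorem norm_mul_sq_le_of_norm_mul_re_sq_le {q : ℂ → ℂ} {a : ℂ} (ha : a.re = 0) {δ C : ℝ}
    (hC : 0 ≤ C) (hq : DifferentiableOn ℂ q (ball a δ \ {a}))
    (hbd : ∀ z ∈ ball a δ \ {a}, ‖q z‖ * z.re ^ 2 ≤ C) :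
    ∀ z ∈ ball a (δ / 2) \ {a}, ‖q z‖ * ‖z - a‖ ^ 2 ≤ 64 * C := by
  rintro z ⟨hz, hza⟩
  set ρ := ‖z - a‖ with hρdef
  have hρ : 0 < ρ := norm_pos_iff.2 (sub_ne_zero.2 hza)
  have hzδ : ρ < δ / 2 := by simpa [dist_eq_norm] using hz
  have hsq : ρ ^ 2 = z.re ^ 2 + (z.im - a.im) ^ 2 := by
    rw [hρdef, Complex.sq_norm, normSq_apply]; simp [ha]; ring
  -- Away from the axis the hypothesis is already strong enough. The remaining points are much
  -- closer to the axis than to `a`.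
  by_cases hre : ρ ^ 2 ≤ 64 * z.re ^ 2
  · have h1 := hbd z ⟨ball_subset_ball (by linarith) hz, hza⟩
    calc ‖q z‖ * ρ ^ 2 ≤ ‖q z‖ * (64 * z.re ^ 2) := by gcongr
      _ ≤ 64 * C := by linarith
  push Not at hre
  obtain ⟨σ, hσ, hσz⟩ : ∃ σ : ℝ, (σ = 1 ∨ σ = -1) ∧ 0 ≤ σ * (z.im - a.im) := by grind
  have hσ2 : σ ^ 2 = 1 := by grind
  set t : ℂ := a + (σ * ρ : ℝ) * I with htdef
  have htre : t.re = 0 := by simp [htdef, ha]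
  have htim : t.im = a.im + σ * ρ := by simp [htdef]
  have hta : ‖t - a‖ = ρ := by
    have : t - a = ((σ * ρ : ℝ) : ℂ) * I := by rw [htdef]; ring
    rw [this, norm_mul, norm_I, mul_one, norm_real, norm_eq_abs, abs_mul]
    have : |σ| = 1 := by grind
    simp_all
  have hzt : ‖z - t‖ ≤ ρ / 4 := by
    have h1 : ‖z - t‖ ^ 2 = z.re ^ 2 + (z.im - a.im - σ * ρ) ^ 2 := by
      rw [Complex.sq_norm, normSq_apply]; simp [htre, htim]; ring
    set y := σ * (z.im - a.im) with hy
    have h2 : (z.im - a.im - σ * ρ) ^ 2 = (y - ρ) ^ 2 := by grind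
    have h3 : (z.im - a.im) ^ 2 = y ^ 2 := by grind
    have h4 : y ≤ ρ := abs_le_of_sq_le_sq' (by nlinarith [sq_nonneg z.re]) hρ.le |>.2
    have h5 : 7 / 8 * ρ ≤ y := by
      by_contra! hlt
      nlinarith
    have h6 : ‖z - t‖ ^ 2 ≤ (ρ / 4) ^ 2 := by rw [h1, h2]; nlinarith
    exact le_of_sq_le_sq h6 (by positivity)
  have hsub : closedBall t (ρ / 2) ⊆ ball a δ \ {a} := by
    intro w hw
    have hw' : ‖w - t‖ ≤ ρ / 2 := by simpa [dist_eq_norm] using hw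
    have h1 : ‖w - a‖ ≤ ‖w - t‖ + ‖t - a‖ := by
      calc ‖w - a‖ = ‖(w - t) + (t - a)‖ := by ring_nf
        _ ≤ _ := norm_add_le _ _
    refine ⟨by simp only [mem_ball, dist_eq_norm]; linarith, ?_⟩
    rintro rfl
    rw [norm_sub_rev] at hw'
    linarith
  -- `t` is the axis point at distance `ρ` from `a` on the side of `z`. On the circle `|w - t| =
  -- ρ/2` one has `(w-t)² + (ρ/2)² = (w-t) · 2 Re w`, so its square exactly cancels the allowed
  -- blow-up `(Re w)⁻²`. At `z` the factor is bounded below, and the maximum principle transfers the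
  -- estimate.
  set h : ℂ → ℂ := fun w => q w * ((w - t) ^ 2 + (ρ / 2 : ℝ) ^ 2) ^ 2 with hh
  have hd : DiffContOnCl ℂ h (ball t (ρ / 2)) := by
    apply DifferentiableOn.diffContOnCl
    rw [closure_ball _ (by positivity)]
    exact (hq.mono hsub).mul (by fun_prop)
  have hmax := Complex.norm_le_of_forall_mem_frontier_norm_le Metric.isBounded_ball hd
    (C := C * ρ ^ 2) (fun w hw => by
      rw [frontier_ball _ (by positivity)] at hw
      have hw' : ‖w - t‖ = ρ / 2 := by simp_all
      have e1 : ((w - t) ^ 2 + (ρ / 2 : ℝ) ^ 2 : ℂ) = (w - t) * (2 * w.re : ℝ) := by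
        rw [← hw', ← mul_conj', sq, ← mul_add, add_conj]
        simp [htre]
      have e2 : ‖h w‖ = (‖q w‖ * w.re ^ 2) * ρ ^ 2 := by
        rw [hh]; simp only
        rw [e1, norm_mul, norm_pow, norm_mul, hw', norm_real, norm_eq_abs, mul_pow, sq_abs]
        ring
      rw [e2]
      gcongr
      exact hbd w (hsub (Metric.sphere_subset_closedBall hw)))
    (subset_closure (by simp only [mem_ball, dist_eq_norm]; linarith) : z ∈ closure _)
  have hlow : 3 / 16 * ρ ^ 2 ≤ ‖(z - t) ^ 2 + ((ρ / 2 : ℝ) : ℂ) ^ 2‖ := by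
    have h1 : ‖((ρ / 2 : ℝ) : ℂ) ^ 2‖ - ‖(z - t) ^ 2‖ ≤ ‖((ρ / 2 : ℝ) : ℂ) ^ 2 + (z - t) ^ 2‖ :=
      norm_sub_le_norm_add _ _
    rw [norm_pow, norm_pow, norm_real, norm_eq_abs, sq_abs, add_comm (((ρ / 2 : ℝ) : ℂ) ^ 2)]
      at h1
    nlinarith [norm_nonneg (z - t)]
  rw [hh] at hmax
  simp only [norm_mul, norm_pow] at hmax
  have h1 : ‖q z‖ * (3 / 16 * ρ ^ 2) ^ 2 ≤ C * ρ ^ 2 := by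
    refine le_trans ?_ hmax
    gcongr
  have h2 : ‖q z‖ * (9 / 256) * ρ ^ 2 ≤ C := by
    have : (‖q z‖ * (9 / 256) * ρ ^ 2) * ρ ^ 2 ≤ C * ρ ^ 2 := by nlinarith
    exact le_of_mul_le_mul_right this (by positivity)
  nlinarith

/-! ### Limits from finite cluster sets -/

/-- The cluster set along a basis of connected sets is connected, and a finite connected set is a
point. Concretely, a small connected set is mapped into disjoint neighbourhoods of the finitely many
cluster values, hence into one of them. This is what handles the corners, where nothing is known
beyond the two possible limits. -/
theorem exists_tendsto_of_finite_cluster {l : Filter ℂ} [l.NeBot] {h : ℂ → ℂ}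
    (hpre : ∀ s ∈ l, ∃ A ∈ l, A ⊆ s ∧ IsPreconnected A ∧ ContinuousOn h A)
    {K : Set ℂ} (hK : IsCompact K) (hKl : ∀ᶠ z in l, h z ∈ K) {S : Set ℂ} (hS : S.Finite)
    (hc : ∀ u : Ultrafilter ℂ, (u : Filter ℂ) ≤ l → ∀ p, Tendsto h u (𝓝 p) → p ∈ S) :
    ∃ p ∈ S, Tendsto h l (𝓝 p) := by
  have hO : ∀ O : Set ℂ, IsOpen O → S ⊆ O → ∀ᶠ z in l, h z ∈ O := by
    intro O hOo hSO; by_contra hcon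
    have : (l ⊓ 𝓟 {z | h z ∉ O}).NeBot := by
      rw [← frequently_mem_iff_neBot]; simp_all
    obtain ⟨u, hu⟩ := Ultrafilter.exists_le (l ⊓ 𝓟 {z | h z ∉ O})
    have hul : (u : Filter ℂ) ≤ l := hu.trans inf_le_left
    obtain ⟨p, -, hp⟩ := hK.ultrafilter_le_nhds (u.map h) (by rw [le_principal_iff]; exact hul hKl)
    have h1 : ∀ᶠ z in (u : Filter ℂ), h z ∈ O := hp (hOo.mem_nhds (hSO (hc u hul p hp)))
    obtain ⟨z, hz1, hz2⟩ := (h1.and (hu.trans inf_le_right (mem_principal_self _))).exists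
    exact hz2 hz1
  obtain ⟨U, hU, hdisj⟩ := hS.t2_separation
  obtain ⟨A, hAl, hAs, hApre, hAc⟩ := hpre _ (hO (⋃ x ∈ S, U x) (isOpen_biUnion fun x _ => (hU x).2)
    fun x hx => mem_biUnion hx (hU x).1)
  obtain ⟨z, hz⟩ := Filter.nonempty_of_mem hAl
  obtain ⟨p, hpS, hzp⟩ : ∃ p ∈ S, h z ∈ U p := by simpa using hAs hz
  have hin : ∀ᶠ z in l, h z ∈ U p := by
    have h1 : h '' A ⊆ U p ∪ ⋃ x ∈ S \ {p}, U x := by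
      rintro _ ⟨y, hy, rfl⟩
      obtain ⟨x, hxS, hx⟩ : ∃ p ∈ S, h y ∈ U p := by simpa using hAs hy
      by_cases hxp : x = p
      · grind
      · exact Or.inr (mem_biUnion (⟨hxS, hxp⟩ : x ∈ S \ {p}) hx)
    have h2 := (hApre.image h hAc).subset_left_of_subset_union (hU p).2
      (isOpen_biUnion fun x _ => (hU x).2) (by
        rw [disjoint_iUnion₂_right]; intro x hx
        exact hdisj hpS hx.1 (Ne.symm hx.2)) h1 ⟨h z, mem_image_of_mem h hz, hzp⟩
    filter_upwards [hAl] with y hy using h2 (mem_image_of_mem h hy)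
  refine ⟨p, hpS, ?_⟩; rw [tendsto_nhds]; intro N hN hpN
  have h3 := hO ((U p ∩ N) ∪ ⋃ x ∈ S \ {p}, U x)
    (((hU p).2.inter hN).union (isOpen_biUnion fun x _ => (hU x).2)) (fun x hx => by
      by_cases hxp : x = p
      · grind
      · exact Or.inr (mem_biUnion (⟨hx, hxp⟩ : x ∈ S \ {p}) (hU x).1))
  filter_upwards [h3, hin] with y hy1 hy2; rcases hy1 with hy1 | hy1
  · exact hy1.2
  · obtain ⟨x, hx, hyx⟩ := mem_iUnion₂.1 hy1
    exact absurd hyx (disjoint_left.1 (hdisj hpS hx.1 (Ne.symm hx.2)) hy2)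

/-! ### Values near a critical point -/

/-- Near a critical point `P - P z0 = ψⁿ` with `n ≥ 2` and `ψ` a local homeomorphism. The points `ξ`
and `ωξ`, with `ω` a primitive `n`-th root of unity, have different `ψ`-preimages with the same
value of `P`. -/
theorem eventually_exists_two_preimages {z0 : ℂ} (hP : AnalyticAt ℂ P z0)
    (hd : deriv P z0 = 0) (hnc : ¬ ∀ᶠ z in 𝓝 z0, P z = P z0) {U : Set ℂ} (hU : U ∈ 𝓝 z0) :
    ∀ᶠ w in 𝓝[≠] (P z0), ∃ z1 ∈ U, ∃ z2 ∈ U, z1 ≠ z2 ∧ P z1 = w ∧ P z2 = w := by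
  have hA : AnalyticAt ℂ (fun z => P z - P z0) z0 := hP.sub analyticAt_const
  obtain ⟨n, g, hg, hg0, hev⟩ := hA.exists_eventuallyEq_pow_smul_nonzero_iff.2 (by grind)
  have hn0 : n ≠ 0 := by
    rintro rfl; have := hev.self_of_nhds; simp_all
  have hn1 : n ≠ 1 := by
    rintro rfl
    have h1 : deriv (fun z => P z - P z0) z0 = deriv (fun z => (z - z0) ^ 1 • g z) z0 :=
      Filter.EventuallyEq.deriv_eq hev
    have h2 : HasDerivAt (fun z => (z - z0) ^ 1 • g z) (g z0) z0 := by
      have := ((hasDerivAt_id z0).sub_const z0).fun_mul hg.differentiableAt.hasDerivAt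
      simpa using this
    rw [h2.deriv, deriv_sub_const, hd] at h1; exact hg0 h1.symm
  obtain ⟨c, hc⟩ := IsAlgClosed.exists_pow_nat_eq (g z0) (Nat.pos_of_ne_zero hn0)
  have hc0 : c ≠ 0 := by rintro rfl; simp_all
  set ψ : ℂ → ℂ := fun z => (z - z0) * (c * exp (log (g z / g z0) / n)) with hψ
  have hgz : AnalyticAt ℂ (fun z => g z / g z0) z0 := hg.div_const
  have hψA : AnalyticAt ℂ (fun z => c * exp (log (g z / g z0) / n)) z0 := by
    have h1 : AnalyticAt ℂ (fun z => log (g z / g z0)) z0 := hgz.clog (by simp [div_self hg0])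
    fun_prop
  have hψd : HasStrictDerivAt ψ c z0 := by
    have hψA' : AnalyticAt ℂ ψ z0 := (analyticAt_id.sub analyticAt_const).mul hψA
    have h2 : HasDerivAt ψ c z0 := by
      have := ((hasDerivAt_id z0).sub_const z0).fun_mul hψA.differentiableAt.hasDerivAt; simp_all
    have h3 := hψA'.hasStrictDerivAt; rwa [h2.deriv] at h3
  have hψpow : ∀ᶠ z in 𝓝 z0, ψ z ^ n = P z - P z0 := by
    filter_upwards [hev, hg.continuousAt.eventually_ne hg0] with z hz hgz; rw [hz, hψ]
    rw [mul_pow, mul_pow, hc, ← exp_nat_mul, mul_div_cancel₀ _ (by exact_mod_cast hn0),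
      exp_log (div_ne_zero hgz hg0), mul_div_cancel₀ _ hg0, smul_eq_mul]
  have hmap := hψd.map_nhds_eq hc0
  have hψ0 : ψ z0 = 0 := by simp [hψ]
  rw [hψ0] at hmap
  have himg : ψ '' (U ∩ {z | ψ z ^ n = P z - P z0}) ∈ 𝓝 (0 : ℂ) := by
    rw [← hmap]; exact image_mem_map (inter_mem hU hψpow)
  obtain ⟨r, hr, hrsub⟩ := Metric.mem_nhds_iff.1 himg; have hω := Complex.isPrimitiveRoot_exp n hn0
  set ω := exp (2 * π * I / n) with hωdef
  have hω1 : ω ≠ 1 := hω.ne_one (by omega)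
  have hωn : ‖ω‖ = 1 := by
    have := congrArg norm hω.pow_eq_one; rw [norm_pow, norm_one] at this
    exact (pow_eq_one_iff_of_nonneg (norm_nonneg _) hn0).1 this
  filter_upwards [mem_nhdsWithin_of_mem_nhds (ball_mem_nhds _ (pow_pos hr n)), self_mem_nhdsWithin]
    with w hw hwne
  obtain ⟨ξ, hξ⟩ := IsAlgClosed.exists_pow_nat_eq (w - P z0) (Nat.pos_of_ne_zero hn0)
  have hξ0 : ξ ≠ 0 := by
    rintro rfl; rw [zero_pow hn0] at hξ; grind
  have hξr : ‖ξ‖ < r := by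
    apply lt_of_pow_lt_pow_left₀ n hr.le; rw [← norm_pow, hξ]; simpa [dist_eq_norm] using hw
  obtain ⟨z1, ⟨hz₁U, hz1⟩, h1⟩ := hrsub (show ξ ∈ ball 0 r by simpa using hξr)
  obtain ⟨z2, ⟨hz₂U, hz2⟩, h2⟩ := hrsub (show ω * ξ ∈ ball 0 r by simpa [hωn] using hξr)
  refine ⟨z1, hz₁U, z2, hz₂U, ?_, ?_, ?_⟩
  · grind
  · grind
  · simp only [mem_ofPred_eq] at hz2; rw [h2, mul_pow, hω.pow_eq_one, one_mul, hξ] at hz2; grind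

/-! ### Primitives on simply connected domains -/

/-- The complex numbers with the discrete topology. -/
def DiscreteComplex : Type := ℂ

instance : TopologicalSpace DiscreteComplex := ⊥

instance : DiscreteTopology DiscreteComplex := ⟨rfl⟩

/-- The bundle of local primitives of a function, given primitives `F i` on disks around the
points `i` of `U`. -/
def primitiveBundle (U : Set ℂ) (r : U → ℝ) (hr : ∀ i, 0 < r i) (F : U → ℂ → ℂ)
    (hF : ∀ i j : U, ∃ c : ℂ, ∀ z ∈ ball (i : ℂ) (r i) ∩ ball (j : ℂ) (r j),
      F i z - F j z = c) : FiberBundleCore U U DiscreteComplex where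
  baseSet i := {x | (x : ℂ) ∈ ball (i : ℂ) (r i)}
  isOpen_baseSet i := isOpen_ball.preimage continuous_subtype_val
  indexAt x := x
  mem_baseSet_at x := mem_ball_self (hr x)
  coordChange i j x v := ((show ℂ from v) + (F i x - F j x) : ℂ)
  coordChange_self i x _ v := by grind
  continuousOn_coordChange i j := by
    obtain ⟨c, hc⟩ := hF i j
    have h1 : Continuous (fun p : U × DiscreteComplex =>
        (show DiscreteComplex from ((show ℂ from p.2) + c : ℂ))) :=
      (continuous_of_discreteTopology (f := fun v : DiscreteComplex =>
        (show DiscreteComplex from ((show ℂ from v) + c : ℂ)))).comp continuous_snd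
    refine h1.continuousOn.congr ?_; rintro ⟨x, v⟩ ⟨hx, -⟩; grind
  coordChange_comp i j k x _ v := by grind

/-- Primitives on disks differ by constants on overlaps, so they glue to a bundle with discrete
fibre, which is a covering map. Over a simply connected base it has a global section, and the
section selects compatible constants of integration. -/
theorem exists_primitive_of_isSimplyConnected {U : Set ℂ} (hUo : IsOpen U)
    (hUc : IsSimplyConnected U) {G : ℂ → ℂ} (hG : DifferentiableOn ℂ G U) :
    ∃ W : ℂ → ℂ, ∀ z ∈ U, HasDerivAt W (G z) z := by
  classical
  have hball : ∀ i : U, ∃ r > 0, ball (i : ℂ) r ⊆ U := fun i => Metric.isOpen_iff.1 hUo i i.2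
  choose r hr hrU using hball
  choose F hF using (fun i => (hG.mono (hrU i)).isExactOn_ball)
  have hconst : ∀ i j : U, ∃ c : ℂ, ∀ z ∈ ball (i : ℂ) (r i) ∩ ball (j : ℂ) (r j),
      F i z - F j z = c := by
    intro i j
    have hd : ∀ z ∈ ball (i : ℂ) (r i) ∩ ball (j : ℂ) (r j),
        HasDerivAt (fun z => F i z - F j z) 0 z := by
      intro z hz; simpa using (hF i z hz.1).fun_sub (hF j z hz.2)
    have hconv : Convex ℝ (ball (i : ℂ) (r i) ∩ ball (j : ℂ) (r j)) :=
      (convex_ball _ _).inter (convex_ball _ _)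
    have hopen : IsOpen (ball (i : ℂ) (r i) ∩ ball (j : ℂ) (r j)) := isOpen_ball.inter isOpen_ball
    obtain ⟨c, hc⟩ := hopen.exists_eq_add_of_deriv_eq hconv.isPreconnected
      (f := fun z => F i z - F j z) (g := fun _ => (0 : ℂ))
      (fun z hz => (hd z hz).differentiableAt.differentiableWithinAt)
      (differentiableOn_const 0) (fun z hz => by simp [(hd z hz).deriv])
    exact ⟨c, fun z hz => by simpa using hc hz⟩
  let Z := primitiveBundle U r hr F hconst
  have hcov : IsCoveringMap (Bundle.TotalSpace.proj : Z.TotalSpace → U) :=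
    FiberBundle.isCoveringMap (F := DiscreteComplex) (E := Z.Fiber)
  have := hUc.simplyConnectedSpace; have := hUo.locallyPathConnectedSpace
  obtain ⟨x0, hx0⟩ := hUc.nonempty
  obtain ⟨s, ⟨-, hs⟩, -⟩ := hcov.existsUnique_continuousMap_lifts (ContinuousMap.id U) ⟨x0, hx0⟩
    (⟨⟨x0, hx0⟩, (show Z.Fiber ⟨x0, hx0⟩ from (0 : ℂ))⟩ : Z.TotalSpace) rfl
  have hs' : ∀ x, (s x).1 = x := fun x => congrFun hs x
  -- The fibre coordinate of the section at `z` is the constant to add to the primitive on the disk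
  -- centred at `z`. In a fixed trivialization this coordinate is locally constant, so near `z` the
  -- function is one primitive plus a constant.
  let W : ℂ → ℂ := fun z => if h : z ∈ U then F ⟨z, h⟩ z + (show ℂ from (s ⟨z, h⟩).2) else 0
  refine ⟨W, fun z hz => ?_⟩; set i : U := ⟨z, hz⟩ with hi
  have hcont : ContinuousAt (fun x => (Z.localTriv i (s x)).2) i := by
    have h1 : ContinuousAt (Z.localTriv i) (s i) := by
      apply (Z.localTriv i).continuousAt; rw [FiberBundleCore.mem_localTriv_source, hs']
      exact Z.mem_baseSet_at i
    fun_prop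
  have hloc : ∀ᶠ x in 𝓝 i, (Z.localTriv i (s x)).2 = (Z.localTriv i (s i)).2 := by
    have := hcont (isOpen_discrete {(Z.localTriv i (s i)).2} |>.mem_nhds rfl); exact this
  set k : ℂ := (show ℂ from (Z.localTriv i (s i)).2) with hk
  have hW : W =ᶠ[𝓝 z] fun w => F i w + k := by
    have h2 : ∀ᶠ w in 𝓝 z, ∀ h : w ∈ U, (Z.localTriv i (s ⟨w, h⟩)).2 = (Z.localTriv i (s i)).2 := by
      rw [hi, nhds_subtype_eq_comap, eventually_comap] at hloc; grind
    filter_upwards [h2, hUo.mem_nhds hz, ball_mem_nhds z (hr i)] with w hw hwU hwb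
    have h3 := hw hwU
    have h4 : (Z.localTriv i (s ⟨w, hwU⟩)).2 =
        (show ℂ from (s ⟨w, hwU⟩).2) + (F (s ⟨w, hwU⟩).1 ((s ⟨w, hwU⟩).1 : ℂ)
          - F i ((s ⟨w, hwU⟩).1 : ℂ)) := rfl
    grind
  exact ((hF i z (mem_ball_self (hr i))).add_const k).congr_of_eventuallyEq hW

/-- `Φ_x - iΦ_y` is holomorphic. The real part of a primitive has the differential of `Φ`, hence
differs from it by a constant. -/
theorem exists_re_eq_of_harmonicOnNhd {U : Set ℂ} (hUo : IsOpen U)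
    (hUc : IsSimplyConnected U) (hΦ : HarmonicOnNhd Φ U) :
    ∃ W : ℂ → ℂ, DifferentiableOn ℂ W U ∧ (∀ z ∈ U, (W z).re = Φ z) ∧
      ∀ z ∈ U, deriv W z = fderiv ℝ Φ z 1 - I * fderiv ℝ Φ z I := by
  obtain ⟨W, hW⟩ := exists_primitive_of_isSimplyConnected hUo hUc (fun z hz =>
    (HarmonicAt.differentiableAt_complex_partial (hΦ z hz)).differentiableWithinAt)
  have hreW : ∀ z ∈ U, HasFDerivAt (fun z => (W z).re) (fderiv ℝ Φ z) z := by
    intro z hz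
    convert! (reCLM.hasFDerivAt.comp z ((hW z hz).hasFDerivAt.restrictScalars ℝ)) using 1
    ext v
    have hv : v = v.re • (1 : ℂ) + v.im • I := by simp
    have : fderiv ℝ Φ z v = v.re * fderiv ℝ Φ z 1 + v.im * fderiv ℝ Φ z I := by
      conv_lhs => rw [hv]
      rw [map_add, map_smul, map_smul, smul_eq_mul, smul_eq_mul]
    rw [this]; simp
  obtain ⟨c, hc⟩ := hUo.exists_is_const_of_fderiv_eq_zero (𝕜 := ℝ)
    hUc.isPathConnected.isConnected.isPreconnected
    (f := fun z => (W z).re - Φ z)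
    (fun z hz => ((hreW z hz).sub
      ((hΦ z hz).1.differentiableAt two_ne_zero).hasFDerivAt).differentiableAt.differentiableWithinAt)
    (fun z hz => by
      have := (hreW z hz).fun_sub ((hΦ z hz).1.differentiableAt two_ne_zero).hasFDerivAt
      rw [this.fderiv]; simp)
  refine ⟨fun z => W z - c, fun z hz => ((hW z hz).sub_const _).differentiableAt.differentiableWithinAt,
    fun z hz => ?_, fun z hz => ?_⟩
  · have := hc z hz; simp only [sub_re, ofReal_re]; linarith
  · rw [((hW z hz).sub_const (c : ℂ)).deriv]

/-! ### Schwarz reflection -/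

/-- Morera: a rectangle crossing the axis is cut along it, and Cauchy's theorem needs only
continuity on the boundary of each half. -/
theorem differentiableOn_of_differentiableAt_off_imaginary_axis {U : Set ℂ} (hU : IsOpen U)
    {F : ℂ → ℂ} (hc : ContinuousOn F U) (hd : ∀ z ∈ U, z.re ≠ 0 → DifferentiableAt ℂ F z) :
    DifferentiableOn ℂ F U := by
  refine (isConservativeOn_and_continuousOn_iff_isDifferentiableOn hU).1 ⟨?_, hc⟩
  have half : ∀ z w : ℂ, Rectangle z w ⊆ U → (0 : ℝ) ∉ Ioo (min z.re w.re) (max z.re w.re) →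
      (∫ x : ℝ in z.re..w.re, F (x + z.im * I)) - (∫ x : ℝ in z.re..w.re, F (x + w.im * I)) +
      I • (∫ y : ℝ in z.im..w.im, F (re w + y * I)) -
      I • (∫ y : ℝ in z.im..w.im, F (re z + y * I)) = 0 := by
    intro z w hzw h0
    refine integral_boundary_rect_eq_zero_of_continuousOn_of_differentiableOn F z w (hc.mono hzw) ?_
    rintro p ⟨hp1, hp2⟩
    refine (hd p (hzw ⟨Ioo_subset_Icc_self hp1, Ioo_subset_Icc_self hp2⟩) ?_).differentiableWithinAt
    grind
  intro z w hzw; rw [← add_eq_zero_iff_eq_neg, wedgeIntegral_add_wedgeIntegral_eq]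
  by_cases h0 : (0 : ℝ) ∈ Ioo (min z.re w.re) (max z.re w.re)
  · have h0u : (0 : ℝ) ∈ uIcc z.re w.re := Ioo_subset_Icc_self h0
    have h0z : uIcc z.re 0 ⊆ uIcc z.re w.re := uIcc_subset_uIcc_left h0u
    have h0w : uIcc 0 w.re ⊆ uIcc z.re w.re := uIcc_subset_uIcc_right h0u
    have hint : ∀ v ∈ uIcc z.im w.im, ∀ a b : ℝ, uIcc a b ⊆ uIcc z.re w.re →
        IntervalIntegrable (fun x : ℝ => F (x + v * I)) MeasureTheory.volume a b := by
      intro v hv a b hab; apply ContinuousOn.intervalIntegrable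
      refine hc.comp (by fun_prop) ?_
      intro x hx
      exact hzw ⟨by simpa using hab hx, by simpa using hv⟩
    have e1 := half z (⟨0, w.im⟩ : ℂ) (fun p hp => hzw ⟨h0z hp.1, hp.2⟩) (by grind)
    have e2 := half (⟨0, z.im⟩ : ℂ) w (fun p hp => hzw ⟨h0w hp.1, hp.2⟩) (by grind)
    have s1 := intervalIntegral.integral_add_adjacent_intervals
      (hint z.im left_mem_uIcc z.re 0 h0z) (hint z.im left_mem_uIcc 0 w.re h0w)
    have s2 := intervalIntegral.integral_add_adjacent_intervals
      (hint w.im right_mem_uIcc z.re 0 h0z) (hint w.im right_mem_uIcc 0 w.re h0w)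
    grind
  grind

/-- Extension of a function from the closed right half-plane by reflection in the imaginary axis. -/
def reflect (F : ℂ → ℂ) (z : ℂ) : ℂ := if 0 ≤ z.re then F z else conj (F (-conj z))

/-- The two defining formulas agree on the axis because the values there are real, so the reflected
function is continuous, and it is holomorphic off the axis. -/
theorem differentiableOn_reflect {U : Set ℂ} (hU : IsOpen U)
    (hsym : ∀ z ∈ U, -conj z ∈ U) {F : ℂ → ℂ}
    (hc : ContinuousOn F (U ∩ {z | 0 ≤ z.re})) (hd : DifferentiableOn ℂ F (U ∩ {z | 0 < z.re}))
    (him : ∀ z ∈ U, z.re = 0 → (F z).im = 0) : DifferentiableOn ℂ (reflect F) U := by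
  have hneg : ∀ z : ℂ, z.re ≤ 0 → z ∈ U → reflect F z = conj (F (-conj z)) := by
    intro z hz hzU; rcases hz.lt_or_eq with h | h
    · rw [reflect, if_neg (not_le.2 h)]
    · rw [reflect, if_pos h.ge]
      have h1 : -conj z = z := by apply Complex.ext <;> simp [h]
      rw [h1, conj_eq_iff_im.2 (him z hzU h)]
  apply differentiableOn_of_differentiableAt_off_imaginary_axis hU
  · have hB : ContinuousOn (reflect F) (U ∩ {z | z.re ≤ 0}) := by
      have : ContinuousOn (fun z => conj (F (-conj z))) (U ∩ {z | z.re ≤ 0}) := by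
        refine continuous_conj.comp_continuousOn (hc.comp (by fun_prop) ?_)
        intro z hz; simp_all
      exact this.congr fun z hz => hneg z hz.2 hz.1
    have hUAB : U = (U ∩ {z | 0 ≤ z.re}) ∪ (U ∩ {z | z.re ≤ 0}) := by
      ext z; grind
    intro z hz; rw [hUAB]; apply ContinuousWithinAt.union
    · by_cases h : 0 ≤ z.re
      · exact (hc.congr fun z hz => by rw [reflect, if_pos (show 0 ≤ z.re from hz.2)]) z ⟨hz, h⟩
      · apply continuousWithinAt_of_notMem_closure; intro hcl
        have : z ∈ {z : ℂ | 0 ≤ z.re} :=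
          closure_minimal inter_subset_right (isClosed_le continuous_const continuous_re) hcl
        exact h this
    · by_cases h : z.re ≤ 0
      · exact hB z ⟨hz, h⟩
      · apply continuousWithinAt_of_notMem_closure; intro hcl
        have : z ∈ {z : ℂ | z.re ≤ 0} :=
          closure_minimal inter_subset_right (isClosed_le continuous_re continuous_const) hcl
        exact h this
  · intro z hz hre
    have hposo : IsOpen {z : ℂ | 0 < z.re} := isOpen_lt continuous_const continuous_re
    have hnego : IsOpen {z : ℂ | z.re < 0} := isOpen_lt continuous_re continuous_const
    rcases lt_or_gt_of_ne hre with h | h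
    · have h2 : DifferentiableAt ℂ (fun w => F (-w)) (conj z) :=
        DifferentiableAt.comp (g := F) _ ((hd _ ⟨hsym z hz, by simpa using h⟩).differentiableAt
          ((hU.inter hposo).mem_nhds ⟨hsym z hz, by simpa using h⟩)) differentiableAt_id.neg
      have h3 := h2.conj_conj; rw [conj_conj] at h3; refine h3.congr_of_eventuallyEq ?_
      filter_upwards [hnego.mem_nhds h] with w hw; rw [reflect, if_neg (not_le.2 hw)]
      rfl
    · refine ((hd z ⟨hz, h⟩).differentiableAt ((hU.inter hposo).mem_nhds ⟨hz, h⟩)).congr_of_eventuallyEq ?_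
      filter_upwards [hposo.mem_nhds h] with w hw; rw [reflect, if_pos (le_of_lt hw)]

/-- Barrier argument in the half-disk of radius `R = r/2` about `i Im ζ`. The harmonic function `((y
- Im ζ)² - x²)/R² + 2x/R` is nonnegative on the diameter and at least `1` on the circular part.
Hence `M` times it dominates `±Re g`, and at `ζ` it is at most `2x/R`. -/
theorem abs_re_le_of_halfDisk {g : ℂ → ℂ} {r M : ℝ} (hM : 0 ≤ M)
    (hg : DifferentiableOn ℂ g (ball 0 r ∩ {z | 0 < z.re}))
    (hbd : ∀ z ∈ ball 0 r ∩ {z : ℂ | 0 < z.re}, |(g z).re| ≤ M)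
    (hlim : ∀ t : ℝ, |t| < r →
      Tendsto (fun z => (g z).re) (𝓝[ball 0 r ∩ {z | 0 < z.re}] (t * I)) (𝓝 0))
    {ζ : ℂ} (hζ : ζ ∈ ball 0 (r / 2) ∩ {z : ℂ | 0 < z.re}) :
    |(g ζ).re| ≤ 4 * M * ζ.re / r := by
  have hζr : ‖ζ‖ < r / 2 := by simpa using hζ.1
  have hr : 0 < r := by linarith [norm_nonneg ζ]
  set R := r / 2 with hR
  have hR0 : 0 < R := by positivity
  set c : ℂ := (ζ.im : ℂ) * I with hc
  have hcim : c.im = ζ.im := by simp [hc]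
  have hcre : c.re = 0 := by simp [hc]
  set U : Set ℂ := ball c R ∩ {z | 0 < z.re} with hUdef
  have hcn : ‖c‖ < R := by
    rw [hc, norm_mul, norm_I, mul_one, norm_real]
    exact (abs_im_le_norm ζ).trans_lt hζr
  have hUo : IsOpen U := isOpen_ball.inter (isOpen_lt continuous_const continuous_re)
  have hUsub : U ⊆ ball 0 r ∩ {z | 0 < z.re} := by
    rintro z ⟨hz1, hz2⟩
    refine ⟨?_, hz2⟩
    simp only [mem_ball, dist_eq_norm, sub_zero] at hz1 ⊢
    calc ‖z‖ = ‖(z - c) + c‖ := by ring_nf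
      _ ≤ ‖z - c‖ + ‖c‖ := norm_add_le _ _
      _ < r := by linarith
  have key : ∀ s : ℝ, (s = 1 ∨ s = -1) → s * (g ζ).re ≤ 4 * M * ζ.re / r := by
    intro s hs
    have hs1 : |s| = 1 := by grind
    set β : ℂ → ℂ := fun z => -((z - c) ^ 2 / R ^ 2) + 2 * (z - c) / R with hβ
    set F : ℂ → ℂ := fun z => s * g z - M * β z with hF
    have hβre : ∀ z, (β z).re = ((z.im - ζ.im) ^ 2 - z.re ^ 2) / R ^ 2 + 2 * z.re / R := by
      intro z
      have e1 : ((z - c) ^ 2 / (R : ℂ) ^ 2).re = (z.re ^ 2 - (z.im - ζ.im) ^ 2) / R ^ 2 := by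
        rw [← ofReal_pow, div_ofReal_re]
        simp [sq, hcre, hcim]
      have e2 : (2 * (z - c) / (R : ℂ)).re = 2 * z.re / R := by
        simp [hcre]
      rw [hβ]
      simp only [add_re, neg_re, e1, e2]
      ring
    have hFre : ∀ z, (F z).re = s * (g z).re - M * (β z).re := by
      intro z; simp [hF]
    have hβc : Continuous fun z => (β z).re := by fun_prop
    have hFd : DifferentiableOn ℂ F U :=
      ((hg.mono hUsub).const_mul _).sub (by fun_prop)
    have hconcl := re_nonpos_of_frontier hUo hFd
      (fun ε _ => Metric.isBounded_ball.subset fun z hz => hz.1.1) (fun p hp ε hε => by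
        have hpcl : p ∈ closure U := hp.1
        have hpU : p ∉ U := by
          rw [hUo.frontier_eq] at hp; exact hp.2
        have hpb : ‖p - c‖ ≤ R := by
          have : p ∈ closedBall c R :=
            closure_minimal (inter_subset_left.trans ball_subset_closedBall)
              Metric.isClosed_closedBall hpcl
          simpa [dist_eq_norm] using this
        have hβt : Tendsto (fun z => (β z).re) (𝓝[U] p) (𝓝 (β p).re) :=
          hβc.continuousAt.mono_left nhdsWithin_le_nhds
        by_cases hp0 : p.re = 0
        · have hpI : p = (p.im : ℂ) * I := by apply Complex.ext <;> simp [hp0]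
          have him : |p.im| < r := by
            have h1 : |p.im - ζ.im| ≤ R := by
              have := (abs_im_le_norm (p - c)).trans hpb
              simpa [hcim] using this
            have h2 : |ζ.im| < R := (abs_im_le_norm ζ).trans_lt hζr
            have h3 : |p.im| ≤ |p.im - ζ.im| + |ζ.im| := by
              calc |p.im| = |(p.im - ζ.im) + ζ.im| := by ring_nf
                _ ≤ _ := abs_add_le _ _
            linarith
          have h1 : Tendsto (fun z => (g z).re) (𝓝[U] p) (𝓝 0) := by
            have := hlim p.im him
            rw [← hpI] at this
            exact this.mono_left (nhdsWithin_mono _ hUsub)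
          have h2 : Tendsto (fun z => (F z).re) (𝓝[U] p) (𝓝 (s * 0 - M * (β p).re)) := by
            simp only [hFre]
            exact (h1.const_mul s).sub (hβt.const_mul M)
          have h3 : 0 ≤ (β p).re := by rw [hβre, hp0]; simp; positivity
          refine h2.eventually_lt_const ?_
          have := mul_nonneg hM h3
          linarith
        · have hpos : 0 < p.re := lt_of_le_of_ne (closure_minimal (t := {z : ℂ | 0 ≤ z.re}) (fun
            z hz => (show 0 < z.re from hz.2).le) (isClosed_le continuous_const continuous_re) hpcl)
            (Ne.symm hp0)
          have hpR : ‖p - c‖ = R := by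
            by_contra hne
            exact hpU ⟨by simpa [dist_eq_norm] using lt_of_le_of_ne hpb hne, hpos⟩
          have h1 : p.re ^ 2 + (p.im - ζ.im) ^ 2 = R ^ 2 := by
            rw [← hpR, Complex.sq_norm, normSq_apply]; simp [hcre, hcim]; ring
          have h2 : 1 ≤ (β p).re := by
            rw [hβre]
            have h3 : p.re ≤ R := by nlinarith [sq_nonneg (p.im - ζ.im)]
            have h4 : ((p.im - ζ.im) ^ 2 - p.re ^ 2) / R ^ 2 + 2 * p.re / R =
                1 + 2 * p.re * (R - p.re) / R ^ 2 := by
              field_simp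
              linear_combination h1
            have : 0 ≤ 2 * p.re * (R - p.re) / R ^ 2 := by positivity
            linarith
          have h3 : Tendsto (fun z => M - M * (β z).re) (𝓝[U] p) (𝓝 (M - M * (β p).re)) :=
            (hβt.const_mul M).const_sub M
          have h5 : M - M * (β p).re < ε := by nlinarith
          filter_upwards [h3.eventually_lt_const h5, self_mem_nhdsWithin] with z hz hzU
          rw [hFre]
          have h6 : s * (g z).re ≤ M := by
            calc s * (g z).re ≤ |s * (g z).re| := le_abs_self _
              _ = |(g z).re| := by grind
              _ ≤ M := hbd z (hUsub hzU)
          linarith)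
    have hζU : ζ ∈ U := by
      refine ⟨?_, hζ.2⟩
      have : ζ - c = (ζ.re : ℂ) := by apply Complex.ext <;> simp [hcre, hcim]
      simp only [mem_ball, dist_eq_norm, this, norm_real]
      exact (abs_re_le_norm ζ).trans_lt hζr
    have h1 := hconcl ζ hζU
    rw [hFre, hβre] at h1
    have h2 : ((ζ.im - ζ.im) ^ 2 - ζ.re ^ 2) / R ^ 2 + 2 * ζ.re / R ≤ 4 * ζ.re / r := by
      have : 2 * ζ.re / R = 4 * ζ.re / r := by field_simp; ring
      rw [this, sub_self]
      have : 0 ≤ ζ.re ^ 2 / R ^ 2 := by positivity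
      grind
    have h3 := mul_le_mul_of_nonneg_left h2 hM
    grind
  rw [abs_le]
  constructor
  · have := key (-1) (Or.inr rfl); linarith
  simp_all

/-- Reflection principle: only the real part is assumed to have a limit at the boundary. -/
theorem exists_extension_of_re_tendsto_zero {g : ℂ → ℂ} {r M : ℝ} (hr : 0 < r) (hM : 0 ≤ M)
    (hg : DifferentiableOn ℂ g (ball 0 r ∩ {z | 0 < z.re}))
    (hbd : ∀ z ∈ ball 0 r ∩ {z : ℂ | 0 < z.re}, |(g z).re| ≤ M)
    (hlim : ∀ t : ℝ, |t| < r →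
      Tendsto (fun z => (g z).re) (𝓝[ball 0 r ∩ {z | 0 < z.re}] (t * I)) (𝓝 0)) :
    ∃ G : ℂ → ℂ, DifferentiableOn ℂ G (ball 0 (r / 4)) ∧
      (∀ z ∈ ball (0 : ℂ) (r / 4), 0 < z.re → G z = g z) ∧
      (∀ z ∈ ball (0 : ℂ) (r / 4), z.re = 0 → (G z).re = 0) ∧
      ∀ z ∈ ball (0 : ℂ) (r / 4), |(G z).re| ≤ M := by
  set D : Set ℂ := ball 0 (r / 4) ∩ {z | 0 < z.re} with hD
  have hDsub : D ⊆ ball 0 r ∩ {z | 0 < z.re} := fun z hz =>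
    ⟨ball_subset_ball (by linarith) hz.1, hz.2⟩
  -- The real part decays linearly at the axis, so on the disk of radius `Re ζ` about `ζ` it is
  -- `O(Re ζ)`, and the gradient estimate bounds the derivative uniformly. Thus `g` is Lipschitz on
  -- the convex half-disk and extends continuously, which gives the imaginary part its boundary
  -- values.
  have hderiv : ∀ ζ ∈ D, ‖deriv g ζ‖ ≤ 64 * M / r := by
    rintro ζ ⟨hζ1, hζ2⟩
    have hζn : ‖ζ‖ < r / 4 := by simpa using hζ1
    have hζ2' : 0 < ζ.re := hζ2
    have hx : ζ.re < r / 4 := (re_le_norm ζ).trans_lt hζn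
    have hsub : ball ζ ζ.re ⊆ ball 0 (r / 2) ∩ {z | 0 < z.re} := by
      intro w hw
      have hw' : ‖w - ζ‖ < ζ.re := by simpa [dist_eq_norm] using hw
      constructor
      · simp only [mem_ball, dist_eq_norm, sub_zero]
        calc ‖w‖ = ‖(w - ζ) + ζ‖ := by ring_nf
          _ ≤ ‖w - ζ‖ + ‖ζ‖ := norm_add_le _ _
          _ < r / 2 := by linarith
      · have := (abs_re_le_norm (w - ζ)).trans_lt hw'
        rw [sub_re, abs_lt] at this
        grind
    have h1 := norm_deriv_le_of_abs_re_le (S := 8 * M * ζ.re / r) hζ2'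
      (hg.mono (hsub.trans fun z hz => ⟨ball_subset_ball (by linarith) hz.1, hz.2⟩))
      (fun w hw => by
        refine (abs_re_le_of_halfDisk hM hg hbd hlim (hsub hw)).trans ?_
        have := (re_le_norm (w - ζ)).trans_lt (by simpa [dist_eq_norm] using hw)
        rw [sub_re] at this
        rw [div_le_div_iff_of_pos_right hr]
        nlinarith)
    calc _ ≤ _ := h1
      _ = 64 * M / r := by field_simp; ring
  have hconv : Convex ℝ D := (convex_ball _ _).inter (convex_halfSpace_re_gt 0)
  have hlip : LipschitzOnWith (Real.toNNReal (64 * M / r)) g D := by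
    apply hconv.lipschitzOnWith_of_nnnorm_deriv_le (𝕜 := ℂ)
    · intro z hz
      exact (hg z (hDsub hz)).differentiableAt
        ((isOpen_ball.inter (isOpen_lt continuous_const continuous_re)).mem_nhds (hDsub hz))
    · intro z hz
      rw [← NNReal.coe_le_coe, coe_nnnorm, Real.coe_toNNReal _ (by positivity)]
      exact hderiv z hz
  obtain ⟨E, hE, hEg⟩ := hlip.extend_finite_dimension
  have hEc : Continuous E := hE.continuous
  have hE0 : ∀ z ∈ ball (0 : ℂ) (r / 4), z.re = 0 → (E z).re = 0 := by
    intro z hz hz0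
    have hzI : z = (z.im : ℂ) * I := by apply Complex.ext <;> simp [hz0]
    have hzcl : z ∈ closure D := by
      rw [Metric.mem_closure_iff]
      intro ε hε
      have hzn : ‖z‖ < r / 4 := by simpa using hz
      set δ := min (ε / 2) ((r / 4 - ‖z‖) / 2) with hδ
      have hδ0 : 0 < δ := lt_min (by linarith) (by linarith)
      refine ⟨z + δ, ⟨?_, ?_⟩, ?_⟩
      · simp only [mem_ball, dist_zero_right]
        calc ‖z + δ‖ ≤ ‖z‖ + ‖(δ : ℂ)‖ := norm_add_le _ _
          _ = ‖z‖ + δ := by rw [norm_real, norm_of_nonneg hδ0.le]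
          _ < r / 4 := by grind
      · simp [hz0, hδ0]
      · simp only [dist_eq_norm, sub_add_cancel_left, norm_neg, norm_real,
          norm_of_nonneg hδ0.le]
        grind
    have : (𝓝[D] z).NeBot := mem_closure_iff_nhdsWithin_neBot.1 hzcl
    have h2 : Tendsto (fun z => (E z).re) (𝓝[D] z) (𝓝 0) := by
      have h3 := hlim z.im ((abs_im_le_norm z).trans_lt (by
        have : ‖z‖ < r / 4 := by simpa using hz
        linarith))
      rw [← hzI] at h3
      refine (h3.mono_left (nhdsWithin_mono _ hDsub)).congr' ?_
      filter_upwards [self_mem_nhdsWithin] with w hw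
      rw [hEg hw]
    exact tendsto_nhds_unique ((continuous_re.comp hEc).continuousAt.mono_left nhdsWithin_le_nhds)
      h2
  -- The factor `I` turns vanishing real part on the axis into real values, as the reflection
  -- requires. It is undone by the factor `-I` below.
  have hrefl : DifferentiableOn ℂ (reflect fun z => I * E z) (ball 0 (r / 4)) := by
    apply differentiableOn_reflect isOpen_ball
    · simp
    · fun_prop
    · refine DifferentiableOn.const_mul ?_ I
      exact (hg.mono hDsub).congr fun z hz => (hEg hz).symm
    simp_all
  have hGre : ∀ z, 0 ≤ z.re → -I * reflect (fun z => I * E z) z = E z := by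
    intro z hz
    rw [reflect, if_pos hz, ← mul_assoc, neg_mul, I_mul_I, neg_neg, one_mul]
  refine ⟨fun z => -I * reflect (fun z => I * E z) z, hrefl.const_mul _, ?_, ?_, ?_⟩
  · grind
  · grind
  · have hpos : ∀ z ∈ ball (0 : ℂ) (r / 4), 0 ≤ z.re → |(E z).re| ≤ M := by
      intro z hz hz0
      rcases hz0.lt_or_eq with h | h
      · rw [← hEg ⟨hz, h⟩]; grind
      grind
    intro z hz
    rcases le_or_gt 0 z.re with h | h
    · grind
    · simp only [reflect, if_neg (not_le.2 h)]
      simpa using (hpos (-conj z) (by simpa using hz) (by simpa using h.le))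

theorem norm_deriv_deriv_le_of_abs_re_le {g : ℂ → ℂ} {c : ℂ} {ρ S : ℝ} (hρ : 0 < ρ)
    (hg : DifferentiableOn ℂ g (ball c ρ))
    (hS : ∀ z ∈ ball c ρ, |(g z).re| ≤ S) : ‖deriv (deriv g) c‖ ≤ 64 * S / ρ ^ 2 := by
  have h1 : DifferentiableOn ℂ (deriv g) (ball c ρ) := hg.deriv isOpen_ball
  have h2 : ∀ z ∈ Metric.sphere c (ρ / 2), ‖deriv g z‖ ≤ 16 * S / ρ := by
    intro z hz
    have hz' : ‖z - c‖ = ρ / 2 := by simp_all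
    have hsub : ball z (ρ / 2) ⊆ ball c ρ := by
      apply Metric.ball_subset_ball'; rw [dist_eq_norm, hz']; linarith
    refine (norm_deriv_le_of_abs_re_le (half_pos hρ) (hg.mono hsub)
      (fun w hw => hS w (hsub hw))).trans (le_of_eq ?_)
    field_simp; ring
  have hS0 : 0 ≤ S := (abs_nonneg _).trans (hS c (mem_ball_self hρ))
  refine (Complex.norm_deriv_le_of_forall_mem_sphere_norm_le (half_pos hρ) (h1.diffContOnCl_ball (by
      intro z hz
      exact Metric.closedBall_subset_ball (by linarith) hz)) h2).trans ?_
  rw [div_div, div_le_div_iff₀ (by positivity) (by positivity)]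
  nlinarith

/-! ### The hypergeometric factor -/

/-- The coefficients of `1 - F(-1/2, 2b, 2b + 3/2; w)`, starting at the power `w`. -/
def hypCoeff (b : ℝ) : ℕ → ℝ
  | 0 => b / (2 * b + 3 / 2)
  | n + 1 => hypCoeff b n * ((n + 1 / 2) * (2 * b + n + 1) / ((2 * b + 5 / 2 + n) * (n + 2)))

include hb

theorem hypCoeff_pos (n : ℕ) : 0 < hypCoeff b n := by
  induction n with
  | zero => simp only [hypCoeff]; positivity
  | succ n ih => simp only [hypCoeff]; positivity

theorem hypCoeff_succ (n : ℕ) :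
    (n + 2) * (2 * b + n + 5 / 2) * hypCoeff b (n + 1) =
      (n + 1 / 2) * (2 * b + n + 1) * hypCoeff b n := by
  simp only [hypCoeff]; field_simp; ring

/-- With `T_n = (n+1)(2b+n+3/2) c_n`, the recursion says `T_n - T_{n+1} = (n+1+b) c_n`, and `T_0 =
b`. The sum therefore telescopes. Positivity of the remainder is all that is used afterwards. -/
theorem sum_hypCoeff (N : ℕ) :
    ∑ n ∈ Finset.range N, (n + 1 + b) * hypCoeff b n =
      b - (N + 1) * (2 * b + N + 3 / 2) * hypCoeff b N := by
  induction N with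
  | zero =>
    simp only [hypCoeff, Finset.range_zero, Finset.sum_empty, Nat.cast_zero]; field_simp; ring
  | succ n ih =>
    rw [Finset.sum_range_succ, ih]; have := hypCoeff_succ hb n; grind

theorem summable_hypCoeff_weighted :
    Summable (fun n : ℕ => (n + 1 + b) * hypCoeff b n) ∧
      ∑' n : ℕ, (n + 1 + b) * hypCoeff b n ≤ b := by
  have h0 : ∀ n : ℕ, 0 ≤ (n + 1 + b) * hypCoeff b n := fun n => by
    have := hypCoeff_pos hb n; positivity
  have h1 : ∀ N : ℕ, ∑ n ∈ Finset.range N, (n + 1 + b) * hypCoeff b n ≤ b := fun N => by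
    rw [sum_hypCoeff hb]; have := hypCoeff_pos hb N
    have : 0 ≤ (N + 1) * (2 * b + N + 3 / 2) * hypCoeff b N := by positivity
    linarith
  exact ⟨summable_of_sum_range_le h0 h1, Real.tsum_le_of_sum_range_le h0 h1⟩

theorem summable_nat_mul_hypCoeff :
    Summable (fun n : ℕ => ((n : ℝ) + 1) * hypCoeff b n) :=
  Summable.of_nonneg_of_le (fun n => by have := hypCoeff_pos hb n; positivity)
    (fun n => by have := hypCoeff_pos hb n; nlinarith) (summable_hypCoeff_weighted hb).1

theorem summable_hypCoeff : Summable (hypCoeff b) :=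
  Summable.of_nonneg_of_le (fun n => (hypCoeff_pos hb n).le) (fun n => by
      have := hypCoeff_pos hb n
      simp_all) (summable_nat_mul_hypCoeff hb)

/-- This is the coefficient condition behind univalence: it compares `w g'` with `b g` for `g =
F(-1/2, 2b, 2b+3/2; -w)` simultaneously on the whole closed disk. -/
theorem tsum_nat_mul_hypCoeff_le :
    ∑' n : ℕ, ((n : ℝ) + 1) * hypCoeff b n ≤ b * (1 - ∑' n : ℕ, hypCoeff b n) := by
  have h := (summable_hypCoeff_weighted hb).2
  have : ∑' n : ℕ, (n + 1 + b) * hypCoeff b n =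
      ∑' n : ℕ, ((n : ℝ) + 1) * hypCoeff b n + b * ∑' n : ℕ, hypCoeff b n := by
    rw [← tsum_mul_left, ← ((summable_nat_mul_hypCoeff hb).tsum_add
      ((summable_hypCoeff hb).mul_left b))]
    grind
  linarith

theorem tsum_hypCoeff_lt_one : ∑' n : ℕ, hypCoeff b n < 1 := by
  have h2 : 0 < ∑' n : ℕ, ((n : ℝ) + 1) * hypCoeff b n :=
    (summable_nat_mul_hypCoeff hb).tsum_pos (fun n => by have := hypCoeff_pos hb n; positivity) 0
      (by have := hypCoeff_pos hb 0; positivity)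
  have : 0 < b * (1 - ∑' n : ℕ, hypCoeff b n) := h2.trans_le (tsum_nat_mul_hypCoeff_le hb); simp_all

omit hb in
/-- The Taylor coefficients of `hypFactor b` at `0`. -/
def hypTaylor (b : ℝ) : ℕ → ℂ
  | 0 => 1
  | n + 1 => -hypCoeff b n * (-1) ^ (n + 1)

theorem hypTaylor_succ (n : ℕ) :
    ((n : ℂ) + 1) * (n + 2 * b + 3 / 2) * hypTaylor b (n + 1) =
      -((n - 1 / 2) * (n + 2 * b)) * hypTaylor b n := by
  cases n with
  | zero =>
    have h1 : (2 * b + 3 / 2 : ℂ) ≠ 0 := by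
      have : ((2 * b + 3 / 2 : ℝ) : ℂ) ≠ 0 := ofReal_ne_zero.mpr (by positivity)
      simp_all
    simp only [hypTaylor, hypCoeff]; push_cast; grind
  | succ n =>
    have h := congrArg (fun x : ℝ => (x : ℂ)) (hypCoeff_succ hb n); push_cast at h
    simp only [hypTaylor, pow_succ]; grind

/-- The leading factor never vanishes for `b > 0`. This identifies three sequences below: the
hypergeometric coefficients, those of an arbitrary power series solution, and those of Euler's
integral. -/
theorem eq_hypTaylor_of_recursion {a : ℕ → ℂ} (h0 : a 0 = 1)
    (h : ∀ n : ℕ, ((n : ℂ) + 1) * (n + 2 * b + 3 / 2) * a (n + 1) =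
      -((n - 1 / 2) * (n + 2 * b)) * a n) : a = hypTaylor b := by
  funext n
  induction n with
  | zero => rw [h0, hypTaylor]
  | succ n ih =>
    have h1 : ((n : ℂ) + 1) * (n + 2 * b + 3 / 2) ≠ 0 := by
      have : ((((n : ℝ) + 1) * (n + 2 * b + 3 / 2) : ℝ) : ℂ) ≠ 0 :=
        ofReal_ne_zero.mpr (by positivity)
      simp_all
    apply mul_left_cancel₀ h1; rw [h, hypTaylor_succ hb, ih]

theorem hypFactor_eq_tsum (w : ℂ) :
    hypFactor b w = ∑' n : ℕ, hypTaylor b n * w ^ n := by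
  have key : (fun n : ℕ => ((n.factorial⁻¹ : ℂ) * (ascPochhammer ℂ n).eval (-1 / 2) *
      (ascPochhammer ℂ n).eval (2 * b : ℂ) * ((ascPochhammer ℂ n).eval (2 * b + 3 / 2 : ℂ))⁻¹) *
        (-1) ^ n) = hypTaylor b := by
    apply eq_hypTaylor_of_recursion hb
    · simp
    · intro n
      have h1 : (2 * b + 3 / 2 + n : ℂ) ≠ 0 := by
        have : ((2 * b + 3 / 2 + n : ℝ) : ℂ) ≠ 0 := ofReal_ne_zero.mpr (by positivity)
        simp_all
      have h2 : ((n : ℂ) + 1) ≠ 0 := by exact_mod_cast Nat.succ_ne_zero n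
      have h3 : (n.factorial : ℂ) ≠ 0 := by exact_mod_cast n.factorial_ne_zero
      rw [ascPochhammer_succ_eval, ascPochhammer_succ_eval, ascPochhammer_succ_eval,
        Nat.factorial_succ, mul_inv]
      grind
  rw [hypFactor, ordinaryHypergeometric_eq_tsum]; refine tsum_congr fun n => ?_
  rw [← congrFun key n, smul_eq_mul, neg_pow w n]; ring

theorem norm_hypTaylor_succ_mul_pow_le (n : ℕ) (hw : ‖w‖ ≤ 1) :
    ‖hypTaylor b (n + 1) * w ^ (n + 1)‖ ≤ hypCoeff b n := by
  rw [hypTaylor, norm_mul, norm_mul, norm_neg, norm_pow, norm_pow, norm_neg, norm_one, one_pow,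
    mul_one, norm_real, norm_of_nonneg (hypCoeff_pos hb n).le]
  exact mul_le_of_le_one_right (hypCoeff_pos hb n).le (pow_le_one₀ (norm_nonneg _) hw)

theorem hasSum_hypFactor (hw : ‖w‖ ≤ 1) :
    HasSum (fun n : ℕ => hypTaylor b n * w ^ n) (hypFactor b w) := by
  rw [hypFactor_eq_tsum hb]; apply Summable.hasSum; rw [← summable_nat_add_iff 1]
  exact Summable.of_norm_bounded (summable_hypCoeff hb)
    (fun n => norm_hypTaylor_succ_mul_pow_le hb n hw)

theorem hasSum_hypFactor' (hw : ‖w‖ ≤ 1) :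
    HasSum (fun n : ℕ => hypCoeff b n * (-w) ^ (n + 1)) (1 - hypFactor b w) := by
  have h := (hasSum_nat_add_iff' 1).mpr (hasSum_hypFactor hb hw)
  simp only [Finset.range_one, Finset.sum_singleton, pow_zero, mul_one] at h
  rw [show hypTaylor b 0 = 1 from rfl] at h; convert! h.neg using 1
  · funext n; rw [hypTaylor, neg_pow w]; ring
  · ring

theorem continuousOn_hypFactor :
    ContinuousOn (hypFactor b) (closedBall 0 1) := by
  refine (continuousOn_const (c := (1 : ℂ)).add (continuousOn_tsum (fun n => by fun_prop)
    (summable_hypCoeff hb) (fun n w hw => norm_hypTaylor_succ_mul_pow_le hb n (by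
    simpa using hw)))).congr fun w hw => ?_
  have hs := (hasSum_hypFactor hb (w := w) (by simpa using hw))
  rw [← hs.tsum_eq, hs.summable.tsum_eq_zero_add]; simp [hypTaylor]

theorem differentiableOn_hypFactor :
    DifferentiableOn ℂ (hypFactor b) (ball 0 1) := by
  have h : DifferentiableOn ℂ (fun w => ∑' n : ℕ, hypTaylor b (n + 1) * w ^ (n + 1)) (ball 0 1) :=
    differentiableOn_tsum_of_summable_norm (summable_hypCoeff hb) (fun n => by fun_prop) isOpen_ball
      (fun n w hw => norm_hypTaylor_succ_mul_pow_le hb n (by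
        have : ‖w‖ < 1 := by simpa using hw
        exact this.le))
  refine ((differentiableOn_const (c := (1 : ℂ))).add h).congr fun w hw => ?_
  have hw' : ‖w‖ < 1 := by simpa using hw
  have hs := (hasSum_hypFactor hb (w := w) hw'.le); rw [← hs.tsum_eq, hs.summable.tsum_eq_zero_add]
  simp [hypTaylor]

omit hb

/-! ### Power series solutions -/

theorem eq_zero_of_hasSum_pow {u : ℕ → ℂ}
    (h : ∀ w ∈ ball (0 : ℂ) 1, HasSum (fun n : ℕ => u n * w ^ n) 0) : u = 0 := by
  have hp : HasFPowerSeriesAt (fun _ : ℂ => (0 : ℂ)) (FormalMultilinearSeries.ofScalars ℂ u) 0 := by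
    rw [hasFPowerSeriesAt_iff]; filter_upwards [ball_mem_nhds (0 : ℂ) one_pos] with w hw
    simpa [FormalMultilinearSeries.coeff_ofScalars, mul_comm] using h w hw
  have h0 := hp.eq_zero; simp_all

/-- The `n`-th Taylor coefficient at `0`. -/
def taylorAt (g : ℂ → ℂ) (n : ℕ) : ℂ := (n.factorial : ℂ)⁻¹ * iteratedDeriv n g 0

theorem hasSum_taylorAt {g : ℂ → ℂ} (hg : DifferentiableOn ℂ g (ball 0 1)) (hw : w ∈ ball (0 : ℂ) 1)
    : HasSum (fun n : ℕ => taylorAt g n * w ^ n) (g w) := by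
  have := Complex.hasSum_taylorSeries_on_ball hg hw; convert! this using 2
  rw [taylorAt]; ring

theorem taylorAt_deriv (g : ℂ → ℂ) (n : ℕ) :
    taylorAt (deriv g) n = (n + 1) * taylorAt g (n + 1) := by
  rw [taylorAt, taylorAt, iteratedDeriv_succ', Nat.factorial_succ]; push_cast; field_simp

theorem taylorAt_eq_of_hasSum {g : ℂ → ℂ} (hg : DifferentiableOn ℂ g (ball 0 1))
    {a : ℕ → ℂ} (h : ∀ w ∈ ball (0 : ℂ) 1, HasSum (fun n : ℕ => a n * w ^ n) (g w)) :
    taylorAt g = a := by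
  have : (fun n => taylorAt g n - a n) = 0 := eq_zero_of_hasSum_pow fun w hw => by
    have := (hasSum_taylorAt hg hw).sub (h w hw); rw [sub_self] at this; grind
  funext n; exact sub_eq_zero.mp (congrFun this n)

theorem HasSum.mul_shift {v : ℕ → ℂ} (h0 : v 0 = 0) {w s : ℂ}
    (h : HasSum (fun n : ℕ => v (n + 1) * w ^ n) s) :
    HasSum (fun n : ℕ => v n * w ^ n) (w * s) := by
  rw [← hasSum_nat_add_iff' 1]
  simp only [Finset.range_one, Finset.sum_singleton, h0, zero_mul, sub_zero]
  convert! h.mul_left w using 2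
  rw [pow_succ]; ring

/-- The left hand side of the hypergeometric equation for `F(-1/2, 2b, 2b + 3/2; -w)`. -/
def hypOp (b : ℝ) (g : ℂ → ℂ) (w : ℂ) : ℂ :=
  w * (1 + w) * deriv (deriv g) w + (2 * b + 3 / 2 + (2 * b + 1 / 2) * w) * deriv g w - b * g w

/-- Comparing coefficients uses `n(n-1) + (2b+1/2)n - b = (n-1/2)(n+2b)`. The equation thus becomes
a two-term recursion, so `g 0` determines the solution that is regular at `0`. -/
theorem hasSum_hypOp {g : ℂ → ℂ} (hg : DifferentiableOn ℂ g (ball 0 1)) (hw : w ∈ ball (0 : ℂ) 1) :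
    HasSum (fun n : ℕ => (((n : ℂ) + 1) * (n + 2 * b + 3 / 2) * taylorAt g (n + 1) +
      (n - 1 / 2) * (n + 2 * b) * taylorAt g n) * w ^ n) (hypOp b g w) := by
  have hg1 := hg.deriv isOpen_ball; have s1 := hasSum_taylorAt hg1 hw
  have s2 := hasSum_taylorAt (hg1.deriv isOpen_ball) hw; simp only [taylorAt_deriv] at s1 s2
  have t1 : HasSum (fun n : ℕ => (n * taylorAt g n) * w ^ n) (w * deriv g w) :=
    HasSum.mul_shift (v := fun n : ℕ => n * taylorAt g n) (by simp) (by grind)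
  have t2 : HasSum (fun n : ℕ => (n * (n + 1) * taylorAt g (n + 1)) * w ^ n)
      (w * deriv (deriv g) w) :=
    HasSum.mul_shift (v := fun n : ℕ => n * (n + 1) * taylorAt g (n + 1)) (by simp) (by grind)
  have t3 : HasSum (fun n : ℕ => (n * (n - 1) * taylorAt g n) * w ^ n)
      (w * (w * deriv (deriv g) w)) :=
    HasSum.mul_shift (v := fun n : ℕ => n * (n - 1) * taylorAt g n) (by simp) (by grind)
  have := (((t2.add t3).add (s1.mul_left (2 * b + 3 / 2 : ℂ))).add
    (t1.mul_left (2 * b + 1 / 2 : ℂ))).sub ((hasSum_taylorAt hg hw).mul_left (b : ℂ))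
  convert! this using 1
  · funext n; ring
  · rw [hypOp]; ring

include hb

theorem taylorAt_hypFactor : taylorAt (hypFactor b) = hypTaylor b :=
  taylorAt_eq_of_hasSum (differentiableOn_hypFactor hb) fun w hw =>
    hasSum_hypFactor hb (by
      have : ‖w‖ < 1 := by simpa using hw
      exact this.le)

theorem hypOp_hypFactor (hw : w ∈ ball (0 : ℂ) 1) :
    hypOp b (hypFactor b) w = 0 := by
  have h := hasSum_hypOp (b := b) (differentiableOn_hypFactor hb) hw
  rw [taylorAt_hypFactor hb] at h; refine h.unique ?_; convert! hasSum_zero using 2 with n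
  rw [hypTaylor_succ hb]; ring

theorem eqOn_hypFactor_of_hypOp_eq_zero {g : ℂ → ℂ}
    (hg : DifferentiableOn ℂ g (ball 0 1)) (h0 : g 0 = 1)
    (h : ∀ w ∈ ball (0 : ℂ) 1, hypOp b g w = 0) :
    EqOn g (hypFactor b) (ball 0 1) := by
  have ht : taylorAt g = hypTaylor b := by
    apply eq_hypTaylor_of_recursion hb
    · simp [taylorAt, h0]
    · intro n
      have := congrFun (eq_zero_of_hasSum_pow fun w hw => (h w hw) ▸ hasSum_hypOp (b := b) hg hw) n
      simp only [Pi.zero_apply] at this; linear_combination this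
  intro w hw; rw [← (hasSum_taylorAt hg hw).tsum_eq, ht, hypFactor_eq_tsum hb]

/-! ### Bounds on the closed unit disk -/

omit hb in
/-- The function `w g'(w)` for `g = hypFactor b`, as a power series on the closed disk. -/
def hypEuler (b : ℝ) (w : ℂ) : ℂ := -∑' n : ℕ, ((n : ℝ) + 1) * hypCoeff b n * (-w) ^ (n + 1)

theorem norm_hypEuler_term_le (n : ℕ) (hw : ‖w‖ ≤ 1) :
    ‖((n : ℝ) + 1 : ℂ) * hypCoeff b n * (-w) ^ (n + 1)‖ ≤ ((n : ℝ) + 1) * hypCoeff b n := by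
  have h1 : ‖((n : ℝ) + 1 : ℂ) * hypCoeff b n‖ = ((n : ℝ) + 1) * hypCoeff b n := by
    have := hypCoeff_pos hb n
    rw [show ((n : ℝ) + 1 : ℂ) * hypCoeff b n = (((n : ℝ) + 1) * hypCoeff b n : ℝ) by push_cast; rfl,
      norm_real, norm_of_nonneg (by positivity)]
  rw [norm_mul, h1, norm_pow, norm_neg]; have := hypCoeff_pos hb n
  exact mul_le_of_le_one_right (by positivity) (pow_le_one₀ (norm_nonneg _) hw)

theorem continuousOn_hypEuler : ContinuousOn (hypEuler b) (closedBall 0 1) :=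
  (continuousOn_tsum (fun n => by fun_prop) (summable_nat_mul_hypCoeff hb)
      (fun n w hw => norm_hypEuler_term_le hb n (by simpa using hw))).neg

theorem mul_deriv_hypFactor (hw : w ∈ ball (0 : ℂ) 1) :
    w * deriv (hypFactor b) w = hypEuler b w := by
  have hs := hasSum_taylorAt ((differentiableOn_hypFactor hb).deriv isOpen_ball) hw
  simp only [taylorAt_deriv, taylorAt_hypFactor hb] at hs
  rw [hypEuler, ← hs.tsum_eq, ← tsum_mul_left, ← tsum_neg]; refine tsum_congr fun n => ?_
  rw [hypTaylor, neg_pow w (n + 1), pow_succ w]; push_cast; ring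

/-- Each term of `Re (1 - g)` is at most its coefficient. The first term, with `-w` to the power
one, is strictly smaller unless `-w = 1`. -/
theorem one_sub_tsum_lt_re_hypFactor (hw : ‖w‖ ≤ 1) (h1 : w ≠ -1) :
    1 - ∑' n : ℕ, hypCoeff b n < (hypFactor b w).re := by
  have h : HasSum (fun n : ℕ => ((hypCoeff b n : ℂ) * (-w) ^ (n + 1)).re)
      (1 - hypFactor b w).re := reCLM.hasSum (hasSum_hypFactor' hb hw)
  rw [sub_re, one_re] at h
  have hle : ∀ n : ℕ, ((hypCoeff b n : ℂ) * (-w) ^ (n + 1)).re ≤ hypCoeff b n := fun n => by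
    rw [re_ofReal_mul]
    refine mul_le_of_le_one_right (hypCoeff_pos hb n).le ((re_le_norm _).trans ?_)
    rw [norm_pow, norm_neg]; exact pow_le_one₀ (norm_nonneg _) hw
  have hlt : ((hypCoeff b 0 : ℂ) * (-w) ^ (0 + 1)).re < hypCoeff b 0 := by
    rw [re_ofReal_mul, zero_add, pow_one, neg_re]
    refine mul_lt_of_lt_one_right (hypCoeff_pos hb 0) ?_; by_contra hcon; apply h1
    have h2 : w.re ^ 2 + w.im ^ 2 ≤ 1 := by
      have := Complex.sq_norm w; rw [normSq_apply] at this; nlinarith [norm_nonneg w]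
    have h3 : w.re = -1 := by nlinarith [sq_nonneg w.im]
    have h4 : w.im = 0 := by simp_all
    apply Complex.ext <;> simp [h3, h4]
  have := hasSum_lt hle hlt h (summable_hypCoeff hb).hasSum; linarith

theorem re_hypFactor_pos (hw : ‖w‖ ≤ 1) : 0 < (hypFactor b w).re := by
  have h : HasSum (fun n : ℕ => ((hypCoeff b n : ℂ) * (-w) ^ (n + 1)).re)
      (1 - hypFactor b w).re := reCLM.hasSum (hasSum_hypFactor' hb hw)
  rw [sub_re, one_re] at h
  have hle : ∀ n : ℕ, ((hypCoeff b n : ℂ) * (-w) ^ (n + 1)).re ≤ hypCoeff b n := fun n => by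
    rw [re_ofReal_mul]
    refine mul_le_of_le_one_right (hypCoeff_pos hb n).le ((re_le_norm _).trans ?_)
    rw [norm_pow, norm_neg]; exact pow_le_one₀ (norm_nonneg _) hw
  have := hasSum_le hle h (summable_hypCoeff hb).hasSum; linarith [tsum_hypCoeff_lt_one hb]

/-- The chain is `|w g'| ≤ Σ (n+1) c_n ≤ b (1 - Σ c_n) < b Re g`. The point `w = -1`, which
corresponds to the corners, is the only place where equality is not excluded. -/
theorem norm_hypEuler_lt (hw : ‖w‖ ≤ 1) (h1 : w ≠ -1) :
    ‖hypEuler b w‖ < b * (hypFactor b w).re := by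
  have h2 : ‖hypEuler b w‖ ≤ ∑' n : ℕ, ((n : ℝ) + 1) * hypCoeff b n := by
    rw [hypEuler, norm_neg]
    exact tsum_of_norm_bounded (summable_nat_mul_hypCoeff hb).hasSum
      (fun n => norm_hypEuler_term_le hb n hw)
  calc ‖hypEuler b w‖ ≤ _ := h2
    _ ≤ b * (1 - ∑' n : ℕ, hypCoeff b n) := tsum_nat_mul_hypCoeff_le hb
    _ < _ := mul_lt_mul_of_pos_left (one_sub_tsum_lt_re_hypFactor hb hw h1) hb

omit hb in
theorem hypFactor_zero (b : ℝ) : hypFactor b 0 = 1 := by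
  rw [hypFactor, neg_zero, ordinaryHypergeometric_zero]

theorem hypFactor_conj (w : ℂ) :
    hypFactor b (conj w) = conj (hypFactor b w) := by
  rw [hypFactor_eq_tsum hb, hypFactor_eq_tsum hb, conj_tsum]; refine tsum_congr fun n => ?_
  cases n with
  | zero => simp [hypTaylor]
  | succ n => simp [hypTaylor]

omit hb

/-! ### Analytic continuation of the hypergeometric factor by Euler's integral -/

/-- The domain of the continuation: the plane cut along `(-∞, -1]`. -/
def cutPlane : Set ℂ := {w | 1 + w ∈ slitPlane}

theorem isOpen_cutPlane : IsOpen cutPlane :=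
  isOpen_slitPlane.preimage (by fun_prop : Continuous fun w : ℂ => 1 + w)

theorem one_add_mul_mem_slitPlane (hw : w ∈ cutPlane) {t : ℝ} (ht : t ∈ Icc (0 : ℝ) 1) :
    1 + w * t ∈ slitPlane := by
  convert! (starConvex_one_slitPlane (show 1 + w ∈ slitPlane from hw) (sub_nonneg.mpr ht.2) ht.1 (by
    ring)) using 1
  simp only [real_smul]; push_cast; ring

theorem starConvex_cutPlane : StarConvex ℝ 0 cutPlane := by
  intro w hw s t hs ht hst; show 1 + _ ∈ slitPlane
  convert! (one_add_mul_mem_slitPlane hw (t := t) ⟨ht, by linarith⟩) using 2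
  simp only [real_smul]; ring

theorem mem_cutPlane_of_norm_le_one (hw : ‖w‖ ≤ 1) (h1 : w ≠ -1) : w ∈ cutPlane := by
  show 1 + w ∈ slitPlane; rw [mem_slitPlane_iff, add_re, one_re, add_im, one_im, zero_add]
  have h2 : w.re ^ 2 + w.im ^ 2 ≤ 1 := by
    have := Complex.sq_norm w; rw [normSq_apply] at this; nlinarith [norm_nonneg w]
  by_cases h : w.im = 0
  · left; by_contra hcon
    push Not at hcon
    have h3 : w.re = -1 := by nlinarith [sq_nonneg w.im]
    exact h1 (Complex.ext (by simp [h3]) (by simp [h]))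
  · exact Or.inr h

/-- The weight in Euler's integral. -/
def eulerWeight (b : ℝ) (t : ℝ) : ℂ := (t : ℂ) ^ ((2 * b : ℂ) - 1) * (1 - (t : ℂ)) ^ ((3 / 2 : ℂ) - 1)

include hb

theorem intervalIntegrable_eulerWeight :
    IntervalIntegrable (eulerWeight b) MeasureTheory.volume 0 1 := by
  apply betaIntegral_convergent
  · simp_all
  · norm_num

omit hb in
/-- The continuation of `hypFactor b`. -/
def hypExt (b : ℝ) (w : ℂ) : ℂ :=
  (betaIntegral (2 * b) (3 / 2))⁻¹ * ∫ t in (0 : ℝ)..1, eulerWeight b t * (1 + w * t) ^ (1 / 2 : ℂ)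

/-- Differentiation under the integral sign: the weight is integrable, and the remaining factor of
the derivative is bounded for `w` in a small closed disk and `t` in `[0, 1]` by compactness. -/
theorem differentiableOn_hypExt : DifferentiableOn ℂ (hypExt b) cutPlane := by
  intro w0 hw0; apply DifferentiableAt.differentiableWithinAt; apply DifferentiableAt.const_mul
  obtain ⟨ε, hε, hball⟩ := Metric.nhds_basis_closedBall.mem_iff.mp (isOpen_cutPlane.mem_nhds hw0)
  have hcont : ∀ s : ℂ, ContinuousOn (fun p : ℂ × ℝ => (1 + p.1 * p.2) ^ s)
      (closedBall w0 ε ×ˢ Icc (0 : ℝ) 1) := fun s =>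
    ContinuousOn.cpow_const (by fun_prop) fun p hp => one_add_mul_mem_slitPlane (hball hp.1) hp.2
  obtain ⟨C, hC⟩ := ((isCompact_closedBall w0 ε).prod isCompact_Icc).exists_bound_of_continuousOn
    (hcont (1 / 2 - 1))
  have hsec : ∀ s : ℂ, ∀ w ∈ closedBall w0 ε,
      ContinuousOn (fun t : ℝ => (1 + w * t) ^ s) (uIcc (0 : ℝ) 1) := fun s w hw => by
    rw [uIcc_of_le zero_le_one]
    exact (hcont s).comp (f := fun t : ℝ => (w, t)) (by fun_prop) fun t ht => ⟨hw, ht⟩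
  have hint : ∀ s : ℂ, ∀ w ∈ closedBall w0 ε, IntervalIntegrable
      (fun t : ℝ => eulerWeight b t * (1 + w * t) ^ s) MeasureTheory.volume 0 1 := fun s w hw =>
    (intervalIntegrable_eulerWeight hb).mul_continuousOn (hsec s w hw)
  have hmem : w0 ∈ closedBall w0 ε := Metric.mem_closedBall_self hε.le
  have huIoc : ∀ t : ℝ, t ∈ uIoc (0 : ℝ) 1 → t ∈ Icc (0 : ℝ) 1 := fun t ht => by grind
  refine (intervalIntegral.hasDerivAt_integral_of_dominated_loc_of_deriv_le
    (F' := fun w t => eulerWeight b t * ((1 / 2 : ℂ) * (1 + w * t) ^ ((1 / 2 : ℂ) - 1) * t))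
    (bound := fun t => ‖eulerWeight b t‖ * C)
    (closedBall_mem_nhds w0 hε) ?_ (hint _ _ hmem) ?_ ?_ ?_ ?_).2.differentiableAt
  · filter_upwards [closedBall_mem_nhds w0 hε] with w hw
    exact (intervalIntegrable_iff.mp (hint _ w hw)).aestronglyMeasurable
  · have : IntervalIntegrable
        (fun t : ℝ => eulerWeight b t * ((1 / 2 : ℂ) * (1 + w0 * t) ^ ((1 / 2 : ℂ) - 1) * t))
        MeasureTheory.volume 0 1 :=
      (intervalIntegrable_eulerWeight hb).mul_continuousOn
        ((continuousOn_const.mul (hsec _ _ hmem)).mul (by fun_prop))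
    exact (intervalIntegrable_iff.mp this).aestronglyMeasurable
  · refine Eventually.of_forall fun t ht w hw => ?_; have ht' := huIoc t ht; rw [norm_mul]
    refine mul_le_mul_of_nonneg_left ?_ (norm_nonneg _)
    rw [norm_mul, norm_mul, norm_real, norm_of_nonneg ht'.1]; have h1 := hC (w, t) ⟨hw, ht'⟩
    have h2 : ‖(1 / 2 : ℂ)‖ = 1 / 2 := by norm_num
    have h3 := norm_nonneg ((1 + w * (t : ℂ)) ^ ((1 / 2 : ℂ) - 1))
    nlinarith [ht'.1, ht'.2, mul_nonneg h3 ht'.1, mul_nonneg h3 (sub_nonneg.mpr ht'.2)]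
  · exact (intervalIntegrable_eulerWeight hb).norm.mul_const C
  · refine Eventually.of_forall fun t ht w hw => ?_; apply HasDerivAt.const_mul
    have h1 : HasDerivAt (fun w : ℂ => 1 + w * t) t w := by
      simpa using ((hasDerivAt_id w).mul_const (t : ℂ)).const_add 1
    exact h1.cpow_const (one_add_mul_mem_slitPlane (hball hw) (huIoc t ht))

omit hb

theorem betaIntegral_add_one_left {u v : ℂ} (hu : 0 < u.re) (hv : 0 < v.re) :
    (u + v) * betaIntegral (u + 1) v = u * betaIntegral u v := by
  have h1 := Gamma_mul_Gamma_eq_betaIntegral hu hv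
  have h2 := Gamma_mul_Gamma_eq_betaIntegral (s := u + 1) (t := v) (by simp; linarith) hv
  have huv : u + v ≠ 0 := fun h => by
    have := congrArg re h; simp only [add_re, zero_re] at this; linarith
  have hG : Gamma (u + v) ≠ 0 := Gamma_ne_zero_of_re_pos (by simp; linarith)
  rw [Gamma_add_one u (fun h => by simp [h] at hu), show u + 1 + v = u + v + 1 by
    ring, Gamma_add_one _ huv] at h2
  grind

theorem betaIntegral_ne_zero {u v : ℂ} (hu : 0 < u.re) (hv : 0 < v.re) : betaIntegral u v ≠ 0 := by
  intro h; have h1 := Gamma_mul_Gamma_eq_betaIntegral hu hv; rw [h, mul_zero] at h1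
  exact mul_ne_zero (Gamma_ne_zero_of_re_pos hu) (Gamma_ne_zero_of_re_pos hv) h1

theorem choose_half_succ (n : ℕ) :
    ((n : ℂ) + 1) * Ring.choose (1 / 2 : ℂ) (n + 1) = (1 / 2 - n) * Ring.choose (1 / 2 : ℂ) n := by
  have h1 := Ring.descPochhammer_eq_factorial_smul_choose (1 / 2 : ℂ) (n + 1)
  rw [descPochhammer_succ_right, Polynomial.smeval_mul, Ring.descPochhammer_eq_factorial_smul_choose
    (1 / 2 : ℂ) n] at h1
  simp only [Polynomial.smeval_sub, Polynomial.smeval_X, Polynomial.smeval_natCast, pow_one,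
    pow_zero, nsmul_eq_mul, mul_one, Nat.factorial_succ] at h1
  push_cast at h1
  have h3 : (n.factorial : ℂ) ≠ 0 := by exact_mod_cast n.factorial_ne_zero
  grind

theorem integral_pow_mul_eulerWeight (b : ℝ) (n : ℕ) :
    ∫ t in (0 : ℝ)..1, (t : ℂ) ^ n * eulerWeight b t = betaIntegral (2 * b + n) (3 / 2) := by
  apply intervalIntegral.integral_congr_ae; refine Eventually.of_forall fun t ht => ?_
  rw [uIoc_of_le zero_le_one] at ht
  rw [eulerWeight, show (2 * b + n : ℂ) - 1 = (2 * b - 1) + n by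
    ring, cpow_add _ _ (ofReal_ne_zero.mpr ht.1.ne'),
    cpow_natCast]
  ring

theorem hasSum_one_add_cpow_half {z : ℂ} (hz : ‖z‖ < 1) :
    HasSum (fun n : ℕ => Ring.choose (1 / 2 : ℂ) n * z ^ n) ((1 + z) ^ (1 / 2 : ℂ)) := by
  have h := (one_add_cpow_hasFPowerSeriesOnBall_zero (a := (1 / 2 : ℂ))).hasSum (y := z) (by
    rw [← ENNReal.ofReal_one, Metric.eball_ofReal]
    simpa using hz)
  simpa [binomialSeries, FormalMultilinearSeries.coeff_ofScalars, mul_comm] using h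

include hb

theorem hasSum_hypExt (hw : ‖w‖ < 1) :
    HasSum (fun n : ℕ => (betaIntegral (2 * b) (3 / 2))⁻¹ * (Ring.choose (1 / 2 : ℂ) n *
      betaIntegral (2 * b + n) (3 / 2)) * w ^ n) (hypExt b w) := by
  have hmul : ∀ t : ℝ, t ∈ uIoc (0 : ℝ) 1 → ‖w * t‖ ≤ ‖w‖ := fun t ht => by
    rw [uIoc_of_le zero_le_one] at ht; rw [norm_mul, norm_real, norm_of_nonneg ht.1.le]
    exact mul_le_of_le_one_right (norm_nonneg _) ht.2
  have hsum : Summable fun n : ℕ => ‖Ring.choose (1 / 2 : ℂ) n‖ * ‖w‖ ^ n := by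
    have := (hasSum_one_add_cpow_half hw).summable.norm; simp_all
  have key : HasSum (fun n : ℕ => ∫ t in (0 : ℝ)..1,
      eulerWeight b t * (Ring.choose (1 / 2 : ℂ) n * (w * t) ^ n))
      (∫ t in (0 : ℝ)..1, eulerWeight b t * (1 + w * t) ^ (1 / 2 : ℂ)) := by
    refine intervalIntegral.hasSum_integral_of_dominated_convergence
      (fun n t => ‖eulerWeight b t‖ * (‖Ring.choose (1 / 2 : ℂ) n‖ * ‖w‖ ^ n)) ?_ ?_ ?_ ?_ ?_
    · intro n
      have : IntervalIntegrable
          (fun t : ℝ => eulerWeight b t * (Ring.choose (1 / 2 : ℂ) n * (w * t) ^ n))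
          MeasureTheory.volume 0 1 :=
        (intervalIntegrable_eulerWeight hb).mul_continuousOn (by fun_prop)
      exact (intervalIntegrable_iff.mp this).aestronglyMeasurable
    · intro n; refine Eventually.of_forall fun t ht => ?_; rw [norm_mul, norm_mul, norm_pow]
      have := hmul t ht; gcongr
    · exact Eventually.of_forall fun t _ => hsum.mul_left _
    · simp_rw [tsum_mul_left]
      exact (intervalIntegrable_eulerWeight hb).norm.mul_const _
    · refine Eventually.of_forall fun t ht => ?_
      exact (hasSum_one_add_cpow_half ((hmul t ht).trans_lt hw)).mul_left _
  have := key.mul_left (betaIntegral (2 * b) (3 / 2))⁻¹; convert! this using 1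
  funext n
  rw [← integral_pow_mul_eulerWeight b n, mul_assoc, mul_right_comm,
    ← intervalIntegral.integral_const_mul]
  congr 2; funext t; rw [mul_pow]; ring

/-- Termwise integration of the binomial series of `(1 + wt)^{1/2}` yields Beta integrals. The
functional equation of the Beta function and the recursion of the binomial coefficients combine to
the hypergeometric recursion. -/
theorem hypExt_eq_hypFactor_of_norm_lt (hw : ‖w‖ < 1) :
    hypExt b w = hypFactor b w := by
  have hre : 0 < (2 * b : ℂ).re := by simp_all
  have hre2 : 0 < (3 / 2 : ℂ).re := by norm_num
  have key : (fun n : ℕ => (betaIntegral (2 * b) (3 / 2))⁻¹ * (Ring.choose (1 / 2 : ℂ) n *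
      betaIntegral (2 * b + n) (3 / 2))) = hypTaylor b := by
    apply eq_hypTaylor_of_recursion hb
    · simp [betaIntegral_ne_zero hre hre2]
    · intro n
      have h1 := betaIntegral_add_one_left (u := 2 * b + n) (v := 3 / 2)
        (by simp at hre ⊢; positivity) hre2
      have h2 := choose_half_succ n; grind
  have h := hasSum_hypExt hb hw
  have h3 : HasSum (fun n : ℕ => hypTaylor b n * w ^ n) (hypExt b w) := by grind
  exact h3.unique (hasSum_hypFactor hb hw.le)

omit hb in
/-- Two functions that agree on the open unit disk and are continuous at a point `w` of the closed
disk (one of them relative to the closed disk) agree at `w`. -/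
theorem eq_of_eqOn_ball {F G : ℂ → ℂ} (h : EqOn F G (ball 0 1)) (hw : ‖w‖ ≤ 1)
    (hF : ContinuousWithinAt F (closedBall 0 1) w)
    (hG : ContinuousWithinAt G (closedBall 0 1) w) : F w = G w := by
  have hne : (𝓝[ball (0 : ℂ) 1] w).NeBot := by
    rw [← mem_closure_iff_nhdsWithin_neBot, closure_ball _ one_ne_zero]; simpa using hw
  have h1 : Tendsto F (𝓝[ball (0 : ℂ) 1] w) (𝓝 (F w)) := hF.mono ball_subset_closedBall
  exact tendsto_nhds_unique (h1.congr' (eventually_mem_nhdsWithin.mono fun z hz => h hz)) (hG.mono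
    ball_subset_closedBall)

theorem hypExt_eq_hypFactor (hw : ‖w‖ ≤ 1) (h1 : w ≠ -1) :
    hypExt b w = hypFactor b w :=
  eq_of_eqOn_ball (F := hypExt b)
    (fun z hz => hypExt_eq_hypFactor_of_norm_lt hb (by simpa using hz)) hw
    (((differentiableOn_hypExt hb).continuousOn.continuousAt
      (isOpen_cutPlane.mem_nhds (mem_cutPlane_of_norm_le_one hw h1))).continuousWithinAt)
    (continuousOn_hypFactor hb w (by simpa using hw))

theorem deriv_hypExt_of_norm_lt (hw : ‖w‖ < 1) :
    deriv (hypExt b) w = deriv (hypFactor b) w := by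
  apply Filter.EventuallyEq.deriv_eq
  filter_upwards [isOpen_ball.mem_nhds (show w ∈ ball (0 : ℂ) 1 by simpa using hw)] with z hz
  exact hypExt_eq_hypFactor_of_norm_lt hb (by simpa using hz)

theorem mul_deriv_hypExt (hw : ‖w‖ ≤ 1) (h1 : w ≠ -1) :
    w * deriv (hypExt b) w = hypEuler b w := by
  refine eq_of_eqOn_ball (F := fun z => z * deriv (hypExt b) z) (fun z hz => ?_) hw ?_
    (continuousOn_hypEuler hb w (by simpa using hw))
  · show z * _ = _
    rw [deriv_hypExt_of_norm_lt hb (by simpa using hz), mul_deriv_hypFactor hb hz]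
  · have := ((differentiableOn_hypExt hb).deriv isOpen_cutPlane).continuousOn.continuousAt
      (isOpen_cutPlane.mem_nhds (mem_cutPlane_of_norm_le_one hw h1))
    fun_prop

/-- Identity theorem on the star-shaped cut plane. The point is to have the equation on the unit
circle itself, hence on the arc of the sector. -/
theorem hypOp_hypExt (hw : w ∈ cutPlane) :
    hypOp b (hypExt b) w = 0 := by
  have hd := differentiableOn_hypExt hb; have hd1 := hd.deriv isOpen_cutPlane
  have hd2 := hd1.deriv isOpen_cutPlane
  have hop : DifferentiableOn ℂ (hypOp b (hypExt b)) cutPlane := by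
    unfold hypOp; fun_prop
  refine (hop.analyticOnNhd isOpen_cutPlane).eqOn_zero_of_preconnected_of_eventuallyEq_zero
    (starConvex_cutPlane.isPathConnected (by simp [cutPlane])).isConnected.isPreconnected (z₀ := 0) (by simp [cutPlane]) ?_ hw
  filter_upwards [ball_mem_nhds (0 : ℂ) one_pos] with z hz
  have hev : hypExt b =ᶠ[𝓝 z] hypFactor b := by
    filter_upwards [isOpen_ball.mem_nhds hz] with y hy
    exact hypExt_eq_hypFactor_of_norm_lt hb (by simpa using hy)
  have := hypOp_hypFactor hb hz
  rw [hypOp, hev.deriv_eq.symm, hev.deriv.deriv_eq.symm, hev.eq_of_nhds.symm] at this; exact this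

omit hb

/-! ### Injective proper maps -/

/-- Along an ultrafilter converging in the target, properness keeps the preimages in a compact part
of `K`. Their limit maps to the limit point, and injectivity identifies it with the prescribed
preimage. -/
theorem continuousOn_invFunOn_of_proper {f : ℂ → ℂ} {K : Set ℂ} (hK : IsClosed K)
    (hf : ContinuousOn f K) (hi : InjOn f K)
    (hp : ∀ R : ℝ, ∃ M : ℝ, ∀ z ∈ K, ‖f z‖ ≤ R → ‖z‖ ≤ M) :
    ContinuousOn (invFunOn f K) (f '' K) ∧ IsClosed (f '' K) := by
  have key : ∀ (p : ℂ) (u : Ultrafilter ℂ), ↑u ≤ 𝓝 p → (f '' K) ∈ u →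
      ∃ q ∈ K, f q = p ∧ Tendsto (invFunOn f K) u (𝓝 q) := by
    intro p u hu hK'; obtain ⟨M, hM⟩ := hp (‖p‖ + 1)
    have h1 : ∀ᶠ y in (u : Filter ℂ), ‖y‖ ≤ ‖p‖ + 1 := by
      have : ∀ᶠ y in 𝓝 p, ‖y‖ < ‖p‖ + 1 := continuous_norm.continuousAt.eventually_lt_const
        (by linarith)
      exact hu (this.mono fun y hy => hy.le)
    have h2 : ∀ᶠ y in (u : Filter ℂ), invFunOn f K y ∈ K ∩ closedBall 0 M := by
      filter_upwards [h1, hK'] with y hy hyK; obtain ⟨z, hz, rfl⟩ := hyK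
      have hm := invFunOn_mem ⟨z, hz, rfl⟩ (f := f) (b := f z); refine ⟨hm, ?_⟩
      rw [mem_closedBall_zero_iff]; apply hM _ hm
      rwa [invFunOn_eq (f := f) (b := f z) ⟨z, hz, rfl⟩]
    have hc : IsCompact (K ∩ closedBall 0 M) := (isCompact_closedBall 0 M).inter_left hK
    obtain ⟨q, hq, hle⟩ := hc.ultrafilter_le_nhds (u.map (invFunOn f K)) (le_principal_iff.mpr h2)
    have ht : Tendsto (invFunOn f K) u (𝓝 q) := hle; refine ⟨q, hq.1, ?_, ht⟩
    have h4 : Tendsto (fun y => f (invFunOn f K y)) u (𝓝 p) :=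
      (tendsto_id.mono_left hu).congr' (by
        filter_upwards [hK'] with y hy; obtain ⟨z, hz, rfl⟩ := hy
        exact (invFunOn_eq ⟨z, hz, rfl⟩).symm)
    exact tendsto_nhds_unique ((hf q hq.1).tendsto.comp (tendsto_nhdsWithin_iff.mpr ⟨ht, h2.mono fun
      y hy => hy.1⟩)) h4
  constructor
  · intro p hp; rw [ContinuousWithinAt, tendsto_iff_ultrafilter]; intro u hu
    obtain ⟨q, hq, hfq, ht⟩ := key p u (hu.trans nhdsWithin_le_nhds) (hu self_mem_nhdsWithin)
    obtain ⟨a, ha, rfl⟩ := hp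
    have : invFunOn f K (f a) = q := by
      rw [hi hq ha hfq]; exact hi (invFunOn_mem ⟨a, ha, rfl⟩) ha (invFunOn_eq ⟨a, ha, rfl⟩)
    rw [this]; exact ht
  · rw [isClosed_iff_ultrafilter]; grind

theorem isSimplyConnected_image_of_continuousOn_inv {f g : ℂ → ℂ} {S : Set ℂ}
    (hS : IsSimplyConnected S) (hf : ContinuousOn f S) (hg : ContinuousOn g (f '' S))
    (hgf : ∀ z ∈ S, g (f z) = z) : IsSimplyConnected (f '' S) := by
  have hmem : ∀ y : f '' S, g y ∈ S := by grind
  let e : S ≃ₜ (f '' S) :=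
    { toFun := fun z => ⟨f z, z, z.2, rfl⟩
      invFun := fun y => ⟨g y, hmem y⟩
      left_inv := fun z => Subtype.ext (hgf z z.2)
      right_inv := by grind
      continuous_toFun := Continuous.subtype_mk hf.domRestrict _
      continuous_invFun := Continuous.subtype_mk hg.domRestrict _ }
  exact e.toHomotopyEquiv.simplyConnectedSpace_iff.mp hS

theorem Convex.isSimplyConnected {S : Set ℂ} (hS : Convex ℝ S) (hne : S.Nonempty) :
    IsSimplyConnected S :=
  have := hS.contractibleSpace hne
  SimplyConnectedSpace.ofContractible S

/-! ### The sector in the logarithmic coordinate -/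

theorem subset_closedLogSector (b : ℝ) : logSector b ⊆ closedLogSector b :=
  fun _ h => ⟨h.1.le, h.2.le⟩

theorem isOpen_logAngle (b : ℝ) : IsOpen (logAngle b) :=
  isOpen_lt continuous_im.abs continuous_const

theorem isOpen_logSector (b : ℝ) : IsOpen (logSector b) :=
  (isOpen_lt continuous_re continuous_const).inter (isOpen_lt continuous_im.abs continuous_const)

theorem isClosed_closedLogSector (b : ℝ) : IsClosed (closedLogSector b) :=
  (isClosed_le continuous_re continuous_const).inter (isClosed_le continuous_im.abs continuous_const)

theorem convex_abs_im_lt (c : ℝ) : Convex ℝ {l : ℂ | |l.im| < c} := by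
  have : {l : ℂ | |l.im| < c} = imLm ⁻¹' ball 0 c := by
    ext l; simp
  rw [this]; exact (convex_ball 0 c).linear_preimage imLm

theorem convex_abs_im_le (c : ℝ) : Convex ℝ {l : ℂ | |l.im| ≤ c} := by
  have : {l : ℂ | |l.im| ≤ c} = imLm ⁻¹' closedBall 0 c := by
    ext l; simp
  rw [this]; exact (convex_closedBall 0 c).linear_preimage imLm

theorem convex_logAngle (b : ℝ) : Convex ℝ (logAngle b) := convex_abs_im_lt _

theorem convex_logSector (b : ℝ) : Convex ℝ (logSector b) :=
  (convex_halfSpace_re_lt 0).inter (convex_abs_im_lt _)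

theorem convex_closedLogSector (b : ℝ) : Convex ℝ (closedLogSector b) :=
  (convex_halfSpace_re_le 0).inter (convex_abs_im_le _)

include hb

theorem neg_one_mem_logSector : (-1 : ℂ) ∈ logSector b := by
  refine ⟨by simp, ?_⟩
  simp only [neg_im, one_im, neg_zero, abs_zero]; positivity

theorem frontier_logSector :
    frontier (logSector b) = closedLogSector b \ logSector b := by
  have hcl : closure (logSector b) = closedLogSector b := by
    apply subset_antisymm
    · exact closure_minimal (subset_closedLogSector b) (isClosed_closedLogSector b)
    · intro l hl
      -- Contracting towards the interior point `-1` moves every point of the closed half-strip into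
      -- the open one.
      have hin : ∀ t : ℝ, t ∈ Ioc (0 : ℝ) 1 → l + t * (-1 - l) ∈ logSector b := fun t ht => by
        have hp : 0 < π * b := by positivity
        obtain ⟨h1, h2⟩ := hl; refine ⟨?_, ?_⟩
        · simp only [add_re, re_ofReal_mul, sub_re, neg_re, one_re]
          nlinarith [ht.1, ht.2, mul_nonneg (sub_nonneg.mpr ht.2) (neg_nonneg.mpr h1)]
        · simp only [add_im, im_ofReal_mul, sub_im, neg_im, one_im]
          rw [show l.im + t * (-0 - l.im) = (1 - t) * l.im by ring, abs_mul,
            abs_of_nonneg (sub_nonneg.mpr ht.2)]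
          nlinarith [ht.1, ht.2, mul_le_mul_of_nonneg_left h2 (sub_nonneg.mpr ht.2),
            mul_pos ht.1 hp]
      have hlim : Tendsto (fun t : ℝ => l + t * (-1 - l)) (𝓝[>] 0) (𝓝 l) := by
        have : Continuous (fun t : ℝ => l + t * (-1 - l)) := by fun_prop
        have h := this.tendsto 0; simp only [ofReal_zero, zero_mul, add_zero] at h
        exact h.mono_left nhdsWithin_le_nhds
      exact mem_closure_of_tendsto hlim (mem_of_superset (Ioc_mem_nhdsGT one_pos) hin)
  rw [frontier, hcl, (isOpen_logSector b).interior_eq]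

theorem norm_exp_div_le_one (h : l.re ≤ 0) : ‖exp (l / b)‖ ≤ 1 := by
  rw [norm_exp, div_ofReal_re]
  exact Real.exp_le_one_iff.mpr (div_nonpos_of_nonpos_of_nonneg h hb.le)

theorem norm_exp_div_lt_one (h : l.re < 0) : ‖exp (l / b)‖ < 1 := by
  rw [norm_exp, div_ofReal_re]; rw [← Real.exp_zero]
  exact exp_lt_exp.mpr (div_neg_of_neg_of_pos h hb)

/-- Within the closed half-strip, the singular value `w = -1` of the hypergeometric function is
taken only at the two corners. -/
theorem exp_div_ne_neg_one (hc : l.re < 0 ∨ |l.im| < π * b) : exp (l / b) ≠ -1 := by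
  intro he; rcases hc with hc | hc
  · have := norm_exp_div_lt_one hb hc; simp_all
  · rw [← exp_pi_mul_I] at he
    have h2 : |l.im / b| < π := by
      rw [abs_div, abs_of_pos hb, div_lt_iff₀ hb]; exact hc
    rw [abs_lt] at h2
    have := exp_inj_of_neg_pi_lt_of_le_pi (by simp_all)
      (by rw [div_ofReal_im]; exact h2.2.le) (by simp [pi_pos]) (by simp) he
    have h3 := congrArg im this; simp at h3; linarith

/-! ### The map `log f` -/

theorem exp_logWedgeMap (h : l ∈ closedLogSector b) :
    exp (logWedgeMap b l) = exp l * hypFactor b (exp (l / b)) := by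
  rw [logWedgeMap, exp_add, exp_log]; intro h0
  have := re_hypFactor_pos hb (norm_exp_div_le_one hb h.1); simp [h0] at this

theorem continuousOn_logWedgeMap :
    ContinuousOn (logWedgeMap b) (closedLogSector b) := by
  have h1 : ContinuousOn (fun l : ℂ => hypFactor b (exp (l / b))) (closedLogSector b) :=
    (continuousOn_hypFactor hb).comp (by fun_prop) fun l hl => by
      simpa using norm_exp_div_le_one hb hl.1
  exact continuousOn_id.add (h1.clog fun l hl =>
    Or.inl (re_hypFactor_pos hb (norm_exp_div_le_one hb hl.1)))

omit hb in
/-- An open set containing the closed sector without its corners, on which `log f` is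
holomorphic. -/
def extDomain (b : ℝ) : Set ℂ := {l | exp (l / b) ∈ cutPlane ∧ 0 < (hypExt b (exp (l / b))).re}

theorem isOpen_extDomain : IsOpen (extDomain b) := by
  have h2 : ContinuousOn (fun l : ℂ => (hypExt b (exp (l / b))).re)
      {l : ℂ | exp (l / b) ∈ cutPlane} :=
    continuous_re.comp_continuousOn ((differentiableOn_hypExt hb).continuousOn.comp (by fun_prop)
      fun l hl => hl)
  exact h2.isOpen_inter_preimage (isOpen_cutPlane.preimage (by
    fun_prop : Continuous fun l : ℂ => exp (l / b))) isOpen_Ioi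

omit hb in
/-- The holomorphic extension of `log f`. -/
def logExt (b : ℝ) (l : ℂ) : ℂ := l + log (hypExt b (exp (l / b)))

theorem mem_extDomain (h : l ∈ closedLogSector b)
    (hc : l.re < 0 ∨ |l.im| < π * b) : l ∈ extDomain b := by
  have h1 := exp_div_ne_neg_one hb hc; have h2 := norm_exp_div_le_one hb h.1
  refine ⟨mem_cutPlane_of_norm_le_one h2 h1, ?_⟩; rw [hypExt_eq_hypFactor hb h2 h1]
  exact re_hypFactor_pos hb h2

theorem logExt_eq (h : l ∈ closedLogSector b)
    (hc : l.re < 0 ∨ |l.im| < π * b) : logExt b l = logWedgeMap b l := by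
  rw [logExt, logWedgeMap,
    hypExt_eq_hypFactor hb (norm_exp_div_le_one hb h.1) (exp_div_ne_neg_one hb hc)]

omit hb in
theorem hasDerivAt_exp_div (b : ℝ) (l : ℂ) :
    HasDerivAt (fun l : ℂ => exp (l / b)) (exp (l / b) * (1 / b)) l :=
  ((hasDerivAt_id l).div_const (b : ℂ)).cexp

theorem hasDerivAt_logExt (h : l ∈ extDomain b) :
    HasDerivAt (logExt b) (1 + deriv (hypExt b) (exp (l / b)) * (exp (l / b) * (1 / b)) /
      hypExt b (exp (l / b))) l := by
  have h1 : HasDerivAt (hypExt b) (deriv (hypExt b) (exp (l / b))) (exp (l / b)) :=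
    ((differentiableOn_hypExt hb).differentiableAt (isOpen_cutPlane.mem_nhds h.1)).hasDerivAt
  have h2 := h1.comp l (hasDerivAt_exp_div b l)
  exact (hasDerivAt_id l).add (h2.clog (show (hypExt b (exp (l / b))) ∈ slitPlane from Or.inl h.2))

theorem differentiableOn_logExt :
    DifferentiableOn ℂ (logExt b) (extDomain b) := fun _ h =>
  (hasDerivAt_logExt hb h).differentiableAt.differentiableWithinAt

/-- The derivative is `1 + w g'(w) / (b g(w))` with `w = e^{l/b}`, and the second summand has
modulus less than one. -/
theorem re_deriv_logExt_pos (h : l ∈ closedLogSector b)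
    (hc : l.re < 0 ∨ |l.im| < π * b) : 0 < (deriv (logExt b) l).re := by
  have h1 := exp_div_ne_neg_one hb hc; have h2 := norm_exp_div_le_one hb h.1
  have h3 := norm_hypEuler_lt hb h2 h1
  rw [(hasDerivAt_logExt hb (mem_extDomain hb h hc)).deriv,
    show deriv (hypExt b) (exp (l / b)) * (exp (l / b) * (1 / b)) =
      exp (l / b) * deriv (hypExt b) (exp (l / b)) * (1 / b) by ring,
    mul_deriv_hypExt hb h2 h1, hypExt_eq_hypFactor hb h2 h1, add_re, one_re]
  have h5 : ‖hypEuler b (exp (l / b)) * (1 / b) / hypFactor b (exp (l / b))‖ < 1 := by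
    have h6 : (hypFactor b (exp (l / b))).re ≤ ‖hypFactor b (exp (l / b))‖ := re_le_norm _
    rw [norm_div, norm_mul, norm_div, norm_one, norm_real, norm_of_nonneg hb.le,
      div_lt_one ((re_hypFactor_pos hb h2).trans_le h6), mul_one_div, div_lt_iff₀ hb]
    nlinarith
  have h7 := (abs_lt.mp ((abs_re_le_norm
    (hypEuler b (exp (l / b)) * (1 / b) / hypFactor b (exp (l / b)))).trans_lt h5)).1
  linarith

theorem logWedgeMap_eventuallyEq (h : l ∈ logSector b) :
    logWedgeMap b =ᶠ[𝓝 l] logExt b := by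
  filter_upwards [(isOpen_logSector b).mem_nhds h] with z hz
  exact (logExt_eq hb (subset_closedLogSector b hz) (Or.inl hz.1)).symm

theorem differentiableOn_logWedgeMap :
    DifferentiableOn ℂ (logWedgeMap b) (logSector b) := fun _ h =>
  (((differentiableOn_logExt hb).differentiableAt ((isOpen_extDomain hb).mem_nhds
    (mem_extDomain hb (subset_closedLogSector b h) (Or.inl h.1)))).congr_of_eventuallyEq
      (logWedgeMap_eventuallyEq hb h)).differentiableWithinAt

/-- The Noshiro–Warschawski argument: along a segment of the convex half-strip the difference
quotient is an average of derivatives with positive real part. It gives injectivity up to the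
boundary and also monotonicity in the horizontal and vertical directions. -/
theorem re_slope_logWedgeMap_pos {p q : ℂ} (hp : p ∈ closedLogSector b)
    (hq : q ∈ closedLogSector b) (hpq : p ≠ q) :
    0 < ((logWedgeMap b q - logWedgeMap b p) / (q - p)).re := by
  set c : ℝ → ℂ := fun t => p + t * (q - p) with hc
  have hcmem : ∀ t ∈ Icc (0 : ℝ) 1, c t ∈ closedLogSector b := fun t ht => by
    have := (convex_closedLogSector b) hp hq (sub_nonneg.mpr ht.2) ht.1 (by ring)
    convert! this using 1
    simp only [hc, real_smul]; push_cast; ring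
  -- A corner is an extreme point of the half-strip, so it cannot be interior to a nondegenerate
  -- segment.
  have hcopen : ∀ t ∈ Ioo (0 : ℝ) 1, (c t).re < 0 ∨ |(c t).im| < π * b := fun t ht => by
    by_contra hcon
    push Not at hcon
    obtain ⟨h1, h2⟩ := hcon; simp only [hc, add_re, re_ofReal_mul, sub_re] at h1
    simp only [hc, add_im, im_ofReal_mul, sub_im] at h2; obtain ⟨hp1, hp2⟩ := hp
    obtain ⟨hq1, hq2⟩ := hq; obtain ⟨ht1, ht2⟩ := ht; rw [abs_le] at hp2 hq2
    have e1 : p.re = 0 := by nlinarith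
    have e2 : q.re = 0 := by nlinarith
    have e3 : p.im = q.im := by
      rcases le_abs.mp h2 with h | h
      · have a1 : p.im = π * b := by nlinarith
        have a2 : q.im = π * b := by nlinarith
        rw [a1, a2]
      · have a1 : p.im = -(π * b) := by nlinarith
        have a2 : q.im = -(π * b) := by nlinarith
        rw [a1, a2]
    exact hpq (Complex.ext (by rw [e1, e2]) e3)
  have hcd : ∀ t : ℝ, HasDerivAt c (q - p) t := fun t => by
    have : HasDerivAt (fun t : ℝ => (t : ℂ)) 1 t := ofRealCLM.hasDerivAt
    simpa [hc] using (this.mul_const (q - p)).const_add p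
  have hcont : ContinuousOn (fun t => (logWedgeMap b (c t) / (q - p)).re) (Icc 0 1) :=
    continuous_re.comp_continuousOn (((continuousOn_logWedgeMap hb).comp
      (fun t _ => (hcd t).continuousAt.continuousWithinAt) hcmem).div_const _)
  have hmono : StrictMonoOn (fun t => (logWedgeMap b (c t) / (q - p)).re) (Icc 0 1) := by
    refine strictMonoOn_of_deriv_pos (convex_Icc 0 1) hcont fun t ht => ?_
    rw [interior_Icc] at ht; have hmem := hcmem t (Ioo_subset_Icc_self ht)
    have h1 := (((differentiableOn_logExt hb).differentiableAt
      ((isOpen_extDomain hb).mem_nhds (mem_extDomain hb hmem (hcopen t ht)))).hasDerivAt.comp t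
        (hcd t)).div_const (q - p)
    rw [mul_div_assoc, div_self (sub_ne_zero.mpr hpq.symm), mul_one] at h1
    have h2 : HasDerivAt (fun t => (logExt b (c t) / (q - p)).re)
        (deriv (logExt b) (c t)).re t := reCLM.hasFDerivAt.comp_hasDerivAt t h1
    have hev : (fun t => (logWedgeMap b (c t) / (q - p)).re) =ᶠ[𝓝 t]
        fun t => (logExt b (c t) / (q - p)).re := by
      filter_upwards [isOpen_Ioo.mem_nhds ht] with s hs
      rw [logExt_eq hb (hcmem s (Ioo_subset_Icc_self hs)) (hcopen s hs)]
    rw [hev.deriv_eq, h2.deriv]; exact re_deriv_logExt_pos hb hmem (hcopen t ht)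
  have := hmono (left_mem_Icc.mpr zero_le_one) (right_mem_Icc.mpr zero_le_one) one_pos
  simp only [hc, ofReal_zero, ofReal_one, zero_mul, one_mul, add_zero, add_sub_cancel] at this
  rw [sub_div, sub_re]; linarith

theorem injOn_logWedgeMap : InjOn (logWedgeMap b) (closedLogSector b) := by
  intro p hp q hq h; by_contra hpq; have := re_slope_logWedgeMap_pos hb hp hq hpq; simp [h] at this

/-! ### The image of the sector -/

omit hb in
theorem logWedgeMap_sub_self (b : ℝ) (l : ℂ) :
    logWedgeMap b l - l = log (hypFactor b (exp (l / b))) := by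
  rw [logWedgeMap, add_sub_cancel_left]

theorem tendsto_exp_div_comap_atBot :
    Tendsto (fun l : ℂ => exp (l / b)) (comap re atBot) (𝓝 0) := by
  rw [tendsto_zero_iff_norm_tendsto_zero]
  simp_rw [norm_exp, div_ofReal_re]
  exact tendsto_exp_atBot.comp (tendsto_comap.atBot_div_const hb)

theorem tendsto_logWedgeMap_sub_self :
    Tendsto (fun l => logWedgeMap b l - l) (comap re atBot) (𝓝 0) := by
  simp_rw [logWedgeMap_sub_self]
  have h1 : ContinuousAt (hypFactor b) 0 :=
    (continuousOn_hypFactor hb).continuousAt (closedBall_mem_nhds 0 one_pos)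
  have h2 : ContinuousAt (fun w => log (hypFactor b w)) 0 :=
    h1.clog (by rw [hypFactor_zero]; exact one_mem_slitPlane)
  simpa [hypFactor_zero, Function.comp_def] using h2.tendsto.comp (tendsto_exp_div_comap_atBot hb)

theorem exists_norm_logWedgeMap_sub_self_le :
    ∃ C : ℝ, ∀ l ∈ closedLogSector b, ‖logWedgeMap b l - l‖ ≤ C := by
  obtain ⟨C, hC⟩ := (isCompact_closedBall (0 : ℂ) 1).exists_bound_of_continuousOn
    ((continuousOn_hypFactor hb).clog fun w hw => Or.inl (re_hypFactor_pos hb (by simpa using hw)))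
  refine ⟨C, fun l hl => ?_⟩; rw [logWedgeMap_sub_self]
  exact hC _ (by simpa using norm_exp_div_le_one hb hl.1)

theorem logWedgeMap_conj (h : l ∈ closedLogSector b) :
    logWedgeMap b (conj l) = conj (logWedgeMap b l) := by
  have h1 := re_hypFactor_pos hb (norm_exp_div_le_one hb h.1)
  have h2 : conj l / b = conj (l / b) := by simp
  rw [logWedgeMap, logWedgeMap, map_add, h2, exp_conj, hypFactor_conj hb, log_conj]; intro h3
  rw [arg_eq_pi_iff] at h3; linarith [h3.1]

theorem im_logWedgeMap_eq_zero_of_conj (h : l.re ≤ 0)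
    (hw : (exp (l / b)).im = 0) : (logWedgeMap b l).im = l.im := by
  have h2 : (hypFactor b (exp (l / b))).im = 0 := by
    have := hypFactor_conj hb (exp (l / b)); rw [conj_eq_iff_im.mpr hw] at this
    exact conj_eq_iff_im.mp this.symm
  rw [logWedgeMap, add_im, log_im, arg_eq_zero_iff.mpr ⟨(re_hypFactor_pos hb (norm_exp_div_le_one hb
    h)).le, h2⟩, add_zero]

/-- On the sides `e^{l/b}` is a negative real number of modulus at most one, where `g` is real and
positive. So `log f` differs from `l` by a real number. -/
theorem im_logWedgeMap_of_side (h : l.re ≤ 0)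
    (hs : |l.im| = π * b) : (logWedgeMap b l).im = l.im := by
  refine im_logWedgeMap_eq_zero_of_conj hb h ?_; rw [exp_im, div_ofReal_im]
  rcases abs_eq (by positivity) |>.mp hs with h | h
  · rw [h, mul_div_assoc, div_self hb.ne', mul_one, Real.sin_pi, mul_zero]
  · rw [h, neg_div, mul_div_assoc, div_self hb.ne', mul_one, Real.sin_neg, Real.sin_pi, neg_zero,
      mul_zero]

theorem im_logWedgeMap_lt {p q : ℂ} (hp : p ∈ closedLogSector b)
    (hq : q ∈ closedLogSector b) (hre : p.re = q.re) (him : p.im < q.im) :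
    (logWedgeMap b p).im < (logWedgeMap b q).im := by
  have h := re_slope_logWedgeMap_pos hb hp hq (fun h => him.ne (by rw [h]))
  have h1 : q - p = (q.im - p.im : ℝ) * I := by apply Complex.ext <;> simp [hre]
  rw [h1, mul_comm, div_mul_eq_div_div, div_ofReal_re, div_I] at h; simp_all

theorem re_logWedgeMap_lt {p q : ℂ} (hp : p ∈ closedLogSector b)
    (hq : q ∈ closedLogSector b) (hre : p.re < q.re) (him : p.im = q.im) :
    (logWedgeMap b p).re < (logWedgeMap b q).re := by
  have h := re_slope_logWedgeMap_pos hb hp hq (fun h => hre.ne (by rw [h]))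
  have h1 : q - p = (q.re - p.re : ℝ) := by apply Complex.ext <;> simp [him]
  rw [h1, div_ofReal_re, sub_re] at h; simp_all

theorem abs_im_logWedgeMap_lt (h : l ∈ closedLogSector b)
    (hs : |l.im| < π * b) : |(logWedgeMap b l).im| < π * b := by
  have hp : 0 ≤ π * b := by positivity
  rw [abs_lt] at hs ⊢
  have h1 : (⟨l.re, π * b⟩ : ℂ) ∈ closedLogSector b := ⟨h.1, by simp [abs_of_nonneg hp]⟩
  have h2 : (⟨l.re, -(π * b)⟩ : ℂ) ∈ closedLogSector b := ⟨h.1, by simp [abs_of_nonneg hp]⟩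
  constructor
  · have := im_logWedgeMap_lt hb h2 h rfl hs.1
    rwa [im_logWedgeMap_of_side hb (by exact h.1) (by simp [abs_of_nonneg hp])] at this
  · have := im_logWedgeMap_lt hb h h1 rfl hs.2
    rwa [im_logWedgeMap_of_side (l := ⟨l.re, π * b⟩) hb h.1 (by simp [abs_of_nonneg hp])] at this

omit hb

/-- `log (e^μ f)`, the logarithm of a multiple of the wedge map. -/
def scaledMap (b μ : ℝ) (l : ℂ) : ℂ := logWedgeMap b l + (μ : ℂ)

/-- The abscissa of the corners of the image of the sector. -/
def cornerRe (b μ : ℝ) : ℝ := (scaledMap b μ ((π * b : ℝ) * I)).re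

include hb

theorem corner_mem_closedLogSector :
    ((π * b : ℝ) : ℂ) * I ∈ closedLogSector b := by
  refine ⟨by simp, ?_⟩
  rw [im_ofReal_mul, I_im, mul_one, abs_of_nonneg (by positivity)]

omit hb in
theorem conj_mem_closedLogSector :
    conj l ∈ closedLogSector b ↔ l ∈ closedLogSector b := by
  show (_ ≤ _ ∧ _ ≤ _) ↔ (_ ≤ _ ∧ _ ≤ _); simp

theorem scaledMap_conj (h : l ∈ closedLogSector b) :
    scaledMap b μ (conj l) = conj (scaledMap b μ l) := by
  rw [scaledMap, scaledMap, map_add, conj_ofReal, logWedgeMap_conj hb h]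

theorem continuousOn_scaledMap :
    ContinuousOn (scaledMap b μ) (closedLogSector b) :=
  (continuousOn_logWedgeMap hb).add continuousOn_const

theorem injOn_scaledMap :
    InjOn (scaledMap b μ) (closedLogSector b) := fun _ hp _ hq h =>
  injOn_logWedgeMap hb hp hq (add_right_cancel h)

theorem differentiableOn_scaledMap :
    DifferentiableOn ℂ (scaledMap b μ) (logSector b) :=
  (differentiableOn_logWedgeMap hb).add_const _

omit hb

theorem im_scaledMap (b μ : ℝ) (l : ℂ) : (scaledMap b μ l).im = (logWedgeMap b l).im := by
  simp [scaledMap]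

theorem re_scaledMap (b μ : ℝ) (l : ℂ) : (scaledMap b μ l).re = (logWedgeMap b l).re + μ := by
  simp [scaledMap]

include hb

theorem exists_norm_scaledMap_sub_self_le :
    ∃ C : ℝ, ∀ l ∈ closedLogSector b, ‖scaledMap b μ l - l‖ ≤ C := by
  obtain ⟨C, hC⟩ := exists_norm_logWedgeMap_sub_self_le hb; refine ⟨C + ‖(μ : ℂ)‖, fun l hl => ?_⟩
  rw [scaledMap, add_sub_right_comm]; exact (norm_add_le _ _).trans (add_le_add_left (hC l hl) _)

theorem scaledMap_side {y : ℝ} (hy : |y| = π * b) :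
    scaledMap b μ '' {l | l.re ≤ 0 ∧ l.im = y} = {l | l.re ≤ cornerRe b μ ∧ l.im = y} := by
  have hsub : ∀ l : ℂ, l.re ≤ 0 → l.im = y → l ∈ closedLogSector b := fun l h1 h2 =>
    ⟨h1, by rw [h2, hy]⟩
  have hcor : (scaledMap b μ (y * I)).re = cornerRe b μ := by
    rcases abs_eq (by positivity) |>.mp hy with h | h
    · rw [h, cornerRe]
    · have := scaledMap_conj hb μ (corner_mem_closedLogSector hb)
      rw [map_mul, conj_ofReal, conj_I] at this
      rw [h, cornerRe, ofReal_neg, neg_mul, ← mul_neg, this, conj_re]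
  apply subset_antisymm
  · rintro _ ⟨l, ⟨h1, h2⟩, rfl⟩; refine ⟨?_, ?_⟩
    · rw [← hcor]; rcases h1.lt_or_eq with h1 | h1
      · rw [re_scaledMap, re_scaledMap]
        have := re_logWedgeMap_lt hb (hsub l h1.le h2) (hsub (y * I) (by simp) (by simp))
          (by simpa using h1) (by simpa using h2)
        linarith
      · rw [show l = y * I from Complex.ext (by simpa using h1) (by simpa using h2)]
    · rw [im_scaledMap, im_logWedgeMap_of_side hb h1 (by rw [h2, hy]), h2]
  · rintro p ⟨h1, h2⟩; obtain ⟨C, hC⟩ := exists_norm_scaledMap_sub_self_le hb μ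
    set c : ℝ → ℂ := fun s => s + y * I with hc
    have hcK : ∀ s ≤ 0, c s ∈ closedLogSector b := fun s hs =>
      hsub _ (by simpa [hc] using hs) (by simp [hc])
    have hcont : ContinuousOn (fun s => (scaledMap b μ (c s)).re) (Iic 0) :=
      continuous_re.comp_continuousOn ((continuousOn_scaledMap hb μ).comp
        (by fun_prop) fun s hs => hcK s hs)
    -- The map displaces points by at most `C`, so at this abscissa the image lies to the left of
    -- `p`. The intermediate value theorem on the side does the rest.
    set s0 := min 0 (p.re - C) with hs0
    have hlow : (scaledMap b μ (c s0)).re ≤ p.re := by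
      have h4 := (re_le_norm _).trans (hC (c s0) (hcK _ (min_le_left _ _))); rw [sub_re] at h4
      have h5 : (c s0).re = s0 := by simp [hc]
      grind
    obtain ⟨s, hs, hse⟩ := intermediate_value_Icc (min_le_left _ _)
      (hcont.mono fun s hs => hs.2) ⟨hlow, (by simp_all)⟩
    refine ⟨c s, ⟨by simpa [hc] using hs.2, by simp [hc]⟩, Complex.ext hse ?_⟩
    rw [im_scaledMap, im_logWedgeMap_of_side hb (hcK s hs.2).1 (by simp [hc, hy]), h2]
    simp [hc]

theorem proper_scaledMap (R : ℝ) :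
    ∃ M : ℝ, ∀ l ∈ closedLogSector b, ‖scaledMap b μ l‖ ≤ R → ‖l‖ ≤ M := by
  obtain ⟨C, hC⟩ := exists_norm_scaledMap_sub_self_le hb μ; refine ⟨R + C, fun l hl h => ?_⟩
  calc ‖l‖ = ‖scaledMap b μ l - (scaledMap b μ l - l)‖ := by rw [sub_sub_cancel]
    _ ≤ _ := (norm_sub_le _ _).trans (add_le_add h (hC l hl))

omit hb in
/-- The inverse of `scaledMap`. -/
def scaledLogInv (b μ : ℝ) : ℂ → ℂ := invFunOn (scaledMap b μ) (closedLogSector b)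

theorem scaledLogInv_map (h : l ∈ closedLogSector b) :
    scaledLogInv b μ (scaledMap b μ l) = l :=
  injOn_scaledMap hb μ (invFunOn_mem ⟨l, h, rfl⟩) h (invFunOn_eq ⟨l, h, rfl⟩)

theorem continuousOn_scaledLogInv :
    ContinuousOn (scaledLogInv b μ) (scaledMap b μ '' closedLogSector b) :=
  (continuousOn_invFunOn_of_proper (isClosed_closedLogSector b) (continuousOn_scaledMap hb μ)
    (injOn_scaledMap hb μ) (proper_scaledMap hb μ)).1

theorem isClosed_image_scaledMap :
    IsClosed (scaledMap b μ '' closedLogSector b) :=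
  (continuousOn_invFunOn_of_proper (isClosed_closedLogSector b) (continuousOn_scaledMap hb μ)
    (injOn_scaledMap hb μ) (proper_scaledMap hb μ)).2

omit hb in
theorem isOpen_image_of_injOn {f : ℂ → ℂ} {S U : Set ℂ} (hSo : IsOpen S) (hS : IsPreconnected S)
    (hf : DifferentiableOn ℂ f S) (hi : InjOn f S) (hU : U ⊆ S) (hUo : IsOpen U) :
    IsOpen (f '' U) := by
  rcases (hf.analyticOnNhd hSo).is_constant_or_isOpen hS with ⟨w, hw⟩ | h
  · have hsub : U.Subsingleton := fun x hx y hy => hi (hU hx) (hU hy)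
      ((hw x (hU hx)).trans (hw y (hU hy)).symm)
    rcases hsub.eq_empty_or_singleton with h | ⟨x, h⟩
    · simp_all
    · exfalso; rw [h] at hUo; exact not_isOpen_singleton x hUo
  · exact h U hU hUo

theorem isOpen_image_logSector :
    IsOpen (scaledMap b μ '' logSector b) :=
  isOpen_image_of_injOn (isOpen_logSector b) (convex_logSector b).isPreconnected
    (differentiableOn_scaledMap hb μ)
    ((injOn_scaledMap hb μ).mono (subset_closedLogSector b)) subset_rfl
    (isOpen_logSector b)

theorem closure_logSector : closure (logSector b) = closedLogSector b := by
  rw [closure_eq_self_union_frontier (logSector b), frontier_logSector hb, union_sdiff_cancel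
    (subset_closedLogSector b)]

theorem closure_image_logSector :
    closure (scaledMap b μ '' logSector b) = scaledMap b μ '' closedLogSector b := by
  apply subset_antisymm
  · exact closure_minimal (image_mono (subset_closedLogSector b)) (isClosed_image_scaledMap hb μ)
  · have := continuousOn_scaledMap hb μ; rw [← closure_logSector hb] at this ⊢
    exact this.image_closure

theorem frontier_image_logSector :
    frontier (scaledMap b μ '' logSector b) =
      scaledMap b μ '' (closedLogSector b \ logSector b) := by
  rw [frontier, closure_image_logSector hb, (isOpen_image_logSector hb μ).interior_eq,
    (injOn_scaledMap hb μ).image_sdiff_subset (subset_closedLogSector b)]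

theorem isSimplyConnected_image_logSector :
    IsSimplyConnected (scaledMap b μ '' logSector b) :=
  isSimplyConnected_image_of_continuousOn_inv
    ((convex_logSector b).isSimplyConnected ⟨_, neg_one_mem_logSector hb⟩)
    ((continuousOn_scaledMap hb μ).mono (subset_closedLogSector b))
    ((continuousOn_scaledLogInv hb μ).mono (image_mono (subset_closedLogSector b)))
    fun _ h => scaledLogInv_map hb μ (subset_closedLogSector b h)

theorem image_logSector_subset_logAngle :
    scaledMap b μ '' logSector b ⊆ logAngle b := by
  rintro _ ⟨l, h, rfl⟩; show |(scaledMap b μ l).im| < π * b; rw [im_scaledMap]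
  exact abs_im_logWedgeMap_lt hb (subset_closedLogSector b h) h.2

omit hb

/-! ### The inverse up to the arc -/

/-- The closed sector without its corners. -/
def cornerless (b : ℝ) : Set ℂ := {l | l ∈ closedLogSector b ∧ (l.re < 0 ∨ |l.im| < π * b)}

theorem AnalyticAt.exists_local_inverse {f : ℂ → ℂ} {a : ℂ} (hf : AnalyticAt ℂ f a)
    (hf' : deriv f a ≠ 0) :
    ∃ H : ℂ → ℂ, AnalyticAt ℂ H (f a) ∧ H (f a) = a ∧ HasDerivAt H (deriv f a)⁻¹ (f a) ∧
      (∀ᶠ z in 𝓝 a, H (f z) = z) ∧ ∀ᶠ w in 𝓝 (f a), f (H w) = w :=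
  have hs := hf.hasStrictDerivAt
  ⟨hs.localInverse f (deriv f a) a hf', hf.analyticAt_localInverse hf',
    (hs.eventually_left_inverse hf').self_of_nhds, (hs.to_localInverse hf').hasDerivAt,
    hs.eventually_left_inverse hf', hs.eventually_right_inverse hf'⟩

include hb

/-- The derivative does not vanish away from the corners, so there is an analytic local inverse on a
full neighbourhood, also at points of the arc and the sides. Continuity of the global inverse on the
closed image makes the two agree from inside. This reduces one-sided regularity at the curve to
two-sided analyticity. -/
theorem exists_local_inverse (h : l ∈ cornerless b) :
    ∃ H : ℂ → ℂ, AnalyticAt ℂ H (scaledMap b μ l) ∧ H (scaledMap b μ l) = l ∧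
      HasDerivAt H (deriv (logExt b) l)⁻¹ (scaledMap b μ l) ∧
      (∀ᶠ p in 𝓝[scaledMap b μ '' cornerless b] (scaledMap b μ l), scaledLogInv b μ p = H p) ∧
      ∀ᶠ p in 𝓝 (scaledMap b μ l), H p ∈ cornerless b → scaledMap b μ (H p) = p := by
  have han : AnalyticAt ℂ (fun z => logExt b z + μ) l :=
    ((differentiableOn_logExt hb).analyticAt ((isOpen_extDomain hb).mem_nhds (mem_extDomain hb h.1
      h.2))).add
      analyticAt_const
  have hval : logExt b l + μ = scaledMap b μ l := by rw [logExt_eq hb h.1 h.2, scaledMap]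
  have hd : deriv (fun z => logExt b z + μ) l = deriv (logExt b) l := deriv_add_const _
  have hne : deriv (logExt b) l ≠ 0 := fun h0 => by
    have := re_deriv_logExt_pos hb h.1 h.2; simp [h0] at this
  obtain ⟨H, h1, h2, h3, h4, h5⟩ := han.exists_local_inverse (hd ▸ hne)
  simp only [hval, hd] at h1 h2 h3 h5
  refine ⟨H, h1, h2, h3, ?_, h5.mono fun p hp hm => by rwa [logExt_eq hb hm.1 hm.2] at hp⟩
  have hsub : scaledMap b μ '' cornerless b ⊆ scaledMap b μ '' closedLogSector b :=
    image_mono fun z hz => hz.1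
  have hc : Tendsto (scaledLogInv b μ) (𝓝[scaledMap b μ '' cornerless b] (scaledMap b μ l))
      (𝓝 l) := by
    have := (continuousOn_scaledLogInv hb μ (scaledMap b μ l) ⟨l, h.1, rfl⟩).mono hsub
    rwa [ContinuousWithinAt, scaledLogInv_map hb μ h.1] at this
  filter_upwards [hc.eventually h4, self_mem_nhdsWithin] with p hp hpm; obtain ⟨z, hz, rfl⟩ := hpm
  rw [scaledLogInv_map hb μ hz.1, logExt_eq hb hz.1 hz.2] at hp; rw [scaledLogInv_map hb μ hz.1]
  exact hp.symm

theorem uniqueDiffWithinAt_image_logSector (h : l ∈ cornerless b) :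
    UniqueDiffWithinAt ℝ (scaledMap b μ '' logSector b) (scaledMap b μ l) := by
  have hd : HasDerivAt (fun z => logExt b z + μ) (deriv (logExt b) l) l :=
    ((differentiableOn_logExt hb).differentiableAt
      ((isOpen_extDomain hb).mem_nhds (mem_extDomain hb h.1 h.2))).hasDerivAt.add_const _
  have hne : deriv (logExt b) l ≠ 0 := fun h0 => by
    have := re_deriv_logExt_pos hb h.1 h.2; simp [h0] at this
  have hS : UniqueDiffWithinAt ℝ (logSector b) l := by
    apply uniqueDiffWithinAt_convex (convex_logSector b)
    · rw [(isOpen_logSector b).interior_eq]; exact ⟨_, neg_one_mem_logSector hb⟩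
    · rw [closure_logSector hb]; exact h.1
  have := (hd.hasFDerivAt.restrictScalars ℝ).hasFDerivWithinAt.uniqueDiffWithinAt hS (by
    apply Function.Surjective.denseRange; intro y
    exact ⟨y / deriv (logExt b) l, by simp [hne]⟩)
  rw [logExt_eq hb h.1 h.2] at this; convert! this using 1
  exact image_congr fun z hz => by
    rw [logExt_eq hb (subset_closedLogSector b hz) (Or.inl hz.1), scaledMap]

omit hb

/-! ### The model potential -/

/-- The map `ζ ↦ ζ^{-1/(2b)} - ζ^{1/(2b)}` of the sector onto the right half plane, in the
logarithmic coordinate. -/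
def modelMap (b : ℝ) (l : ℂ) : ℂ := exp (-l / (2 * b)) - exp (l / (2 * b))

theorem div_two_mul_re (b : ℝ) (l : ℂ) : (l / (2 * b)).re = l.re / (2 * b) := by
  rw [show (2 * b : ℂ) = ((2 * b : ℝ) : ℂ) by push_cast; rfl, div_ofReal_re]

theorem div_two_mul_im (b : ℝ) (l : ℂ) : (l / (2 * b)).im = l.im / (2 * b) := by
  rw [show (2 * b : ℂ) = ((2 * b : ℝ) : ℂ) by push_cast; rfl, div_ofReal_im]

theorem modelMap_re (b : ℝ) (l : ℂ) : (modelMap b l).re =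
    (rexp (-(l.re / (2 * b))) - rexp (l.re / (2 * b))) * Real.cos (l.im / (2 * b)) := by
  rw [modelMap, sub_re, exp_re, exp_re, neg_div, neg_re, neg_im, div_two_mul_re, div_two_mul_im,
    Real.cos_neg]
  ring

theorem hasDerivAt_modelMap (b : ℝ) (l : ℂ) : HasDerivAt (modelMap b)
    (-(1 / (2 * b)) * (exp (-l / (2 * b)) + exp (l / (2 * b)))) l := by
  convert! ((((hasDerivAt_id l).neg).div_const (2 * b : ℂ)).cexp).sub (((hasDerivAt_id l).div_const
    (2 * b : ℂ)).cexp) using 1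
  simp only [Pi.neg_apply, id]; ring

theorem differentiable_modelMap (b : ℝ) : Differentiable ℂ (modelMap b) := fun l =>
  (hasDerivAt_modelMap b l).differentiableAt

theorem modelMap_conj (b : ℝ) (l : ℂ) : modelMap b (conj l) = conj (modelMap b l) := by
  have h : ∀ z : ℂ, conj z / (2 * b) = conj (z / (2 * b)) := fun z => by
    rw [show (2 * b : ℂ) = ((2 * b : ℝ) : ℂ) by push_cast; rfl, map_div₀, conj_ofReal]
  rw [modelMap, modelMap, map_sub, ← map_neg, h, h, exp_conj, exp_conj]

include hb

theorem abs_im_div_le (h : |l.im| ≤ π * b) :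
    |l.im / (2 * b)| ≤ π / 2 := by
  rw [abs_div, abs_of_pos (by positivity : 0 < 2 * b), div_le_div_iff₀ (by positivity) two_pos]
  linarith

theorem abs_im_div_lt (h : |l.im| < π * b) :
    |l.im / (2 * b)| < π / 2 := by
  rw [abs_div, abs_of_pos (by positivity : 0 < 2 * b), div_lt_div_iff₀ (by positivity) two_pos]
  linarith

theorem re_modelMap_pos (h : l ∈ logSector b) :
    0 < (modelMap b l).re := by
  rw [modelMap_re]
  have h1 : l.re / (2 * b) < 0 := div_neg_of_neg_of_pos h.1 (by positivity)
  refine mul_pos (sub_pos.mpr (exp_lt_exp.mpr (by linarith))) ?_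
  exact cos_pos_of_mem_Ioo (abs_lt.mp (abs_im_div_lt hb h.2))

theorem re_modelMap_eq_zero (h : l ∈ closedLogSector b \ logSector b) : (modelMap b l).re = 0 := by
  rw [modelMap_re]; obtain ⟨⟨h1, h2⟩, h3⟩ := h; rcases h1.lt_or_eq with h4 | h4
  · have h5 : |l.im| = π * b := by
      by_contra h6; exact h3 ⟨h4, lt_of_le_of_ne h2 h6⟩
    have h6 : Real.cos (l.im / (2 * b)) = 0 := by
      rw [← Real.cos_abs, abs_div, h5, abs_of_pos (by positivity : 0 < 2 * b),
        show π * b / (2 * b) = π / 2 by field_simp, Real.cos_pi_div_two]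
    rw [h6, mul_zero]
  · rw [h4]; simp

theorem re_modelMap_nonneg (h : l ∈ closedLogSector b) :
    0 ≤ (modelMap b l).re := by
  by_cases h1 : l ∈ logSector b
  · exact (re_modelMap_pos hb h1).le
  · exact (re_modelMap_eq_zero hb ⟨h, h1⟩).ge

theorem mem_logSector_of_re_modelMap_pos (h : l ∈ closedLogSector b)
    (h1 : 0 < (modelMap b l).re) : l ∈ logSector b := by
  by_contra h2; exact h1.ne' (re_modelMap_eq_zero hb ⟨h, h2⟩)

theorem re_exp_neg_div_nonneg (h : l ∈ closedLogSector b) :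
    0 ≤ (exp (-l / (2 * b))).re := by
  rw [exp_re, neg_div, neg_im, div_two_mul_im, Real.cos_neg]
  exact mul_nonneg (Real.exp_nonneg _)
    (Real.cos_nonneg_of_mem_Icc (abs_le.mp (abs_im_div_le hb h.2)))

theorem exp_neg_div_inj {p q : ℂ} (hp : p ∈ closedLogSector b)
    (hq : q ∈ closedLogSector b) (h : exp (-p / (2 * b)) = exp (-q / (2 * b))) : p = q := by
  have h1 := abs_le.mp (abs_im_div_le hb hp.2); have h2 := abs_le.mp (abs_im_div_le hb hq.2)
  have hpi := pi_pos
  have := exp_inj_of_neg_pi_lt_of_le_pi (by rw [neg_div, neg_im, div_two_mul_im]; linarith)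
    (by rw [neg_div, neg_im, div_two_mul_im]; linarith)
    (by rw [neg_div, neg_im, div_two_mul_im]; linarith)
    (by rw [neg_div, neg_im, div_two_mul_im]; linarith) h
  have hb' : (2 * b : ℂ) ≠ 0 := by
    have : (b : ℂ) ≠ 0 := ofReal_ne_zero.mpr hb.ne'; simp [this]
  grind

omit hb in
theorem exp_div_eq_inv (b : ℝ) (l : ℂ) : exp (l / (2 * b)) = (exp (-l / (2 * b)))⁻¹ := by
  rw [← exp_neg, neg_div, neg_neg]

theorem one_le_norm_exp_neg_div (h : l.re ≤ 0) :
    1 ≤ ‖exp (-l / (2 * b))‖ := by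
  rw [norm_exp, neg_div, neg_re, div_two_mul_re]; apply Real.one_le_exp
  have := div_nonpos_of_nonpos_of_nonneg h (by positivity : 0 ≤ 2 * b)
  linarith

omit hb in
theorem conj_eq_inv_of_norm_eq_one {v : ℂ} (h : ‖v‖ = 1) : conj v = v⁻¹ := by
  rw [inv_def, normSq_eq_norm_sq, h]; simp

/-- With `v = e^{-l/2b}` the map is `v - 1/v`, so equal values mean `v' = v` or `v v' = -1`. As
`|v|, |v'| ≥ 1`, the second case forces modulus one and `v' = -conj v`. Since both real parts are
nonnegative they vanish, and again `v' = v`. -/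
theorem injOn_modelMap : InjOn (modelMap b) (closedLogSector b) := by
  intro p hp q hq h; apply exp_neg_div_inj hb hp hq
  rw [modelMap, modelMap, exp_div_eq_inv b p, exp_div_eq_inv b q] at h
  have hv := one_le_norm_exp_neg_div hb hp.1; have hv' := one_le_norm_exp_neg_div hb hq.1
  have hr := re_exp_neg_div_nonneg hb hp; have hr' := re_exp_neg_div_nonneg hb hq
  have hv0 := exp_ne_zero (-p / (2 * b)); have hv0' := exp_ne_zero (-q / (2 * b))
  generalize exp (-p / (2 * b)) = v at *
  generalize exp (-q / (2 * b)) = v' at *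
  by_contra hne
  have h1 : (v - v') * (1 + v * v') = 0 := by grind
  have h2 : v * v' = -1 := by grind
  have h3 : ‖v‖ * ‖v'‖ = 1 := by rw [← norm_mul, h2, norm_neg, norm_one]
  have h5 : v' = -conj v := by
    rw [conj_eq_inv_of_norm_eq_one (by nlinarith)]
    grind
  have h6 : v.re = 0 := by
    rw [h5, neg_re, conj_re] at hr'; linarith
  apply hne; rw [h5]
  apply Complex.ext <;> simp [h6]

omit hb in
-- The two roots of `v² - Wv - 1` are negative reciprocals, so one has modulus at least one. If its
-- real part were negative, `Re W ≥ 0` would force modulus one, and then the other root serves.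
theorem exists_sub_inv_eq {W : ℂ} (hW : 0 ≤ W.re) : ∃ v : ℂ, 1 ≤ ‖v‖ ∧ 0 ≤ v.re ∧ v - v⁻¹ = W := by
  obtain ⟨s, hs⟩ := IsAlgClosed.exists_pow_nat_eq (W ^ 2 + 4) two_pos
  obtain ⟨v, hv⟩ : ∃ v : ℂ, v ^ 2 - W * v - 1 = 0 := ⟨(W + s) / 2, by grind⟩
  obtain ⟨u, hu, hu1⟩ : ∃ u : ℂ, u - u⁻¹ = W ∧ 1 ≤ ‖u‖ := by
    rcases le_total 1 ‖v‖ with h | h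
    · exact ⟨v, (by grind), h⟩
    · refine ⟨-v⁻¹, ?_, ?_⟩
      · grind
      · rw [norm_neg, norm_inv]
        exact (one_le_inv₀ (norm_pos_iff.mpr (fun h => by simp [h] at hv))).mpr h
  by_cases hr : 0 ≤ u.re
  · grind
  · push Not at hr
    have hre : W.re * ‖u‖ ^ 2 = u.re * (‖u‖ ^ 2 - 1) := by
      rw [← hu, sub_re, inv_re, normSq_eq_norm_sq]; field_simp
    have h1 : ‖u‖ = 1 := by
      by_contra h1; have h2 : 1 < ‖u‖ := lt_of_le_of_ne hu1 (Ne.symm h1)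
      have h3 : 0 < ‖u‖ ^ 2 - 1 := by nlinarith
      have h4 := mul_neg_of_neg_of_pos hr h3
      have h5 : 0 ≤ W.re * ‖u‖ ^ 2 := by positivity
      linarith
    refine ⟨-u⁻¹, by simp [h1], ?_, ?_⟩
    · rw [← conj_eq_inv_of_norm_eq_one h1, neg_re, conj_re]; linarith
    grind

theorem surjOn_modelMap {W : ℂ} (hW : 0 ≤ W.re) :
    ∃ l ∈ closedLogSector b, modelMap b l = W := by
  have hb' : (b : ℂ) ≠ 0 := ofReal_ne_zero.mpr hb.ne'
  obtain ⟨v, hv1, hvr, hv⟩ := exists_sub_inv_eq hW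
  have hexp : exp (-(((-(2 * b) : ℝ) : ℂ) * log v) / (2 * b)) = v := by
    rw [show -(((-(2 * b) : ℝ) : ℂ) * log v) / (2 * b) = log v by push_cast; field_simp,
      exp_log (norm_pos_iff.mp (one_pos.trans_le hv1))]
  refine ⟨((-(2 * b) : ℝ) : ℂ) * log v, ⟨?_, ?_⟩, ?_⟩
  · rw [re_ofReal_mul, log_re]
    exact mul_nonpos_of_nonpos_of_nonneg (by linarith) (log_nonneg hv1)
  · rw [im_ofReal_mul, log_im, abs_mul, abs_neg, abs_of_pos (by positivity : 0 < 2 * b)]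
    have := abs_arg_le_pi_div_two_iff.mpr hvr; nlinarith
  · rw [modelMap, exp_div_eq_inv b (((-(2 * b) : ℝ) : ℂ) * log v), hexp, hv]

theorem norm_modelMap_ge (h : l.re ≤ 0) :
    rexp (-(l.re / (2 * b))) - 1 ≤ ‖modelMap b l‖ := by
  have h1 : ‖exp (-l / (2 * b))‖ = rexp (-(l.re / (2 * b))) := by
    rw [norm_exp, neg_div, neg_re, div_two_mul_re]
  have h2 : ‖exp (l / (2 * b))‖ ≤ 1 := by
    rw [exp_div_eq_inv, norm_inv]; exact inv_le_one_of_one_le₀ (one_le_norm_exp_neg_div hb h)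
  have := norm_sub_norm_le (exp (-l / (2 * b))) (exp (l / (2 * b))); rw [modelMap]; linarith

theorem proper_modelMap (R : ℝ) :
    ∃ M : ℝ, ∀ l ∈ closedLogSector b, ‖modelMap b l‖ ≤ R → ‖l‖ ≤ M := by
  refine ⟨2 * b * R + π * b, fun l hl h => ?_⟩; have h1 := norm_modelMap_ge hb hl.1
  have h2 := add_one_le_exp (-(l.re / (2 * b)))
  have h3 : -(l.re / (2 * b)) ≤ R := by linarith
  rw [← neg_div, div_le_iff₀ (by positivity)] at h3
  have h4 := norm_le_abs_re_add_abs_im l; rw [abs_of_nonpos hl.1] at h4; linarith [hl.2]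

omit hb in
/-- The inverse of `modelMap`. -/
def modelInv (b : ℝ) : ℂ → ℂ := invFunOn (modelMap b) (closedLogSector b)

theorem modelInv_map (h : l ∈ closedLogSector b) :
    modelInv b (modelMap b l) = l :=
  injOn_modelMap hb (invFunOn_mem ⟨l, h, rfl⟩) h (invFunOn_eq ⟨l, h, rfl⟩)

theorem image_modelMap : modelMap b '' closedLogSector b = {W | 0 ≤ W.re} := by
  apply subset_antisymm
  · rintro _ ⟨l, h, rfl⟩; exact re_modelMap_nonneg hb h
  · intro W hW; obtain ⟨l, h, rfl⟩ := surjOn_modelMap hb hW; exact ⟨l, h, rfl⟩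

theorem modelInv_mem {W : ℂ} (h : 0 ≤ W.re) :
    modelInv b W ∈ closedLogSector b ∧ modelMap b (modelInv b W) = W :=
  ⟨invFunOn_mem (surjOn_modelMap hb h), invFunOn_eq (surjOn_modelMap hb h)⟩

theorem modelInv_mem_logSector {W : ℂ} (h : 0 < W.re) :
    modelInv b W ∈ logSector b := by
  obtain ⟨h1, h2⟩ := modelInv_mem hb h.le
  exact mem_logSector_of_re_modelMap_pos hb h1 (h2.symm ▸ h)

theorem continuousOn_modelInv : ContinuousOn (modelInv b) {W | 0 ≤ W.re} := by
  rw [← image_modelMap hb]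
  exact (continuousOn_invFunOn_of_proper (isClosed_closedLogSector b)
    (differentiable_modelMap b).continuous.continuousOn (injOn_modelMap hb)
    (proper_modelMap hb)).1

theorem deriv_modelMap_ne_zero (h : l ∈ cornerless b) :
    deriv (modelMap b) l ≠ 0 := by
  rw [(hasDerivAt_modelMap b l).deriv]
  refine mul_ne_zero (by simp [ofReal_ne_zero.mpr hb.ne']) fun h0 => exp_div_ne_neg_one hb h.2 ?_
  have h1 : exp (l / b) = exp (l / (2 * b)) * exp (l / (2 * b)) := by
    rw [← exp_add]; grind
  rw [h1]; have h2 := exp_div_eq_inv b l; have h3 := exp_ne_zero (-l / (2 * b)); grind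

theorem differentiableAt_modelInv {W : ℂ} (h : 0 < W.re) :
    DifferentiableAt ℂ (modelInv b) W := by
  have hopen : IsOpen {W : ℂ | 0 < W.re} := isOpen_lt continuous_const continuous_re
  refine (HasDerivAt.of_local_left_inverse (f := modelMap b) (f' := deriv (modelMap b) (modelInv b W))
    ?_ (differentiable_modelMap b _).hasDerivAt
    (deriv_modelMap_ne_zero hb ⟨(modelInv_mem hb h.le).1, Or.inl (modelInv_mem_logSector hb h).1⟩)
      ?_).differentiableAt
  · exact ((continuousOn_modelInv hb).mono (fun z (hz : 0 < z.re) => hz.le)).continuousAt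
      (hopen.mem_nhds h)
  · filter_upwards [hopen.mem_nhds h] with z hz; exact (modelInv_mem hb (le_of_lt hz)).2

/-! ### The differential equation in the logarithmic coordinate -/

/-- Substitution `w = e^{l/b}`. Up to a nowhere vanishing factor, the defect in the equation for `f`
is the defect in the hypergeometric equation. The open set `U` is left free so as to serve both the
unit disk and the cut plane. -/
theorem logODE_eq_hypOp {g : ℂ → ℂ} {U : Set ℂ} (hU : IsOpen U)
    (hg : DifferentiableOn ℂ g U) (h : exp (l / b) ∈ U) (h1 : 1 + exp (l / b) ≠ 0) :
    deriv (deriv fun l => exp l * g (exp (l / b))) l +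
        1 / (2 * b) * ((1 - exp (l / b)) / (1 + exp (l / b))) *
          deriv (fun l => exp l * g (exp (l / b))) l -
      (1 + 1 / (2 * b)) * (exp l * g (exp (l / b))) =
    exp l * exp (l / b) / (b ^ 2 * (1 + exp (l / b))) * hypOp b g (exp (l / b)) := by
  have hb' : (b : ℂ) ≠ 0 := ofReal_ne_zero.mpr hb.ne'
  have hd : ∀ z : ℂ, exp (z / b) ∈ U → HasDerivAt (fun l => exp l * g (exp (l / b)))
      (exp z * g (exp (z / b)) + exp z * (deriv g (exp (z / b)) * (exp (z / b) * (1 / b)))) z :=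
    fun z hz => (hasDerivAt_exp z).mul
      ((hg.differentiableAt (hU.mem_nhds hz)).hasDerivAt.comp z (hasDerivAt_exp_div b z))
  have hev : deriv (fun l => exp l * g (exp (l / b))) =ᶠ[𝓝 l] fun z =>
      exp z * g (exp (z / b)) + exp z * (deriv g (exp (z / b)) * (exp (z / b) * (1 / b))) := by
    have : {z : ℂ | exp (z / b) ∈ U} ∈ 𝓝 l :=
      (hU.preimage (by fun_prop : Continuous fun z : ℂ => exp (z / b))).mem_nhds h
    filter_upwards [this] with z hz; exact (hd z hz).deriv
  have hd2 : HasDerivAt (fun z =>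
      exp z * g (exp (z / b)) + exp z * (deriv g (exp (z / b)) * (exp (z / b) * (1 / b)))) _ l :=
    (hd l h).add ((hasDerivAt_exp l).mul
      ((((hg.deriv hU).differentiableAt (hU.mem_nhds h)).hasDerivAt.comp l (hasDerivAt_exp_div b
        l)).mul
        ((hasDerivAt_exp_div b l).mul_const (1 / (b : ℂ)))))
  rw [hev.deriv_eq, hd2.deriv, (hd l h).deriv, hypOp]; grind

theorem exp_div_mem_ball (h : l ∈ logSector b) :
    exp (l / b) ∈ ball (0 : ℂ) 1 := by
  simpa using norm_exp_div_lt_one hb h.1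

theorem one_add_exp_ne_zero (hc : l.re < 0 ∨ |l.im| < π * b) : 1 + exp (l / b) ≠ 0 := fun h =>
  exp_div_ne_neg_one hb hc (by linear_combination h)

theorem satisfiesLogWedgeODE_iff {g : ℂ → ℂ}
    (hg : DifferentiableOn ℂ g (ball 0 1)) :
    SatisfiesLogWedgeODE b (fun l => exp l * g (exp (l / b))) ↔
      ∀ w ∈ ball (0 : ℂ) 1, hypOp b g w = 0 := by
  have hb' : (b : ℂ) ≠ 0 := ofReal_ne_zero.mpr hb.ne'; constructor
  · intro h
    -- Points of the sector are recovered from `w` by `l = b log w`, and the principal logarithm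
    -- reaches only the slit disk. The identity theorem then crosses the slit.
    have key : ∀ w ∈ ball (0 : ℂ) 1, w ∈ slitPlane → hypOp b g w = 0 := by
      intro w hw hs; have hw0 := slitPlane_ne_zero hs
      have hexp : exp ((b * log w) / b) = w := by rw [mul_div_cancel_left₀ _ hb', exp_log hw0]
      have hmem : b * log w ∈ logSector b := by
        constructor
        · rw [re_ofReal_mul, log_re]
          exact mul_neg_of_pos_of_neg hb (Real.log_neg (norm_pos_iff.mpr hw0) (by simpa using hw))
        · rw [im_ofReal_mul, log_im, abs_mul, abs_of_pos hb, mul_comm]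
          exact mul_lt_mul_of_pos_right (abs_lt.mpr ⟨neg_pi_lt_arg w, lt_of_le_of_ne (arg_le_pi w) (mem_slitPlane_iff_arg.mp hs).1⟩) hb
      have h1 := logODE_eq_hypOp hb isOpen_ball hg (exp_div_mem_ball hb hmem)
        (one_add_exp_ne_zero hb (Or.inl hmem.1))
      rw [h _ hmem, sub_self] at h1; rcases mul_eq_zero.mp h1.symm with h2 | h2
      · have := one_add_exp_ne_zero hb (Or.inl hmem.1); have h3 := exp_ne_zero ((b * log w) / b)
        have h4 := exp_ne_zero (b * log w); grind
      · rwa [hexp] at h2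
    have hg1 := hg.deriv isOpen_ball; have hg2 := hg1.deriv isOpen_ball
    have hop : DifferentiableOn ℂ (hypOp b g) (ball 0 1) := by
      unfold hypOp; fun_prop
    have hhalf : (1 / 2 : ℂ) ∈ ball (0 : ℂ) 1 := by simp; norm_num
    refine (hop.analyticOnNhd isOpen_ball).eqOn_zero_of_preconnected_of_eventuallyEq_zero
      (convex_ball 0 1).isPreconnected hhalf ?_
    filter_upwards [isOpen_ball.mem_nhds hhalf,
      isOpen_slitPlane.mem_nhds (show (1 / 2 : ℂ) ∈ slitPlane by left; norm_num)] with w hw hs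
    exact key w hw hs
  · intro h l hl
    have h1 := logODE_eq_hypOp hb isOpen_ball hg (exp_div_mem_ball hb hl)
      (one_add_exp_ne_zero hb (Or.inl hl.1))
    rw [h _ (exp_div_mem_ball hb hl), mul_zero] at h1; exact sub_eq_zero.mp h1

theorem satisfiesLogWedgeODE_iff_eqOn {g : ℂ → ℂ}
    (hg : DifferentiableOn ℂ g (ball 0 1)) :
    (g 0 = 1 ∧ SatisfiesLogWedgeODE b (fun l => exp l * g (exp (l / b)))) ↔
      EqOn g (hypFactor b) (ball 0 1) := by
  rw [satisfiesLogWedgeODE_iff hb hg]; constructor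
  · rintro ⟨h0, h⟩; exact eqOn_hypFactor_of_hypOp_eq_zero hb hg h0 h
  · intro h
    refine ⟨by rw [h (mem_ball_self one_pos), hypFactor_zero], fun w hw => ?_⟩
    have hev : g =ᶠ[𝓝 w] hypFactor b := by
      filter_upwards [isOpen_ball.mem_nhds hw] with z hz; exact h hz
    rw [hypOp, hev.deriv_eq, hev.deriv.deriv_eq, hev.eq_of_nhds]; exact hypOp_hypFactor hb hw

theorem satisfiesLogWedgeODE_hypFactor :
    SatisfiesLogWedgeODE b (fun l => exp l * hypFactor b (exp (l / b))) :=
  ((satisfiesLogWedgeODE_iff_eqOn hb (differentiableOn_hypFactor hb)).mpr fun _ _ => rfl).2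

omit hb

/-! ### The image of the arc -/

/-- The arc of the sector, parametrized by the unit interval. -/
def arcParam (b t : ℝ) : ℂ := ((π * b * (2 * t - 1) : ℝ) : ℂ) * I

/-- The curve that bounds the image of the sector. -/
def arcCurve (b μ t : ℝ) : ℂ := scaledMap b μ (arcParam b t)

theorem arcParam_re (b t : ℝ) : (arcParam b t).re = 0 := by simp [arcParam]

theorem arcParam_im (b t : ℝ) : (arcParam b t).im = π * b * (2 * t - 1) := by
  rw [arcParam, im_ofReal_mul, I_im, mul_one]

include hb

theorem arcParam_mem {t : ℝ} (ht : t ∈ Icc (0 : ℝ) 1) :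
    arcParam b t ∈ closedLogSector b := by
  refine ⟨(arcParam_re b t).le, ?_⟩
  rw [arcParam_im, abs_mul, abs_of_pos (by positivity : 0 < π * b)]
  exact mul_le_of_le_one_right (by positivity) (abs_le.mpr ⟨by linarith [ht.1], by linarith [ht.2]⟩)

theorem arcParam_mem_cornerless {t : ℝ} (ht : t ∈ Ioo (0 : ℝ) 1) :
    arcParam b t ∈ cornerless b := by
  refine ⟨arcParam_mem hb (Ioo_subset_Icc_self ht), Or.inr ?_⟩
  rw [arcParam_im, abs_mul, abs_of_pos (by positivity : 0 < π * b)]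
  exact mul_lt_of_lt_one_right (by positivity) (abs_lt.mpr ⟨by linarith [ht.1], by linarith [ht.2]⟩)

omit hb

theorem continuous_arcParam (b : ℝ) : Continuous (arcParam b) := by
  unfold arcParam; fun_prop

theorem hasDerivAt_arcParam (b t : ℝ) :
    HasDerivAt (arcParam b) (((2 * (π * b) : ℝ) : ℂ) * I) t := by
  have h1 : HasDerivAt (fun t : ℝ => π * b * (2 * t - 1)) (2 * (π * b)) t := by
    convert! (((hasDerivAt_id t).const_mul 2).sub_const 1).const_mul (π * b) using 1
    ring
  exact h1.ofReal_comp.mul_const I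

include hb

theorem arcParam_injective : Function.Injective (arcParam b) := by
  intro s t h; have h1 := congrArg im h; rw [arcParam_im, arcParam_im] at h1
  have := mul_left_cancel₀ (by positivity : π * b ≠ 0) h1
  linarith

theorem exists_arcParam (h : l ∈ closedLogSector b)
    (h0 : l.re = 0) : ∃ t ∈ Icc (0 : ℝ) 1, arcParam b t = l := by
  have hp : 0 < π * b := by positivity
  have h2 := abs_le.mp h.2; refine ⟨(l.im / (π * b) + 1) / 2, ⟨?_, ?_⟩, ?_⟩
  · have : -1 ≤ l.im / (π * b) := by rw [le_div_iff₀ hp]; linarith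
    linarith
  · have : l.im / (π * b) ≤ 1 := by rw [div_le_iff₀ hp]; linarith
    linarith
  · apply Complex.ext
    · rw [arcParam_re, h0]
    · rw [arcParam_im]; field_simp; ring

theorem closedLogSector_diff_logSector : closedLogSector b \ logSector b =
      arcParam b '' Icc 0 1 ∪ {l | l.re ≤ 0 ∧ |l.im| = π * b} := by
  ext l; constructor
  · rintro ⟨h1, h2⟩; rcases h1.1.lt_or_eq with h3 | h3
    · right; refine ⟨h1.1, ?_⟩; by_contra h4; exact h2 ⟨h3, lt_of_le_of_ne h1.2 h4⟩
    · left; exact exists_arcParam hb h1 h3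
  · rintro (⟨t, ht, rfl⟩ | ⟨h1, h2⟩)
    · exact ⟨arcParam_mem hb ht, fun h => (arcParam_re b t).not_lt h.1⟩
    · exact ⟨⟨h1, h2.le⟩, fun h => h2.not_lt h.2⟩

theorem hasDerivAt_arcCurve {t : ℝ} (ht : t ∈ Ioo (0 : ℝ) 1) :
    HasDerivAt (arcCurve b μ)
      (deriv (logExt b) (arcParam b t) * (((2 * (π * b) : ℝ) : ℂ) * I)) t := by
  have hm := arcParam_mem_cornerless hb ht
  refine ((((differentiableOn_logExt hb).differentiableAt ((isOpen_extDomain hb).mem_nhds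
    (mem_extDomain hb hm.1 hm.2))).hasDerivAt.comp t (hasDerivAt_arcParam b t)).add_const (μ :
    ℂ)).congr_of_eventuallyEq ?_
  filter_upwards [isOpen_Ioo.mem_nhds ht] with s hs; have hm' := arcParam_mem_cornerless hb hs
  simp only [arcCurve, scaledMap, Function.comp]; rw [logExt_eq hb hm'.1 hm'.2]

theorem contDiffOn_arcCurve :
    ContDiffOn ℝ 2 (arcCurve b μ) (Ioo 0 1) := by
  intro t ht; apply ContDiffAt.contDiffWithinAt; have hm := arcParam_mem_cornerless hb ht
  have h1 : ContDiffAt ℂ 2 (logExt b) (arcParam b t) :=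
    ((differentiableOn_logExt hb).analyticAt
      ((isOpen_extDomain hb).mem_nhds (mem_extDomain hb hm.1 hm.2))).contDiffAt
  have h2 : ContDiffAt ℝ 2 (arcParam b) t := by
    have : ContDiff ℝ 2 (fun t : ℝ => ((π * b * (2 * t - 1) : ℝ) : ℂ) * I) :=
      (ofRealCLM.contDiff.comp (contDiff_const.mul
        ((contDiff_const.mul contDiff_id).sub contDiff_const))).mul contDiff_const
    exact this.contDiffAt
  have h3 : ContDiffAt ℝ 2 (fun t => logExt b (arcParam b t) + (μ : ℂ)) t :=
    ((h1.restrict_scalars ℝ).comp t h2).add contDiffAt_const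
  refine h3.congr_of_eventuallyEq ?_; filter_upwards [isOpen_Ioo.mem_nhds ht] with s hs
  have hm' := arcParam_mem_cornerless hb hs; simp only [arcCurve, scaledMap]
  rw [logExt_eq hb hm'.1 hm'.2]

theorem deriv_logExt_ne_zero (h : l ∈ cornerless b) :
    deriv (logExt b) l ≠ 0 := fun h0 => by
  have := re_deriv_logExt_pos hb h.1 h.2; simp [h0] at this

theorem arcCurve_conj {t : ℝ} (ht : t ∈ Icc (0 : ℝ) 1) :
    conj (arcCurve b μ t) = arcCurve b μ (1 - t) := by
  rw [arcCurve, ← scaledMap_conj hb μ (arcParam_mem hb ht), arcCurve]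
  rw [arcParam, arcParam, map_mul, conj_ofReal, conj_I]; push_cast; ring

theorem image_side_scaledMap :
    scaledMap b μ '' {l | l.re ≤ 0 ∧ |l.im| = π * b} =
      {l | l.re ≤ cornerRe b μ ∧ |l.im| = π * b} := by
  have hp : 0 ≤ π * b := by positivity
  have hsplit : ∀ x : ℝ, {l : ℂ | l.re ≤ x ∧ |l.im| = π * b} =
      {l | l.re ≤ x ∧ l.im = π * b} ∪ {l | l.re ≤ x ∧ l.im = -(π * b)} := fun x => by
    ext l; simp only [mem_ofPred_eq, mem_union, abs_eq hp]; tauto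
  rw [hsplit, hsplit, image_union, scaledMap_side hb μ (abs_of_nonneg hp),
    scaledMap_side hb μ (by grind)]

theorem frontier_image_logSector' :
    frontier (scaledMap b μ '' logSector b) = arcCurve b μ '' Icc 0 1 ∪
      {l | l.re ≤ cornerRe b μ ∧ |l.im| = π * b} := by
  rw [frontier_image_logSector hb, closedLogSector_diff_logSector hb, image_union, image_image,
    image_side_scaledMap hb]
  rfl

theorem arcCurve_endpoints :
    arcCurve b μ 0 = cornerRe b μ - ((π * b : ℝ) : ℂ) * I ∧
      arcCurve b μ 1 = cornerRe b μ + ((π * b : ℝ) : ℂ) * I := by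
  have h1 : arcCurve b μ 1 = cornerRe b μ + ((π * b : ℝ) : ℂ) * I := by
    have h2 : arcParam b 1 = ((π * b : ℝ) : ℂ) * I := by rw [arcParam]; congr 2; ring
    apply Complex.ext
    · rw [arcCurve, h2, cornerRe]; simp
    · rw [arcCurve, h2, im_scaledMap, (im_logWedgeMap_of_side hb (l := ((π * b : ℝ) : ℂ) * I) (by
        simp) (by rw [im_ofReal_mul, I_im, mul_one, abs_of_nonneg (by positivity)]))]
      simp
  refine ⟨?_, h1⟩
  have h3 := arcCurve_conj hb μ (t := 1) (by simp)
  rw [sub_self, h1] at h3; rw [← h3]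
  apply Complex.ext <;> simp

theorem re_scaledMap_le :
    ∃ C : ℝ, ∀ l ∈ closedLogSector b, |(scaledMap b μ l).re - l.re| ≤ C := by
  obtain ⟨C, hC⟩ := exists_norm_scaledMap_sub_self_le hb μ; refine ⟨C, fun l hl => ?_⟩
  exact (abs_re_le_norm _).trans (hC l hl)

theorem isLogWedgeRegion_image :
    IsLogWedgeRegion b (arcCurve b μ) (scaledMap b μ '' logSector b) where
  continuousOn := (continuousOn_scaledMap hb μ).comp (continuous_arcParam b).continuousOn
    fun _ ht => arcParam_mem hb ht
  injOn := fun _ hs _ ht h => arcParam_injective hb (injOn_scaledMap hb μ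
    (arcParam_mem hb (Ioo_subset_Icc_self hs)) (arcParam_mem hb (Ioo_subset_Icc_self ht)) h)
  mapsTo := fun t ht => by
    show |(scaledMap b μ (arcParam b t)).im| < _; have h := arcParam_mem_cornerless hb ht
    rw [im_scaledMap]
    exact abs_im_logWedgeMap_lt hb h.1 (h.2.resolve_left (arcParam_re b t).not_lt)
  contDiffOn := contDiffOn_arcCurve hb μ
  regular := fun t ht => by
    rw [(hasDerivAt_arcCurve hb μ ht).deriv]
    exact mul_ne_zero (deriv_logExt_ne_zero hb (arcParam_mem_cornerless hb ht))
      (mul_ne_zero (ofReal_ne_zero.mpr (by positivity)) I_ne_zero)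
  symmetric := by
    rw [image_image]; ext p; constructor
    · rintro ⟨t, ht, rfl⟩
      exact ⟨1 - t, ⟨by linarith [ht.2], by linarith [ht.1]⟩, (arcCurve_conj hb μ ht).symm⟩
    · rintro ⟨t, ht, rfl⟩
      have ht' : 1 - t ∈ Icc (0 : ℝ) 1 := ⟨by linarith [ht.2], by linarith [ht.1]⟩
      refine ⟨1 - t, ht', ?_⟩; simp only [arcCurve_conj hb μ ht', sub_sub_cancel]
  isOpen := isOpen_image_logSector hb μ
  isBounded := by
    obtain ⟨C, hC⟩ := re_scaledMap_le hb μ; refine ⟨rexp C, ?_⟩; rintro _ ⟨l, hl, rfl⟩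
    rw [norm_exp]; have h1 := (abs_le.mp (hC l (subset_closedLogSector b hl))).2
    exact exp_le_exp.mpr (by linarith [hl.1])
  isSimplyConnected := isSimplyConnected_image_logSector hb μ
  subset := image_logSector_subset_logAngle hb μ
  boundary := ⟨cornerRe b μ, (arcCurve_endpoints hb μ).1, (arcCurve_endpoints hb μ).2,
    frontier_image_logSector' hb μ⟩

/-! ### The potential of the image -/

omit hb in
/-- The potential of the image of the sector. -/
def imagePotential (b μ : ℝ) (p : ℂ) : ℝ :=
  -(rexp (-μ / (2 * b)) * (modelMap b (scaledLogInv b μ p)).re)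

theorem image_union_arc_subset :
    scaledMap b μ '' logSector b ∪ arcCurve b μ '' Ioo 0 1 ⊆ scaledMap b μ '' cornerless b := by
  rintro _ (⟨l, hl, rfl⟩ | ⟨t, ht, rfl⟩)
  · exact ⟨l, ⟨subset_closedLogSector b hl, Or.inl hl.1⟩, rfl⟩
  · exact ⟨_, arcParam_mem_cornerless hb ht, rfl⟩

/-- Off the corners the potential is, from inside, the real part of an analytic function on a full
neighbourhood. Harmonicity, smoothness up to the curve and the value of the normal derivative are
all read off from it. -/
theorem exists_analytic_imagePotential (h : l ∈ cornerless b) :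
    ∃ F : ℂ → ℂ, AnalyticAt ℂ F (scaledMap b μ l) ∧ HasDerivAt F (-(rexp (-μ / (2 * b)) : ℂ) *
        (deriv (modelMap b) l * (deriv (logExt b) l)⁻¹)) (scaledMap b μ l) ∧
      ∀ᶠ p in 𝓝[scaledMap b μ '' cornerless b] (scaledMap b μ l),
        imagePotential b μ p = (F p).re := by
  obtain ⟨H, h1, h2, h3, h4, _⟩ := exists_local_inverse hb μ h
  refine ⟨fun p => -(rexp (-μ / (2 * b)) : ℂ) * modelMap b (H p), ?_, ?_, ?_⟩
  · exact analyticAt_const.mul (((differentiable_modelMap b).analyticAt _).comp h1)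
  · have := (differentiable_modelMap b (H (scaledMap b μ l))).hasDerivAt.comp _ h3; rw [h2] at this
    exact this.const_mul _
  · filter_upwards [h4] with p hp; rw [imagePotential, hp, ← ofReal_neg, re_ofReal_mul]; ring

theorem harmonicOnNhd_imagePotential :
    HarmonicOnNhd (imagePotential b μ) (scaledMap b μ '' logSector b) := by
  rintro _ ⟨l, hl, rfl⟩
  obtain ⟨F, h1, _, h3⟩ := exists_analytic_imagePotential hb μ ⟨subset_closedLogSector b hl, Or.inl
    hl.1⟩
  rw [nhdsWithin_eq_nhds.mpr (mem_of_superset ((isOpen_image_logSector hb μ).mem_nhds ⟨l, hl, rfl⟩)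
    (subset_union_left.trans (image_union_arc_subset hb μ)))] at h3
  exact (harmonicAt_congr_nhds h3).mpr h1.harmonicAt_re

theorem contDiffOn_imagePotential :
    ContDiffOn ℝ 2 (imagePotential b μ) (scaledMap b μ '' cornerless b) := by
  rintro _ ⟨l, hl, rfl⟩; obtain ⟨F, h1, _, h3⟩ := exists_analytic_imagePotential hb μ hl
  have h4 : ContDiffAt ℝ 2 (fun p => (F p).re) (scaledMap b μ l) :=
    reCLM.contDiff.contDiffAt.comp _ (h1.contDiffAt.restrict_scalars ℝ)
  exact h4.contDiffWithinAt.congr_of_eventuallyEq h3 (h3.self_of_nhdsWithin ⟨l, hl, rfl⟩)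

theorem continuousOn_imagePotential :
    ContinuousOn (imagePotential b μ) (scaledMap b μ '' closedLogSector b) :=
  (continuousOn_const.mul (continuous_re.comp_continuousOn
    ((differentiable_modelMap b).continuous.comp_continuousOn (continuousOn_scaledLogInv hb μ)))).neg

theorem imagePotential_eq_zero {p : ℂ}
    (h : p ∈ frontier (scaledMap b μ '' logSector b)) : imagePotential b μ p = 0 := by
  rw [frontier_image_logSector hb] at h; obtain ⟨l, hl, rfl⟩ := h
  rw [imagePotential, scaledLogInv_map hb μ hl.1, re_modelMap_eq_zero hb hl, mul_zero, neg_zero]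

omit hb

/-! ### Behaviour of the potential of the image at the vertex -/

/-- An analytic function is Lipschitz near `0`. Comparing `s` with its projection to the imaginary
axis, where `Re D` vanishes, costs at most the Lipschitz constant times `Re s`. -/
theorem exists_re_le_mul_re_of_imaginary {D : ℂ → ℂ} (hD : AnalyticAt ℂ D 0)
    (him : ∀ᶠ y : ℝ in 𝓝 0, (D (y * I)).re = 0) :
    ∃ C : ℝ, 0 ≤ C ∧ ∀ᶠ s in 𝓝 (0 : ℂ), 0 ≤ s.re → |(D s).re| ≤ C * s.re := by
  obtain ⟨K, t, ht, hK⟩ := hD.hasStrictDerivAt.hasStrictFDerivAt.exists_lipschitzOnWith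
  have hproj : Tendsto (fun s : ℂ => (s.im : ℂ) * I) (𝓝 0) (𝓝 0) := by
    have : Continuous (fun s : ℂ => (s.im : ℂ) * I) := by fun_prop
    simpa using this.tendsto 0
  have him' : Tendsto (fun s : ℂ => s.im) (𝓝 0) (𝓝 0) := by simpa using continuous_im.tendsto 0
  refine ⟨K, K.2, ?_⟩; filter_upwards [ht, hproj ht, him'.eventually him] with s hs hs' h0 hre
  have h1 := hK.dist_le_mul s hs _ hs'; rw [dist_eq, dist_eq] at h1
  have h2 : s - (s.im : ℂ) * I = (s.re : ℂ) := by apply Complex.ext <;> simp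
  rw [h2, norm_real, norm_of_nonneg hre] at h1
  have h3 := (abs_re_le_norm (D s - D ((s.im : ℂ) * I))).trans h1; simp_all

/-- The correction factor `(f(ζ)/ζ)^{-1/(2b)}` as a function of `ζ^{1/(2b)}`. -/
def vertexFactor (b : ℝ) (s : ℂ) : ℂ := exp (-log (hypFactor b (s ^ 2)) / (2 * b))

include hb

theorem analyticAt_vertexFactor {s : ℂ} (hs : ‖s‖ < 1) :
    AnalyticAt ℂ (vertexFactor b) s := by
  have h2 : ‖s ^ 2‖ < 1 := by simp_all
  have h1 : AnalyticAt ℂ (fun s : ℂ => hypFactor b (s ^ 2)) s :=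
    ((differentiableOn_hypFactor hb).analyticAt
      (isOpen_ball.mem_nhds (by simpa using h2))).fun_comp (by fun_prop)
  exact ((h1.clog (Or.inl (re_hypFactor_pos hb h2.le))).neg.div_const).cexp

omit hb in
theorem vertexFactor_zero (b : ℝ) : vertexFactor b 0 = 1 := by simp [vertexFactor, hypFactor_zero]

theorem vertexFactor_imaginary {y : ℝ} (hy : |y| < 1) :
    (vertexFactor b (y * I)).im = 0 := by
  have h2 : ‖((y : ℂ) * I) ^ 2‖ ≤ 1 := by
    rw [norm_pow, norm_mul, norm_I, mul_one, norm_real]; exact (pow_le_one₀ (abs_nonneg _) hy.le)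
  have h1 : (hypFactor b (((y : ℂ) * I) ^ 2)).im = 0 := by
    have := hypFactor_conj hb (((y : ℂ) * I) ^ 2)
    rw [map_pow, map_mul, conj_ofReal, conj_I, mul_neg, neg_sq] at this
    exact conj_eq_iff_im.mp this.symm
  have h3 : (log (hypFactor b (((y : ℂ) * I) ^ 2))).im = 0 := by
    rw [log_im, arg_eq_zero_iff]; exact ⟨(re_hypFactor_pos hb h2).le, h1⟩
  rw [vertexFactor, exp_im, neg_div, neg_im, div_two_mul_im, h3]; simp

/-- The asymptotics at the vertex must hold with small relative error up to the sides, where `Re s⁻¹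
= Re s/|s|²` tends to zero. So the error has to be `O(Re s)` rather than merely bounded. It is,
because `vertexFactor` is real on the imaginary axis, and the real part of its difference quotient
at `0` vanishes there. -/
theorem exists_vertex_bound :
    ∃ C : ℝ, 0 ≤ C ∧ ∀ᶠ s in 𝓝 (0 : ℂ), s ≠ 0 → 0 ≤ s.re →
      |(vertexFactor b s / s).re - (s⁻¹).re| ≤ C * s.re := by
  have hD : AnalyticAt ℂ (dslope (vertexFactor b) 0) 0 := by
    have : DifferentiableOn ℂ (dslope (vertexFactor b) 0) (ball 0 1) := by
      rw [Complex.differentiableOn_dslope (ball_mem_nhds 0 one_pos)]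
      exact fun s hs => (analyticAt_vertexFactor hb
        (by simpa using hs)).differentiableAt.differentiableWithinAt
    exact this.analyticAt (ball_mem_nhds 0 one_pos)
  have hval : ∀ s : ℂ, s ≠ 0 → dslope (vertexFactor b) 0 s = vertexFactor b s / s - s⁻¹ :=
    fun s hs => by
      rw [dslope_of_ne _ hs, slope_def_field, vertexFactor_zero, sub_zero]; field_simp
  have hne : ∀ᶠ y : ℝ in 𝓝[≠] 0, (dslope (vertexFactor b) 0 (y * I)).re = 0 := by
    have h1 : ∀ᶠ y : ℝ in 𝓝 0, |y| < 1 := continuous_abs.continuousAt.eventually_lt_const (by simp)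
    filter_upwards [h1.filter_mono nhdsWithin_le_nhds, self_mem_nhdsWithin] with y hy hy0
    rw [hval _ (mul_ne_zero (ofReal_ne_zero.mpr hy0) I_ne_zero), sub_re, div_re, inv_re,
      vertexFactor_imaginary hb hy]
    simp
  have hcont : ContinuousAt (fun y : ℝ => (dslope (vertexFactor b) 0 (y * I)).re) 0 := by
    have h1 : ContinuousAt (fun y : ℝ => (y : ℂ) * I) 0 := by fun_prop
    have h2 : ContinuousAt (dslope (vertexFactor b) 0) ((fun y : ℝ => (y : ℂ) * I) 0) := by
      simpa using hD.continuousAt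
    fun_prop
  have h0 : (dslope (vertexFactor b) 0 ((0 : ℝ) * I)).re = 0 :=
    tendsto_nhds_unique (hcont.tendsto.mono_left nhdsWithin_le_nhds)
      (tendsto_const_nhds.congr' (hne.mono fun y hy => hy.symm))
  have hall : ∀ᶠ y : ℝ in 𝓝 0, (dslope (vertexFactor b) 0 (y * I)).re = 0 := by
    rw [eventually_nhdsWithin_iff] at hne; grind
  obtain ⟨C, hC, h⟩ := exists_re_le_mul_re_of_imaginary hD hall
  refine ⟨C, hC, h.mono fun s hs hs0 hre => ?_⟩; simp_all

omit hb in
theorem exp_neg_scaledMap (l : ℂ) : exp (-scaledMap b μ l / (2 * b)) =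
      rexp (-μ / (2 * b)) * (vertexFactor b (exp (l / (2 * b))) / exp (l / (2 * b))) := by
  have h1 : exp (l / (2 * b)) ^ 2 = exp (l / b) := by
    rw [← exp_nat_mul]; grind
  rw [vertexFactor, h1, ← exp_sub, ofReal_exp, ← exp_add, scaledMap, logWedgeMap]; push_cast; ring

/-- With `s = e^{l/2b}` and `r = Re s⁻¹`, both the term `Re s` of the model potential and the error
of `exists_vertex_bound` are `O(r|s|²)`, hence negligible against `r`. The factor `e^{-μ/2b}` in the
potential compensates the scaling by `e^μ`. -/
theorem near_vertex_imagePotential :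
    IsEquivalent (comap re atBot ⊓ 𝓟 (scaledMap b μ '' logSector b)) (imagePotential b μ)
      (fun l => -(exp (-l / (2 * b))).re) := by
  obtain ⟨C, hC0, hC⟩ := exists_vertex_bound hb; obtain ⟨C', hC'⟩ := re_scaledMap_le hb μ
  set F := comap re atBot ⊓ 𝓟 (scaledMap b μ '' logSector b) with hF
  have hre : Tendsto (fun p => (scaledLogInv b μ p).re) F atBot := by
    refine tendsto_atBot_mono' F ?_ (tendsto_atBot_add_const_right F C' (tendsto_comap.mono_left
      inf_le_left))
    filter_upwards [mem_inf_of_right (mem_principal_self _)] with p hp; obtain ⟨l, hl, rfl⟩ := hp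
    have h2 := subset_closedLogSector b hl; rw [scaledLogInv_map hb μ h2]; grind
  have hs : Tendsto (fun p => exp (scaledLogInv b μ p / (2 * b))) F (𝓝 0) := by
    rw [tendsto_zero_iff_norm_tendsto_zero]
    simp_rw [norm_exp, div_two_mul_re]
    exact tendsto_exp_atBot.comp (hre.atBot_div_const (by positivity))
  rw [IsEquivalent, isLittleO_iff]; intro ε hε
  have hsmall : ∀ᶠ s : ℂ in 𝓝 0, (1 + C) * ‖s‖ ^ 2 ≤ ε * (1 - C * ‖s‖ ^ 2) ∧
      0 ≤ 1 - C * ‖s‖ ^ 2 := by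
    have hc1 : ContinuousAt (fun s : ℂ => ε * (1 - C * ‖s‖ ^ 2) - (1 + C) * ‖s‖ ^ 2) 0 := by
      fun_prop
    have hc2 : ContinuousAt (fun s : ℂ => 1 - C * ‖s‖ ^ 2) 0 := by fun_prop
    have e2 : ∀ᶠ s : ℂ in 𝓝 0, 0 < 1 - C * ‖s‖ ^ 2 := hc2.tendsto.eventually_const_lt (by simp)
    filter_upwards [(hc1.tendsto.eventually_const_lt (by simpa using hε)), e2] with s h1 h2
    grind
  filter_upwards [hs.eventually hC, hs.eventually hsmall, mem_inf_of_right (mem_principal_self _)]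
    with p h1 h2 hp
  obtain ⟨l, hl, rfl⟩ := hp; have hK := subset_closedLogSector b hl
  rw [scaledLogInv_map hb μ hK] at h1 h2; set s := exp (l / (2 * b)) with hsdef
  have hs0 : s ≠ 0 := exp_ne_zero _
  have hinv : exp (-l / (2 * b)) = s⁻¹ := by rw [hsdef, ← exp_neg, neg_div]
  have hsre : (s⁻¹).re = s.re / ‖s‖ ^ 2 := by rw [inv_re, normSq_eq_norm_sq]
  have hpos : 0 ≤ s.re := by
    have := re_exp_neg_div_nonneg hb hK; rw [hinv, hsre] at this; by_contra hneg
    exact this.not_gt (div_neg_of_neg_of_pos (not_le.mp hneg) (by positivity))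
  have h3 := h1 hs0 hpos; have hk : 0 < rexp (-μ / (2 * b)) := exp_pos _; simp only [Pi.sub_apply]
  rw [imagePotential, scaledLogInv_map hb μ hK, exp_neg_scaledMap, ← hsdef, re_ofReal_mul,
    modelMap, ← hsdef, hinv, sub_re]
  generalize rexp (-μ / (2 * b)) = k at *
  set X := (vertexFactor b s / s).re
  have hsr : (s⁻¹).re * ‖s‖ ^ 2 = s.re := by rw [hsre]; field_simp
  have hr0 : 0 ≤ (s⁻¹).re := by rw [hsre]; positivity
  generalize (s⁻¹).re = r at *
  generalize ‖s‖ ^ 2 = m at *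
  rw [← hsr] at h3 ⊢; rw [abs_le] at h3
  rw [norm_eq_abs, norm_eq_abs, abs_neg, abs_mul, abs_of_pos hk]
  have hX : r * (1 - C * m) ≤ X := by nlinarith [h3.1]
  rw [abs_of_nonneg ((mul_nonneg hr0 h2.2).trans hX), show -(k * (r - r * m)) - -(k * X) = k * (X -
    r + r * m) by ring, abs_mul,
    abs_of_pos hk, mul_left_comm]
  refine mul_le_mul_of_nonneg_left ?_ hk.le
  have h4 : |X - r + r * m| ≤ (1 + C) * (r * m) := by grind
  calc |X - r + r * m| ≤ r * ((1 + C) * m) := by linarith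
    _ ≤ r * (ε * (1 - C * m)) := mul_le_mul_of_nonneg_left h2.1 hr0
    _ = ε * (r * (1 - C * m)) := by ring
    _ ≤ ε * X := mul_le_mul_of_nonneg_left hX hε.le

theorem isLogWedgePotential_image :
    IsLogWedgePotential b (arcCurve b μ) (scaledMap b μ '' logSector b) (imagePotential b μ) where
  harmonic := harmonicOnNhd_imagePotential hb μ
  contDiffOn := (contDiffOn_imagePotential hb μ).mono (image_union_arc_subset hb μ)
  continuousOn := by
    rw [closure_image_logSector hb]; exact continuousOn_imagePotential hb μ
  eq_zero := fun _ h => imagePotential_eq_zero hb μ h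
  near_vertex := near_vertex_imagePotential hb μ

omit hb

/-! ### The boundary condition on the arc -/

/-- The extension of `f` in the logarithmic coordinate. -/
def wedgeExt (b : ℝ) (l : ℂ) : ℂ := exp (logExt b l)

theorem wedgeExt_eq (h : l ∈ extDomain b) :
    wedgeExt b l = exp l * hypExt b (exp (l / b)) := by
  rw [wedgeExt, logExt, exp_add, exp_log]; intro h0; have := h.2; simp [h0] at this

include hb

theorem wedgeExt_ode (h : l ∈ extDomain b) (h1 : 1 + exp (l / b) ≠ 0) :
    deriv (deriv (wedgeExt b)) l +
        1 / (2 * b) * ((1 - exp (l / b)) / (1 + exp (l / b))) * deriv (wedgeExt b) l =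
      (1 + 1 / (2 * b)) * wedgeExt b l := by
  have hev : wedgeExt b =ᶠ[𝓝 l] fun l => exp l * hypExt b (exp (l / b)) := by
    filter_upwards [(isOpen_extDomain hb).mem_nhds h] with z hz; exact wedgeExt_eq hz
  rw [hev.deriv_eq, hev.deriv.deriv_eq, hev.eq_of_nhds]
  have := logODE_eq_hypOp hb isOpen_cutPlane (differentiableOn_hypExt hb) h.1 h1
  rw [hypOp_hypExt hb h.1, mul_zero] at this; grind

theorem differentiableOn_wedgeExt :
    DifferentiableOn ℂ (wedgeExt b) (extDomain b) :=
  (differentiableOn_logExt hb).cexp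

theorem deriv_wedgeExt (h : l ∈ extDomain b) :
    deriv (wedgeExt b) l = wedgeExt b l * deriv (logExt b) l :=
  ((differentiableOn_logExt hb).differentiableAt
    ((isOpen_extDomain hb).mem_nhds h)).hasDerivAt.cexp.deriv

omit hb in
theorem mobius_exp_I (α : ℝ) (h : Real.cos (α / 2) ≠ 0) :
    (1 - exp (α * I)) / (1 + exp (α * I)) = -(Real.tan (α / 2) : ℂ) * I := by
  have h1 : exp (α * I) = exp ((α / 2 : ℝ) * I) * exp ((α / 2 : ℝ) * I) := by
    rw [← exp_add]; push_cast; ring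
  have h2 : exp ((α / 2 : ℝ) * I) = Real.cos (α / 2) + Real.sin (α / 2) * I := by
    rw [exp_mul_I, ofReal_cos, ofReal_sin]
  have h3 : (Real.cos (α / 2) : ℂ) ^ 2 + (Real.sin (α / 2) : ℂ) ^ 2 = 1 := by simp
  have hc : (Real.cos (α / 2) : ℂ) ≠ 0 := ofReal_ne_zero.mpr h
  have hs : (Real.cos (α / 2) : ℂ) + Real.sin (α / 2) * I ≠ 0 := by
    rw [← h2]; exact exp_ne_zero _
  rw [h1, h2, Real.tan_eq_sin_div_cos, ofReal_div]
  generalize (Real.cos (α / 2) : ℂ) = c at *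
  generalize (Real.sin (α / 2) : ℂ) = s at *
  have h4 : 1 + (c + s * I) * (c + s * I) = 2 * c * (c + s * I) := by
    linear_combination (-1 : ℂ) * h3 + s ^ 2 * I_sq
  grind

/-- Let `Q(θ) = Re(conj f · Df)` on the arc. In `Q'` the term with `|Df|²` is imaginary and drops
out. The equation replaces `D²f`: its multiple of `f` contributes nothing, and since `(1-w)/(1+w) =
-i tan(θ/2b)` on `|w| = 1`, what remains is `Q' = -(1/2b) tan(θ/2b) Q`. This is also the equation of
`cos(θ/2b)`. -/
theorem arc_quotient_const : ∃ K : ℝ, 0 < K ∧ ∀ θ : ℝ, |θ| < π * b →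
      ‖wedgeExt b (θ * I)‖ ^ 2 * (deriv (logExt b) (θ * I)).re = K * Real.cos (θ / (2 * b)) := by
  have hmem : ∀ θ : ℝ, |θ| < π * b → ((θ : ℂ) * I) ∈ cornerless b := fun θ h =>
    ⟨⟨by simp, by simpa using h.le⟩, Or.inr (by simpa using h)⟩
  have hext : ∀ θ : ℝ, |θ| < π * b → ((θ : ℂ) * I) ∈ extDomain b := fun θ h =>
    mem_extDomain hb (hmem θ h).1 (hmem θ h).2
  have hcos : ∀ θ : ℝ, |θ| < π * b → 0 < Real.cos (θ / (2 * b)) := fun θ h => by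
    have := abs_im_div_lt (l := θ * I) hb (by simpa using h)
    apply cos_pos_of_mem_Ioo; simpa using abs_lt.mp this
  set Q : ℝ → ℝ := fun θ => (conj (wedgeExt b (θ * I)) * deriv (wedgeExt b) (θ * I)).re with hQ
  have hQeq : ∀ θ : ℝ, |θ| < π * b →
      Q θ = ‖wedgeExt b (θ * I)‖ ^ 2 * (deriv (logExt b) (θ * I)).re := fun θ h => by
    simp only [hQ]
    rw [deriv_wedgeExt hb (hext θ h), ← mul_assoc, conj_mul', ← ofReal_pow, re_ofReal_mul]
  have hline : ∀ θ : ℝ, HasDerivAt (fun θ : ℝ => (θ : ℂ) * I) I θ := fun θ => by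
    simpa using (ofRealCLM.hasDerivAt (x := θ)).mul_const I
  have hQd : ∀ θ : ℝ, |θ| < π * b →
      HasDerivAt Q (-(1 / (2 * b)) * Real.tan (θ / (2 * b)) * Q θ) θ := fun θ h => by
    have hx := (isOpen_extDomain hb).mem_nhds (hext θ h)
    have d1 : HasDerivAt (fun θ : ℝ => wedgeExt b (θ * I)) (deriv (wedgeExt b) (θ * I) * I) θ :=
      HasDerivAt.comp (h₂ := wedgeExt b) (h := fun θ : ℝ => (θ : ℂ) * I) θ
        ((differentiableOn_wedgeExt hb).differentiableAt hx).hasDerivAt (hline θ)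
    have d2 : HasDerivAt (fun θ : ℝ => deriv (wedgeExt b) (θ * I))
        (deriv (deriv (wedgeExt b)) (θ * I) * I) θ :=
      HasDerivAt.comp (h₂ := deriv (wedgeExt b)) (h := fun θ : ℝ => (θ : ℂ) * I) θ
        (((differentiableOn_wedgeExt hb).deriv (isOpen_extDomain hb)).differentiableAt
          hx).hasDerivAt (hline θ)
    have h1 := wedgeExt_ode hb (hext θ h) (one_add_exp_ne_zero hb (hmem θ h).2)
    have h2 : exp ((θ : ℂ) * I / b) = exp ((θ / b : ℝ) * I) := by
      push_cast; ring
    have h3 : θ / b / 2 = θ / (2 * b) := by field_simp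
    rw [h2, mobius_exp_I _ (by grind), h3] at h1
    convert! (reCLM.hasFDerivAt.comp_hasDerivAt θ ((d1.star.mul d2))) using 1
    generalize Real.tan (θ / (2 * b)) = τ at h1 ⊢
    have h4 : deriv (deriv (wedgeExt b)) (θ * I) = ((1 + 1 / (2 * b) : ℝ) : ℂ) * wedgeExt b (θ * I) +
        ((1 / (2 * b) * τ : ℝ) : ℂ) * (deriv (wedgeExt b) (θ * I) * I) := by
      push_cast; linear_combination h1
    rw [h4]; simp only [hQ]
    simp only [reCLM_apply, star_def, map_mul, conj_I, add_re, mul_re, mul_im, conj_re, conj_im, I_re, I_im, neg_re,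
      neg_im, add_im, ofReal_re, ofReal_im]
    ring
  set J : Set ℝ := Ioo (-(π * b)) (π * b) with hJ
  have hJm : ∀ θ ∈ J, |θ| < π * b := fun θ h => abs_lt.mpr h
  have hR : ∀ θ ∈ J, HasDerivAt (fun θ => Q θ / Real.cos (θ / (2 * b))) 0 θ := fun θ h => by
    have hc := (hcos θ (hJm θ h)).ne'
    have d5 : HasDerivAt (fun θ : ℝ => Real.cos (θ / (2 * b)))
        (-Real.sin (θ / (2 * b)) * (1 / (2 * b))) θ :=
      ((hasDerivAt_id θ).div_const (2 * b)).cos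
    convert! (hQd θ (hJm θ h)).div d5 hc using 1
    rw [Real.tan_eq_sin_div_cos]; field_simp; ring
  obtain ⟨K, hK⟩ := isOpen_Ioo.exists_is_const_of_deriv_eq_zero (s := J)
    (isPreconnected_Ioo) (fun θ h => (hR θ h).differentiableAt.differentiableWithinAt)
    (fun θ h => (hR θ h).deriv)
  refine ⟨K, ?_, fun θ h => ?_⟩
  · have h0 : (0 : ℝ) ∈ J := by
      constructor <;> [exact neg_lt_zero.mpr (by positivity); positivity]
    have h1 := hK 0 h0; simp only [zero_div, Real.cos_zero, div_one] at h1
    rw [← h1, hQeq 0 (hJm 0 h0)]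
    have := re_deriv_logExt_pos hb (hmem 0 (hJm 0 h0)).1 (hmem 0 (hJm 0 h0)).2
    have h2 : wedgeExt b ((0 : ℝ) * I) ≠ 0 := exp_ne_zero _; positivity
  grind

omit hb

/-! ### The direct statement on the surface -/

theorem inner_eq_re_conj_mul (z w : ℂ) : inner ℝ z w = (conj z * w).re := by
  rw [Complex.inner, mul_comm]

theorem eventually_sub_mem_add_notMem {R : ℂ → ℝ} {z n : ℂ} {m : ℝ} (hm : 0 < m)
    (hd : HasDerivAt (fun s : ℝ => R (z + s * n)) m 0) (h0 : R z = 0)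
    (hΩ : ∀ᶠ p in 𝓝 z, (R p < 0 → p ∈ Ω) ∧ (p ∈ Ω → R p < 0)) :
    ∀ᶠ ε : ℝ in 𝓝[>] 0, z - ε * n ∈ Ω ∧ z + ε * n ∉ Ω := by
  have hpos : ∀ᶠ s : ℝ in 𝓝[≠] 0, 0 < slope (fun s : ℝ => R (z + s * n)) 0 s :=
    (hasDerivAt_iff_tendsto_slope.mp hd).eventually_const_lt hm
  have hslope : ∀ s : ℝ, slope (fun s : ℝ => R (z + s * n)) 0 s = R (z + s * n) / s := fun s => by
    rw [slope_def_field, ofReal_zero, zero_mul, add_zero, h0, sub_zero, sub_zero]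
  simp only [hslope] at hpos; rw [eventually_nhdsWithin_iff] at hpos
  have hpath : Tendsto (fun s : ℝ => z + s * n) (𝓝 0) (𝓝 z) := by
    have : Continuous (fun s : ℝ => z + s * n) := by fun_prop
    have h := this.tendsto 0; simp_all
  have hneg : Tendsto (fun ε : ℝ => -ε) (𝓝 0) (𝓝 0) := by
    simpa using (continuous_neg (G := ℝ)).tendsto 0
  have hall := hpos.and (hpath.eventually hΩ)
  filter_upwards [(hneg.eventually hall).filter_mono nhdsWithin_le_nhds,
    hall.filter_mono nhdsWithin_le_nhds, self_mem_nhdsWithin] with ε e1 e2 (hε : 0 < ε)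
  constructor
  · have f5 : R (z + (-ε : ℝ) * n) < 0 := by
      by_contra hcon
      exact (e1.1 (neg_ne_zero.mpr hε.ne')).not_ge (div_nonpos_of_nonneg_of_nonpos (not_lt.mp hcon)
        (by linarith))
    rw [show z - ε * n = z + (-ε : ℝ) * n by push_cast; ring]
    exact e1.2.1 f5
  · intro h; exact (e2.1 hε.ne').not_gt (div_neg_of_neg_of_pos (e2.2.2 h) hε)

include hb

/-- The real part of the local inverse is a defining function of the image near a point of the arc,
because the half-strip is `Re < 0` there. -/
theorem exists_defining_function {t : ℝ} (ht : t ∈ Ioo (0 : ℝ) 1) :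
    ∃ H : ℂ → ℂ, HasDerivAt H (deriv (logExt b) (arcParam b t))⁻¹ (arcCurve b μ t) ∧
      (H (arcCurve b μ t)).re = 0 ∧
      ∀ᶠ p in 𝓝 (arcCurve b μ t), ((H p).re < 0 → p ∈ scaledMap b μ '' logSector b) ∧
        (p ∈ scaledMap b μ '' logSector b → (H p).re < 0) := by
  have hm := arcParam_mem_cornerless hb ht
  obtain ⟨H, h1, h2, h3, h4, h5⟩ := exists_local_inverse hb μ hm; refine ⟨H, h3, ?_, ?_⟩
  · show (H (scaledMap b μ (arcParam b t))).re = 0; rw [h2, arcParam_re]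
  · have him : ∀ᶠ p in 𝓝 (scaledMap b μ (arcParam b t)), |(H p).im| < π * b := by
      have hc : ContinuousAt (fun p => |(H p).im|) (scaledMap b μ (arcParam b t)) :=
        (continuous_abs.comp continuous_im).continuousAt.comp h1.continuousAt
      refine hc.tendsto.eventually_lt_const ?_; rw [h2]
      exact hm.2.resolve_left (arcParam_re b t).not_lt
    rw [eventually_nhdsWithin_iff] at h4; filter_upwards [h4, h5, him] with p e1 e2 e3; constructor
    · intro f5; have f6 : H p ∈ logSector b := ⟨f5, e3⟩
      exact ⟨_, f6, e2 ⟨subset_closedLogSector b f6, Or.inl f5⟩⟩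
    · rintro ⟨z, hz, rfl⟩; have hzc : z ∈ cornerless b := ⟨subset_closedLogSector b hz, Or.inl hz.1⟩
      have f1 := e1 ⟨z, hzc, rfl⟩; rw [scaledLogInv_map hb μ hzc.1] at f1; rw [← f1]; exact hz.1

omit hb

theorem hasDerivAt_re_comp_line {H : ℂ → ℂ} {H' z n : ℂ} (h : HasDerivAt H H' z) :
    HasDerivAt (fun s : ℝ => (H (z + s * n)).re) (H' * n).re 0 := by
  have e1 : HasDerivAt (fun s : ℝ => z + s * n) n 0 := by
    simpa using ((ofRealCLM.hasDerivAt (x := 0)).mul_const n).const_add z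
  have e2 : HasDerivAt (fun s : ℝ => H (z + s * n)) (H' * n) 0 := by
    refine HasDerivAt.comp (h₂ := H) (h := fun s : ℝ => z + s * n) 0 ?_ e1; simp_all
  exact reCLM.hasFDerivAt.comp_hasDerivAt (0 : ℝ) e2

theorem inner_mul_div_norm_self {d : ℂ} (hd : d ≠ 0) (c : ℝ) :
    inner ℝ (d * (c * I)) (d / ‖d‖) = 0 := by
  have hn0 : (‖d‖ : ℂ) ≠ 0 := ofReal_ne_zero.mpr (norm_ne_zero_iff.mpr hd)
  rw [inner_eq_re_conj_mul, map_mul, map_mul, conj_ofReal, conj_I]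
  have : conj d * ((c : ℂ) * -I) * (d / ‖d‖) = ((-c * ‖d‖ : ℝ) : ℂ) * I := by
    have h1 : conj d * d = ‖d‖ ^ 2 := by rw [conj_mul']
    have h2 : conj d * (d / ‖d‖) = ‖d‖ := by grind
    push_cast; grind
  rw [this]; simp

theorem norm_div_norm_self {d : ℂ} (hd : d ≠ 0) : ‖d / ‖d‖‖ = 1 := by simp_all

include hb

/-- The outer normal of the half-strip along the arc is `1`, and a conformal map rotates it to the
direction of its derivative. -/
theorem isOutwardUnitNormal_image {t : ℝ} (ht : t ∈ Ioo (0 : ℝ) 1) :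
    IsOutwardUnitNormal (scaledMap b μ '' logSector b) (arcCurve b μ) t
      (deriv (logExt b) (arcParam b t) / ‖deriv (logExt b) (arcParam b t)‖) := by
  have hne := deriv_logExt_ne_zero hb (arcParam_mem_cornerless hb ht)
  refine ⟨norm_div_norm_self hne, ?_, ?_⟩
  · rw [(hasDerivAt_arcCurve hb μ ht).deriv]; exact inner_mul_div_norm_self hne _
  · obtain ⟨H, h1, h2, h3⟩ := exists_defining_function hb μ ht
    refine eventually_sub_mem_add_notMem ?_ (hasDerivAt_re_comp_line h1) h2 h3
    rw [← mul_div_assoc, inv_mul_cancel₀ hne, one_div, ← ofReal_inv, ofReal_re]; positivity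

omit hb

theorem fderivWithin_re_apply {F : ℂ → ℂ} {F' z : ℂ} {f : ℂ → ℝ} {s : Set ℂ}
    (hF : HasDerivAt F F' z) (hf : ∀ᶠ p in 𝓝[s] z, f p = (F p).re) (hz : z ∈ s)
    (hs : UniqueDiffWithinAt ℝ s z) (ν : ℂ) : fderivWithin ℝ f s z ν = (F' * ν).re := by
  have h1 : HasFDerivAt (fun p => (F p).re) _ z :=
    reCLM.hasFDerivAt.comp z (hF.hasFDerivAt.restrictScalars ℝ)
  rw [((h1.hasFDerivWithinAt (s := s)).congr_of_eventuallyEq hf (hf.self_of_nhdsWithin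
    hz)).fderivWithin hs]
  simp [mul_comm]

theorem deriv_modelMap_imaginary (b θ : ℝ) : deriv (modelMap b) (θ * I) =
    ((-(1 / b) * Real.cos (θ / (2 * b)) : ℝ) : ℂ) := by
  rw [(hasDerivAt_modelMap b _).deriv]
  have e1 : -((θ : ℂ) * I) / (2 * b) = -((θ / (2 * b) : ℝ) : ℂ) * I := by push_cast; ring
  have e2 : ((θ : ℂ) * I) / (2 * b) = ((θ / (2 * b) : ℝ) : ℂ) * I := by push_cast; ring
  rw [e1, e2, ofReal_mul, ofReal_cos, Complex.cos]; push_cast; ring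

include hb

/-- The normal velocity of the arc. -/
theorem normal_velocity_image : ∃ c : ℝ, ∀ t ∈ Ioo (0 : ℝ) 1,
    ‖exp (arcCurve b μ t)‖⁻¹ * fderivWithin ℝ (imagePotential b μ)
        (scaledMap b μ '' logSector b ∪ arcCurve b μ '' Ioo 0 1) (arcCurve b μ t)
        (deriv (logExt b) (arcParam b t) / ‖deriv (logExt b) (arcParam b t)‖) =
      c * inner ℝ (exp (arcCurve b μ t)) (exp (arcCurve b μ t) / ‖exp (arcCurve b μ t)‖ *
        (deriv (logExt b) (arcParam b t) / ‖deriv (logExt b) (arcParam b t)‖)) := by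
  obtain ⟨K, hK, hQ⟩ := arc_quotient_const hb
  -- With `d = (log f)'`, the normal derivative in the logarithmic coordinate is `e^{-μ/2b}
  -- cos(θ/2b)/(b|d|)`. The condition asks that it equal `c e^{2μ} |f|² Re d / |d|`, and `|f|² Re d
  -- = K cos(θ/2b)`.
  refine ⟨rexp (-μ / (2 * b)) / (b * rexp μ ^ 2 * K), fun t ht => ?_⟩
  have hm := arcParam_mem_cornerless hb ht; have hne := deriv_logExt_ne_zero hb hm
  obtain ⟨F, _, h2, h3⟩ := exists_analytic_imagePotential hb μ hm
  rw [fderivWithin_re_apply (z := arcCurve b μ t) h2 (h3.filter_mono (nhdsWithin_mono _ (image_union_arc_subset hb μ)))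
    (Or.inr ⟨t, ht, rfl⟩) ((uniqueDiffWithinAt_image_logSector hb μ hm).mono subset_union_left)]
  have hθ : arcParam b t = ((arcParam b t).im : ℂ) * I := by
    apply Complex.ext <;> simp [arcParam_re]
  have hmod := deriv_modelMap_imaginary b (arcParam b t).im
  have hq := hQ (arcParam b t).im (hm.2.resolve_left (arcParam_re b t).not_lt); rw [← hθ] at hq hmod
  have hexp : ‖exp (arcCurve b μ t)‖ = rexp μ * ‖wedgeExt b (arcParam b t)‖ := by
    rw [arcCurve, scaledMap, exp_add, norm_mul, wedgeExt, logExt_eq hb hm.1 hm.2, mul_comm,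
      norm_exp (μ : ℂ), ofReal_re]
  have hw0 : ‖wedgeExt b (arcParam b t)‖ ≠ 0 := norm_ne_zero_iff.mpr (exp_ne_zero _)
  have hinner : ∀ E d : ℂ, ‖E‖ ≠ 0 → inner ℝ E (E / ‖E‖ * (d / ‖d‖)) = ‖E‖ * (d.re / ‖d‖) :=
    fun E d hE => by
      rw [inner_eq_re_conj_mul, ← mul_assoc, ← mul_div_assoc (conj E), conj_mul', sq,
        mul_div_assoc, div_self (ofReal_ne_zero.mpr hE), mul_one, re_ofReal_mul, div_ofReal_re]
  rw [hinner _ _ (norm_ne_zero_iff.mpr (exp_ne_zero _)), hmod, hexp]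
  generalize deriv (logExt b) (arcParam b t) = d at *
  have hcalc : (-(rexp (-μ / (2 * b)) : ℂ) *
      (((-(1 / b) * Real.cos ((arcParam b t).im / (2 * b)) : ℝ) : ℂ) * d⁻¹) * (d / ‖d‖)) =
      ((rexp (-μ / (2 * b)) * (1 / b) * Real.cos ((arcParam b t).im / (2 * b)) / ‖d‖ : ℝ) : ℂ) := by
    have : d⁻¹ * (d / ‖d‖) = (‖d‖ : ℂ)⁻¹ := by grind
    rw [mul_assoc, mul_assoc _ _ (d / _), this]; push_cast; ring
  rw [hcalc, ofReal_re]; grind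

theorem solvesLogKillingProblem_image :
    SolvesLogKillingProblem b (scaledMap b μ '' logSector b) := by
  obtain ⟨c, hc⟩ := normal_velocity_image hb μ
  exact ⟨arcCurve b μ, imagePotential b μ, c, isLogWedgeRegion_image hb μ,
    isLogWedgePotential_image hb μ, fun t ht =>
    ⟨_, isOutwardUnitNormal_image hb μ ht, hc t ht⟩⟩

omit hb

/-! ### Passing from the logarithmic coordinate to the plane -/

theorem log_exp_of_mem (hb1 : b ≤ 1) (h : l ∈ logAngle b) : log (exp l) = l := by
  have h1 := abs_lt.mp (show |l.im| < π * b from h)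
  have h2 : π * b ≤ π := mul_le_of_le_one_right pi_pos.le hb1
  exact log_exp (by linarith) (by linarith)

theorem arg_exp_of_mem_logAngle (hb1 : b ≤ 1) (h : l ∈ logAngle b) :
    (exp l).arg = l.im := by
  rw [← log_im, log_exp_of_mem hb1 h]

theorem exp_mem_openAngle (hb1 : b ≤ 1) (h : l ∈ logAngle b) :
    exp l ∈ openAngle b := by
  refine ⟨exp_ne_zero _, ?_⟩; rw [arg_exp_of_mem_logAngle hb1 h]; exact h

theorem log_mem_logAngle {z : ℂ} (h : z ∈ openAngle b) : log z ∈ logAngle b := by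
  show |(log z).im| < _; rw [log_im]; exact h.2

theorem openAngle_subset_slitPlane (hb1 : b ≤ 1) : openAngle b ⊆ slitPlane := by
  intro z hz; rw [mem_slitPlane_iff_arg]; refine ⟨fun h => ?_, hz.1⟩; have h1 := hz.2
  rw [h, abs_of_pos pi_pos] at h1; nlinarith [pi_pos]

theorem injOn_exp_logAngle (hb1 : b ≤ 1) : InjOn exp (logAngle b) := fun p hp q hq h => by
  rw [← log_exp_of_mem hb1 hp, ← log_exp_of_mem hb1 hq, h]

theorem abs_im_le_of_mem_closure (hΩ : Ω ⊆ logAngle b) :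
    ∀ l ∈ closure Ω, |l.im| ≤ π * b :=
  closure_minimal (fun _ hl => (show |Complex.im _| < _ from hΩ hl).le)
    (isClosed_le continuous_im.abs continuous_const)

/-- The period is `2πi`. A point of the closed strip and a point of the open strip have imaginary
parts differing by less than `2π`, so congruent points coincide, even for `b = 1`. -/
theorem exp_mem_image_iff (hb1 : b ≤ 1) {S : Set ℂ} (hS : S ⊆ logAngle b) {p : ℂ}
    (hp : |p.im| ≤ π * b) (h : exp p ∈ exp '' S) : p ∈ S := by
  obtain ⟨q, hq, hpq⟩ := h; have h1 := abs_le.mp hp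
  have h2 := abs_lt.mp (show |q.im| < π * b from hS hq)
  have h3 : π * b ≤ π := mul_le_of_le_one_right pi_pos.le hb1
  obtain ⟨n, rfl⟩ := exp_eq_exp_iff_exists_int.mp hpq
  simp only [add_im, mul_im, intCast_re, intCast_im, ofReal_re, ofReal_im, mul_re, I_re, I_im,
    re_ofNat, im_ofNat] at h2
  have h4 : (n : ℝ) < 1 := by nlinarith [pi_pos]
  have h5 : (-1 : ℝ) < n := by nlinarith [pi_pos]
  norm_cast at h4 h5
  obtain rfl : n = 0 := by omega
  simpa using hq

/-- Away from the vertex `exp` is proper on the closed strip: `Re g p = log |p|` stays bounded as `p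
→ z ≠ 0`. The ultrafilter formulation avoids a continuous branch of the logarithm, which for `b = 1`
does not exist across the negative axis. -/
theorem exp_image_closure (hΩ : Ω ⊆ logAngle b)
    {z : ℂ} (hz0 : z ≠ 0) {u : Ultrafilter ℂ} (hu : ↑u ≤ 𝓝 z)
    {g : ℂ → ℂ} (hg : ∀ᶠ p in (u : Filter ℂ), g p ∈ closure Ω ∧ exp (g p) = p) :
    ∃ l ∈ closure Ω, exp l = z ∧ Tendsto g u (𝓝 l) := by
  have hz : 0 < ‖z‖ := norm_pos_iff.mpr hz0
  have hbd : ∀ᶠ p in (u : Filter ℂ),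
      g p ∈ closure Ω ∩ closedBall 0 (|Real.log (‖z‖ / 2)| + |Real.log (‖z‖ + 1)| + π * b) := by
    have h1 : ∀ᶠ p in 𝓝 z, ‖z‖ / 2 < ‖p‖ :=
      continuous_norm.continuousAt.tendsto.eventually_const_lt (half_lt_self hz)
    have h2 : ∀ᶠ p in 𝓝 z, ‖p‖ < ‖z‖ + 1 :=
      continuous_norm.continuousAt.tendsto.eventually_lt_const (lt_add_one _)
    filter_upwards [hg, hu h1, hu h2] with p hp h1 h2; refine ⟨hp.1, ?_⟩
    rw [mem_closedBall_zero_iff]; have h3 := abs_im_le_of_mem_closure hΩ _ hp.1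
    have h4 : (g p).re = Real.log ‖p‖ := by conv_rhs => rw [← hp.2, norm_exp, Real.log_exp]
    have h5 := Real.log_lt_log (half_pos hz) h1
    have h6 := Real.log_lt_log ((half_pos hz).trans h1) h2
    have h7 : |(g p).re| ≤ |Real.log (‖z‖ / 2)| + |Real.log (‖z‖ + 1)| := by grind
    linarith [norm_le_abs_re_add_abs_im (g p)]
  obtain ⟨l, hl, hle⟩ := ((isCompact_closedBall _ _).inter_left isClosed_closure).ultrafilter_le_nhds
    (u.map g) (le_principal_iff.mpr hbd)
  refine ⟨l, hl.1, ?_, hle⟩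
  exact tendsto_nhds_unique ((continuous_exp.tendsto l).comp (show Tendsto g u (𝓝 l) from hle))
    ((tendsto_id.mono_left hu).congr' (hg.mono fun p hp => hp.2.symm))

/-- A right inverse of the exponential map on a set. -/
theorem exists_right_inverse_exp (S : Set ℂ) : ∃ g : ℂ → ℂ, ∀ p ∈ exp '' S, g p ∈ S ∧ exp (g p) = p
    :=
  ⟨invFunOn exp S, fun _ hp => ⟨invFunOn_mem hp, invFunOn_eq hp⟩⟩

theorem closure_exp_image (hΩ : Ω ⊆ logAngle b) {z : ℂ} (hz0 : z ≠ 0) :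
    z ∈ closure (exp '' Ω) ↔ z ∈ exp '' closure Ω := by
  constructor
  · intro h; obtain ⟨u, hu1, hu2⟩ := mem_closure_iff_ultrafilter.mp h
    obtain ⟨g, hg⟩ := exists_right_inverse_exp Ω
    obtain ⟨l, h1, h2, _⟩ := exp_image_closure hΩ hz0 hu2 (g := g)
      (mem_of_superset hu1 fun p hp => ⟨subset_closure (hg p hp).1, (hg p hp).2⟩)
    exact ⟨l, h1, h2⟩
  · rintro ⟨l, h, rfl⟩; exact continuous_exp.continuousOn.image_closure ⟨l, h, rfl⟩

theorem mem_frontier_exp_image (hb1 : b ≤ 1) (ho : IsOpen Ω)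
    (hΩ : Ω ⊆ logAngle b) {z : ℂ} (hz0 : z ≠ 0) :
    z ∈ frontier (exp '' Ω) ↔ z ∈ exp '' frontier Ω := by
  rw [(isOpenMap_exp _ ho).frontier_eq, ho.frontier_eq, Set.mem_sdiff, closure_exp_image hΩ hz0]
  constructor
  · grind
  · rintro ⟨l, ⟨h1, h2⟩, rfl⟩
    exact ⟨⟨l, h1, rfl⟩, fun h => h2 (exp_mem_image_iff hb1 hΩ (abs_im_le_of_mem_closure hΩ l h1) h)⟩

theorem zero_mem_frontier_exp_image (ho : IsOpen Ω) {x y : ℝ}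
    (h : ∀ s : ℝ, s ≤ x → (s : ℂ) + (y : ℂ) * I ∈ frontier Ω) : (0 : ℂ) ∈ frontier (exp '' Ω) := by
  rw [(isOpenMap_exp _ ho).frontier_eq]; refine ⟨?_, fun ⟨l, _, hl⟩ => exp_ne_zero l hl⟩
  have hlim : Tendsto (fun s : ℝ => exp ((s : ℂ) + (y : ℂ) * I)) atBot (𝓝 0) := by
    rw [tendsto_zero_iff_norm_tendsto_zero]
    simp only [norm_exp, add_re, ofReal_re, re_ofReal_mul, I_re, mul_zero, add_zero]
    exact tendsto_exp_atBot
  refine isClosed_closure.mem_of_tendsto hlim ?_; filter_upwards [eventually_le_atBot x] with s hs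
  exact continuous_exp.continuousOn.image_closure ⟨_, frontier_subset_closure (h s hs), rfl⟩

include hb

theorem isWedgeRegion_exp (hb1 : b ≤ 1) (h : IsLogWedgeRegion b γ Ω) : IsWedgeRegion b (fun t => exp
    (γ t)) (exp '' Ω) where
  continuousOn := h.continuousOn.cexp
  injOn := fun s hs t ht hst => h.injOn hs ht
    (injOn_exp_logAngle hb1 (h.mapsTo hs) (h.mapsTo ht) hst)
  mapsTo := fun t ht => exp_mem_openAngle hb1 (h.mapsTo ht)
  contDiffOn := h.contDiffOn.cexp
  regular := fun t ht => by
    have hd : HasDerivAt γ (deriv γ t) t :=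
      ((h.contDiffOn.differentiableOn two_ne_zero).differentiableAt
        (isOpen_Ioo.mem_nhds ht)).hasDerivAt
    rw [hd.cexp.deriv]; exact mul_ne_zero (exp_ne_zero _) (h.regular t ht)
  symmetric := by
    have h1 : (fun t => exp (γ t)) '' Icc 0 1 = exp '' (γ '' Icc 0 1) := by rw [image_image]
    have h2 : ∀ S : Set ℂ, conj '' (exp '' S) = exp '' (conj '' S) := by
      intro S; rw [image_image, image_image]; simp
    rw [h1, h2, h.symmetric]
  isOpen := isOpenMap_exp _ h.isOpen
  isBounded := by
    obtain ⟨M, hM⟩ := h.isBounded; rw [isBounded_iff_forall_norm_le]; refine ⟨M, ?_⟩; grind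
  isSimplyConnected := isSimplyConnected_image_of_continuousOn_inv (g := log) h.isSimplyConnected
    continuous_exp.continuousOn (by
      rintro _ ⟨l, hl, rfl⟩
      exact (continuousAt_clog (openAngle_subset_slitPlane hb1
        (exp_mem_openAngle hb1 (h.subset hl)))).continuousWithinAt)
    fun l hl => log_exp_of_mem hb1 (h.subset hl)
  subset := by
    rintro _ ⟨l, hl, rfl⟩; exact exp_mem_openAngle hb1 (h.subset hl)
  boundary := by
    obtain ⟨x, h0, h1, hf⟩ := h.boundary
    have hp : 0 ≤ π * b := by positivity
    refine ⟨rexp x, exp_pos x, ?_, ?_, ?_⟩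
    · rw [h0, sub_eq_add_neg, exp_add, ofReal_exp]; simp
    · rw [h1, exp_add, ofReal_exp]
    · have hzero : (0 : ℂ) ∈ frontier (exp '' Ω) := by
        refine zero_mem_frontier_exp_image (x := x) (y := π * b) h.isOpen fun s hs => ?_; rw [hf]
        exact Or.inr ⟨by simpa using hs, by simpa using abs_of_nonneg hp⟩
      ext z
      by_cases hz0 : z = 0
      · rw [hz0]; refine iff_of_true hzero (Or.inr ⟨0, le_rfl, (exp_pos x).le, Or.inl ?_⟩); simp
      · rw [mem_frontier_exp_image hb1 h.isOpen h.subset hz0, hf, image_union, image_image]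
        refine or_congr Iff.rfl ?_; constructor
        · rintro ⟨l, ⟨h2, h3⟩, rfl⟩; refine ⟨rexp l.re, (exp_pos _).le, exp_le_exp.mpr h2, ?_⟩
          rw [ofReal_exp, ← exp_add, ← exp_add]
          rcases (abs_eq hp).mp h3 with h4 | h4 <;> simp [← h4]
        · rintro ⟨r, hr0, hr, hz⟩
          have hr1 : 0 < r := by
            refine lt_of_le_of_ne hr0 fun hr2 => hz0 ?_; rw [← hr2] at hz; simpa using hz
          have hlog : ∀ y : ℝ, |y| = π * b → z = r * exp (y * I) →
              z ∈ exp '' {l : ℂ | l.re ≤ x ∧ |l.im| = π * b} := fun y hy hz =>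
            ⟨Real.log r + y * I, ⟨by simpa using (Real.log_le_iff_le_exp hr1).mpr hr, by simpa⟩, by
              rw [hz, exp_add, ← ofReal_exp, Real.exp_log hr1]⟩
          exact hz.elim (hlog _ (by rw [abs_neg, abs_of_nonneg hp])) (hlog _ (abs_of_nonneg hp))

omit hb

/-- The principal logarithm can fail to invert `exp` on the closed strip only for `b = 1`, where it
moves the lower side to the upper one. On both sides `Φ` vanishes, and both are cut off at the same
abscissa, so the composition is unaffected. -/
theorem log_eq_of_exp_image (hb1 : b ≤ 1) (h : IsLogWedgeRegion b γ Ω) (hΦ : ∀ l ∈ frontier Ω, Φ l =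
    0) (hl : l ∈ closure Ω) : Φ (log (exp l)) = Φ l := by
  have h1 : π * b ≤ π := mul_le_of_le_one_right pi_pos.le hb1
  rcases (abs_im_le_of_mem_closure h.subset l hl).lt_or_eq with h2 | h2
  · rw [log_exp_of_mem hb1 h2]
  obtain ⟨x, h3, h4, hf⟩ := h.boundary
  have h5 : l ∈ frontier Ω := by
    rw [h.isOpen.frontier_eq]; exact ⟨hl, fun h6 => (show |l.im| < π * b from h.subset h6).ne h2⟩
  by_cases h6 : l.im = -π
  · have h7 : π * b = π := by grind
    have h8 : log (exp l) = (l.re : ℂ) + π * I := by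
      have : exp l = exp ((l.re : ℂ) + π * I) := by
        conv_lhs => rw [← re_add_im l, h6]
        rw [exp_add, exp_add, ofReal_neg, neg_mul, exp_neg, exp_pi_mul_I]; norm_num
      rw [this, log_exp] <;> simp [pi_pos]
    rw [h8, hΦ l h5]; apply hΦ; rw [hf] at h5 ⊢
    have h9 : ∀ p : ℂ, |p.im| = π * b → p ∈ γ '' Icc 0 1 → p.re = x := by
      rintro _ hp ⟨t, ht, rfl⟩; rcases ht.1.eq_or_lt with h10 | h10
      · rw [← h10, h3]; simp
      rcases ht.2.eq_or_lt with h11 | h11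
      · rw [h11, h4]; simp
      · exact absurd hp (show |(γ t).im| < π * b from h.mapsTo ⟨h10, h11⟩).ne
    right
    refine ⟨?_, by simp_all⟩
    have : l.re ≤ x := h5.elim (fun h6 => (h9 l h2 h6).le) fun h6 => h6.1; simpa using this
  · rw [log_exp]
    · grind
    grind

theorem tendsto_log_nhdsWithin_zero (hb1 : b ≤ 1) (hΩ : Ω ⊆ logAngle b) :
    Tendsto log (𝓝[exp '' Ω] 0) (comap re atBot ⊓ 𝓟 Ω) := by
  refine tendsto_inf.mpr ⟨tendsto_comap_iff.mpr ?_, ?_⟩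
  · exact ((Real.tendsto_log_nhdsGT_zero.comp tendsto_norm_nhdsNE_zero).mono_left (nhdsWithin_mono _
      (by simp))).congr fun z =>
      (log_re z).symm
  · refine tendsto_principal.mpr ?_; filter_upwards [self_mem_nhdsWithin] with z hz
    obtain ⟨l, hl, rfl⟩ := hz; rwa [log_exp_of_mem hb1 (hΩ hl)]

theorem isWedgePotential_exp (hb1 : b ≤ 1) (h : IsLogWedgeRegion b γ Ω) (hΦ : IsLogWedgePotential b
    γ Ω Φ) :
    IsWedgePotential b (fun t => exp (γ t)) (exp '' Ω) (fun z => Φ (log z)) where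
  harmonic := by
    rintro _ ⟨l, hl, rfl⟩; obtain ⟨r, hr, hball⟩ := Metric.isOpen_iff.mp h.isOpen l hl
    obtain ⟨F, hF, hre⟩ :=
      InnerProductSpace.HarmonicOnNhd.exists_analyticOnNhd_ball_re_eq (hΦ.harmonic.mono hball)
    have hlog : AnalyticAt ℂ log (exp l) := analyticAt_clog (openAngle_subset_slitPlane hb1
      (exp_mem_openAngle hb1 (h.subset hl)))
    have hle := log_exp_of_mem hb1 (h.subset hl)
    have h1 : AnalyticAt ℂ (fun z => F (log z)) (exp l) := by
      refine AnalyticAt.fun_comp (g := F) ?_ hlog; rw [hle]; exact hF _ (mem_ball_self hr)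
    refine (harmonicAt_congr_nhds ?_).mpr h1.harmonicAt_re
    have h2 : ∀ᶠ z in 𝓝 (exp l), log z ∈ ball l r := by
      refine hlog.continuousAt.tendsto.eventually_mem ?_; rw [hle]; exact ball_mem_nhds _ hr
    filter_upwards [h2] with z hz; exact (hre hz).symm
  contDiffOn := by
    have h1 : ContDiffOn ℝ 2 log (exp '' Ω ∪ (fun t => exp (γ t)) '' Ioo 0 1) := by
      rintro z hz
      have hs : z ∈ slitPlane := by
        apply openAngle_subset_slitPlane hb1; rcases hz with ⟨l, hl, rfl⟩ | ⟨t, ht, rfl⟩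
        · exact exp_mem_openAngle hb1 (h.subset hl)
        · exact exp_mem_openAngle hb1 (h.mapsTo ht)
      exact ((contDiffAt_log hs).restrict_scalars ℝ).contDiffWithinAt
    refine hΦ.contDiffOn.comp h1 ?_; rintro _ (⟨l, hl, rfl⟩ | ⟨t, ht, rfl⟩)
    · left; rwa [log_exp_of_mem hb1 (h.subset hl)]
    · right; refine ⟨t, ht, ?_⟩; rw [log_exp_of_mem hb1 (h.mapsTo ht)]
  continuousOn := by
    -- At a point of the negative axis with `b = 1` the approach may be from either side of the cut.
    -- Each ultrafilter selects preimages converging to a point of one side.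
    rintro z ⟨hz, hz0⟩; refine (tendsto_iff_ultrafilter _ _ _).mpr fun u hu => ?_
    obtain ⟨g, hg⟩ := exists_right_inverse_exp (closure Ω)
    have hu2 : ∀ᶠ p in (u : Filter ℂ), g p ∈ closure Ω ∧ exp (g p) = p := by
      filter_upwards [hu self_mem_nhdsWithin] with p hp
      exact hg p ((closure_exp_image h.subset hp.2).mp hp.1)
    obtain ⟨l, h1, h2, h3⟩ := exp_image_closure h.subset hz0 (hu.trans nhdsWithin_le_nhds) hu2
    show Tendsto _ _ (𝓝 (Φ (log z))); rw [← h2, log_eq_of_exp_image hb1 h hΦ.eq_zero h1]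
    refine ((hΦ.continuousOn l h1).tendsto.comp (tendsto_nhdsWithin_iff.mpr ⟨h3, hu2.mono fun p hp
      => hp.1⟩)).congr' ?_
    filter_upwards [hu2] with p hp
    rw [comp_apply, ← log_eq_of_exp_image hb1 h hΦ.eq_zero hp.1, hp.2]
  eq_zero := fun z hz hz0 => by
    obtain ⟨l, hl, rfl⟩ := (mem_frontier_exp_image hb1 h.isOpen h.subset hz0).mp hz
    rw [log_eq_of_exp_image hb1 h hΦ.eq_zero (frontier_subset_closure hl)]; exact hΦ.eq_zero l hl
  near_vertex := by
    refine (hΦ.near_vertex.comp_tendsto (tendsto_log_nhdsWithin_zero hb1 h.subset)).congr_right ?_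
    filter_upwards [self_mem_nhdsWithin] with z hz; obtain ⟨l, hl, rfl⟩ := hz
    rw [comp_apply, cpow_def_of_ne_zero (exp_ne_zero _)]; congr 3; ring

theorem log_mem_logSector {ζ : ℂ} (h : ζ ∈ openSector b) : log ζ ∈ logSector b :=
  ⟨by rw [log_re]; exact Real.log_neg (norm_pos_iff.mpr h.1) h.2.1, by rw [log_im]; exact h.2.2⟩

theorem exp_mem_openSector (hb1 : b ≤ 1) (h : l ∈ logSector b) :
    exp l ∈ openSector b :=
  ⟨exp_ne_zero _, by simpa [norm_exp] using h.1, (exp_mem_openAngle hb1 h.2).2⟩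

include hb

/-- The image of the sector under the map `r f`. -/
theorem image_wedgeMap (hb1 : b ≤ 1) {r : ℝ} (hr : 0 < r) :
    (fun ζ => (r : ℂ) * wedgeMap b ζ) '' openSector b =
      exp '' (scaledMap b (Real.log r) '' logSector b) := by
  have key : ∀ l ∈ logSector b, exp (scaledMap b (Real.log r) l) = r * wedgeMap b (exp l) := by
    intro l hl
    have h1 : exp l ^ (1 / b : ℂ) = exp (l / b) := by
      rw [cpow_def_of_ne_zero (exp_ne_zero _), log_exp_of_mem hb1 hl.2, mul_one_div]
    rw [scaledMap, exp_add, exp_logWedgeMap hb (subset_closedLogSector b hl),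
      ← ofReal_exp, Real.exp_log hr, wedgeMap, h1, mul_comm]
  rw [image_image]; ext p; constructor
  · rintro ⟨ζ, h, rfl⟩; refine ⟨log ζ, log_mem_logSector h, ?_⟩; show exp _ = (r : ℂ) * wedgeMap b ζ
    rw [key _ (log_mem_logSector h), exp_log h.1]
  · rintro ⟨l, hl, rfl⟩; exact ⟨exp l, exp_mem_openSector hb1 hl, (key l hl).symm⟩

theorem solvesKillingProblem_image (hb1 : b ≤ 1) (μ : ℝ) :
    SolvesKillingProblem b (exp '' (scaledMap b μ '' logSector b)) := by
  have hR := isLogWedgeRegion_image hb μ; obtain ⟨c, hc⟩ := normal_velocity_image hb μ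
  refine ⟨_, _, c, isWedgeRegion_exp hb hb1 hR, isWedgePotential_exp hb1 hR
    (isLogWedgePotential_image hb μ), fun t ht => ?_⟩
  have hm := arcParam_mem_cornerless hb ht; have hne := deriv_logExt_ne_zero hb hm
  have hγ := hR.mapsTo ht; have hlog := log_exp_of_mem hb1 hγ
  have hs : exp (arcCurve b μ t) ∈ slitPlane :=
    openAngle_subset_slitPlane hb1 (exp_mem_openAngle hb1 hγ)
  have hlog' : HasDerivAt log (exp (arcCurve b μ t))⁻¹ (exp (arcCurve b μ t)) := hasDerivAt_log hs
  obtain ⟨_, hE, hd⟩ : ‖exp (arcCurve b μ t)‖ ≠ 0 ∧ exp (arcCurve b μ t) ≠ 0 ∧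
      ‖deriv (logExt b) (arcParam b t)‖ ≠ 0 :=
    ⟨norm_ne_zero_iff.mpr (exp_ne_zero _), exp_ne_zero _, norm_ne_zero_iff.mpr hne⟩
  have hν := hc t ht; obtain ⟨hν0, hν1, _⟩ := isOutwardUnitNormal_image hb μ ht
  obtain ⟨H, g1, g2, g3⟩ := exists_defining_function hb μ ht
  obtain ⟨F, _, h2, h3⟩ := exists_analytic_imagePotential hb μ hm
  have huniq := uniqueDiffWithinAt_image_logSector hb μ hm
  rw [fderivWithin_re_apply (z := arcCurve b μ t) h2 (h3.filter_mono (nhdsWithin_mono _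
    (image_union_arc_subset hb μ))) (Or.inr ⟨t, ht, rfl⟩) (huniq.mono subset_union_left)] at hν
  have hcurve := hasDerivAt_arcCurve hb μ ht; set E := exp (arcCurve b μ t) with hEdef
  set d := deriv (logExt b) (arcParam b t) with hddef
  -- The normal in the plane is the normal in the logarithmic coordinate, rotated by the argument of
  -- the derivative `E` of `exp`.
  refine ⟨E / ‖E‖ * (d / ‖d‖), ⟨?_, ?_, ?_⟩, ?_⟩
  · rw [norm_mul, norm_div_norm_self hE, hν0, one_mul]
  · rw [hcurve.cexp.deriv, inner_eq_re_conj_mul, map_mul, ← hEdef]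
    rw [inner_eq_re_conj_mul, hcurve.deriv] at hν1
    rw [show ∀ x y : ℂ, conj E * x * (E / ‖E‖ * y) = (conj E * E / ‖E‖) * (x * y) from fun x y => by
        ring, conj_mul', sq, mul_div_assoc, div_self (ofReal_ne_zero.mpr (norm_ne_zero_iff.mpr hE)),
        mul_one, re_ofReal_mul,
      hν1, mul_zero]
  · have hHlog : HasDerivAt (fun z => H (log z)) (d⁻¹ * E⁻¹) E := by
      refine HasDerivAt.comp E ?_ hlog'; grind
    refine eventually_sub_mem_add_notMem (R := fun z => (H (log z)).re) (m := (‖E‖⁻¹ * ‖d‖⁻¹)) ?_ ?_ ?_ ?_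
    · positivity
    · convert! hasDerivAt_re_comp_line hHlog (n := E / ‖E‖ * (d / ‖d‖)) using 1
      have : d⁻¹ * E⁻¹ * (E / ‖E‖ * (d / ‖d‖)) = ((‖E‖⁻¹ * ‖d‖⁻¹ : ℝ) : ℂ) := by
        push_cast; field_simp
      rw [this, ofReal_re]
    · grind
    · have hcont : Tendsto log (𝓝 E) (𝓝 (arcCurve b μ t)) := by
        have := hlog'.continuousAt.tendsto; rwa [hlog] at this
      filter_upwards [hcont.eventually g3, isOpen_slitPlane.mem_nhds hs] with p hp hps
      refine ⟨fun h => ⟨_, hp.1 h, exp_log (slitPlane_ne_zero hps)⟩, fun h => hp.2 ?_⟩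
      obtain ⟨q, hq, rfl⟩ := h; rwa [log_exp_of_mem hb1 (hR.subset hq)]
  · have h2' : HasDerivAt F (-(rexp (-μ / (2 * b)) : ℂ) *
        (deriv (modelMap b) (arcParam b t) * d⁻¹)) (log E) := by
      rw [hlog]; exact h2
    have hset : exp '' (scaledMap b μ '' logSector b) ∪ (fun t => exp (arcCurve b μ t)) '' Ioo 0 1 =
        exp '' (scaledMap b μ '' logSector b ∪ arcCurve b μ '' Ioo 0 1) := by grind
    have hmem : E ∈ exp '' (scaledMap b μ '' logSector b ∪ arcCurve b μ '' Ioo 0 1) :=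
      ⟨_, Or.inr ⟨t, ht, rfl⟩, rfl⟩
    rw [hset, fderivWithin_re_apply (f := fun z => imagePotential b μ (log z)) (HasDerivAt.comp E
      h2' hlog') ?_ hmem ?_,
      ← hν, ← re_ofReal_mul, ofReal_inv]
    · grind
    · have hcont : Tendsto log (𝓝[exp '' (scaledMap b μ '' logSector b ∪ arcCurve b μ '' Ioo 0 1)] E)
          (𝓝[scaledMap b μ '' logSector b ∪ arcCurve b μ '' Ioo 0 1] (arcCurve b μ t)) := by
        refine tendsto_nhdsWithin_iff.mpr ⟨?_, ?_⟩
        · have := hlog'.continuousAt.tendsto; rw [hlog] at this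
          exact this.mono_left nhdsWithin_le_nhds
        · filter_upwards [self_mem_nhdsWithin] with p hp; obtain ⟨q, hq, rfl⟩ := hp
          rw [log_exp_of_mem hb1]
          · exact hq
          · rcases hq with hq | ⟨s, hs, rfl⟩
            · exact hR.subset hq
            · exact hR.mapsTo hs
      exact hcont.eventually (h3.filter_mono (nhdsWithin_mono _ (image_union_arc_subset hb μ)))
    · refine (((hasDerivAt_exp (arcCurve b μ t)).hasFDerivAt.restrictScalars
        ℝ).hasFDerivWithinAt.uniqueDiffWithinAt (huniq.mono subset_union_left) ?_)
      apply Function.Surjective.denseRange; intro y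
      exact ⟨y / E, by simpa using div_mul_cancel₀ y hE⟩

/-! ### The differential equation in the plane -/

theorem satisfiesWedgeODE_wedgeMap (hb1 : b ≤ 1) :
    SatisfiesWedgeODE b (wedgeMap b) := by
  have hpow : ∀ ζ ≠ 0, ζ ^ (1 / b : ℂ) = exp (log ζ / b) := fun ζ h => by
    rw [cpow_def_of_ne_zero h, mul_one_div]
  have hsub : ∀ ζ ∈ openSector b, ζ ≠ 0 ∧ log ζ ∈ logSector b ∧ ζ ∈ slitPlane := fun ζ h =>
    ⟨h.1, log_mem_logSector h, openAngle_subset_slitPlane hb1 ⟨h.1, h.2.2⟩⟩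
  have hev : ∀ ζ ∈ openSector b, ∀ᶠ z in 𝓝 ζ, z ∈ openSector b := fun ζ h => by
    have hc : Tendsto log (𝓝 ζ) (𝓝 (log ζ)) := (continuousAt_clog (hsub ζ h).2.2).tendsto
    filter_upwards [hc.eventually_mem ((isOpen_logSector b).mem_nhds (hsub ζ h).2.1),
      isOpen_slitPlane.mem_nhds (hsub ζ h).2.2] with z hz hzs
    rw [← exp_log (slitPlane_ne_zero hzs)]; exact exp_mem_openSector hb1 hz
  set G : ℂ → ℂ := fun l => exp l * hypFactor b (exp (l / b)) with hG
  have hGd : DifferentiableOn ℂ G (logSector b) := by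
    exact differentiable_exp.differentiableOn.mul ((differentiableOn_hypFactor hb).comp (fun l _ =>
      (differentiableAt_id.div_const (b : ℂ)).cexp.differentiableWithinAt)
      fun l h => exp_div_mem_ball hb h)
  have hcomp : ∀ (f K : ℂ → ℂ), DifferentiableOn ℂ K (logSector b) →
      (∀ ζ ∈ openSector b, f ζ = K (log ζ)) → ∀ ζ ∈ openSector b, eulerD f ζ = deriv K (log ζ) := by
    intro f K hK hf ζ h
    have h1 : HasDerivAt (fun z => K (log z)) (deriv K (log ζ) * ζ⁻¹) ζ :=
      HasDerivAt.comp ζ (hK.differentiableAt ((isOpen_logSector b).mem_nhds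
        (hsub ζ h).2.1)).hasDerivAt (hasDerivAt_log (hsub ζ h).2.2)
    have h2 : f =ᶠ[𝓝 ζ] fun z => K (log z) := (hev ζ h).mono fun z hz => hf z hz
    have h0 := (hsub ζ h).1; rw [eulerD, h2.deriv_eq, h1.deriv]; field_simp
  have e0 : ∀ ζ ∈ openSector b, wedgeMap b ζ = G (log ζ) := fun ζ h => by
    simp only [wedgeMap, hpow ζ h.1, hG, exp_log h.1]
  have e1 := hcomp _ _ hGd e0; intro ζ h
  rw [(hcomp _ _ (hGd.deriv (isOpen_logSector b)) e1) ζ h, e1 ζ h, e0 ζ h, hpow ζ h.1]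
  exact satisfiesLogWedgeODE_hypFactor hb _ (hsub ζ h).2.1

omit hb

/-! ### Injective holomorphic functions -/

theorem deriv_ne_zero_of_injOn {f : ℂ → ℂ} {U : Set ℂ} (hU : IsOpen U)
    (hf : DifferentiableOn ℂ f U) (hi : InjOn f U) {z : ℂ} (hz : z ∈ U) : deriv f z ≠ 0 := by
  intro h0; have hn := hU.mem_nhds hz
  have hnc : ¬ ∀ᶠ w in 𝓝 z, f w = f z := by
    intro h
    have h1 : ∀ᶠ w in 𝓝[≠] z, w ∈ U ∧ f w = f z ∧ w ≠ z := by
      filter_upwards [nhdsWithin_le_nhds hn, nhdsWithin_le_nhds h, self_mem_nhdsWithin]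
        with w h1 h2 h3
      exact ⟨h1, h2, h3⟩
    obtain ⟨w, h1, h2, h3⟩ := h1.exists; exact h3 (hi h1 hz h2)
  obtain ⟨w, z1, h1, z2, h2, h3, h4, h5⟩ :=
    (eventually_exists_two_preimages (hf.analyticAt hn) h0 hnc hn).exists
  exact h3 (hi h1 h2 (h4.trans h5.symm))

theorem differentiableOn_leftInvOn {f g : ℂ → ℂ} {U : Set ℂ} (hU : IsOpen U)
    (hf : DifferentiableOn ℂ f U) (hg : ∀ z ∈ U, g (f z) = z) : DifferentiableOn ℂ g (f '' U) := by
  rintro _ ⟨z, hz, rfl⟩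
  obtain ⟨H, h1, h2, _, _, h3⟩ := (hf.analyticAt (hU.mem_nhds hz)).exists_local_inverse
    (deriv_ne_zero_of_injOn hU hf (fun p hp q hq h => by grind) hz)
  refine DifferentiableAt.differentiableWithinAt (h1.differentiableAt.congr_of_eventuallyEq ?_)
  have h4 : ∀ᶠ w in 𝓝 (f z), H w ∈ U := by
    refine h1.continuousAt.tendsto.eventually_mem ?_; rw [h2]; exact hU.mem_nhds hz
  filter_upwards [h3, h4] with w h5 h6; rw [← hg _ h6, h5]

/-! ### Automorphisms of the right half-plane -/

theorem norm_add_conj_sq_sub (a b : ℂ) : ‖a + conj b‖ ^ 2 - ‖a - b‖ ^ 2 = 4 * a.re * b.re := by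
  rw [Complex.sq_norm, Complex.sq_norm, normSq_apply, normSq_apply]; simp; ring

theorem add_conj_ne_zero {a b : ℂ} (ha : 0 < a.re) (hb : 0 < b.re) : a + conj b ≠ 0 := fun h => by
  have := congrArg re h; simp at this; linarith

/-- The Schwarz–Pick lemma for the right half-plane. -/
theorem schwarz_pick_halfPlane {T : ℂ → ℂ} (hT : DifferentiableOn ℂ T {W | 0 < W.re})
    (hm : ∀ W : ℂ, 0 < W.re → 0 < (T W).re) {V W : ℂ} (hV : 0 < V.re) (hW : 0 < W.re) :
    V.re * W.re / ‖V + conj W‖ ^ 2 ≤ (T V).re * (T W).re / ‖T V + conj (T W)‖ ^ 2 := by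
  -- The Cayley map of the disk onto the half-plane with `A 0 = W`; further down `A z0 = V`. The
  -- classical Schwarz lemma then applies to `g`, which vanishes at `0`.
  set A : ℂ → ℂ := fun z => (W + z * conj W) / (1 - z) with hA
  have h1z : ∀ z ∈ ball (0 : ℂ) 1, 1 - z ≠ 0 := fun z hz h => by
    rw [sub_eq_zero] at h; rw [← h] at hz; simp at hz
  have hAre : ∀ z ∈ ball (0 : ℂ) 1, 0 < (A z).re := by
    intro z hz; have h1 : ‖z‖ < 1 := mem_ball_zero_iff.mp hz
    have h2 : (A z).re = W.re * (1 - ‖z‖ ^ 2) / normSq (1 - z) := by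
      rw [hA, Complex.sq_norm]; simp only [div_re, normSq_apply]; simp; ring
    simp_all
  set g : ℂ → ℂ := fun z => (T (A z) - T W) / (T (A z) + conj (T W)) with hg
  have hTA : DifferentiableOn ℂ (fun z => T (A z)) (ball 0 1) := hT.comp (by fun_prop) hAre
  have hgd : DifferentiableOn ℂ g (ball 0 1) :=
    (hTA.sub_const _).div (hTA.add_const _) fun z hz =>
      add_conj_ne_zero (hm _ (hAre z hz)) (hm W hW)
  have hmaps : MapsTo g (ball 0 1) (closedBall 0 1) := by
    intro z hz
    rw [mem_closedBall_zero_iff, hg, norm_div, div_le_one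
      (norm_pos_iff.mpr (add_conj_ne_zero (hm _ (hAre z hz)) (hm W hW)))]
    have := norm_add_conj_sq_sub (T (A z)) (T W); have h2 := mul_pos (hm _ (hAre z hz)) (hm W hW)
    exact (sq_le_sq₀ (norm_nonneg _) (norm_nonneg _)).mp (by nlinarith)
  have hne := add_conj_ne_zero hV hW; have hn : 0 < ‖V + conj W‖ := norm_pos_iff.mpr hne
  have hn' : 0 < ‖T V + conj (T W)‖ := norm_pos_iff.mpr (add_conj_ne_zero (hm V hV) (hm W hW))
  have e1 := norm_add_conj_sq_sub V W; have e2 := norm_add_conj_sq_sub (T V) (T W)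
  have p1 := mul_pos hV hW; set z0 := (V - W) / (V + conj W) with hz0
  have hz0n : ‖z0‖ < 1 := by
    rw [hz0, norm_div, div_lt_one hn]
    exact (sq_lt_sq₀ (norm_nonneg _) hn.le).mp (by nlinarith)
  have hAz : A z0 = V := by grind
  have key := norm_le_norm_of_mapsTo_ball hgd hmaps (by simp [hg, hA]) hz0n
  rw [hg] at key; simp only [hAz] at key; rw [hz0, norm_div, norm_div] at key
  have key2 := pow_le_pow_left₀ (by positivity) key 2
  rw [div_pow, div_pow] at key2
  have f1 : V.re * W.re / ‖V + conj W‖ ^ 2 = (1 - ‖V - W‖ ^ 2 / ‖V + conj W‖ ^ 2) / 4 := by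
    field_simp; linarith
  have f2 : (T V).re * (T W).re / ‖T V + conj (T W)‖ ^ 2 =
      (1 - ‖T V - T W‖ ^ 2 / ‖T V + conj (T W)‖ ^ 2) / 4 := by
    field_simp; linarith
  rw [f1, f2]; linarith

/-- Schwarz–Pick for `T` and for its left inverse gives equality. Taking one point to be `x → +∞`
and multiplying by `x`, the left side tends to `Re W` and the right side to `κ Re (T W) / κ²`. -/
theorem re_eq_mul_re_of_automorphism {T S : ℂ → ℂ} (hT : DifferentiableOn ℂ T {W | 0 < W.re})
    (hTm : ∀ W : ℂ, 0 < W.re → 0 < (T W).re) (hS : DifferentiableOn ℂ S {W | 0 < W.re})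
    (hSm : ∀ W : ℂ, 0 < W.re → 0 < (S W).re) (hST : ∀ W : ℂ, 0 < W.re → S (T W) = W)
    {κ : ℝ} (hκ : 0 < κ) (hlim : Tendsto (fun x : ℝ => T x / x) atTop (𝓝 (κ : ℂ)))
    {W : ℂ} (hW : 0 < W.re) : (T W).re = κ * W.re := by
  have heq : ∀ᶠ x : ℝ in atTop, W.re / ‖1 + conj W / x‖ ^ 2 =
      (T x / x).re * (T W).re / ‖T x / x + conj (T W) / x‖ ^ 2 := by
    filter_upwards [eventually_gt_atTop 0] with x hx
    have hx' : 0 < (x : ℂ).re := by simpa using hx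
    have hx0 : (x : ℂ) ≠ 0 := ofReal_ne_zero.mpr hx.ne'
    have h2 := schwarz_pick_halfPlane hS hSm (hTm _ hx') (hTm _ hW); rw [hST _ hx', hST _ hW] at h2
    have h3 := le_antisymm (schwarz_pick_halfPlane hT hTm hx' hW) h2
    have e1 : (1 : ℂ) + conj W / x = (x + conj W) / x := by field_simp
    have e2 : T x / x + conj (T W) / x = (T x + conj (T W)) / x := by rw [add_div]
    have n1 : 0 < ‖(x : ℂ) + conj W‖ := norm_pos_iff.mpr (add_conj_ne_zero hx' hW)
    have n2 : 0 < ‖T x + conj (T W)‖ := norm_pos_iff.mpr (add_conj_ne_zero (hTm _ hx') (hTm _ hW))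
    rw [e1, e2, norm_div, norm_div, norm_real, norm_eq_abs, abs_of_pos hx, div_ofReal_re]
    rw [ofReal_re] at h3; grind
  have hinv : ∀ c : ℂ, Tendsto (fun x : ℝ => c / (x : ℂ)) atTop (𝓝 0) := fun c => by
    have h1 : Tendsto (fun x : ℝ => ((x⁻¹ : ℝ) : ℂ)) atTop (𝓝 ((0 : ℝ) : ℂ)) :=
      (continuous_ofReal.tendsto 0).comp tendsto_inv_atTop_zero
    have h2 := h1.const_mul c; rw [ofReal_zero, mul_zero] at h2; refine h2.congr fun x => ?_
    rw [ofReal_inv, div_eq_mul_inv]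
  have hl : Tendsto (fun x : ℝ => W.re / ‖1 + conj W / x‖ ^ 2) atTop
      (𝓝 (W.re / ‖(1 : ℂ) + 0‖ ^ 2)) :=
    tendsto_const_nhds.div ((tendsto_const_nhds.add (hinv _)).norm.pow 2) (by simp)
  have := tendsto_nhds_unique (hl.congr' heq) ((((continuous_re.tendsto _).comp hlim).mul_const
    _).div ((hlim.add (hinv _)).norm.pow 2) (by simp [hκ.ne']))
  rw [add_zero, add_zero, norm_one, one_pow, div_one, ofReal_re, norm_real, norm_eq_abs,
    sq_abs] at this
  rw [this]; field_simp

theorem isOpen_halfPlane : IsOpen {W : ℂ | 0 < W.re} := isOpen_lt continuous_const continuous_re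

theorem convex_halfPlane : Convex ℝ {W : ℂ | 0 < W.re} := convex_halfSpace_re_gt 0

theorem exists_eq_add_mul_I_of_re_eq {T : ℂ → ℂ} (hT : DifferentiableOn ℂ T {W | 0 < W.re}) {κ : ℝ}
    (hre : ∀ W : ℂ, 0 < W.re → (T W).re = κ * W.re) :
    ∃ τ : ℝ, ∀ W : ℂ, 0 < W.re → T W = κ * W + τ * I := by
  have hd : DifferentiableOn ℂ (fun W => T W - κ * W) {W | 0 < W.re} :=
    hT.sub (differentiableOn_id.const_mul _)
  have h0 : ∀ W : ℂ, 0 < W.re → (T W - κ * W).re = 0 := fun W hW => by simp_all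
  rcases (hd.analyticOnNhd isOpen_halfPlane).is_constant_or_isOpen
    convex_halfPlane.isPreconnected with ⟨w, hw⟩ | h
  · refine ⟨w.im, fun W hW => ?_⟩; have h2 := h0 W hW; rw [hw W hW] at h2
    have h3 : w = w.im * I := by apply Complex.ext <;> simp [h2]
    grind
  · have h2 : (1 : ℂ) ∈ {W : ℂ | 0 < W.re} := by simp
    obtain ⟨ε, hε, hball⟩ := Metric.isOpen_iff.mp (h _ Subset.rfl isOpen_halfPlane) _ ⟨1, h2, rfl⟩
    have h3 : T 1 - κ * 1 + ((ε / 2 : ℝ) : ℂ) ∈ ball (T 1 - κ * 1) ε := by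
      rw [mem_ball_iff_norm, add_sub_cancel_left, norm_real, norm_eq_abs, abs_of_pos (half_pos hε)]
      exact half_lt_self hε
    obtain ⟨W, hW, hW2⟩ := hball h3; have h4 := congrArg re hW2
    rw [h0 W hW, add_re, h0 1 h2, ofReal_re] at h4; linarith

/-! ### Conformal maps of the sector onto the image -/

theorem modelMap_eq_mul (b : ℝ) (l : ℂ) :
    modelMap b l = exp (-l / (2 * b)) * (1 - exp (l / b)) := by
  rw [modelMap, mul_sub, mul_one, ← exp_add]; congr 2; ring

include hb

theorem modelInv_ofReal {x : ℝ} (hx : 0 ≤ x) :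
    modelInv b x = ((modelInv b x).re : ℂ) := by
  obtain ⟨h1, h2⟩ := modelInv_mem hb (W := x) (by simpa using hx)
  have h3 : conj (modelInv b x) = modelInv b x := by
    refine injOn_modelMap hb (conj_mem_closedLogSector.mpr h1) h1 ?_
    rw [modelMap_conj, h2, conj_ofReal]
  exact (conj_eq_iff_real.mp h3).choose_spec.trans (by
    conv_rhs => rw [(conj_eq_iff_real.mp h3).choose_spec]
    rw [ofReal_re])

theorem tendsto_re_modelInv :
    Tendsto (fun x : ℝ => (modelInv b x).re) atTop atBot := by
  have h1 : Tendsto (fun x : ℝ => -(2 * b) * Real.log x) atTop atBot :=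
    Real.tendsto_log_atTop.const_mul_atTop_of_neg (by linarith)
  refine tendsto_atBot_mono' _ ?_ h1; filter_upwards [eventually_gt_atTop 0] with x hx
  obtain ⟨h2, h3⟩ := modelInv_mem hb (W := x) (by simpa using hx.le)
  rw [modelInv_ofReal hb hx.le] at h3; have h4 := congrArg re h3
  rw [modelMap_re, ofReal_re, ofReal_im, zero_div, Real.cos_zero, mul_one, ofReal_re] at h4
  have h5 : x ≤ rexp (-((modelInv b x).re / (2 * b))) := by
    linarith [exp_pos ((modelInv b x).re / (2 * b))]
  have h6 := (Real.log_le_iff_le_exp hx).mpr h5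
  have h8 : (modelInv b x).re = 2 * b * ((modelInv b x).re / (2 * b)) := by field_simp
  rw [h8]; nlinarith

theorem tendsto_scaledLogInv_comp {ψ : ℝ → ℂ} {ν : ℂ}
    (hψ : ∀ᶠ x : ℝ in atBot, ψ x ∈ scaledMap b μ '' logSector b)
    (hlim : Tendsto (fun x : ℝ => ψ x - x) atBot (𝓝 ν)) :
    Tendsto (fun x : ℝ => (scaledLogInv b μ (ψ x)).re) atBot atBot ∧
    Tendsto (fun x : ℝ => scaledLogInv b μ (ψ x) - x) atBot (𝓝 (ν - μ)) := by
  obtain ⟨C, hC⟩ := exists_norm_scaledMap_sub_self_le hb μ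
  have h1 : Tendsto (fun x : ℝ => (scaledLogInv b μ (ψ x)).re) atBot atBot := by
    refine tendsto_atBot_mono' _ ?_ (tendsto_atBot_add_const_right atBot (‖ν‖ + 1 + C) tendsto_id)
    filter_upwards [hψ, hlim.norm.eventually_lt_const (lt_add_one _)] with x hx h2
    obtain ⟨l, hl, hx⟩ := hx; have h3 := subset_closedLogSector b hl; rw [← hx] at h2 ⊢
    rw [scaledLogInv_map hb μ h3]; have h4 := (re_le_norm _).trans h2.le
    have h5 := (neg_le_abs _).trans ((abs_re_le_norm _).trans (hC l h3))
    rw [sub_re, ofReal_re] at h4; rw [sub_re] at h5; grind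
  refine ⟨h1, ?_⟩
  have h4 := hlim.sub (((tendsto_logWedgeMap_sub_self hb).comp (tendsto_comap_iff.mpr
    h1)).add_const (μ : ℂ))
  rw [zero_add] at h4; refine h4.congr' ?_; filter_upwards [hψ] with x hx; obtain ⟨l, hl, hx⟩ := hx
  rw [comp_apply, ← hx, scaledLogInv_map hb μ (subset_closedLogSector b hl), scaledMap]; ring

theorem tendsto_modelMap_div {q : ℝ → ℂ} {ν : ℂ}
    (hq : Tendsto (fun x => (q x).re) atBot atBot)
    (hlim : Tendsto (fun x : ℝ => q x - x) atBot (𝓝 ν)) :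
    Tendsto (fun x : ℝ => modelMap b (q x) / modelMap b x) atBot (𝓝 (exp (-ν / (2 * b)))) := by
  have e2 : Tendsto (fun x : ℝ => exp ((x : ℂ) / b)) atBot (𝓝 0) :=
    (tendsto_exp_div_comap_atBot hb).comp (tendsto_comap_iff.mpr tendsto_id)
  have e3 : Tendsto (fun x : ℝ => exp (-(q x - x) / (2 * b))) atBot (𝓝 (exp (-ν / (2 * b)))) :=
    (continuous_exp.tendsto _).comp (hlim.neg.div_const _)
  have e4 := e3.mul ((tendsto_const_nhds (x := (1 : ℂ))).sub ((tendsto_exp_div_comap_atBot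
    hb).comp (tendsto_comap_iff.mpr hq)) |>.div
    ((tendsto_const_nhds (x := (1 : ℂ))).sub e2) (by simp))
  rw [sub_zero, div_one, mul_one] at e4; refine e4.congr fun x => ?_
  rw [modelMap_eq_mul, modelMap_eq_mul, Pi.div_apply, mul_div_mul_comm, ← exp_sub]; congr 2; ring

/-- Conjugation by the model map gives an automorphism of the right half-plane. The behaviour at the
vertex says that it is asymptotic to a positive multiple of `x` along the real axis, hence it is
affine with a purely imaginary translation. -/
theorem exists_modelMap_eq_of_conformal {ψ : ℂ → ℂ}
    (hd : DifferentiableOn ℂ ψ (logSector b))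
    (hψ : BijOn ψ (logSector b) (scaledMap b μ '' logSector b)) {ν : ℝ}
    (hlim : Tendsto (fun x : ℝ => ψ x - x) atBot (𝓝 (ν : ℂ))) :
    ∃ κ : ℝ, 0 < κ ∧ ∃ τ : ℝ, ∀ l ∈ logSector b,
      modelMap b (scaledLogInv b μ (ψ l)) = κ * modelMap b l + τ * I := by
  have hsub := subset_closedLogSector b
  have hinv : ∀ p ∈ scaledMap b μ '' logSector b, scaledLogInv b μ p ∈ logSector b := by
    rintro _ ⟨l, hl, rfl⟩; rwa [scaledLogInv_map hb μ (hsub hl)]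
  have hmd : DifferentiableOn ℂ (modelInv b) {W | 0 < W.re} := fun W hW =>
    (differentiableAt_modelInv hb hW).differentiableWithinAt
  have hmm : MapsTo (modelInv b) {W | 0 < W.re} (logSector b) := fun W hW =>
    modelInv_mem_logSector hb hW
  set T : ℂ → ℂ := fun W => modelMap b (scaledLogInv b μ (ψ (modelInv b W))) with hT
  set S : ℂ → ℂ := fun W => modelMap b (invFunOn ψ (logSector b)
    (scaledMap b μ (modelInv b W))) with hS
  have hψinv : ∀ l ∈ logSector b, invFunOn ψ (logSector b) (ψ l) = l := fun l hl =>
    hψ.injOn (invFunOn_mem ⟨l, hl, rfl⟩) hl (invFunOn_eq ⟨l, hl, rfl⟩)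
  have hTd : DifferentiableOn ℂ T {W | 0 < W.re} := by
    exact (differentiable_modelMap b).comp_differentiableOn
      (((differentiableOn_leftInvOn (isOpen_logSector b) (differentiableOn_scaledMap hb μ) (fun l hl
        => scaledLogInv_map hb μ (hsub hl))).comp hd hψ.mapsTo).comp hmd hmm)
  have hSd : DifferentiableOn ℂ S {W | 0 < W.re} := by
    have h1 := differentiableOn_leftInvOn (isOpen_logSector b) hd hψinv; rw [hψ.image_eq] at h1
    exact (differentiable_modelMap b).comp_differentiableOn
      ((h1.comp (differentiableOn_scaledMap hb μ) fun l hl => ⟨l, hl, rfl⟩).comp hmd hmm)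
  have hST : ∀ W : ℂ, 0 < W.re → S (T W) = W := by
    intro W hW; obtain ⟨q, hq, hqe⟩ := hψ.mapsTo (hmm hW); simp only [hT, hS]
    rw [← hqe, scaledLogInv_map hb μ (hsub hq), modelInv_map hb (hsub hq), hqe, hψinv _ (hmm hW),
      (modelInv_mem hb (show 0 ≤ W.re from le_of_lt hW)).2]
  have hreal : ∀ x : ℝ, x < 0 → (x : ℂ) ∈ logSector b := fun x hx =>
    ⟨by simpa using hx, by rw [ofReal_im, abs_zero]; positivity⟩
  have hTlim : Tendsto (fun x : ℝ => T x / x) atTop (𝓝 ((rexp (-(ν - μ) / (2 * b)) : ℝ) : ℂ)) := by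
    obtain ⟨l1, l2⟩ := tendsto_scaledLogInv_comp hb μ
      ((eventually_lt_atBot 0).mono fun x hx => hψ.mapsTo (hreal x hx)) hlim
    have l3 := (tendsto_modelMap_div hb l1 l2).comp (tendsto_re_modelInv hb)
    have e : exp (-((ν : ℂ) - μ) / (2 * b)) = ((rexp (-(ν - μ) / (2 * b)) : ℝ) : ℂ) := by
      push_cast
      rfl
    rw [e] at l3; refine l3.congr' ?_; filter_upwards [eventually_ge_atTop 0] with x hx
    rw [comp_apply, ← modelInv_ofReal hb hx, (modelInv_mem hb (W := x) (by simpa using hx)).2]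
  obtain ⟨τ, hτ⟩ := exists_eq_add_mul_I_of_re_eq hTd fun W hW =>
    re_eq_mul_re_of_automorphism hTd (fun W hW => re_modelMap_pos hb (hinv _ (hψ.mapsTo (hmm hW))))
      hSd (fun W hW => re_modelMap_pos hb ((fun p hp => invFunOn_mem (hψ.surjOn hp)) _ ⟨_, hmm hW,
        rfl⟩)) hST (exp_pos _) hTlim hW
  refine ⟨rexp (-(ν - μ) / (2 * b)), exp_pos _, τ, fun l hl => ?_⟩
  have := hτ _ (re_modelMap_pos hb hl); simp only [hT] at this
  rwa [modelInv_map hb (hsub hl)] at this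

/-- The value of the model map on the sides of the sector. -/
theorem modelMap_side {σ : ℝ} (hσ : σ = 1 ∨ σ = -1) (h : l.im = σ * (π * b)) : modelMap b l =
      -(σ * (rexp (-(l.re / (2 * b))) + rexp (l.re / (2 * b))) : ℝ) * I := by
  have hb' : (b : ℂ) ≠ 0 := ofReal_ne_zero.mpr hb.ne'
  have h2 : l / (2 * b) = ((l.re / (2 * b) : ℝ) : ℂ) + (σ : ℂ) * (π / 2 * I) := by
    conv_lhs => rw [← re_add_im l, h]
    push_cast; field_simp
  have h3 : exp ((σ : ℂ) * (π / 2 * I)) = σ * I := by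
    rcases hσ with rfl | rfl
    · simp
    · rw [ofReal_neg, ofReal_one, neg_one_mul, exp_neg, exp_pi_div_two_mul_I, inv_I, neg_one_mul]
  have h4 : exp (-((σ : ℂ) * (π / 2 * I))) = -(σ * I) := by
    rw [exp_neg, h3]
    rcases hσ with rfl | rfl <;> simp
  rw [modelMap, neg_div, h2, neg_add, exp_add, exp_add, h3, h4]; push_cast; ring

omit hb in
theorem two_le_exp_neg_add_exp (x : ℝ) : 2 ≤ rexp (-x) + rexp x := by
  have h1 := add_one_le_exp x; have h2 := add_one_le_exp (-x); linarith

theorem exists_side_point {σ : ℝ} (hσ : σ = 1 ∨ σ = -1) {s : ℝ}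
    (hs : 2 ≤ s) : ∃ l : ℂ, l.re ≤ 0 ∧ l.im = σ * (π * b) ∧ modelMap b l = -(σ * s : ℝ) * I := by
  have hsq : 0 ≤ s ^ 2 - 4 := by nlinarith
  set y := (s + Real.sqrt (s ^ 2 - 4)) / 2 with hy; have hr := Real.sq_sqrt hsq
  have hr0 := Real.sqrt_nonneg (s ^ 2 - 4)
  have hy1 : 1 ≤ y := by rw [hy]; linarith
  have hysum : y + y⁻¹ = s := by grind
  refine ⟨((-(2 * b * Real.log y) : ℝ) : ℂ) + ((σ * (π * b) : ℝ) : ℂ) * I, ?_, ?_, ?_⟩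
  · rw [add_re, ofReal_re, re_ofReal_mul, I_re, mul_zero, add_zero]; have := log_nonneg hy1
    simp_all
  · simp
  · rw [modelMap_side hb hσ (by simp)]
    have : (((-(2 * b * Real.log y) : ℝ) : ℂ) + ((σ * (π * b) : ℝ) : ℂ) * I).re / (2 * b) =
        -Real.log y := by
      rw [add_re, ofReal_re, re_ofReal_mul, I_re, mul_zero, add_zero]; field_simp
    rw [this, neg_neg, Real.exp_neg, Real.exp_log (by linarith), hysum]

theorem abs_side_le {p : ℂ} (h : |p.im| = π * b) {s : ℝ}
    (hp : modelMap b p = s * I) : 2 ≤ |s| ∧ (p.re = 0 → |s| = 2) := by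
  have hpi : 0 ≤ π * b := by positivity
  obtain ⟨σ, hσ, him⟩ : ∃ σ : ℝ, (σ = 1 ∨ σ = -1) ∧ p.im = σ * (π * b) := by grind
  rw [modelMap_side hb hσ him] at hp; have h1 := congrArg im hp
  rw [← ofReal_neg, im_ofReal_mul, im_ofReal_mul, I_im, mul_one, mul_one] at h1
  have h3 : |s| = rexp (-(p.re / (2 * b))) + rexp (p.re / (2 * b)) := by
    rw [← h1, abs_neg, abs_mul, abs_of_pos (show 0 < rexp (-(p.re / (2 * b))) +
      rexp (p.re / (2 * b)) by positivity)]
    rcases hσ with rfl | rfl <;> simp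
  rw [h3]; refine ⟨two_le_exp_neg_add_exp (p.re / (2 * b)), fun h0 => ?_⟩; rw [h0]; norm_num

/-- On this side the model map takes the values `-iσs` with `s ≥ 2`, the corner being `s = 2`. The
affine map sends `s` to `κs - στ`, which by `h1` never enters `(-2, 2)`; being increasing in `s`, it
must be at least `2` from the start, since otherwise it would vanish for some `s ≥ 2`. By `h2` the
value `2` is attained, and by monotonicity this happens at `s = 2`. -/
theorem side_offset_eq_two {σ κ τ : ℝ} (hσ : σ = 1 ∨ σ = -1) (hκ : 0 < κ)
    {g : ℂ → ℂ}
    (hg : ∀ l ∈ closedLogSector b, modelMap b (g l) = κ * modelMap b l + τ * I)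
    (h1 : ∀ l : ℂ, l.re ≤ 0 → l.im = σ * (π * b) → |(g l).im| = π * b)
    (h2 : ∃ l : ℂ, l.re ≤ 0 ∧ l.im = σ * (π * b) ∧ (g l).re = 0) :
    2 * κ - σ * τ = 2 := by
  have hσa : |σ| = 1 := by grind
  have key : ∀ l : ℂ, l.re ≤ 0 → l.im = σ * (π * b) → ∀ s : ℝ, modelMap b l = -(σ * s : ℝ) * I →
      2 ≤ |κ * s - σ * τ| ∧ ((g l).re = 0 → |κ * s - σ * τ| = 2) := by
    intro l h h' s hs
    have e := hg l ((fun l h h' => ⟨h, by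
      rw [h', abs_mul, hσa, one_mul, abs_of_pos (by positivity)]⟩) l h h')
    have e2 : modelMap b (g l) = ((-(σ * (κ * s - σ * τ)) : ℝ) : ℂ) * I := by
      rw [e, hs]
      have h3 : ((σ : ℂ)) * σ = 1 := by exact_mod_cast (by grind)
      push_cast; grind
    have h4 := abs_side_le hb (h1 l h h') e2; grind
  have hge : 2 ≤ 2 * κ - σ * τ := by
    by_contra hlt; obtain ⟨l, e1, e2, e3⟩ := exists_side_point hb hσ le_rfl
    have h3 := (key l e1 e2 2 e3).1
    have h4 : κ * 2 - σ * τ ≤ -2 := by grind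
    have hs : 2 ≤ σ * τ / κ := by
      rw [le_div_iff₀ hκ]; linarith
    obtain ⟨l', f1, f2, f3⟩ := exists_side_point hb hσ hs; grind
  obtain ⟨l, e1, e2, e3⟩ := h2; have h3 := (key l e1 e2 _ (modelMap_side hb hσ e2)).2 e3
  have h5 := mul_le_mul_of_nonneg_left (two_le_exp_neg_add_exp (l.re / (2 * b))) hκ.le
  have h6 := le_abs_self (κ * (rexp (-(l.re / (2 * b))) + rexp (l.re / (2 * b))) - σ * τ); linarith

/-! ### Uniqueness of the conformal map -/

/-- The two sides give `2κ - τ = 2` and `2κ + τ = 2`. -/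
theorem eq_self_of_side_conditions {κ τ : ℝ} (hκ : 0 < κ) {g : ℂ → ℂ}
    (hgm : ∀ l ∈ closedLogSector b, g l ∈ closedLogSector b)
    (hg : ∀ l ∈ closedLogSector b, modelMap b (g l) = κ * modelMap b l + τ * I)
    (h1 : ∀ σ : ℝ, σ = 1 ∨ σ = -1 → ∀ l : ℂ, l.re ≤ 0 → l.im = σ * (π * b) →
      |(g l).im| = π * b)
    (h2 : ∀ σ : ℝ, σ = 1 ∨ σ = -1 → ∃ l : ℂ, l.re ≤ 0 ∧ l.im = σ * (π * b) ∧ (g l).re = 0) :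
    ∀ l ∈ closedLogSector b, g l = l := by
  have e1 := side_offset_eq_two hb (Or.inl rfl) hκ hg (h1 1 (Or.inl rfl)) (h2 1 (Or.inl rfl))
  have e2 := side_offset_eq_two hb (Or.inr rfl) hκ hg (h1 (-1) (Or.inr rfl)) (h2 (-1) (Or.inr rfl))
  have hκ1 : κ = 1 := by linarith
  have hτ : τ = 0 := by linarith
  intro l hl; refine injOn_modelMap hb (hgm l hl) hl ?_; simp_all

theorem exists_conformal_form {ψ : ℂ → ℂ}
    (hd : DifferentiableOn ℂ ψ (logSector b))
    (hψ : BijOn ψ (logSector b) (scaledMap b μ '' logSector b)) {ν : ℝ}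
    (hlim : Tendsto (fun x : ℝ => ψ x - x) atBot (𝓝 (ν : ℂ))) :
    ∃ κ : ℝ, 0 < κ ∧ ∃ τ : ℝ, ∃ g : ℂ → ℂ, (∀ l ∈ closedLogSector b, g l ∈ closedLogSector b) ∧
      (∀ l ∈ closedLogSector b, modelMap b (g l) = κ * modelMap b l + τ * I) ∧
      ContinuousOn (fun l => scaledMap b μ (g l)) (closedLogSector b) ∧
      ∀ l ∈ logSector b, ψ l = scaledMap b μ (g l) := by
  obtain ⟨κ, hκ, τ, h⟩ := exists_modelMap_eq_of_conformal hb μ hd hψ hlim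
  have hre : ∀ l ∈ closedLogSector b, 0 ≤ (κ * modelMap b l + τ * I).re := fun l hl => by
    rw [add_re, re_ofReal_mul, re_ofReal_mul, I_re, mul_zero, add_zero]
    exact mul_nonneg hκ.le (re_modelMap_nonneg hb hl)
  refine ⟨κ, hκ, τ, fun l => modelInv b (κ * modelMap b l + τ * I),
    fun l hl => (modelInv_mem hb (hre l hl)).1, fun l hl => (modelInv_mem hb (hre l hl)).2, ?_, ?_⟩
  · have h1 : Continuous fun l => κ * modelMap b l + τ * I :=
      (continuous_const.mul (differentiable_modelMap b).continuous).add continuous_const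
    exact (continuousOn_scaledMap hb μ).comp ((continuousOn_modelInv hb).comp h1.continuousOn hre)
      fun l hl => (modelInv_mem hb (hre l hl)).1
  · intro l hl; obtain ⟨q, hq, hqe⟩ := hψ.mapsTo hl; have hq' := subset_closedLogSector b hq
    simp only; rw [← h l hl, ← hqe, scaledLogInv_map hb μ hq', modelInv_map hb hq']

theorem frontier_logSector_inter_ray {y : ℝ} (hy : |y| = π * b) :
    frontier (logSector b) ∩ logRayAt y = {l | l.re ≤ 0 ∧ l.im = y} := by
  rw [frontier_logSector hb]; ext l; constructor
  · rintro ⟨⟨h1, _⟩, h2⟩; exact ⟨h1.1, h2⟩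
  · rintro ⟨h1, h2⟩
    refine ⟨⟨⟨h1, by rw [h2, hy]⟩, fun h3 => ?_⟩, h2⟩
    have := h3.2; grind

theorem abs_im_eq_of_abs_im_scaledMap (h : l ∈ closedLogSector b) (hy : |(scaledMap b μ l).im| = π *
    b) :
    |l.im| = π * b := by
  refine h.2.lt_or_eq.resolve_left fun h1 => ?_; have := abs_im_logWedgeMap_lt hb h h1
  rw [im_scaledMap] at hy; exact this.ne hy

theorem frontier_image_inter_ray {y : ℝ} (hy : |y| = π * b) :
    frontier (scaledMap b μ '' logSector b) ∩ logRayAt y =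
      {l | l.re ≤ cornerRe b μ ∧ l.im = y} := by
  rw [← scaledMap_side hb μ hy, frontier_image_logSector hb]; ext p; constructor
  · rintro ⟨⟨l, ⟨h1, _⟩, rfl⟩, h2⟩; have h3 : (scaledMap b μ l).im = y := h2
    refine ⟨l, ⟨h1.1, ?_⟩, rfl⟩
    rw [← h3, im_scaledMap, im_logWedgeMap_of_side hb h1.1 (abs_im_eq_of_abs_im_scaledMap hb μ h1
      (by rw [h3, hy]))]
  · rintro ⟨l, ⟨h1, h2⟩, rfl⟩
    have h3 : |l.im| = π * b := by rw [h2, hy]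
    refine ⟨⟨l, ⟨⟨h1, h3.le⟩, fun h4 => h4.2.ne h3⟩, rfl⟩, ?_⟩; show (scaledMap b μ l).im = y
    rw [im_scaledMap, im_logWedgeMap_of_side hb h1 h3, h2]

theorem bijOn_scaledMap_side {y : ℝ} (hy : |y| = π * b) :
    BijOn (scaledMap b μ) {l | l.re ≤ 0 ∧ l.im = y} {l | l.re ≤ cornerRe b μ ∧ l.im = y} := by
  rw [← scaledMap_side hb μ hy]
  have h : {l : ℂ | l.re ≤ 0 ∧ l.im = y} ⊆ closedLogSector b := fun l h => ⟨h.1, by rw [h.2, hy]⟩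
  exact ((injOn_scaledMap hb μ).mono h).bijOn_image

theorem abs_sign_mul {σ : ℝ} (hσ : σ = 1 ∨ σ = -1) :
    |σ * (π * b)| = π * b := by
  have : 0 < π * b := by positivity
  grind

theorem scaledMap_corner (h : l ∈ closedLogSector b)
    (hy : |l.im| = π * b) (hre : (scaledMap b μ l).re = cornerRe b μ) : l.re = 0 := by
  have h1 : scaledMap b μ l = scaledMap b μ (l.im * I) := by
    have hm : (l.im : ℂ) * I ∈ {p : ℂ | p.re ≤ 0 ∧ p.im = l.im} := by constructor <;> simp
    refine Complex.ext ?_ ?_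
    · refine le_antisymm ?_ ?_
      · rcases h.1.lt_or_eq with h2 | h2
        · rw [re_scaledMap, re_scaledMap]
          have := re_logWedgeMap_lt hb h (q := l.im * I) ⟨by simp, by simpa using hy.le⟩
            (by simpa using h2) (by simp)
          linarith
        · rw [show (l.im : ℂ) * I = l from Complex.ext (by simpa using h2.symm) (by simp)]
      · rw [hre]; exact ((bijOn_scaledMap_side hb μ hy).mapsTo hm).1
    · rw [im_scaledMap, im_scaledMap, im_logWedgeMap_of_side hb h.1 hy,
        im_logWedgeMap_of_side hb hm.1 (by rw [hm.2, hy]), hm.2]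
  rw [(injOn_scaledMap hb μ h ⟨by simp, by simpa using hy.le⟩ h1)]
  simp

theorem tendsto_ofReal_comap_atBot :
    Tendsto (fun x : ℝ => (x : ℂ)) atBot (comap re atBot ⊓ 𝓟 (logSector b)) := by
  refine tendsto_inf.mpr ⟨tendsto_comap_iff.mpr tendsto_id, tendsto_principal.mpr ?_⟩
  filter_upwards [eventually_lt_atBot 0] with x hx
  exact ⟨by simpa using hx, by rw [ofReal_im, abs_zero]; positivity⟩

theorem isLogSectorConformalMap_iff (φ : ℂ → ℂ) :
    IsLogSectorConformalMap b φ (scaledMap b μ '' logSector b) ↔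
      EqOn φ (scaledMap b μ) (closedLogSector b) := by
  have hsub := subset_closedLogSector b
  have hp : 0 < π * b := by positivity
  have hside : ∀ y : ℝ, |y| = π * b →
      {l : ℂ | l.re ≤ 0 ∧ l.im = y} ⊆ closedLogSector b := fun y hy l h =>
    ⟨h.1, by rw [h.2, hy]⟩
  constructor
  · intro h
    obtain ⟨ν, hν⟩ := h.vertex
    obtain ⟨κ, hκ, τ, g, hgm, hg, hgc, hψ⟩ := exists_conformal_form hb μ h.differentiableOn h.bijOn
      (hν.comp (tendsto_ofReal_comap_atBot hb))
    have hφ : EqOn φ (fun l => scaledMap b μ (g l)) (closedLogSector b) :=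
      EqOn.of_subset_closure hψ h.continuousOn hgc hsub (closure_logSector hb).ge
    have hbij : ∀ σ : ℝ, σ = 1 ∨ σ = -1 → BijOn φ {l | l.re ≤ 0 ∧ l.im = σ * (π * b)}
        {l | l.re ≤ cornerRe b μ ∧ l.im = σ * (π * b)} := by
      intro σ hσ
      rw [← frontier_logSector_inter_ray hb (abs_sign_mul hb hσ),
        ← frontier_image_inter_ray hb μ (abs_sign_mul hb hσ)]
      rcases hσ with rfl | rfl
      · rw [one_mul]
        exact h.upper
      · rw [neg_one_mul]
        exact h.lower
    have hself := eq_self_of_side_conditions hb hκ hgm hg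
      (fun σ hσ l h1 h2 => by
        have h3 := hside _ (abs_sign_mul hb hσ) ⟨h1, h2⟩
        refine abs_im_eq_of_abs_im_scaledMap hb μ (hgm l h3) ?_
        have h4 := ((hbij σ hσ).mapsTo ⟨h1, h2⟩).2
        rw [hφ h3] at h4
        rw [h4, abs_sign_mul hb hσ])
      fun σ hσ => by
        obtain ⟨l, ⟨h1, h2⟩, h3⟩ := (hbij σ hσ).surjOn
          (show (cornerRe b μ : ℂ) + ((σ * (π * b) : ℝ) : ℂ) * I ∈ _ from
            ⟨by simp, by simp⟩)
        have h4 := hside _ (abs_sign_mul hb hσ) ⟨h1, h2⟩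
        refine ⟨l, h1, h2, ?_⟩
        rw [hφ h4] at h3
        simp only at h3
        refine scaledMap_corner hb μ (hgm l h4)
          (abs_im_eq_of_abs_im_scaledMap hb μ (hgm l h4) ?_) ?_
        · rw [h3, add_im, ofReal_im, zero_add, im_ofReal_mul, I_im, mul_one, abs_sign_mul hb hσ]
        simp_all
    intro l hl
    grind
  · intro h
    have hs : ∀ y : ℝ, |y| = π * b → BijOn φ (frontier (logSector b) ∩ logRayAt y)
        (frontier (scaledMap b μ '' logSector b) ∩ logRayAt y) := fun y hy => by
      rw [frontier_logSector_inter_ray hb hy, frontier_image_inter_ray hb μ hy]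
      exact (bijOn_scaledMap_side hb μ hy).congr fun l hl => (h (hside y hy hl)).symm
    exact
      { differentiableOn := (differentiableOn_scaledMap hb μ).congr fun l hl => h (hsub hl)
        bijOn := ((injOn_scaledMap hb μ).mono hsub).bijOn_image.congr
          fun l hl => (h (hsub hl)).symm
        continuousOn := (continuousOn_scaledMap hb μ).congr h
        upper := hs _ (abs_of_pos hp)
        lower := hs _ (by grind)
        vertex := by
          refine ⟨μ, ?_⟩
          have h1 := ((tendsto_logWedgeMap_sub_self hb).add_const (μ : ℂ)).mono_left
            (inf_le_left (b := 𝓟 (logSector b)))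
          rw [zero_add] at h1
          refine h1.congr' ?_
          filter_upwards [mem_inf_of_right (mem_principal_self _)] with l hl
          rw [h (hsub hl), scaledMap]
          ring }

/-! ### Conformal maps of the sector in the plane -/

omit hb in
-- The sides meet the cut of the principal power only for `b = 1`, and then the exponent is `1`.
theorem exp_cpow_of_mem (hb1 : b ≤ 1) (h : |l.im| ≤ π * b) :
    exp l ^ (1 / b : ℂ) = exp (l / b) := by
  rcases h.lt_or_eq with h1 | h1
  · rw [cpow_def_of_ne_zero (exp_ne_zero _), log_exp_of_mem hb1 h1, mul_one_div]
  rcases hb1.lt_or_eq with h2 | h2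
  · have h3 : |l.im| < π := by nlinarith [pi_pos]
    rw [cpow_def_of_ne_zero (exp_ne_zero _), log_exp (abs_lt.mp h3).1 (abs_lt.mp h3).2.le, mul_one_div]
  simp_all

theorem exp_scaledMap (hb1 : b ≤ 1) (μ : ℝ) (h : l ∈ closedLogSector b) :
    exp (scaledMap b μ l) = (rexp μ : ℂ) * wedgeMap b (exp l) := by
  rw [scaledMap, exp_add, exp_logWedgeMap hb h, ← ofReal_exp, wedgeMap,
    exp_cpow_of_mem hb1 h.2, mul_comm]

omit hb

theorem openSector_eq_image (hb1 : b ≤ 1) : openSector b = exp '' logSector b := by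
  ext ζ; constructor
  · rintro ⟨h1, h2, h3⟩; refine ⟨log ζ, ⟨?_, ?_⟩, exp_log h1⟩
    · rw [log_re]; exact Real.log_neg (norm_pos_iff.mpr h1) h2
    · rw [log_im]; exact h3
  · rintro ⟨l, hl, rfl⟩; refine ⟨exp_ne_zero _, ?_, ?_⟩
    · rw [norm_exp]; exact Real.exp_zero ▸ exp_lt_exp.mpr hl.1
    · rw [arg_exp_of_mem_logAngle hb1 hl.2]; exact hl.2

theorem log_mem_closedLogSector {ζ : ℂ} (h : ζ ∈ closedSector b) :
    log ζ ∈ closedLogSector b := by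
  refine ⟨?_, ?_⟩
  · rw [log_re]; exact Real.log_nonpos (norm_nonneg _) h.1
  · rw [log_im]; exact h.2

theorem exp_mem_closedSector (hb1 : b ≤ 1) (h : l ∈ closedLogSector b) :
    exp l ∈ closedSector b := by
  refine ⟨?_, ?_⟩
  · rw [norm_exp]; exact Real.exp_le_one_iff.mpr h.1
  · rcases h.2.lt_or_eq with h1 | h1
    · rw [arg_exp_of_mem_logAngle hb1 h1]; exact h.2
    rcases hb1.lt_or_eq with h2 | h2
    · have h3 : |l.im| < π := by nlinarith [pi_pos]
      rw [← log_im, log_exp (abs_lt.mp h3).1 (abs_lt.mp h3).2.le]; exact h.2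
    · rw [h2, mul_one]; exact abs_arg_le_pi _

include hb

theorem zero_mem_closedSector : (0 : ℂ) ∈ closedSector b := by
  refine ⟨by simp, ?_⟩
  rw [arg_zero, abs_zero]; positivity

omit hb

/-- The trace on a side of the angle of the boundary of a region in the plane. -/
theorem frontier_exp_image_inter_ray (hb1 : b ≤ 1) (ho : IsOpen Ω)
    (hΩ : Ω ⊆ logAngle b) {x : ℝ} (hf : ∀ y : ℝ, |y| = π * b →
      frontier Ω ∩ logRayAt y = {l | l.re ≤ x ∧ l.im = y}) {y : ℝ} (hy : |y| = π * b) :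
    frontier (exp '' Ω) ∩ rayAt y = insert 0 (exp '' {l | l.re ≤ x ∧ l.im = y}) := by
  ext z
  by_cases hz0 : z = 0
  · rw [hz0]
    refine iff_of_true ⟨zero_mem_frontier_exp_image (x := x) (y := y) ho fun s hs => ?_,
      ⟨0, le_rfl, by simp⟩⟩ (mem_insert _ _)
    have : (s : ℂ) + y * I ∈ {l : ℂ | l.re ≤ x ∧ l.im = y} := ⟨by simpa using hs, by simp⟩
    grind
  · rw [mem_inter_iff, mem_frontier_exp_image hb1 ho hΩ hz0, mem_insert_iff, or_iff_right hz0]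
    constructor
    · rintro ⟨⟨l, hl, rfl⟩, r, hr0, hr⟩
      have hr1 : 0 < r := hr0.lt_of_ne fun h => hz0 (by rw [hr, ← h]; simp)
      have hp : exp ((Real.log r : ℂ) + y * I) = exp l := by
        rw [exp_add, ← ofReal_exp, Real.exp_log hr1, hr]
      refine ⟨(Real.log r : ℂ) + y * I, ⟨?_, by simp⟩, hp⟩
      have h1 : |l.im| = π * b := by
        refine ((abs_im_le_of_mem_closure hΩ) _ (frontier_subset_closure hl)).lt_or_eq.resolve_left
          fun h => ?_
        have h3 : |((Real.log r : ℂ) + y * I).im| < π * b := (exp_mem_image_iff hb1 (S :=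
          logAngle b) subset_rfl (p := (Real.log r : ℂ) + y * I) (by simpa using hy.le) (hp ▸ ⟨l, h,
          rfl⟩))
        simp [hy] at h3
      have h2 : l ∈ frontier Ω ∩ logRayAt l.im := ⟨hl, rfl⟩; grind
    · rintro ⟨l, h, rfl⟩; have h1 := h; rw [← hf y hy] at h1
      refine ⟨⟨l, h1.1, rfl⟩, rexp l.re, (exp_pos _).le, ?_⟩; rw [ofReal_exp, ← exp_add]; congr 1
      apply Complex.ext <;> simp [h.2]

theorem injOn_exp_side (x y : ℝ) : InjOn exp {l : ℂ | l.re ≤ x ∧ l.im = y} := by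
  intro p hp q hq h; have h3 := congrArg norm h; rw [norm_exp, norm_exp] at h3
  exact Complex.ext (Real.exp_injective h3) (hp.2.trans hq.2.symm)

include hb

theorem continuousOn_wedgeMap (hb1 : b ≤ 1) :
    ContinuousOn (wedgeMap b) (closedSector b) := by
  have h1 : ContinuousOn (fun ζ : ℂ => ζ ^ (1 / b : ℂ)) (closedSector b) := by
    rcases hb1.lt_or_eq with h2 | h2
    · intro ζ hζ; refine (continuousAt_cpow_const_of_re_pos ?_ ?_).continuousWithinAt
      · by_cases h0 : ζ = 0
        · left; rw [h0]; simp
        have h3 : ζ ∈ slitPlane := by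
          rw [mem_slitPlane_iff_arg]; refine ⟨fun h => ?_, h0⟩; have h4 := hζ.2
          rw [h, abs_of_pos pi_pos] at h4; nlinarith [pi_pos]
        rcases h3 with h | h
        · exact Or.inl h.le
        · exact Or.inr h
      simp_all
    · rw [h2]; simp only [ofReal_one, div_one, cpow_one]; exact continuousOn_id
  have h2 : MapsTo (fun ζ : ℂ => ζ ^ (1 / b : ℂ)) (closedSector b) (closedBall 0 1) := by
    intro ζ hζ; rw [mem_closedBall_zero_iff]; simp only
    by_cases h0 : ζ = 0
    · rw [h0, zero_cpow (by simpa using hb.ne'), norm_zero]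
      exact zero_le_one
    · rw [cpow_def_of_ne_zero h0, mul_one_div]
      exact norm_exp_div_le_one hb (log_mem_closedLogSector hζ).1
  exact continuousOn_id.mul ((continuousOn_hypFactor hb).comp h1 h2)

omit hb in
theorem wedgeMap_zero (b : ℝ) : wedgeMap b 0 = 0 := by rw [wedgeMap, zero_mul]

theorem sectorConformalMap_forms (hb1 : b ≤ 1) (μ : ℝ) {y : ℝ}
    (hy : |y| = π * b) :
    frontier (openSector b) ∩ rayAt y = insert 0 (exp '' {l | l.re ≤ 0 ∧ l.im = y}) ∧
    frontier (exp '' (scaledMap b μ '' logSector b)) ∩ rayAt y =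
      insert 0 (exp '' {l | l.re ≤ cornerRe b μ ∧ l.im = y}) := by
  rw [openSector_eq_image hb1]
  exact ⟨frontier_exp_image_inter_ray hb1 (isOpen_logSector b) (fun l h => h.2)
    (fun y hy => frontier_logSector_inter_ray hb hy) hy,
    frontier_exp_image_inter_ray hb1 (isOpen_image_logSector hb μ)
    (image_logSector_subset_logAngle hb μ) (fun y hy => frontier_image_inter_ray hb μ hy) hy⟩

theorem isSectorConformalMap_of_eqOn (hb1 : b ≤ 1) (μ : ℝ) {φ : ℂ → ℂ}
    (h : EqOn φ (fun ζ => (rexp μ : ℂ) * wedgeMap b ζ) (closedSector b)) :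
    IsSectorConformalMap b φ (exp '' (scaledMap b μ '' logSector b)) := by
  have hsub := subset_closedLogSector b; have hM := image_logSector_subset_logAngle hb μ
  have key : ∀ l ∈ closedLogSector b, φ (exp l) = exp (scaledMap b μ l) := fun l hl => by
    rw [h (exp_mem_closedSector hb1 hl), exp_scaledMap hb hb1 μ hl]
  have hp : 0 < π * b := by positivity
  have h0 : φ 0 = 0 := by simpa only [wedgeMap_zero, mul_zero] using h (zero_mem_closedSector hb)
  have hside : ∀ y : ℝ, |y| = π * b → BijOn φ (frontier (openSector b) ∩ rayAt y)
      (frontier (exp '' (scaledMap b μ '' logSector b)) ∩ rayAt y) := by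
    intro y hy; obtain ⟨e1, e2⟩ := sectorConformalMap_forms hb hb1 μ hy
    have hcl : ∀ l ∈ {l : ℂ | l.re ≤ 0 ∧ l.im = y}, l ∈ closedLogSector b := fun l hl =>
      ⟨hl.1, by rw [hl.2, hy]⟩
    have hb2 := bijOn_scaledMap_side hb μ hy; rw [e1, e2]; refine ⟨?_, ?_, ?_⟩
    · rintro _ (rfl | ⟨l, hl, rfl⟩)
      · grind
      · rw [key l (hcl l hl)]; exact Or.inr ⟨_, hb2.mapsTo hl, rfl⟩
    · rintro _ (rfl | ⟨p, hp, rfl⟩) _ (rfl | ⟨q, hq, rfl⟩) hpq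
      · rfl
      · simp_all
      · simp_all
      · rw [key p (hcl p hp), key q (hcl q hq)] at hpq
        rw [hb2.injOn hp hq (injOn_exp_side _ _ (hb2.mapsTo hp) (hb2.mapsTo hq) hpq)]
    · rintro _ (rfl | ⟨p, hp, rfl⟩)
      · grind
      · obtain ⟨l, hl, rfl⟩ := hb2.surjOn hp; grind
  have hlog : ∀ ζ ∈ openSector b, log ζ ∈ logSector b ∧ exp (log ζ) = ζ := fun ζ hζ => by
    have h1 := hζ; rw [openSector_eq_image hb1] at h1; obtain ⟨l, hl, rfl⟩ := h1
    rw [log_exp_of_mem hb1 hl.2]; exact ⟨hl, rfl⟩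
  refine ⟨?_, ⟨?_, ?_, ?_⟩, ?_, hside _ (abs_of_pos hp), hside _ (by grind),
    h0, rexp μ, exp_pos μ, ?_⟩
  · have h1 : DifferentiableOn ℂ (fun ζ => exp (scaledMap b μ (log ζ))) (openSector b) := by
      refine DifferentiableOn.cexp ((differentiableOn_scaledMap hb μ).comp (fun ζ hζ => ?_)
        fun ζ hζ => (hlog ζ hζ).1)
      exact (differentiableAt_log (openAngle_subset_slitPlane hb1
        ⟨hζ.1, hζ.2.2⟩)).differentiableWithinAt
    refine h1.congr fun ζ hζ => ?_; grind
  · intro ζ hζ; grind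
  · intro ζ hζ ξ hξ e; rw [← (hlog ζ hζ).2, ← (hlog ξ hξ).2] at e ⊢
    rw [key _ (hsub (hlog ζ hζ).1), key _ (hsub (hlog ξ hξ).1)] at e
    rw [injOn_scaledMap hb μ (hsub (hlog ζ hζ).1) (hsub (hlog ξ hξ).1)
      (injOn_exp_logAngle hb1 (hM ⟨_, (hlog ζ hζ).1, rfl⟩) (hM ⟨_, (hlog ξ hξ).1, rfl⟩) e)]
  · rintro _ ⟨_, ⟨l, hl, rfl⟩, rfl⟩; refine ⟨exp l, ?_, key l (hsub hl)⟩
    rw [openSector_eq_image hb1]; exact ⟨l, hl, rfl⟩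
  · exact (continuousOn_const.mul (continuousOn_wedgeMap hb hb1)).congr h
  · have h1 : Tendsto (fun l => exp (scaledMap b μ l - l)) (comap re atBot ⊓ 𝓟 (logSector b))
        (𝓝 (exp μ)) := by
      refine (continuous_exp.tendsto _).comp ?_
      have h1 := ((tendsto_logWedgeMap_sub_self hb).add_const (μ : ℂ)).mono_left
        (inf_le_left (b := 𝓟 (logSector b)))
      rw [zero_add] at h1; refine h1.congr fun l => ?_; rw [scaledMap]; ring
    have h2 := h1.comp (tendsto_log_nhdsWithin_zero hb1 (Ω := logSector b) fun l h => h.2)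
    rw [← openSector_eq_image hb1, ← ofReal_exp] at h2; refine h2.congr' ?_
    filter_upwards [self_mem_nhdsWithin] with ζ hζ
    rw [comp_apply, exp_sub, ← key _ (hsub (hlog ζ hζ).1), (hlog ζ hζ).2]

/-- The map is lifted to the strip by the logarithm, which is continuous on the open angle.
Positivity of the derivative at `0` becomes the real limit of `ψ x - x`, and the argument on the
surface applies. -/
theorem IsSectorConformalMap.eqOn (hb1 : b ≤ 1) (μ : ℝ) {φ : ℂ → ℂ}
    (h : IsSectorConformalMap b φ (exp '' (scaledMap b μ '' logSector b))) :
    EqOn φ (fun ζ => (rexp μ : ℂ) * wedgeMap b ζ) (closedSector b) := by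
  have hM := image_logSector_subset_logAngle hb μ
  have hmaps : ∀ ℓ ∈ logSector b, ∃ p ∈ scaledMap b μ '' logSector b, exp p = φ (exp ℓ) := by
    intro ℓ hℓ; apply h.bijOn.mapsTo; rw [openSector_eq_image hb1]; grind
  set ψ : ℂ → ℂ := fun ℓ => log (φ (exp ℓ)) with hψdef
  have hψ : ∀ ℓ ∈ logSector b, ψ ℓ ∈ scaledMap b μ '' logSector b ∧ exp (ψ ℓ) = φ (exp ℓ) := by
    intro ℓ hℓ; obtain ⟨p, hp, e⟩ := hmaps ℓ hℓ; simp only [hψdef]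
    rw [← e, log_exp_of_mem hb1 (hM hp)]; exact ⟨hp, rfl⟩
  have hmem : ∀ ℓ ∈ logSector b, exp ℓ ∈ openSector b := fun ℓ hℓ => by
    rw [openSector_eq_image hb1]; grind
  have hd : DifferentiableOn ℂ ψ (logSector b) := by
    refine DifferentiableOn.clog (h.differentiableOn.comp differentiable_exp.differentiableOn hmem)
      fun ℓ hℓ => ?_
    obtain ⟨p, hp, e⟩ := hmaps ℓ hℓ; rw [← e]
    exact openAngle_subset_slitPlane hb1 (exp_mem_openAngle hb1 (hM hp))
  have hbij : BijOn ψ (logSector b) (scaledMap b μ '' logSector b) := by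
    refine ⟨fun ℓ hℓ => (hψ ℓ hℓ).1, fun p hp q hq e => ?_, fun p hp => ?_⟩
    · exact injOn_exp_logAngle hb1 hp.2 hq.2 (h.bijOn.injOn (hmem p hp) (hmem q hq) (by grind))
    · obtain ⟨ζ, hζ, e⟩ := h.bijOn.surjOn ⟨p, hp, rfl⟩; rw [openSector_eq_image hb1] at hζ
      obtain ⟨ℓ, hℓ, rfl⟩ := hζ
      exact ⟨ℓ, hℓ, injOn_exp_logAngle hb1 (hM (hψ ℓ hℓ).1) (hM hp) ((hψ ℓ hℓ).2.trans e)⟩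
  obtain ⟨l, hl, hlim⟩ := h.deriv_zero_pos
  have hexp : Tendsto (fun x : ℝ => exp x) atBot (𝓝[openSector b] 0) := by
    refine tendsto_nhdsWithin_iff.mpr ⟨?_, ?_⟩
    · have := (continuous_ofReal.tendsto 0).comp tendsto_exp_atBot; rw [ofReal_zero] at this
      exact this.congr fun x => by simp
    · filter_upwards [eventually_lt_atBot 0] with x hx
      exact hmem _ ⟨by simpa using hx, by rw [ofReal_im, abs_zero]; positivity⟩
  have hψlim : Tendsto (fun x : ℝ => ψ x - x) atBot (𝓝 ((Real.log l : ℝ) : ℂ)) := by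
    have h1 := (hlim.comp hexp).clog (ofReal_mem_slitPlane.mpr hl); rw [← ofReal_log hl.le] at h1
    refine h1.congr' ?_; filter_upwards [eventually_lt_atBot 0] with x hx
    have hx' : (x : ℂ) ∈ logSector b := ⟨by simpa using hx, by rw [ofReal_im, abs_zero]; positivity⟩
    have h2 : φ (exp x) / exp x ≠ 0 := by
      rw [← (hψ _ hx').2]; simp
    have h3 : φ (exp x) = ((rexp x : ℝ) : ℂ) * (φ (exp x) / exp x) := by
      rw [ofReal_exp, mul_div_cancel₀ _ (exp_ne_zero _)]
    simp only [hψdef, comp_apply]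
    conv_rhs => rw [h3]
    rw [log_ofReal_mul (exp_pos x) h2, Real.log_exp]; ring
  obtain ⟨κ, hκ, τ, g, hgm, hg, hgc, hgψ⟩ := exists_conformal_form hb μ hd hbij hψlim
  have hφ : ∀ ℓ ∈ closedLogSector b, φ (exp ℓ) = exp (scaledMap b μ (g ℓ)) := by
    have h1 : EqOn (fun ℓ => φ (exp ℓ)) (fun ℓ => exp (scaledMap b μ (g ℓ)))
        (closedLogSector b) := by
      refine EqOn.of_subset_closure (s := logSector b) (fun ℓ hℓ => ?_)
        (h.continuousOn.comp continuous_exp.continuousOn fun ℓ hℓ => exp_mem_closedSector hb1 hℓ)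
        hgc.cexp (subset_closedLogSector b) (closure_logSector hb).ge
      grind
    exact h1
  have hp : 0 < π * b := by positivity
  have hside : ∀ σ : ℝ, σ = 1 ∨ σ = -1 →
      BijOn φ (insert 0 (exp '' {ℓ | ℓ.re ≤ 0 ∧ ℓ.im = σ * (π * b)}))
        (insert 0 (exp '' {ℓ | ℓ.re ≤ cornerRe b μ ∧ ℓ.im = σ * (π * b)})) := by
    intro σ hσ; obtain ⟨e1, e2⟩ := sectorConformalMap_forms hb hb1 μ (abs_sign_mul hb hσ)
    rw [← e1, ← e2]; rcases hσ with rfl | rfl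
    · rw [one_mul]; exact h.upper
    · rw [neg_one_mul]; exact h.lower
  have hcl : ∀ σ : ℝ, σ = 1 ∨ σ = -1 → ∀ ℓ : ℂ, ℓ.re ≤ 0 → ℓ.im = σ * (π * b) →
      ℓ ∈ closedLogSector b := fun σ hσ ℓ h1 h2 => ⟨h1, by grind⟩
  -- Only the absolute value of the imaginary part is recovered: for `b = 1` both sides project to
  -- the same ray and cannot be told apart. The conditions of `eq_self_of_side_conditions` need no
  -- more.
  have himM : ∀ σ : ℝ, σ = 1 ∨ σ = -1 → ∀ ℓ ∈ closedLogSector b, ∀ p : ℂ,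
      p.im = σ * (π * b) → exp p = exp (scaledMap b μ ℓ) → |ℓ.im| = π * b := by
    intro σ hσ ℓ hℓ p hp e; refine hℓ.2.lt_or_eq.resolve_left fun h1 => ?_
    have h2 : scaledMap b μ ℓ ∈ logAngle b := by
      show |(scaledMap b μ ℓ).im| < _; rw [im_scaledMap]; exact abs_im_logWedgeMap_lt hb hℓ h1
    have h3 : |p.im| = π * b := by grind
    have h4 : |p.im| < π * b :=
      exp_mem_image_iff hb1 (S := logAngle b) subset_rfl h3.le (e ▸ ⟨_, h2, rfl⟩)
    exact h4.ne h3
  have hself := eq_self_of_side_conditions hb hκ hgm hg (fun σ hσ ℓ h1 h2 => by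
      have h4 := (hside σ hσ).mapsTo (Or.inr ⟨ℓ, ⟨h1, h2⟩, rfl⟩); rw [hφ ℓ (hcl σ hσ ℓ h1 h2)] at h4
      rcases h4 with h4 | ⟨p, hp, e⟩
      · exact absurd h4 (exp_ne_zero _)
      grind)
    fun σ hσ => by
      set p : ℂ := (cornerRe b μ : ℂ) + ((σ * (π * b) : ℝ) : ℂ) * I with hpdef
      have hp1 : p.re = cornerRe b μ := by simp [hpdef]
      have hp2 : p.im = σ * (π * b) := by simp [hpdef]
      obtain ⟨ζ, hζ, e⟩ := (hside σ hσ).surjOn (Or.inr ⟨p, ⟨hp1.le, hp2⟩, rfl⟩)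
      rcases hζ with rfl | ⟨ℓ, ⟨h1, h2⟩, rfl⟩
      · rw [h.map_zero] at e; exact absurd e.symm (exp_ne_zero _)
      · have h3 := hcl σ hσ ℓ h1 h2; rw [hφ ℓ h3] at e
        refine ⟨ℓ, h1, h2, scaledMap_corner hb μ (hgm ℓ h3)
          (himM σ hσ _ (hgm ℓ h3) p hp2 e.symm) ?_⟩
        grind
  intro ζ hζ
  by_cases h0 : ζ = 0
  · rw [h0, h.map_zero]; simp only; rw [wedgeMap_zero, mul_zero]
  · have h1 := log_mem_closedLogSector hζ; rw [← exp_log h0, hφ _ h1, hself _ h1]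
    exact exp_scaledMap hb hb1 μ h1

theorem isSectorConformalMap_iff (hb1 : b ≤ 1) (μ : ℝ) (φ : ℂ → ℂ) :
    IsSectorConformalMap b φ (exp '' (scaledMap b μ '' logSector b)) ↔
      EqOn φ (fun ζ => (rexp μ : ℂ) * wedgeMap b ζ) (closedSector b) :=
  ⟨IsSectorConformalMap.eqOn hb hb1 μ, isSectorConformalMap_of_eqOn hb hb1 μ⟩

omit hb

/-! ### Local geometry of a region near a regular boundary arc -/

theorem subset_of_disjoint_frontier {X : Type*} [TopologicalSpace X] {s Ω : Set X} (ho : IsOpen Ω)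
    (hs : IsPreconnected s) (hne : (s ∩ Ω).Nonempty) (hd : ∀ p ∈ s, p ∉ frontier Ω) : s ⊆ Ω := by
  refine hs.subset_left_of_subset_union ho isClosed_closure.isOpen_compl
    (disjoint_compl_right.mono_left subset_closure) (fun p hp => ?_) hne
  by_contra h; rw [mem_union, not_or, mem_compl_iff, not_not] at h
  exact hd p hp (by rw [ho.frontier_eq]; exact ⟨h.2, h.1⟩)

theorem isBigO_sq_of_contDiffAt {h : ℝ → ℝ} {t0 : ℝ} (hh : ContDiffAt ℝ 2 h t0) (h0 : h t0 = 0)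
    (h1 : deriv h t0 = 0) : ∃ C : ℝ, 0 < C ∧ ∀ᶠ t in 𝓝 t0, |h t| ≤ C * (t - t0) ^ 2 := by
  have hd : ContDiffAt ℝ 1 (deriv h) t0 := hh.derivWithin (m := 1) (by norm_num)
  obtain ⟨C, hC, hbd⟩ := (hd.differentiableAt one_ne_zero).hasDerivAt.isBigO_sub.exists_pos
  obtain ⟨ε, hε, hball⟩ := eventually_nhds_iff_ball.mp (hbd.bound.and ((hh.eventually (by
    simp)).mono fun t ht => ht.differentiableAt two_ne_zero))
  refine ⟨C, hC, eventually_nhds_iff_ball.mpr ⟨ε, hε, fun t ht => ?_⟩⟩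
  have hseg : ∀ s ∈ uIcc t0 t, |s - t0| ≤ |t - t0| := fun s hs => abs_sub_left_of_mem_uIcc hs
  have hsb : ∀ s ∈ uIcc t0 t, s ∈ ball t0 ε := fun s hs => lt_of_le_of_lt (hseg s hs) ht
  have := Convex.norm_image_sub_le_of_norm_deriv_le (f := h) (s := uIcc t0 t) (C := C * |t - t0|)
    (fun s hs => (hball s (hsb s hs)).2) (fun s hs => by
      have e := (hball s (hsb s hs)).1; rw [h1, sub_zero] at e
      exact e.trans (mul_le_mul_of_nonneg_left (hseg s hs) hC.le))
    (convex_uIcc _ _) left_mem_uIcc right_mem_uIcc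
  rw [h0, sub_zero, norm_eq_abs, norm_eq_abs] at this
  rwa [mul_assoc, ← abs_mul, ← sq, abs_of_nonneg (sq_nonneg (t - t0))] at this

set_option maxHeartbeats 1000000 in
/-- One-sided collar neighbourhoods of the points of a regular boundary arc. -/
theorem exists_collar {t0 : ℝ} {ν : ℂ} (ho : IsOpen Ω)
    (hγ : ContDiffAt ℝ 2 γ t0) (hreg : deriv γ t0 ≠ 0) (hν : ‖ν‖ = 1)
    (hperp : inner ℝ (deriv γ t0) ν = 0) (hfr : ∀ᶠ t in 𝓝 t0, γ t ∈ frontier Ω)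
    (hloc : ∀ J ∈ 𝓝 t0, ∀ᶠ p in 𝓝 (γ t0), p ∈ frontier Ω → p ∈ γ '' J) {p : ℝ → ℂ} {m : ℝ}
    (hm : 0 < m) (hp : HasDerivAt p (m * ν) 0) (hp0 : p 0 = γ t0)
    (hside : ∀ᶠ ε : ℝ in 𝓝[>] 0, p (-ε) ∈ Ω ∧ p ε ∉ Ω) :
    ∃ δ > 0, ∃ r > 0, ∃ C > 0, (∀ t s : ℝ, |t - t0| < δ → 0 < s → s < δ → γ t - s * ν ∈ Ω) ∧
      (∀ z ∈ ball (γ t0) r, ∃ t s : ℝ, |t - t0| ≤ C * ‖z - γ t0‖ ∧ |s| ≤ C * ‖z - γ t0‖ ∧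
        |t - t0| < δ ∧ |s| < δ ∧ z = γ t - s * ν ∧ (z ∈ Ω → 0 < s)) ∧
      ∀ t : ℝ, |t - t0| < δ → |(conj ν * (γ t - γ t0)).re| ≤ C * (t - t0) ^ 2 := by
  -- The collar coordinates `(t, s) ↦ γ t - sν` with a fixed normal `ν`. The differential at `(t0,
  -- 0)` is invertible because `ν` is orthogonal to the nonzero tangent.
  have hE : HasStrictFDerivAt (fun q : ℝ × ℝ => γ q.1 - q.2 * ν)
      ((ContinuousLinearMap.fst ℝ ℝ ℝ).smulRight (deriv γ t0) -
        (ContinuousLinearMap.snd ℝ ℝ ℝ).smulRight ν) (t0, 0) := by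
    exact (HasStrictFDerivAt.comp (t0, (0 : ℝ)) (hγ.hasStrictDerivAt two_ne_zero).hasStrictFDerivAt
      hasStrictFDerivAt_fst).sub
      ((ContinuousLinearMap.snd ℝ ℝ ℝ).smulRight ν).hasStrictFDerivAt
  have hinj : Function.Injective ((ContinuousLinearMap.fst ℝ ℝ ℝ).smulRight (deriv γ t0) -
      (ContinuousLinearMap.snd ℝ ℝ ℝ).smulRight ν) := by
    refine (injective_iff_map_eq_zero _).mpr fun q hq => ?_
    have h1 : q.1 • deriv γ t0 = q.2 • ν := sub_eq_zero.mp hq; have h2 := congrArg (inner ℝ · ν) h1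
    simp only [real_inner_smul_left, hperp, real_inner_self_eq_norm_sq, hν] at h2
    have h3 : q.2 = 0 := by linarith
    rw [h3, zero_smul, smul_eq_zero] at h1; exact Prod.ext (h1.resolve_right hreg) h3
  set e := (LinearMap.linearEquivOfInjective (K := ℝ) (((ContinuousLinearMap.fst ℝ ℝ ℝ).smulRight
    (deriv γ t0) - (ContinuousLinearMap.snd ℝ ℝ ℝ).smulRight ν : ℝ × ℝ →L[ℝ] ℂ) : ℝ × ℝ →ₗ[ℝ] ℂ) hinj
    (by simp)).toContinuousLinearEquiv with he
  have hE' : HasStrictFDerivAt (fun q : ℝ × ℝ => γ q.1 - q.2 * ν) (e : ℝ × ℝ →L[ℝ] ℂ) (t0, 0) := hE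
  set L := hE'.localInverse _ _ _ with hL
  have hEp : γ (t0, (0 : ℝ)).1 - ((t0, (0 : ℝ)).2 : ℂ) * ν = γ t0 := by simp
  have hL0 : L (γ t0) = (t0, 0) := by
    have := hE'.localInverse_apply_image; rwa [hEp] at this
  have hLd := hE'.to_localInverse.hasFDerivAt; have hR := hE'.eventually_right_inverse
  rw [hEp] at hLd hR
  obtain ⟨C1, hC1, hh⟩ := isBigO_sq_of_contDiffAt (h := fun t => (conj ν * (γ t - γ t0)).re)
    (reCLM.contDiff.contDiffAt.comp t0 (contDiffAt_const.mul (hγ.sub contDiffAt_const))) (by simp) (by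
      rw [real_inner_comm, inner_eq_re_conj_mul] at hperp
      exact (reCLM.hasFDerivAt.comp_hasDerivAt t0 (((hγ.differentiableAt
        two_ne_zero).hasDerivAt.sub_const _).const_mul (conj ν))).deriv.trans hperp)
  obtain ⟨C2, hC2, hB⟩ := hLd.isBigO_sub.exists_pos
  obtain ⟨δ1, hδ1, hb1⟩ := eventually_nhds_iff_ball.mp hE'.eventually_left_inverse
  obtain ⟨δ2, hδ2, hb2⟩ := eventually_nhds_iff_ball.mp
    (hh.and (hfr.and ((hγ.eventually (by simp)).mono fun t ht => ht.continuousAt)))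
  obtain ⟨δ3, hδ3, hb3⟩ := eventually_nhds_iff_ball.mp (hE'.continuousAt.tendsto.eventually
    (p := fun p => p ∈ frontier Ω → p ∈ γ '' ball t0 δ1) (by
      rw [hEp]; exact hloc _ (ball_mem_nhds _ hδ1)))
  obtain ⟨δ, hδ, d1, d2, d3⟩ : ∃ δ > 0, δ ≤ δ1 ∧ δ ≤ δ2 ∧ δ ≤ δ3 :=
    ⟨min δ1 (min δ2 δ3), by positivity, by simp, by simp, by simp⟩
  have hmb : ∀ {t s d : ℝ}, |t - t0| < d → |s| < d → (t, s) ∈ ball (t0, (0 : ℝ)) d :=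
    fun h1 h2 => max_lt h1 (by simpa using h2)
  -- In a small box the frontier is exactly `s = 0`: by `hloc` frontier points nearby lie on a short
  -- piece of the curve, and the coordinates are injective.
  have hnf : ∀ t s, |t - t0| < δ → |s| < δ → s ≠ 0 → γ t - s * ν ∉ frontier Ω := by
    intro t s ht hs hs0 hmem
    obtain ⟨t', ht', h1⟩ := hb3 (t, s) (hmb (ht.trans_le d3) (hs.trans_le d3)) hmem
    have h2 := hb1 (t, s) (hmb (ht.trans_le d1) (hs.trans_le d1))
    have h3 := hb1 (t', 0) (hmb ht' (by simpa))
    grind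
  -- the coordinates of the transversal path
  have hesymm : e.symm (m * ν) = (0, -m) := by
    rw [ContinuousLinearEquiv.symm_apply_eq]; show _ = (0 : ℝ) • deriv γ t0 - (-m) • ν; simp
  have hud : HasDerivAt (fun ε => (L (p ε)).2) (-m) 0 := by
    rw [← hp0] at hLd
    have := (ContinuousLinearMap.snd ℝ ℝ ℝ).hasFDerivAt.comp_hasDerivAt (0 : ℝ)
      (hLd.comp_hasDerivAt (0 : ℝ) hp)
    simp only [ContinuousLinearEquiv.coe_coe, hesymm] at this; exact this
  have hpt : Tendsto p (𝓝 0) (𝓝 (γ t0)) := hp0 ▸ hp.continuousAt.tendsto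
  have hLt : Tendsto L (𝓝 (γ t0)) (𝓝 (t0, 0)) := hL0 ▸ hLd.continuousAt.tendsto
  have hsl : ∀ᶠ ε in 𝓝 (0 : ℝ), ε ≠ 0 → ε⁻¹ * (L (p ε)).2 < 0 := by
    have := (hasDerivAt_iff_tendsto_slope_zero.mp hud).eventually_lt_const (neg_lt_zero.mpr hm)
    rw [eventually_nhdsWithin_iff] at this; simpa [hp0, hL0] using this
  obtain ⟨ρ, hρ, hbρ⟩ := eventually_nhds_iff_ball.mp (hsl.and (hpt.eventually (hR.and
    (hLt.eventually (ball_mem_nhds _ hδ)))))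
  have hpos : ∀ ε : ℝ, |ε| < ρ → ε ≠ 0 → ∃ t s : ℝ, |t - t0| < δ ∧ |s| < δ ∧ p ε = γ t - s * ν ∧
      ε⁻¹ * s < 0 := fun ε h1 h2 => by
    obtain ⟨h3, h4, h5⟩ := hbρ ε (by simpa using h1)
    rw [Prod.dist_eq, max_lt_iff] at h5
    exact ⟨_, _, h5.1, by simpa using h5.2, h4.symm, h3 h2⟩
  obtain ⟨ε, hε : 0 < ε, ⟨hεm, hεp⟩, hερ⟩ := (eventually_mem_nhdsWithin.and (hside.and (nhdsWithin_le_nhds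
    (gt_mem_nhds hρ)))).exists
  have hconn : ∀ I : Set ℝ, IsPreconnected I →
      IsPreconnected ((fun q : ℝ × ℝ => γ q.1 - q.2 * ν) '' (ball t0 δ ×ˢ I)) := by
    intro I hI; refine ((convex_ball t0 δ).isPreconnected.prod hI).image _ ?_
    refine ContinuousOn.sub (fun q hq => ?_) (by fun_prop)
    have h1 : ContinuousAt γ q.1 := (hb2 q.1 (ball_subset_ball d2 hq.1)).2.2; fun_prop
  -- The half-box `s > 0` is connected and misses the frontier. One point of the transversal path
  -- lies in it and in `Ω`, so all of it does. The half-box `s < 0` is excluded in the same way.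
  have hminus : ∀ t s : ℝ, |t - t0| < δ → 0 < s → s < δ → γ t - s * ν ∈ Ω := by
    have h1 := subset_of_disjoint_frontier ho (hconn (Ioo 0 δ) isPreconnected_Ioo) ?_ ?_
    · exact fun t s ht hs hs' => h1 ⟨(t, s), ⟨ht, hs, hs'⟩, rfl⟩
    · obtain ⟨t, s, e1, e2, e3, e4⟩ := hpos (-ε) (by rwa [abs_neg, abs_of_pos hε]) (by linarith)
      rw [inv_neg, neg_mul, neg_lt_zero] at e4
      exact ⟨_, ⟨(t, s), ⟨e1, pos_of_mul_pos_right e4 (inv_pos.mpr hε).le, (abs_lt.mp e2).2⟩, rfl⟩,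
        (congrArg (· ∈ Ω) e3).mp hεm⟩
    · rintro _ ⟨⟨t, s⟩, ⟨h2, h3, h4⟩, rfl⟩
      exact hnf t s h2 (by rwa [abs_of_pos h3]) h3.ne'
  have hplus : ∀ t s : ℝ, |t - t0| < δ → s < 0 → -δ < s → γ t - s * ν ∉ Ω := by
    intro t s ht hs hs' hmem
    have h1 := subset_of_disjoint_frontier ho (hconn (Ioo (-δ) 0) isPreconnected_Ioo)
      ⟨_, ⟨(t, s), ⟨ht, hs', hs⟩, rfl⟩, hmem⟩ (by
        rintro _ ⟨⟨t, s⟩, ⟨h2, h3, h4⟩, rfl⟩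
        exact hnf t s h2 (by rw [abs_of_neg h4]; linarith) h4.ne)
    obtain ⟨t, s, e1, e2, e3, e4⟩ := hpos ε (by rwa [abs_of_pos hε]) hε.ne'
    exact hεp (e3 ▸ h1 ⟨(t, s), ⟨e1, (abs_lt.mp e2).1, (pos_iff_neg_of_mul_neg e4).mp
      (inv_pos.mpr hε)⟩, rfl⟩)
  obtain ⟨r, hr, hbr⟩ := eventually_nhds_iff_ball.mp (hR.and (hB.bound.and
    (hLt.eventually (ball_mem_nhds _ hδ))))
  refine ⟨δ, hδ, r, hr, C1 + C2, by positivity, hminus, fun z hz => ?_, fun t ht =>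
    (hb2 t (ht.trans_le d2)).1.trans (mul_le_mul_of_nonneg_right (by linarith) (sq_nonneg _))⟩
  obtain ⟨h1, h2, h3⟩ := hbr z hz; rw [← hL, hL0, Prod.norm_def] at h2
  rw [Prod.dist_eq, max_lt_iff] at h3; have h4 := mul_nonneg hC1.le (norm_nonneg (z - γ t0))
  have h5 := (le_max_left _ _).trans h2; have h6 := (le_max_right _ _).trans h2
  simp only [Prod.fst_sub, Prod.snd_sub, sub_zero, norm_eq_abs] at h5 h6
  simp only [Real.dist_eq, sub_zero] at h3
  refine ⟨_, _, by linarith, by linarith, h3.1, h3.2, h1.symm, fun hzΩ => ?_⟩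
  by_contra hs; rcases (not_lt.mp hs).lt_or_eq with h | h
  · exact hplus _ _ h3.1 h (by linarith [(abs_lt.mp h3.2).1]) (by rwa [h1])
  · have h7 := (hb2 _ (h3.1.trans_le d2)).2.1; rw [h, ofReal_zero, zero_mul, sub_zero] at h1
    rw [ho.frontier_eq, h1] at h7; exact h7.2 hzΩ

/-! ### Analytic functions on a region with the asymptotics of the potential at the vertex -/

/-- `P` is analytic on a region `Ω` of the strip that fills the strip near its end `re → -∞`,
`Re P` vanishes on the boundary and `Re P ∼ Re e^{-l/2b}` at the end. -/
structure IsUniformizer (b : ℝ) (Ω : Set ℂ) (P : ℂ → ℂ) : Prop where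
  isOpen : IsOpen Ω
  isPreconnected : IsPreconnected Ω
  subset : Ω ⊆ logAngle b
  bounded : ∃ M : ℝ, ∀ l ∈ Ω, l.re ≤ M
  vertex : ∃ R : ℝ, ∀ l ∈ logAngle b, l.re < R → l ∈ Ω
  differentiableOn : DifferentiableOn ℂ P Ω
  tendsto_re : ∀ p ∈ frontier Ω, Tendsto (fun z => (P z).re) (𝓝[Ω] p) (𝓝 0)
  near : ∀ ε > 0, ∃ R : ℝ, ∀ l ∈ logAngle b, l.re < R →
    |(P l).re - (exp (-l / (2 * b))).re| ≤ ε * (exp (-l / (2 * b))).re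

include hb

/-- The coordinate `v = e^{-l/2b}` identifies the strip with the right half-plane and the vertex
with infinity. In it the normalisation at the vertex reads `Re P ∼ Re v`. -/
theorem log_chart {v : ℂ} (hv : 0 < v.re) :
    -2 * b * log v ∈ logAngle b ∧ (-2 * b * log v).re = -2 * b * Real.log ‖v‖ ∧
      exp (-(-2 * b * log v) / (2 * b)) = v := by
  have e : (-2 * b * log v : ℂ) = ((-2 * b : ℝ) : ℂ) * log v := by push_cast; ring
  have hb' : (b : ℂ) ≠ 0 := ofReal_ne_zero.mpr hb.ne'
  refine ⟨?_, by rw [e, re_ofReal_mul, log_re], ?_⟩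
  · show |(_ : ℂ).im| < _
    rw [e, im_ofReal_mul, log_im, abs_mul, abs_of_neg (by linarith)]
    have := abs_arg_lt_pi_div_two_iff.mpr (Or.inl hv); nlinarith
  · rw [show -(-2 * b * log v) / (2 * b) = log v by field_simp, exp_log (by rintro rfl; simp at hv)]

theorem re_exp_neg_div_pos (h : l ∈ logAngle b) :
    0 < (exp (-l / (2 * b))).re := by
  rw [exp_re, neg_div, neg_im, Real.cos_neg]
  exact mul_pos (exp_pos _) (cos_pos_of_mem_Ioo (abs_lt.mp (by
    rw [div_two_mul_im]; exact abs_im_div_lt hb h)))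

theorem log_chart_symm (h : l ∈ logAngle b) :
    -2 * b * log (exp (-l / (2 * b))) = l := by
  have hb' : (b : ℂ) ≠ 0 := ofReal_ne_zero.mpr hb.ne'; have := abs_lt.mp (abs_im_div_lt hb h)
  rw [log_exp (by rw [neg_div, neg_im, div_two_mul_im]; linarith)
    (by rw [neg_div, neg_im, div_two_mul_im]; linarith)]
  field_simp

omit hb

theorem norm_exp_neg_div (l : ℂ) : ‖exp (-l / (2 * b))‖ = rexp (-l.re / (2 * b)) := by
  rw [norm_exp, div_two_mul_re, neg_re]

namespace IsUniformizer

/-- Far out `|Re(P - v)| ≤ (ε/24) Re v`. On the disk of radius `Re v / 2` this is at most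
`(ε/24)(3/2) Re v`, so the gradient estimate gives `|(P - v)'| ≤ ε`. The real part alone thus
controls the derivative, up to the boundary. -/
theorem exists_lipschitz (h : IsUniformizer b Ω P) (hb : 0 < b) {ε : ℝ} (hε : 0 < ε) :
    ∃ R0 > 0, (∀ l ∈ logAngle b, R0 < ‖exp (-l / (2 * b))‖ → l ∈ Ω) ∧
      ∀ K ⊆ {v : ℂ | 0 < v.re ∧ R0 < ‖v‖}, Convex ℝ K → ∀ v ∈ K, ∀ v' ∈ K,
        ‖(P (-2 * b * log v) - v) - (P (-2 * b * log v') - v')‖ ≤ ε * ‖v - v'‖ := by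
  obtain ⟨R1, h1⟩ := h.vertex
  obtain ⟨R2, h2⟩ := h.near (ε / 24) (by positivity)
  set R := min R1 R2 with hR; set R0 := rexp (-R / (2 * b)) with hR₀
  have hre : ∀ l ∈ logAngle b, R0 < ‖exp (-l / (2 * b))‖ → l.re < R := fun l _ hn => by
    rw [norm_exp_neg_div, hR₀, exp_lt_exp, div_lt_div_iff_of_pos_right (by linarith)] at hn
    linarith
  have hmem : ∀ v : ℂ, 0 < v.re → R0 < ‖v‖ →
      -2 * b * log v ∈ Ω ∧ |(P (-2 * b * log v) - v).re| ≤ ε / 24 * v.re := fun v hv hn => by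
    obtain ⟨c1, c2, c3⟩ := log_chart hb hv
    have c4 := hre _ c1 (by rwa [c3])
    have c5 := h2 _ c1 (c4.trans_le (min_le_right _ _)); simp_all
  have hdiff : ∀ v : ℂ, 0 < v.re → R0 < ‖v‖ →
      DifferentiableAt ℂ (fun v => P (-2 * b * log v) - v) v := fun v hv hn =>
    (DifferentiableAt.comp v (h.differentiableOn.differentiableAt
      (h.isOpen.mem_nhds (hmem v hv hn).1)) ((differentiableAt_log (Or.inl hv)).const_mul _)).sub
      differentiableAt_id
  have hR0 : 0 < R0 := exp_pos _
  -- The doubled radius leaves room for disks of radius `Re w / 2 ≤ |w| / 2`.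
  refine ⟨2 * R0, by positivity, fun l hl hn => h1 l hl ((hre l hl (by linarith)).trans_le
    (min_le_left _ _)), fun K hK hKc v hv v' hv' => ?_⟩
  refine hKc.norm_image_sub_le_of_norm_deriv_le (𝕜 := ℂ)
    (fun w hw => hdiff w (hK hw).1 (by linarith [(hK hw).2])) (fun w hw => ?_) hv' hv
  obtain ⟨hw1, hw2⟩ := hK hw
  have hball : ∀ z ∈ ball w (w.re / 2), 0 < z.re ∧ z.re < 3 / 2 * w.re ∧ R0 < ‖z‖ := by
    intro z hz; rw [mem_ball, dist_eq_norm] at hz; have e1 := abs_le.mp (abs_re_le_norm (z - w))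
    have e2 := norm_sub_norm_le w z; rw [norm_sub_rev] at e2; rw [sub_re] at e1
    have e3 := re_le_norm w
    exact ⟨by linarith, by linarith, by linarith⟩
  have := norm_deriv_le_of_abs_re_le (S := ε / 24 * (3 / 2 * w.re)) (half_pos hw1)
    (fun z hz => (hdiff z (hball z hz).1 (hball z hz).2.2).differentiableWithinAt)
    (fun z hz => (hmem z (hball z hz).1 (hball z hz).2.2).2.trans
      (mul_le_mul_of_nonneg_left (hball z hz).2.1.le (by positivity)))
  refine this.trans_eq ?_; field_simp; ring

/-- A half-plane without a disk is not convex, but outside a larger disk it is covered by the three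
convex pieces `Re v > R0`, `Im v > R0` and `Im v < -R0`. The Lipschitz bound is used on each. -/
theorem norm_sub_exp_le (h : IsUniformizer b Ω P) (hb : 0 < b) {ε : ℝ} (hε : 0 < ε) :
    ∃ R C : ℝ, ∀ l ∈ logAngle b, l.re < R → l ∈ Ω ∧
      ‖P l - exp (-l / (2 * b))‖ ≤ ε * ‖exp (-l / (2 * b))‖ + C := by
  obtain ⟨R0, hR0, hΩ, hL⟩ := h.exists_lipschitz hb hε
  have key : ∀ K : Set ℂ, Convex ℝ K → K ⊆ {v : ℂ | 0 < v.re ∧ R0 < ‖v‖} →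
      ∃ C, ∀ v ∈ K, ‖P (-2 * b * log v) - v‖ ≤ ε * ‖v‖ + C := by
    intro K hc hK; rcases K.eq_empty_or_nonempty with rfl | ⟨w, hw⟩
    · simp
    refine ⟨ε * ‖w‖ + ‖P (-2 * b * log w) - w‖, fun v hv => ?_⟩; have e1 := hL K hK hc v hv w hw
    have e2 := norm_sub_norm_le (P (-2 * b * log v) - v) (P (-2 * b * log w) - w)
    have e3 := mul_le_mul_of_nonneg_left (norm_sub_le v w) hε.le; linarith
  have hH := convex_halfSpace_re_gt (r := 0)
  obtain ⟨C1, h1⟩ := key {v | R0 < v.re} (convex_halfSpace_re_gt _)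
    fun v hv => ⟨hR0.trans hv, lt_of_lt_of_le hv (re_le_norm v)⟩
  obtain ⟨C2, h₂⟩ := key ({v | 0 < v.re} ∩ {v | R0 < v.im}) (hH.inter (convex_halfSpace_im_gt _))
    fun v hv => ⟨hv.1, lt_of_lt_of_le hv.2 (im_le_norm v)⟩
  obtain ⟨C3, h3⟩ := key ({v | 0 < v.re} ∩ {v | v.im < -R0}) (hH.inter (convex_halfSpace_im_lt _))
    fun v hv => ⟨hv.1, by
      have := (abs_le.mp (abs_im_le_norm v)).1
      grind⟩
  refine ⟨-2 * b * Real.log (2 * R0), max C1 (max C2 C3), fun l hl hre => ?_⟩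
  have hn : 2 * R0 < ‖exp (-l / (2 * b))‖ := by
    rw [norm_exp_neg_div, ← log_lt_iff_lt_exp (by linarith), lt_div_iff₀ (by linarith)]
    linarith
  refine ⟨hΩ l hl (by linarith), ?_⟩
  have hp := re_exp_neg_div_pos hb hl; set v := exp (-l / (2 * b)) with hv
  suffices ‖P (-2 * b * log v) - v‖ ≤ ε * ‖v‖ + max C1 (max C2 C3) by
    rwa [log_chart_symm hb hl] at this
  have m1 := le_max_left C1 (max C2 C3); have m2 := (le_max_left C2 C3).trans (le_max_right C1 _)
  have m3 := (le_max_right C2 C3).trans (le_max_right C1 _)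
  by_cases c1 : R0 < v.re
  · linarith [h1 v c1]
  by_cases c2 : R0 < v.im
  · grind
  by_cases c3 : v.im < -R0
  · grind
  have := norm_le_abs_re_add_abs_im v; rw [abs_of_pos hp] at this
  linarith [abs_le.mpr ⟨not_lt.mp c3, not_lt.mp c2⟩]

/-- For `ε = 1/2`, equal values of `P` imply `|v - v'| ≤ |v - v'|/2`. -/
theorem exists_injOn (h : IsUniformizer b Ω P) (hb : 0 < b) : ∃ R0 > 0,
    (∀ l ∈ logAngle b, R0 < ‖exp (-l / (2 * b))‖ → l ∈ Ω) ∧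
      InjOn P {l | l ∈ logAngle b ∧ R0 < (exp (-l / (2 * b))).re} := by
  obtain ⟨R0, hR0, hΩ, hL⟩ := h.exists_lipschitz hb one_half_pos
  refine ⟨R0, hR0, hΩ, fun l hl l' hl' he => ?_⟩
  have := hL {v | R0 < v.re} (fun v hv => ⟨hR0.trans hv, lt_of_lt_of_le hv (re_le_norm v)⟩)
    (convex_halfSpace_re_gt _) _ hl.2 _ hl'.2
  rw [log_chart_symm hb hl.1, log_chart_symm hb hl'.1, he, sub_sub_sub_cancel_left,
    norm_sub_rev] at this
  have h0 : ‖exp (-l / (2 * b)) - exp (-l' / (2 * b))‖ ≤ 0 := by linarith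
  rw [← log_chart_symm hb hl.1, sub_eq_zero.mp (norm_le_zero_iff.mp h0), log_chart_symm hb hl'.1]

theorem tendsto_of_re (h : IsUniformizer b Ω P) (hb : 0 < b) (B : ℝ) :
    ∃ R : ℝ, ∀ l ∈ Ω, ‖P l‖ ≤ B → R ≤ l.re := by
  obtain ⟨R, C, hRC⟩ := h.norm_sub_exp_le hb one_half_pos
  refine ⟨min R (-2 * b * Real.log (2 * (|B| + |C| + 1))), fun l hl hB => ?_⟩; by_contra hlt
  rw [not_le, lt_min_iff] at hlt; have e1 := (hRC l (h.subset hl) hlt.1).2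
  have e2 : 2 * (|B| + |C| + 1) < ‖exp (-l / (2 * b))‖ := by
    rw [norm_exp_neg_div, ← log_lt_iff_lt_exp (by positivity), lt_div_iff₀ (by linarith)]
    linarith [hlt.2]
  have e3 := norm_sub_norm_le (exp (-l / (2 * b))) (P l); rw [norm_sub_rev] at e3; grind

theorem exists_isCompact (h : IsUniformizer b Ω P) (hb : 0 < b) (B : ℝ) :
    ∃ K : Set ℂ, IsCompact K ∧ ∀ l ∈ Ω, ‖P l‖ ≤ B → l ∈ K := by
  obtain ⟨R, hR⟩ := h.tendsto_of_re hb B; obtain ⟨M, hM⟩ := h.bounded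
  exact ⟨Icc R M ×ℂ Icc (-(π * b)) (π * b), isCompact_Icc.reProdIm isCompact_Icc,
    fun l hl hB => ⟨⟨hR l hl hB, hM l hl⟩, abs_le.mp (show |l.im| < _ from h.subset hl).le⟩⟩

theorem isOpen_image (h : IsUniformizer b Ω P) (hb : 0 < b) :
    ∀ s ⊆ Ω, IsOpen s → IsOpen (P '' s) := by
  rcases (h.differentiableOn.analyticOnNhd h.isOpen).is_constant_or_isOpen h.isPreconnected
    with ⟨w, hw⟩ | h1
  · obtain ⟨R, hR⟩ := h.tendsto_of_re hb ‖w‖; obtain ⟨R', hR'⟩ := h.vertex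
    have hm : ((min R R' - 1 : ℝ) : ℂ) ∈ Ω := hR' _ (by
      show |(_ : ℂ).im| < _
      rw [ofReal_im, abs_zero]; positivity) (by rw [ofReal_re]; grind)
    have := hR _ hm (by rw [hw _ hm])
    rw [ofReal_re] at this; grind
  · exact h1

/-- The maximum principle for `-P` gives `Re P ≥ 0`; superlevel sets are bounded because `Re P ≥ 0`
near the vertex. The open mapping property makes the inequality strict. -/
theorem re_pos (h : IsUniformizer b Ω P) (hb : 0 < b) : ∀ z ∈ Ω, 0 < (P z).re := by
  have h0 : ∀ z ∈ Ω, 0 ≤ (P z).re := fun z hz => by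
    have := re_nonpos_of_frontier h.isOpen (F := fun z => -P z) h.differentiableOn.neg
      (fun ε hε => ?_) (fun p hp ε hε => ?_) z hz
    · simpa using this
    · obtain ⟨R, hR⟩ := h.near 1 one_pos; obtain ⟨M, hM⟩ := h.bounded
      refine ((isCompact_Icc (a := R) (b := M)).reProdIm
        (isCompact_Icc (a := -(π * b)) (b := π * b))).isBounded.subset ?_
      rintro z ⟨hz, hz'⟩; refine ⟨⟨?_, hM z hz⟩, abs_le.mp (show |z.im| < _ from h.subset hz).le⟩
      by_contra hlt; have e1 := (abs_le.mp (hR z (h.subset hz) (not_le.mp hlt))).1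
      rw [neg_re] at hz'; linarith
    · have := (h.tendsto_re p hp).neg; rw [neg_zero] at this
      simpa using this.eventually_lt_const hε
  intro z hz
  obtain ⟨ρ, hρ, hb'⟩ := Metric.isOpen_iff.mp (h.isOpen_image hb Ω subset_rfl h.isOpen) (P z)
    ⟨z, hz, rfl⟩
  obtain ⟨z', hz', e⟩ := hb' (show P z - (ρ / 2 : ℝ) ∈ ball (P z) ρ by
    rw [mem_ball, dist_eq_norm, sub_sub_cancel_left, norm_neg, norm_real, norm_eq_abs,
      abs_of_pos (by linarith)]
    linarith)
  have := h0 z' hz'; rw [e, sub_re, ofReal_re] at this; linarith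

/-- Properness of `P` over the open half-plane: bounded values keep the points in a compact set, and
convergence to the frontier would force `Re P → 0`. -/
theorem exists_of_ultrafilter (h : IsUniformizer b Ω P) (hb : 0 < b) {u : Ultrafilter ℂ} {W : ℂ}
    (hW : 0 < W.re) (hu : Ω ∈ u) (hP : Tendsto P u (𝓝 W)) :
    ∃ z ∈ Ω, P z = W ∧ (u : Filter ℂ) ≤ 𝓝 z := by
  obtain ⟨K, hK, hKm⟩ := h.exists_isCompact hb (‖W‖ + 1)
  have hKu : K ∈ u := by
    filter_upwards [hu, hP.norm.eventually_lt_const (lt_add_one ‖W‖)] with z h1 h2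
    exact hKm z h1 h2.le
  obtain ⟨z, -, hz⟩ := hK.ultrafilter_le_nhds u (le_principal_iff.mpr hKu)
  have hzΩ : z ∈ Ω := by
    by_contra hn
    have hf : z ∈ frontier Ω := by
      rw [h.isOpen.frontier_eq]; exact ⟨mem_closure_iff_ultrafilter.mpr ⟨u, hu, hz⟩, hn⟩
    have := tendsto_nhds_unique ((continuous_re.tendsto W).comp hP)
      ((h.tendsto_re z hf).mono_left (le_inf hz (le_principal_iff.mpr hu)))
    linarith
  exact ⟨z, hzΩ, tendsto_nhds_unique ((h.differentiableOn.continuousOn.continuousAt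
    (h.isOpen.mem_nhds hzΩ)).tendsto.mono_left hz) hP, hz⟩

theorem eventually_mem (h : IsUniformizer b Ω P) (hb : 0 < b) {V : Set ℂ} {W : ℂ}
    (hW : 0 < W.re) (hV : ∀ z ∈ Ω, P z = W → V ∈ 𝓝 z) :
    ∀ᶠ W' in 𝓝 W, ∀ z ∈ Ω, P z = W' → z ∈ V := by
  suffices ∀ᶠ z in comap P (𝓝 W), z ∈ Ω → z ∈ V by
    filter_upwards [eventually_comap.mp this] with W' h1 z hz he using h1 z he hz
  by_contra hne
  obtain ⟨u, hu, hu'⟩ : ∃ u : Ultrafilter ℂ, ↑u ≤ comap P (𝓝 W) ∧ ∀ᶠ z in u, ¬(z ∈ Ω → z ∈ V) := by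
    have := frequently_iff_neBot.mp (not_eventually.mp hne)
    exact ⟨Ultrafilter.of _, (Ultrafilter.of_le _).trans inf_le_left,
      (Ultrafilter.of_le _).trans inf_le_right (mem_principal_self _)⟩
  obtain ⟨z, hz, e, hle⟩ := h.exists_of_ultrafilter hb (u := u) hW (by simp_all)
    (tendsto_comap.mono_left hu)
  obtain ⟨z', h1, h2⟩ := (hu'.and (show ∀ᶠ z in u, z ∈ V from hle (hV z hz e))).exists
  exact h1 fun _ => h2

/-- Large values of `Re P` come only from the neighbourhood of the vertex, where `Re P ≤ 2 Re
e^{-l/2b}`. Otherwise a limit point in the compact remainder would contradict either continuity of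
`P` or its boundary values. -/
theorem exists_re_bound (h : IsUniformizer b Ω P) (R0 : ℝ) :
    ∃ B : ℝ, ∀ l ∈ Ω, B < (P l).re → R0 < (exp (-l / (2 * b))).re := by
  obtain ⟨R, hR⟩ := h.near 1 one_pos; obtain ⟨M, hM⟩ := h.bounded; by_contra hno
  push Not at hno
  choose g hg1 hg2 hg3 using hno
  have hre : ∀ᶠ B in atTop, R ≤ (g B).re := by
    filter_upwards [eventually_ge_atTop (2 * R0)] with B hB; by_contra hlt
    have e1 := (abs_le.mp (hR _ (h.subset (hg1 B)) (not_le.mp hlt))).2; grind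
  set u := Ultrafilter.of (map g atTop) with hu
  have hu' : (u : Filter ℂ) ≤ map g atTop := Ultrafilter.of_le _
  obtain ⟨z, -, hz⟩ := ((isCompact_Icc (a := R) (b := M)).reProdIm (isCompact_Icc (a := -(π * b))
    (b := π * b))).ultrafilter_le_nhds u (le_principal_iff.mpr (hu' (mem_map.mpr (by
    filter_upwards [hre] with B hB
    exact ⟨⟨hB, hM _ (hg1 B)⟩, abs_le.mp (show |(g B).im| < _ from h.subset (hg1 B)).le⟩))))
  have huΩ : Ω ∈ u := hu' (mem_map.mpr (univ_mem' hg1))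
  have hlim : ∃ a, Tendsto (fun z => (P z).re) u (𝓝 a) := by
    by_cases hzΩ : z ∈ Ω
    · exact ⟨_, (continuous_re.continuousAt.comp (h.differentiableOn.continuousOn.continuousAt
        (h.isOpen.mem_nhds hzΩ))).tendsto.mono_left hz⟩
    · exact ⟨0, (h.tendsto_re z (by
        rw [h.isOpen.frontier_eq]
        exact ⟨mem_closure_iff_ultrafilter.mpr ⟨u, huΩ, hz⟩, hzΩ⟩)).mono_left (le_inf hz
          (le_principal_iff.mpr huΩ))⟩
  obtain ⟨a, ha⟩ := hlim
  have h1 : ∀ᶠ z in u, a + 1 < (P z).re := hu' (mem_map.mpr (by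
    filter_upwards [eventually_gt_atTop (a + 1)] with B hB using hB.trans (hg2 B)))
  obtain ⟨w, h2, h3⟩ := (h1.and (ha.eventually_lt_const (lt_add_one a))).exists; linarith

/-- A degree argument. The set of values with exactly one preimage, and that one noncritical, is
open by properness. Its complement in the half-plane is open too: two distinct preimages persist, a
critical point produces two preimages for all nearby values, and values not taken form an open set.
It is nonempty because far to the left `P` is injective, and values with large real part are taken
only there. The half-plane is connected. -/
theorem bijOn (h : IsUniformizer b Ω P) (hb : 0 < b) : BijOn P Ω {W | 0 < W.re} := by
  have ho := h.isOpen_image hb; have han := h.differentiableOn.analyticOnNhd h.isOpen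
  set N := {W : ℂ | 0 < W.re ∧ ∃ z ∈ Ω, P z = W ∧ deriv P z ≠ 0 ∧ ∀ z' ∈ Ω, P z' = W → z' = z}
    with hN
  suffices hsub : {W : ℂ | 0 < W.re} ⊆ N by
    refine ⟨fun z hz => h.re_pos hb z hz, fun z hz z' hz' e => ?_, fun W hW => ?_⟩
    · obtain ⟨-, w, -, -, -, hw⟩ := hsub (h.re_pos hb z hz); grind
    grind
  have hNo : IsOpen N := by
    refine isOpen_iff_mem_nhds.mpr ?_; rintro W ⟨hW, z, hz, rfl, hd, huniq⟩
    obtain ⟨H, -, -, -, hl, -⟩ := (han z hz).exists_local_inverse hd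
    obtain ⟨V, hV, hVo, hzV⟩ := _root_.eventually_nhds_iff.mp (hl.and ((h.isOpen.mem_nhds hz)))
    have hinj : InjOn P V := fun p hp q hq e => by grind
    have hVΩ : V ⊆ Ω := fun p hp => (hV p hp).2
    filter_upwards [h.eventually_mem hb hW (V := V) fun z' hz' e => huniq z' hz' e ▸
      hVo.mem_nhds hzV, (ho V hVΩ hVo).mem_nhds ⟨z, hzV, rfl⟩, isOpen_halfPlane.mem_nhds hW]
      with W' h1 ⟨z', hz', e⟩ h3
    exact ⟨h3, z', hVΩ hz', e, deriv_ne_zero_of_injOn hVo (h.differentiableOn.mono hVΩ) hinj hz',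
      fun z'' hz'' e' => hinj (h1 z'' hz'' e') hz' (e'.trans e.symm)⟩
  have htwo : ∀ W, (∃ z1 ∈ Ω, ∃ z2 ∈ Ω, z1 ≠ z2 ∧ P z1 = W ∧ P z2 = W) → ∀ᶠ W' in 𝓝 W, W' ∉ N := by
    rintro W ⟨z1, h1, z2, h2, hne, rfl, e⟩
    obtain ⟨V1, V2, o1, o2, m1, m2, hdis⟩ := t2_separation hne
    filter_upwards [(ho _ inter_subset_right (o1.inter h.isOpen)).mem_nhds ⟨z1, ⟨m1, h1⟩, rfl⟩,
      (ho _ inter_subset_right (o2.inter h.isOpen)).mem_nhds ⟨z2, ⟨m2, h2⟩, e⟩]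
    rintro W' ⟨p, hp, e1⟩ ⟨q, hq, e2⟩ ⟨-, z, -, -, -, hz⟩; grind
  have hCo : IsOpen ({W : ℂ | 0 < W.re} \ N) := by
    refine isOpen_iff_mem_nhds.mpr fun W ⟨hW, hWN⟩ => ?_; have hW' := isOpen_halfPlane.mem_nhds hW
    by_cases h1 : ∃ z ∈ Ω, P z = W
    · obtain ⟨z, hz, e⟩ := h1
      by_cases h2 : ∃ z' ∈ Ω, P z' = W ∧ z' ≠ z
      · obtain ⟨z', hz', e', hne⟩ := h2
        filter_upwards [hW', htwo W ⟨z', hz', z, hz, hne, e', e⟩] with W' h3 h4 using ⟨h3, h4⟩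
      · have hnc : ¬∀ᶠ z' in 𝓝 z, P z' = P z := fun hc => by
          obtain ⟨V, hV, hVo, hzV⟩ := _root_.eventually_nhds_iff.mp (hc.and (h.isOpen.mem_nhds hz))
          have := ho V (fun p hp => (hV p hp).2) hVo
          rw [show P '' V = {P z} from Subset.antisymm (image_subset_iff.mpr fun p hp => (hV p hp).1)
            (singleton_subset_iff.mpr ⟨z, hzV, rfl⟩)] at this
          exact not_isOpen_singleton _ this
        have h3 := eventually_exists_two_preimages (han z hz) (by grind) hnc (h.isOpen.mem_nhds hz)
        rw [e, eventually_nhdsWithin_iff] at h3; filter_upwards [hW', h3] with W' h4 h5; grind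
    · filter_upwards [hW', h.eventually_mem hb hW (V := ∅) fun z hz e => (h1 ⟨z, hz, e⟩).elim]
        with W' h2 h3
      grind
  refine convex_halfPlane.isPreconnected.subset_left_of_subset_union hNo hCo
    disjoint_sdiff_right (fun W hW => by grind) ?_
  obtain ⟨R0, hR0, hΩ, hinj⟩ := h.exists_injOn hb
  set U := {ℓ | ℓ ∈ logAngle b ∧ R0 < (exp (-ℓ / (2 * b))).re} with hU
  have hUΩ : U ⊆ Ω := fun ℓ hℓ => hΩ ℓ hℓ.1 (hℓ.2.trans_le (re_le_norm _))
  obtain ⟨B, hB'⟩ := h.exists_re_bound R0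
  have hB : ∀ ℓ ∈ Ω, B < (P ℓ).re → ℓ ∈ U := fun ℓ hℓ hlt => ⟨h.subset hℓ, hB' ℓ hℓ hlt⟩
  obtain ⟨R1, hR1⟩ := h.near (1 / 2) one_half_pos
  -- a point of the real axis far to the left
  set s := min (min R1 (-2 * b * Real.log R0)) (-2 * b * (2 * |B| + 2)) - 1 with hs
  have hvn : (exp (-(s : ℂ) / (2 * b))).re = rexp (-s / (2 * b)) := by
    rw [show -(s : ℂ) / (2 * b) = ((-s / (2 * b) : ℝ) : ℂ) by push_cast; ring, exp_ofReal_re]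
  have hsA : (s : ℂ) ∈ logAngle b := by
    show |(_ : ℂ).im| < _; rw [ofReal_im, abs_zero]; positivity
  have m1 := min_le_left (min R1 (-2 * b * Real.log R0)) (-2 * b * (2 * |B| + 2))
  have m2 := min_le_right (min R1 (-2 * b * Real.log R0)) (-2 * b * (2 * |B| + 2))
  have m3 := min_le_left R1 (-2 * b * Real.log R0)
  have m4 := min_le_right R1 (-2 * b * Real.log R0)
  have hsU : (s : ℂ) ∈ U := ⟨hsA, by
    rw [hvn, ← log_lt_iff_lt_exp hR0, lt_div_iff₀ (by linarith)]
    linarith⟩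
  have hPB : B < (P s).re := by
    have e1 := (abs_le.mp (hR1 s hsA (by rw [ofReal_re]; linarith))).1
    have e2 : 2 * |B| + 2 < -s / (2 * b) := by
      rw [lt_div_iff₀ (by linarith)]
      linarith
    linarith [add_one_le_exp (-s / (2 * b)), le_abs_self B]
  exact ⟨P s, h.re_pos hb _ (hUΩ hsU), h.re_pos hb _ (hUΩ hsU), s, hUΩ hsU, rfl,
    deriv_ne_zero_of_injOn ((isOpen_logAngle b).inter (isOpen_lt continuous_const
      (continuous_re.comp (by fun_prop)))) (h.differentiableOn.mono hUΩ) hinj hsU,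
    fun z hz e => hinj (hB z hz (e ▸ hPB)) hsU e⟩

end IsUniformizer

/-! ### Regular boundary points -/

/-- At the boundary point `p` of `Ω`, the function `P` extends as a `C²` function with the value
`iy` and nonzero derivative, and the curvature condition of the free boundary holds. -/
def IsRegularPoint (Ω : Set ℂ) (P : ℂ → ℂ) (p : ℂ) (y : ℝ) : Prop :=
  ∃ d1 d2 : ℂ, d1 ≠ 0 ∧ Tendsto (deriv P) (𝓝[Ω] p) (𝓝 d1) ∧
    Tendsto (deriv (deriv P)) (𝓝[Ω] p) (𝓝 d2) ∧ Tendsto P (𝓝[Ω] p) (𝓝 (y * I)) ∧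
    ((d1 - d2) / d1 ^ 3).im = 0

/-- The boundary point lemma of Hopf. -/
theorem re_mul_neg_of_ball_subset {p ν d1 : ℂ} {ρ : ℝ} (ho : IsOpen Ω)
    (hP : DifferentiableOn ℂ P Ω) (hpos : ∀ z ∈ Ω, 0 < (P z).re) (hρ : 0 < ρ) (hν : ‖ν‖ = 1)
    (hball : ball (p - ρ * ν) ρ ⊆ Ω)
    (h0 : Tendsto (fun z => (P z).re) (𝓝[Ω] p) (𝓝 0))
    (h1 : Tendsto (deriv P) (𝓝[Ω] p) (𝓝 d1)) : (d1 * ν).re < 0 := by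
  by_contra hn
  have hdist : ∀ s : ℝ, ‖(p - s * ν) - (p - ρ * ν)‖ = |ρ - s| := fun s => by
    rw [show (p - s * ν) - (p - ρ * ν) = ((ρ - s : ℝ) : ℂ) * ν by push_cast; ring, norm_mul, hν,
      mul_one, norm_real, norm_eq_abs]
  have hmem : ∀ s : ℝ, 0 < s → s < ρ → p - s * ν ∈ ball (p - ρ * ν) ρ := fun s h h' => by
    rw [mem_ball, dist_eq_norm, hdist, abs_of_pos (by linarith)]
    linarith
  set c := p - ρ * ν with hc; have hPc : 0 < (P c).re := hpos c (hball (mem_ball_self hρ))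
  have hlow : ∀ s : ℝ, 0 < s → s < ρ → (P c).re / (4 * ρ) * s ≤ (P (p - s * ν)).re := by
    intro s h h'
    have := re_lower_bound_of_ball (hP.mono hball) (fun z hz => hpos z (hball hz)) (hmem s h h')
    rw [hdist, abs_of_pos (by linarith)] at this
    refine le_of_eq_of_le ?_ this; field_simp; ring
  have hseg : Tendsto (fun s : ℝ => p - s * ν) (𝓝[>] 0) (𝓝[Ω] p) := by
    refine tendsto_nhdsWithin_iff.mpr ⟨?_, ?_⟩
    · have : Tendsto (fun s : ℝ => p - s * ν) (𝓝 0) (𝓝 (p - (0 : ℝ) * ν)) := Continuous.tendsto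
        (by fun_prop) 0
      rw [ofReal_zero, zero_mul, sub_zero] at this; exact this.mono_left nhdsWithin_le_nhds
    · filter_upwards [Ioo_mem_nhdsGT hρ] with s hs using hball (hmem s hs.1 hs.2)
  -- Along the inner normal `Re P` grows at least like `κs`. Were `Re(d1 ν)` nonnegative, the
  -- derivative would eventually be below `κ/2` and the growth at most `κs/2`.
  set κ := (P c).re / (4 * ρ) with hκ
  have hκ0 : 0 < κ := by positivity
  obtain ⟨δ, hδ, hδ'⟩ := mem_nhdsGT_iff_exists_Ioo_subset.mp (((continuous_re.tendsto _).comp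
    ((h1.comp hseg).mul_const ν)).eventually_const_lt
    (show -(κ / 2) < (d1 * ν).re by linarith))
  have hδ0 : (0 : ℝ) < min δ ρ := lt_min hδ hρ
  have hder : ∀ s : ℝ, s ∈ Ioo 0 (min δ ρ) → HasDerivAt (fun s : ℝ => (P (p - s * ν)).re)
      (-(deriv P (p - s * ν) * ν).re) s := by
    intro s hs
    convert! (reCLM.hasFDerivAt.comp_hasDerivAt s ((hP.differentiableAt (ho.mem_nhds (hball (hmem s
      hs.1 (hs.2.trans_le (min_le_right _ _)))))).hasDerivAt.comp s (((ofRealCLM.hasDerivAt (x :=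
      s)).mul_const ν).const_sub p))) using 1
    simp
  have hle : ∀ s : ℝ, s ∈ Ioo 0 (min δ ρ) → (P (p - s * ν)).re ≤ κ / 2 * s := by
    intro s hs
    have hup : ∀ᶠ s' : ℝ in 𝓝[>] 0, (P (p - s * ν)).re - (P (p - s' * ν)).re ≤ κ / 2 * s := by
      filter_upwards [Ioo_mem_nhdsGT hs.1] with s' hs'
      have := (convex_Ioo 0 (min δ ρ)).image_sub_le_mul_sub_of_deriv_le (C := κ / 2)
        (f := fun s : ℝ => (P (p - s * ν)).re)
        (fun t ht => (hder t ht).continuousAt.continuousWithinAt)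
        (fun t ht => (hder t (interior_subset ht)).differentiableAt.differentiableWithinAt)
        (fun t ht => by
          have ht := interior_subset ht; rw [(hder t ht).deriv]
          have := hδ' ⟨ht.1, ht.2.trans_le (min_le_left _ _)⟩
          grind) s' ⟨hs'.1, hs'.2.trans hs.2⟩ s hs hs'.2.le
      have h2 : κ / 2 * s' > 0 := by simp_all
      linarith
    have := le_of_tendsto ((tendsto_const_nhds (x := (P (p - s * ν)).re)).sub (h0.comp hseg)) hup
    rwa [sub_zero] at this
  have hm : min δ ρ / 2 ∈ Ioo (0 : ℝ) (min δ ρ) := ⟨by linarith, by linarith⟩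
  have e1 := hle _ hm; have e2 := hlow _ hm.1 (hm.2.trans_le (min_le_right _ _)); nlinarith

/-- The curve leaves its tangent only quadratically, so a small disk tangent from inside fits. For
`w = conj ν (z - γ t0)` in the disk, `-Re w > |w|²/(2ρ) ≥ C³|w|²`, which beats the deviation of the
curve and makes the collar coordinate `s` positive. -/
theorem exists_ball_subset_of_collar {t0 : ℝ} {ν : ℂ} {δ r C : ℝ}
    (hν : ‖ν‖ = 1) (hr : 0 < r) (hC : 0 < C)
    (h₁ : ∀ t s : ℝ, |t - t0| < δ → 0 < s → s < δ → γ t - s * ν ∈ Ω)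
    (h₂ : ∀ z ∈ ball (γ t0) r, ∃ t s : ℝ, |t - t0| ≤ C * ‖z - γ t0‖ ∧
      |s| ≤ C * ‖z - γ t0‖ ∧ |t - t0| < δ ∧ |s| < δ ∧ z = γ t - s * ν ∧ (z ∈ Ω → 0 < s))
    (h3 : ∀ t : ℝ, |t - t0| < δ → |(conj ν * (γ t - γ t0)).re| ≤ C * (t - t0) ^ 2) :
    ∃ ρ : ℝ, 0 < ρ ∧ ball (γ t0 - ρ * ν) ρ ⊆ Ω := by
  have hνν : conj ν * ν = 1 := by rw [mul_comm, mul_conj', hν]; norm_num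
  set ρ := min (r / 2) (1 / (2 * (C * C ^ 2))) with hρ
  have hρ0 : 0 < ρ := lt_min (half_pos hr) (by positivity)
  refine ⟨ρ, hρ0, fun z hz => ?_⟩; rw [mem_ball, dist_eq_norm] at hz
  set w := conj ν * (z - γ t0) with hw
  have hwn : ‖w‖ = ‖z - γ t0‖ := by simp_all
  have e1 : ‖w + ρ‖ < ρ := by
    have : w + ρ = conj ν * (z - (γ t0 - ρ * ν)) := by grind
    simp_all
  have e2 : ‖w‖ ^ 2 + 2 * ρ * w.re < 0 := by
    have h1 := pow_lt_pow_left₀ e1 (norm_nonneg _) two_ne_zero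
    rw [Complex.sq_norm, normSq_apply, add_re, add_im, ofReal_re, ofReal_im] at h1
    rw [Complex.sq_norm, normSq_apply]; nlinarith
  have e3 : ‖z - γ t0‖ < r := by
    have h2 := norm_sub_le (w + ρ) ρ
    rw [add_sub_cancel_right, norm_real, norm_eq_abs, abs_of_pos hρ0] at h2; grind
  obtain ⟨t, s, q1, q2, q3, q4, q5, -⟩ := h₂ z (by rwa [mem_ball, dist_eq_norm])
  have e4 : s = (conj ν * (γ t - γ t0)).re - w.re := by
    have : conj ν * (γ t - γ t0) - w = (s : ℂ) := by grind
    rw [← sub_re, this, ofReal_re]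
  have e5 : (t - t0) ^ 2 ≤ C ^ 2 * ‖w‖ ^ 2 := by
    rw [← sq_abs, ← mul_pow, hwn]; exact pow_le_pow_left₀ (abs_nonneg _) q1 2
  have e6 := (abs_le.mp (h3 t q3)).1
  have e7 : ρ * (2 * (C * C ^ 2)) ≤ 1 := by
    rw [← le_div_iff₀ (by positivity)]
    exact min_le_right _ _
  have e8 := mul_le_mul_of_nonneg_left e5 hC.le; rw [q5]
  exact h₁ t s q3 (by nlinarith) (abs_lt.mp q4).2

/-- A bounded derivative makes `P` Lipschitz in the collar coordinates, where the region is locally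
a convex half-ball. Hence values are Cauchy at the boundary point, and the collar estimates transfer
the limit back. -/
theorem exists_tendsto_of_collar {t0 : ℝ} {ν : ℂ} {δ r C K : ℝ}
    (ho : IsOpen Ω) (hγ : ContDiffAt ℝ 2 γ t0) (hδ : 0 < δ) (hr : 0 < r) (hC : 0 < C)
    (h1 : ∀ t s : ℝ, |t - t0| < δ → 0 < s → s < δ → γ t - s * ν ∈ Ω)
    (h2 : ∀ z ∈ ball (γ t0) r, ∃ t s : ℝ, |t - t0| ≤ C * ‖z - γ t0‖ ∧
      |s| ≤ C * ‖z - γ t0‖ ∧ |t - t0| < δ ∧ |s| < δ ∧ z = γ t - s * ν ∧ (z ∈ Ω → 0 < s)) (hP :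
    DifferentiableOn ℂ P Ω) (hK : 0 < K)
    (hbd : ∀ᶠ z in 𝓝[Ω] (γ t0), ‖deriv P z‖ ≤ K) [(𝓝[Ω] (γ t0)).NeBot] :
    ∃ L, Tendsto P (𝓝[Ω] (γ t0)) (𝓝 L) := by
  set E : ℝ × ℝ → ℂ := fun q => γ q.1 - q.2 * ν with hEdef
  have hE : ContDiffAt ℝ 1 E (t0, 0) :=
    ((hγ.of_le one_le_two).comp (t0, (0 : ℝ)) contDiffAt_fst).sub
      ((ofRealCLM.contDiff.contDiffAt.comp _ contDiffAt_snd).mul contDiffAt_const)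
  have hE0 : E (t0, 0) = γ t0 := by simp [hEdef]
  obtain ⟨η, hη, hb⟩ := eventually_nhds_iff_ball.mp (((hE.eventually (by simp)).and
    ((hE.fderiv_right (m := 0) le_rfl).continuousAt.nnnorm.eventually_lt_const (lt_add_one _))).and
    ((hE.continuousAt.tendsto.eventually (p := fun z => z ∈ Ω → ‖deriv P z‖ ≤ K) (by
      rw [hE0]; exact eventually_nhdsWithin_iff.mp hbd)).and (ball_mem_nhds _ hδ)))
  have hlip : LipschitzOnWith (⟨K, hK.le⟩ * (‖fderiv ℝ E (t0, 0)‖₊ + 1)) (P ∘ E)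
      (ball (t0, 0) η ∩ {q | 0 < q.2}) := by
    have hq : ∀ q ∈ ball (t0, (0 : ℝ)) η ∩ {q | 0 < q.2}, E q ∈ Ω := fun q hq => by
      have := (hb q hq.1).2.2
      rw [Prod.dist_eq, max_lt_iff, Real.dist_eq, Real.dist_eq, sub_zero] at this; grind
    exact Convex.lipschitzOnWith_of_nnnorm_hasFDerivWithin_le (𝕜 := ℝ) (fun q h =>
      (HasDerivAt.comp_hasFDerivAt q (hP.differentiableAt (ho.mem_nhds (hq q h))).hasDerivAt
      ((hb q h.1).1.1.differentiableAt one_ne_zero).hasFDerivAt).hasFDerivWithinAt)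
      (fun q h => (nnnorm_smul_le _ _).trans (mul_le_mul' ((hb q h.1).2.1 (hq q h))
        (hb q h.1).1.2.le)) ((convex_ball _ _).inter (convex_halfSpace_gt (LinearMap.snd ℝ ℝ ℝ).isLinear 0))
  have hle : 𝓝[Ω] (γ t0) ≤ map E (𝓝[ball (t0, 0) η ∩ {q | 0 < q.2}] (t0, 0)) := by
    refine le_map_iff.mpr fun U hU => ?_; obtain ⟨ε, hε, hεU⟩ := Metric.mem_nhdsWithin_iff.mp hU
    have hm : 0 < min ε η / C := by positivity
    filter_upwards [self_mem_nhdsWithin, nhdsWithin_le_nhds (ball_mem_nhds _ hr),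
      nhdsWithin_le_nhds (ball_mem_nhds _ hm)] with z hz hz1 hz2
    obtain ⟨t, s, q1, q2, -, -, q5, q6⟩ := h2 z hz1
    rw [mem_ball, dist_eq_norm, lt_div_iff₀' hC] at hz2
    have : (t, s) ∈ ball (t0, (0 : ℝ)) (min ε η) :=
      max_lt (q1.trans_lt hz2) (by simpa using q2.trans_lt hz2)
    exact ⟨(t, s), hεU ⟨ball_subset_ball (min_le_left _ _) this,
      ball_subset_ball (min_le_right _ _) this, q6 hz⟩, q5.symm⟩
  have hne : (𝓝[ball (t0, (0 : ℝ)) η ∩ {q | 0 < q.2}] (t0, 0)).NeBot := map_neBot_iff E |>.mp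
    (NeBot.mono inferInstance hle)
  have := cauchy_map_iff_exists_tendsto.mp ((cauchy_nhds.mono' hne nhdsWithin_le_nhds).map_of_le
    hlip.uniformContinuousOn (le_principal_iff.mpr self_mem_nhdsWithin))
  exact this.imp fun L hL => (tendsto_map'_iff.mpr hL).mono_left hle

/-- The points of the straight sides are regular. -/
theorem IsUniformizer.isRegularPoint_side (h : IsUniformizer b Ω P) (hb : 0 < b) {p : ℂ} (hp :
    |p.im| = π * b) {r : ℝ} (hr : 0 < r)
    (hΩ : ball p r ∩ logAngle b ⊆ Ω) : p ∈ frontier Ω ∧ ∃ y, IsRegularPoint Ω P p y := by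
  obtain ⟨σ, hσ, hpσ⟩ : ∃ σ : ℝ, σ * σ = 1 ∧ p.im = σ * (π * b) := by
    rcases abs_eq (by positivity) |>.mp hp with e | e
    exacts [⟨1, by norm_num, by linarith⟩, ⟨-1, by norm_num, by linarith⟩]
  have hσa : |σ| = 1 := by grind
  have hσc : (σ : ℂ) * σ = 1 := by rw [← ofReal_mul, hσ, ofReal_one]
  have hnorm : ‖(σ : ℂ) * I‖ = 1 := by simp_all
  -- frontier points and points of the region near `p`
  have him : ∀ ζ : ℂ, (p - σ * I * ζ).im = σ * (π * b - ζ.re) := fun ζ => by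
    simp [mul_assoc, hpσ]; ring
  have hiff : ∀ ζ : ℂ, ‖ζ‖ < min r (π * b) → (p - σ * I * ζ ∈ Ω ↔ 0 < ζ.re) := by
    intro ζ hζ; have e1 := (abs_le.mp (abs_re_le_norm ζ)).2
    have e2 := hζ.trans_le (min_le_right _ _)
    have e3 : p - σ * I * ζ ∈ logAngle b ↔ 0 < ζ.re := by
      show |(_ : ℂ).im| < _ ↔ _; grind
    refine ⟨fun h' => e3.mp (h.subset h'), fun h' => hΩ ⟨?_, e3.mpr h'⟩⟩; simp_all
  have hcont : ∀ ζ, ContinuousAt (fun ζ : ℂ => p - σ * I * ζ) ζ := fun ζ => by fun_prop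
  have htend : ∀ ζ0 : ℂ, ‖ζ0‖ < min r (π * b) → Tendsto (fun ζ : ℂ => p - σ * I * ζ)
      (𝓝[{z | 0 < z.re}] ζ0) (𝓝[Ω] (p - σ * I * ζ0)) := fun ζ0 h₀ =>
    tendsto_nhdsWithin_iff.mpr ⟨(hcont ζ0).tendsto.mono_left nhdsWithin_le_nhds, by
      filter_upwards [self_mem_nhdsWithin, nhdsWithin_le_nhds
        (continuous_norm.continuousAt.eventually_lt_const h₀)] with ζ h1 h2 using (hiff ζ h2).mpr h1⟩
  have hfr : ∀ ζ0 : ℂ, ‖ζ0‖ < min r (π * b) → ζ0.re = 0 → p - σ * I * ζ0 ∈ frontier Ω := by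
    intro ζ0 h₀ h1; rw [h.isOpen.frontier_eq]
    refine ⟨?_, fun hc => by grind⟩
    have : (𝓝[{z : ℂ | 0 < z.re}] ζ0).NeBot := mem_closure_iff_nhdsWithin_neBot.mp (by simp_all)
    exact mem_closure_iff_nhdsWithin_neBot.mpr ((htend ζ0 h₀).neBot)
  have hm0 : 0 < min r (π * b) := lt_min hr (by positivity)
  have h00 : ‖(0 : ℂ)‖ < min r (π * b) := by rwa [norm_zero]
  have hp0 : p - σ * I * 0 = p := by ring
  have hpf : p ∈ frontier Ω := by grind
  obtain ⟨r1, hr₁, hb1⟩ := eventually_nhds_iff_ball.mp (eventually_nhdsWithin_iff.mp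
    ((h.tendsto_re p hpf).eventually_lt_const one_pos))
  set ρ := min (min r (π * b)) r1 with hρ; have hρ0 : 0 < ρ := lt_min hm0 hr₁
  have hsm : ∀ ζ ∈ ball (0 : ℂ) ρ, ‖ζ‖ < min r (π * b) := fun ζ hζ => by simp_all
  have hin : ∀ ζ ∈ ball (0 : ℂ) ρ ∩ {z | 0 < z.re}, p - σ * I * ζ ∈ Ω := fun ζ hζ =>
    (hiff ζ (hsm ζ hζ.1)).mpr hζ.2
  have hder : ∀ ζ, HasDerivAt (fun ζ : ℂ => p - σ * I * ζ) (-(σ * I)) ζ := fun ζ => by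
    simpa using ((hasDerivAt_id ζ).const_mul (σ * I : ℂ)).const_sub p
  -- In the coordinate `ζ` with `z = p - σiζ` the side is the imaginary axis and the region is `Re ζ
  -- > 0`. Since `Re P → 0` at the side, `P` continues analytically across it.
  obtain ⟨G, hG, hGe, hG0, -⟩ := exists_extension_of_re_tendsto_zero (g := fun ζ => P (p - σ * I * ζ))
    hρ0 zero_le_one (fun ζ hζ => ((h.differentiableOn.differentiableAt (h.isOpen.mem_nhds
      (hin ζ hζ))).comp ζ (hder ζ).differentiableAt).differentiableWithinAt)
    (fun ζ hζ => by
      rw [abs_of_pos (h.re_pos hb _ (hin ζ hζ))]; refine (hb1 _ ?_ (hin ζ hζ)).le; have := hζ.1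
      rw [mem_ball_zero_iff] at this
      rw [mem_ball, dist_eq_norm, sub_sub_cancel_left, norm_neg, norm_mul, hnorm, one_mul]
      grind)
    (fun t ht => by
      have ht' : ‖(t * I : ℂ)‖ < min r (π * b) := by
        rw [norm_mul, norm_I, mul_one, norm_real, norm_eq_abs]; grind
      exact (h.tendsto_re _ (hfr _ ht' (by simp))).comp
        ((htend _ ht').mono_left (nhdsWithin_mono _ (by grind))))
  -- transport back
  have hB : ball (0 : ℂ) (ρ / 4) ∈ 𝓝 (0 : ℂ) := ball_mem_nhds _ (by linarith)
  set Z : ℂ → ℂ := fun z => σ * I * (z - p) with hZ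
  have hZinv : ∀ z, p - σ * I * Z z = z := fun z => by
    simp only [hZ]; linear_combination (p - z) * (σ * σ) * I_sq + (z - p) * hσc
  have hZt : Tendsto Z (𝓝 p) (𝓝 0) := Continuous.tendsto' (by fun_prop) _ _ (by simp [hZ])
  set F : ℂ → ℂ := fun z => G (Z z)
  have hF : AnalyticAt ℂ F p := AnalyticAt.fun_comp (g := G)
    (by simpa [hZ] using hG.analyticAt hB) (by fun_prop)
  have hPF : P =ᶠ[𝓝[Ω] p] F := by
    filter_upwards [self_mem_nhdsWithin, nhdsWithin_le_nhds (hZt hB)] with z hz hzb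
    show P z = G (Z z)
    rw [hGe _ hzb ((hiff _ (hsm _ (ball_subset_ball (by linarith) hzb))).mp (by rwa [hZinv])), hZinv]
  have hde : ∀ f g : ℂ → ℂ, f =ᶠ[𝓝[Ω] p] g → deriv f =ᶠ[𝓝[Ω] p] deriv g := fun f g hfg => by
    rw [EventuallyEq, ← eventually_eventually_nhdsWithin] at hfg
    filter_upwards [hfg, self_mem_nhdsWithin] with z h1 hz; rw [h.isOpen.nhdsWithin_eq hz] at h1
    exact EventuallyEq.deriv_eq h1
  have hlim : ∀ f g : ℂ → ℂ, AnalyticAt ℂ g p → f =ᶠ[𝓝[Ω] p] g → Tendsto f (𝓝[Ω] p) (𝓝 (g p)) :=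
    fun f g hg hfg => (hg.continuousAt.tendsto.mono_left nhdsWithin_le_nhds).congr' hfg.symm
  have hl1 := hlim _ _ hF.deriv (hde _ _ hPF)
  -- `Re F = 0` on the side, so the derivatives of `F` at `p` are imaginary
  have hax : ∀ f : ℂ → ℂ, AnalyticAt ℂ f p → (∀ᶠ t : ℝ in 𝓝 0, (f (p + t)).re = 0) →
      ∀ᶠ t : ℝ in 𝓝 0, (deriv f (p + t)).re = 0 := fun f hf h0 => by
    have : Tendsto (fun t : ℝ => p + t) (𝓝 0) (𝓝 p) :=
      Continuous.tendsto' (by fun_prop) _ _ (by simp)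
    filter_upwards [h0.eventually_nhds, this hf.eventually_analyticAt] with t h1 h2
    have e' : HasDerivAt (fun _ : ℝ => (0 : ℝ)) _ t := (reCLM.hasFDerivAt.comp_hasDerivAt t
      (h2.differentiableAt.hasDerivAt.comp t (ofRealCLM.hasDerivAt.const_add
      p))).congr_of_eventuallyEq
      (h1.mono fun s hs => hs.symm)
    simpa using e'.unique (hasDerivAt_const t 0)
  have a0 : ∀ᶠ t : ℝ in 𝓝 0, (F (p + t)).re = 0 := by
    have : Tendsto (fun t : ℝ => Z (p + t)) (𝓝 0) (𝓝 0) :=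
      Continuous.tendsto' (by fun_prop) _ _ (by simp [hZ])
    filter_upwards [this hB] with t ht using hG0 _ ht (by simp [hZ])
  have a1 := hax F hF a0
  have r0 : (F p).re = 0 := by simpa using a0.self_of_nhds
  have r2 : (deriv (deriv F) p).re = 0 := by simpa using (hax _ hF.deriv a1).self_of_nhds
  have hopf := re_mul_neg_of_ball_subset (p := p) (ν := σ * I) (ρ := ρ / 2) h.isOpen
    h.differentiableOn (h.re_pos hb) (half_pos hρ0) hnorm (fun z hz => by
      rw [mem_ball, dist_eq_norm] at hz
      have e1 : Z z - (ρ / 2 : ℝ) = σ * I * (z - (p - (ρ / 2 : ℝ) * (σ * I))) := by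
        simp only [hZ]; linear_combination -(ρ / 2 : ℝ) * ((σ * σ) * I_sq - hσc)
      have e2 : ‖Z z - (ρ / 2 : ℝ)‖ < ρ / 2 := by rwa [e1, norm_mul, hnorm, one_mul]
      have e3 := norm_le_norm_sub_add (Z z) (ρ / 2 : ℝ)
      have e4 := (abs_le.mp (abs_re_le_norm (Z z - (ρ / 2 : ℝ)))).1; rw [sub_re, ofReal_re] at e4
      rw [norm_real, norm_eq_abs, abs_of_pos (half_pos hρ0)] at e3; rw [← hZinv z]
      exact (hiff _ ((show ‖Z z‖ < ρ by linarith).trans_le (min_le_left _ _))).mpr (by linarith))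
    (h.tendsto_re p hpf) hl1
  have him : ∀ w : ℂ, w.re = 0 → w = w.im * I := fun w hw => Complex.ext (by simp [hw]) (by simp)
  have hd0 : deriv F p ≠ 0 := fun h0 => by simp [h0] at hopf
  refine ⟨hpf, (F p).im, _, _, hd0, hl1, hlim _ _ hF.deriv.deriv (hde _ _ (hde _ _ hPF)), ?_, ?_⟩
  · grind
  · have e1 := him _ (by simpa using a1.self_of_nhds)
    set u := (deriv F p).im; rw [e1] at hd0 ⊢; rw [him _ r2]; set v := (deriv (deriv F) p).im
    have : (u * I - v * I : ℂ) / (u * I) ^ 3 = ((v - u) / u ^ 3 : ℝ) := by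
      push_cast; rw [div_eq_div_iff (pow_ne_zero 3 hd0) (pow_ne_zero 3 (left_ne_zero_of_mul hd0))]
      linear_combination ((u - v) * u ^ 3 * I : ℂ) * I_sq
    rw [this, ofReal_im]

/-! ### Regularity at the free boundary -/

/-- A solution of the free boundary problem in the strip, with the analytic function `P` whose real
part is `-Φ`. The points `x ± iπb` are the corners of `Ω`. -/
structure IsWedgeSolution (b x c : ℝ) (γ : ℝ → ℂ) (Ω : Set ℂ) (Φ : ℂ → ℝ) (P : ℂ → ℂ) : Prop
    extends IsUniformizer b Ω P where
  deriv_eq : ∀ z ∈ Ω, deriv P z = -(fderiv ℝ Φ z 1 - I * fderiv ℝ Φ z I)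
  contDiffOn : ContDiffOn ℝ 2 Φ (Ω ∪ γ '' Ioo 0 1)
  eq_zero : ∀ t ∈ Ioo (0 : ℝ) 1, Φ (γ t) = 0
  curve : ContDiffOn ℝ 2 γ (Ioo 0 1)
  regular : ∀ t ∈ Ioo (0 : ℝ) 1, deriv γ t ≠ 0
  frontier_mem : ∀ t ∈ Ioo (0 : ℝ) 1, γ t ∈ frontier Ω
  near_curve : ∀ t ∈ Ioo (0 : ℝ) 1, ∀ J ∈ 𝓝 t, ∀ᶠ p in 𝓝 (γ t), p ∈ frontier Ω → p ∈ γ '' J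
  normal : ∀ t ∈ Ioo (0 : ℝ) 1, ∃ ν : ℂ, ‖ν‖ = 1 ∧ inner ℝ (deriv γ t) ν = 0 ∧
    (∃ p : ℝ → ℂ, ∃ m : ℝ, 0 < m ∧ HasDerivAt p (m * ν) 0 ∧ p 0 = γ t ∧
      ∀ᶠ ε : ℝ in 𝓝[>] 0, p (-ε) ∈ Ω ∧ p ε ∉ Ω) ∧
    ∃ A : ℂ →L[ℝ] ℝ, HasFDerivWithinAt Φ A (Ω ∪ γ '' Ioo 0 1) (γ t) ∧
      A ν = c * rexp (2 * (γ t).re) * ν.re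
  frontier_cases : ∀ p ∈ frontier Ω, (∃ t ∈ Ioo (0 : ℝ) 1, γ t = p) ∨ (|p.im| = π * b ∧ p.re ≤ x)
  side : ∀ p : ℂ, |p.im| = π * b → p.re < x → ∃ r > 0, ball p r ∩ logAngle b ⊆ Ω

namespace IsWedgeSolution

variable {x c : ℝ}

theorem exists_normal (h : IsWedgeSolution b x c γ Ω Φ P) {t0 : ℝ} (ht : t0 ∈ Ioo (0 : ℝ) 1) :
    ∃ ν : ℂ, ‖ν‖ = 1 ∧ inner ℝ (deriv γ t0) ν = 0 ∧
      (∃ A : ℂ →L[ℝ] ℝ, HasFDerivWithinAt Φ A (Ω ∪ γ '' Ioo 0 1) (γ t0) ∧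
        A ν = c * rexp (2 * (γ t0).re) * ν.re) ∧
      (∃ ρ : ℝ, 0 < ρ ∧ ball (γ t0 - ρ * ν) ρ ⊆ Ω) ∧
      ∀ K > 0, (∀ᶠ z in 𝓝[Ω] (γ t0), ‖deriv P z‖ ≤ K) → ∃ L, Tendsto P (𝓝[Ω] (γ t0)) (𝓝 L) := by
  obtain ⟨ν, hν, hperp, ⟨p, m, hm, hp, hp0, hside⟩, hn⟩ := h.normal t0 ht
  have hIoo := Ioo_mem_nhds ht.1 ht.2; have hγ : ContDiffAt ℝ 2 γ t0 := h.curve.contDiffAt hIoo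
  obtain ⟨δ, hδ, r, hr, C, hC, h1, h2, h3⟩ := exists_collar h.isOpen hγ (h.regular t0 ht) hν hperp
    (by filter_upwards [hIoo] with t ht using h.frontier_mem t ht) (h.near_curve t0 ht) hm hp hp0
    hside
  have : (𝓝[Ω] (γ t0)).NeBot := mem_closure_iff_nhdsWithin_neBot.mp
    (frontier_subset_closure (h.frontier_mem t0 ht))
  exact ⟨ν, hν, hperp, hn, exists_ball_subset_of_collar hν hr hC h1 h2 h3, fun K hK hbd =>
    exists_tendsto_of_collar h.isOpen hγ hδ hr hC h1 h2 h.differentiableOn hK hbd⟩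

/-- At points of the curve the interior tangent disk has the point on its boundary, and a disk
determines derivatives there. -/
theorem uniqueDiffOn (h : IsWedgeSolution b x c γ Ω Φ P) : UniqueDiffOn ℝ (Ω ∪ γ '' Ioo 0 1) := by
  rintro p (hp | ⟨t, ht, rfl⟩)
  · exact (h.isOpen.uniqueDiffWithinAt hp).mono subset_union_left
  · obtain ⟨ν, hν, -, -, ⟨ρ, hρ, hball⟩, -⟩ := h.exists_normal ht
    refine UniqueDiffWithinAt.mono (uniqueDiffWithinAt_convex (convex_ball _ _) ?_ ?_)
      (hball.trans subset_union_left)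
    · rw [isOpen_ball.interior_eq]; simp_all
    · rw [closure_ball _ hρ.ne', mem_closedBall, dist_eq_norm, sub_sub_cancel, norm_mul, hν,
        mul_one, norm_real, norm_eq_abs, abs_of_pos hρ]

/-- The points of the free boundary are regular. -/
theorem isRegularPoint_curve (h : IsWedgeSolution b x c γ Ω Φ P) (hb : 0 < b) {t0 : ℝ}
    (ht0 : t0 ∈ Ioo (0 : ℝ) 1) : ∃ y, IsRegularPoint Ω P (γ t0) y := by
  have hu := h.uniqueDiffOn; set s := Ω ∪ γ '' Ioo 0 1 with hs
  have hms : ∀ t ∈ Ioo (0 : ℝ) 1, γ t ∈ s := fun t ht => Or.inr ⟨t, ht, rfl⟩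
  -- `D` is the `C¹` extension of `P'` to the curve, built from the one-sided differential of `Φ`.
  -- Its own one-sided differential will supply the boundary values of `P''`.
  set A := fderivWithin ℝ Φ s with hA; set D : ℂ → ℂ := fun z => -(A z 1 - I * A z I) with hD
  have hAc : ContDiffOn ℝ 1 A s := h.contDiffOn.fderivWithin hu (by norm_num)
  have hDc : ContDiffOn ℝ 1 D s :=
    ((ofRealCLM.contDiff.comp_contDiffOn (hAc.clm_apply contDiffOn_const)).sub
      (contDiffOn_const.mul (ofRealCLM.contDiff.comp_contDiffOn
        (hAc.clm_apply contDiffOn_const)))).neg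
  have hDre : ∀ z v : ℂ, (D z * v).re = -A z v := fun z v => by
    have : A z v = v.re * A z 1 + v.im * A z I := by
      conv_lhs => rw [show v = v.re • (1 : ℂ) + v.im • I by simp]
      rw [map_add, map_smul, map_smul, smul_eq_mul, smul_eq_mul]
    rw [this, hD]; simp; ring
  have hΩs : ∀ z ∈ Ω, s ∈ 𝓝 z := fun z hz => mem_of_superset (h.isOpen.mem_nhds hz) subset_union_left
  have hDP : ∀ z ∈ Ω, D z = deriv P z := fun z hz => by
    rw [h.deriv_eq z hz, hD, hA]; simp only [fderivWithin_of_mem_nhds (hΩs z hz)]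
  set B := fderivWithin ℝ D s with hB
  have hBP : ∀ z ∈ Ω, ∀ v, B z v = deriv (deriv P) z * v := fun z hz v => by
    have e1 : D =ᶠ[𝓝 z] deriv P := by filter_upwards [h.isOpen.mem_nhds hz] with w hw using hDP w hw
    rw [hB, fderivWithin_of_mem_nhds (hΩs z hz), e1.fderiv_eq, (((h.differentiableOn.analyticOnNhd
      h.isOpen) z hz).deriv.differentiableAt.hasDerivAt.hasFDerivAt.restrictScalars ℝ).fderiv]
    simp [mul_comm]
  have hlim : ∀ t ∈ Ioo (0 : ℝ) 1, Tendsto (deriv P) (𝓝[Ω] (γ t)) (𝓝 (D (γ t))) := fun t ht =>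
    ((hDc.continuousOn (γ t) (hms t ht)).mono_left (nhdsWithin_mono _ subset_union_left)).congr'
      (by filter_upwards [self_mem_nhdsWithin] with z hz using hDP z hz)
  -- Since `Φ = 0` along the curve, `D γ'` is imaginary, so `Dν` is real, and by Hopf's lemma it is
  -- negative. Then `1/D = ν/(Dν)` and `Dν = -∂Φ/∂ν`, so that the dilation law becomes `c e^{2 Re γ}
  -- Re(1/D) = -1`.
  have hreal : ∀ t ∈ Ioo (0 : ℝ) 1, HasDerivAt γ (deriv γ t) t ∧ (D (γ t) * deriv γ t).re = 0 ∧
      D (γ t) ≠ 0 ∧ c * (rexp (2 * (γ t).re) * ((D (γ t))⁻¹).re) = -1 := by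
    intro t ht; have hIoo := Ioo_mem_nhds ht.1 ht.2
    obtain ⟨ν, hν, hperp, ⟨_, hA', hn⟩, ⟨ρ, hρ, hball⟩, -⟩ := h.exists_normal ht
    rw [← hA'.fderivWithin (hu _ (hms t ht))] at hn
    have hγ : HasDerivAt γ (deriv γ t) t :=
      ((h.curve.contDiffAt hIoo).differentiableAt two_ne_zero).hasDerivAt
    have h1 : (D (γ t) * deriv γ t).re = 0 := by
      have e2 := (((h.contDiffOn.differentiableOn two_ne_zero) (γ t) (hms t
        ht)).hasFDerivWithinAt.comp_hasDerivAt t hγ (by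
        filter_upwards [hIoo] with t ht using hms t ht)).congr_of_eventuallyEq (f₁ := fun _ => (0 :
        ℝ))
        (by filter_upwards [hIoo] with t ht using (h.eq_zero t ht).symm)
      rw [hDre, e2.unique (hasDerivAt_const t 0), neg_zero]
    have h2 := re_mul_neg_of_ball_subset h.isOpen h.differentiableOn (h.re_pos hb) hρ hν hball
      (h.tendsto_re _ (h.frontier_mem t ht)) (hlim t ht)
    have h3 : D (γ t) ≠ 0 := fun h0 => by simp [h0] at h2
    refine ⟨hγ, h1, h3, ?_⟩; set d := D (γ t) with hd
    have hβ : (d * deriv γ t) = ((d * deriv γ t).im : ℂ) * I := Complex.ext (by simpa) (by simp)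
    have hβ0 : (d * deriv γ t).im ≠ 0 := fun h0 => by
      rw [h0, ofReal_zero, zero_mul] at hβ; exact (mul_ne_zero h3 (h.regular t ht)) hβ
    have h4 : (d * ν).im = 0 := by
      rw [inner_eq_re_conj_mul] at hperp
      have e1 : ((d * deriv γ t).re * (d * ν).re + (d * deriv γ t).im * (d * ν).im : ℝ) = 0 := by
        have : (conj (d * deriv γ t) * (d * ν)).re = 0 := by
          rw [map_mul, show conj d * conj (deriv γ t) * (d * ν) =
            (d * conj d) * (conj (deriv γ t) * ν) by ring, mul_conj, re_ofReal_mul,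
            hperp, mul_zero]
        rw [mul_re, conj_re, conj_im] at this; linarith
      grind
    have h5 : d * ν = ((d * ν).re : ℂ) := Complex.ext rfl h4
    have h6 : d⁻¹ = ((((d * ν).re)⁻¹ : ℝ) : ℂ) * ν := by
      rw [ofReal_inv, ← h5]; grind
    have h7 := hDre (γ t) ν; rw [hn] at h7
    rw [h6, re_ofReal_mul, show c * (rexp (2 * (γ t).re) * ((d * ν).re⁻¹ * ν.re)) =
      (c * rexp (2 * (γ t).re) * ν.re) / (d * ν).re by ring, ← neg_eq_iff_eq_neg.mpr h7, neg_div,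
      div_self h2.ne]
  obtain ⟨hγ, h1, h3, h4⟩ := hreal t0 ht0; have hIoo := Ioo_mem_nhds ht0.1 ht0.2
  set p := γ t0 with hp; set d := D p with hd
  have hl2 : ∀ v, Tendsto (fun z => B z v) (𝓝[Ω] p) (𝓝 (B p v)) := fun v =>
    ((ContinuousLinearMap.apply ℝ ℂ v).continuous.tendsto _).comp
      (((hDc.continuousOn_fderivWithin hu le_rfl) p (hms t0 ht0)).mono_left (nhdsWithin_mono _
        subset_union_left))
  have hne : (𝓝[Ω] p).NeBot := mem_closure_iff_nhdsWithin_neBot.mp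
    (frontier_subset_closure (h.frontier_mem t0 ht0))
  have hl2' : Tendsto (deriv (deriv P)) (𝓝[Ω] p) (𝓝 (B p 1)) := (hl2 1).congr'
    (by filter_upwards [self_mem_nhdsWithin] with z hz using by rw [hBP z hz, mul_one])
  obtain ⟨L, hL⟩ : ∃ L, Tendsto P (𝓝[Ω] p) (𝓝 L) := by
    obtain ⟨ν, -, -, -, -, hlip⟩ := h.exists_normal ht0
    refine hlip (‖d‖ + 1) (by positivity) ?_
    filter_upwards [(hlim t0 ht0).norm.eventually_lt_const (lt_add_one _)] with z hz using hz.le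
  refine ⟨L.im, d, B p 1, h3, hlim t0 ht0, hl2', ?_, ?_⟩
  · rwa [show (L.im : ℂ) * I = L from Complex.ext (by
      simp [tendsto_nhds_unique ((continuous_re.tendsto L).comp hL) (h.tendsto_re p (h.frontier_mem
      t0 ht0))]) (by simp)]
  -- differentiate the relation on the boundary along the curve
  have hDγ : HasDerivAt (fun t => D (γ t)) (B p 1 * deriv γ t0) t0 := by
    rw [← (fun v => tendsto_nhds_unique (hl2 v) ((hl2'.mul_const v).congr' (by
      filter_upwards [self_mem_nhdsWithin] with z hz using (hBP z hz v).symm)))]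
    exact ((hDc.differentiableOn one_ne_zero) p (hms t0 ht0)).hasFDerivWithinAt.comp_hasDerivAt t0 hγ
      (by filter_upwards [hIoo] with t ht using hms t ht)
  have hinv : HasDerivAt (fun t => ((D (γ t))⁻¹).re)
      (-(B p 1 * deriv γ t0) / d ^ 2).re t0 := reCLM.hasFDerivAt.comp_hasDerivAt t0 (hDγ.inv h3)
  have hexp : HasDerivAt (fun t => rexp (2 * (γ t).re))
      (rexp (2 * p.re) * (2 * (deriv γ t0).re)) t0 :=
    ((reCLM.hasFDerivAt.comp_hasDerivAt t0 hγ).const_mul 2).exp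
  have hz := (((hexp.mul hinv).const_mul c).congr_of_eventuallyEq (f₁ := fun _ => (-1 : ℝ)) (by
    filter_upwards [hIoo] with t ht using (hreal t ht).2.2.2.symm)).unique (hasDerivAt_const t0 (-1
    : ℝ))
  have hc0 : c ≠ 0 := fun h0 => by simp [h0] at h4
  have hz' : 2 * (deriv γ t0).re * (d⁻¹).re + (-(B p 1 * deriv γ t0) / d ^ 2).re = 0 := by grind
  set β := (d * deriv γ t0).im with hβ
  -- As `Dγ'` is imaginary, `γ' = iβ/d` with `β` real. Inserting this into the differentiated
  -- relation and cancelling `β` leaves the vanishing of `Im(1/d² - P''/d³)`.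
  have hγβ : deriv γ t0 = (β : ℂ) * I * d⁻¹ := by
    have : d * deriv γ t0 = (β : ℂ) * I := Complex.ext (by simpa) (by simp [hβ])
    grind
  have hβ0 : β ≠ 0 := fun h0 => h.regular t0 ht0 (by rw [hγβ, h0]; simp)
  rw [show (d - B p 1) / d ^ 3 = d⁻¹ * d⁻¹ - B p 1 * (d⁻¹ * (d⁻¹ * d⁻¹)) by field_simp]
  rw [hγβ, show -(B p 1 * (β * I * d⁻¹)) / d ^ 2 = (β : ℂ) * (-I * (B p 1 * (d⁻¹ * (d⁻¹ * d⁻¹)))) by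
    field_simp, mul_assoc (β : ℂ), re_ofReal_mul, re_ofReal_mul] at hz'
  have e1 : β * ((d⁻¹ * d⁻¹ - B p 1 * (d⁻¹ * (d⁻¹ * d⁻¹))).im) = 0 := by
    simp only [mul_re, mul_im, sub_im, I_re, I_im, neg_re, neg_im] at hz' ⊢; linear_combination -hz'
  grind

/-- All boundary points except the corners are regular. -/
theorem isRegularPoint (h : IsWedgeSolution b x c γ Ω Φ P) (hb : 0 < b) {p : ℂ}
    (hp : p ∈ frontier Ω) : (|p.im| = π * b ∧ p.re = x) ∨ ∃ y, IsRegularPoint Ω P p y := by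
  rcases h.frontier_cases p hp with ⟨t, ht, rfl⟩ | ⟨h1, h2⟩
  · exact Or.inr (h.isRegularPoint_curve hb ht)
  · rcases h2.lt_or_eq with h3 | h3
    · obtain ⟨r, hr, hΩ⟩ := h.side p h1 h3; exact Or.inr (h.isRegularPoint_side hb h1 hr hΩ).2
    grind

end IsWedgeSolution

/-! ### Boundary values of the inverse map -/

/-- The right half plane. -/
abbrev rhp : Set ℂ := {W | 0 < W.re}

instance nhdsWithin_halfPlane_neBot (y : ℝ) : (𝓝[rhp] (y * I : ℂ)).NeBot :=
  mem_closure_iff_nhdsWithin_neBot.mp (by simp)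

theorem mem_closure_rhp {z : ℂ} (hz : 0 ≤ z.re) : z ∈ closure rhp := by simp_all

/-- Extension by reflection of an analytic function with real boundary values. -/
theorem differentiableOn_reflect_extendFrom {q : ℂ → ℂ} {U : Set ℂ} (hU : IsOpen U)
    (hs : ∀ z ∈ U, -conj z ∈ U) (hq : DifferentiableOn ℂ q rhp)
    (hr : ∀ z ∈ U, z.re = 0 → ∃ a : ℝ, Tendsto q (𝓝[rhp] z) (𝓝 a)) :
    DifferentiableOn ℂ (reflect (extendFrom rhp q)) U ∧ ∀ W ∈ rhp, extendFrom rhp q W = q W := by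
  have hFe : ∀ W ∈ rhp, extendFrom rhp q W = q W := fun W hW =>
    extendFrom_eq (subset_closure hW) (hq.continuousOn W hW)
  refine ⟨differentiableOn_reflect hU hs ?_ ?_ fun z hz h0 => ?_, hFe⟩
  · refine continuousOn_extendFrom (fun z hz => mem_closure_rhp hz.2) fun z hz => ?_
    rcases (show 0 ≤ z.re from hz.2).lt_or_eq with h | h
    · exact ⟨_, hq.continuousOn z h⟩
    grind
  · exact (hq.mono inter_subset_right).congr fun z hz => hFe z hz.2
  · obtain ⟨a, ha⟩ := hr z hz h0; rw [extendFrom_eq (mem_closure_rhp h0.ge) ha, ofReal_im]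

theorem eq_im_mul_I {z : ℂ} (hz : z.re = 0) : z = z.im * I := Complex.ext (by simp [hz]) (by simp)

/-- An analytic function on the half plane with constant boundary values on an interval takes
this value. -/
theorem eq_const_of_tendsto_const {f : ℂ → ℂ} (hf : DifferentiableOn ℂ f rhp) {a b : ℝ} (hab : a <
    b)
    {p : ℂ} (hp : ∀ y ∈ Icc a b, Tendsto f (𝓝[rhp] (y * I)) (𝓝 p)) : ∃ W ∈ rhp, f W = p := by
  set U := im ⁻¹' Ioo a b with hU; have hUo : IsOpen U := isOpen_Ioo.preimage continuous_im
  have hlim : ∀ z ∈ U, z.re = 0 → Tendsto (fun W => f W - p) (𝓝[rhp] z) (𝓝 (0 : ℝ)) :=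
    fun z hz h0 => by
      rw [ofReal_zero, ← sub_self p, eq_im_mul_I h0]
      exact (hp _ (Ioo_subset_Icc_self hz)).sub_const p
  -- Since `f - p` tends to zero on the interval, it reflects across to a horizontal strip. It
  -- vanishes on a segment of the axis, hence identically.
  obtain ⟨hd, he⟩ := differentiableOn_reflect_extendFrom hUo
    (fun z hz => by simpa [hU] using hz) (hf.sub_const p) fun z hz h0 => ⟨0, hlim z hz h0⟩
  set m : ℂ := ((a + b) / 2 : ℝ) * I with hm
  have hmU : ∀ x : ℝ, x + m ∈ U := fun x => by
    simp only [hU, hm, mem_preimage, add_im, ofReal_im, im_ofReal_mul, I_im, mul_one, zero_add]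
    grind
  have hm0 : m ∈ U := by simp_all
  have hfreq : ∃ᶠ z in 𝓝[≠] m, reflect (extendFrom rhp fun W => f W - p) z = 0 := by
    have h1 : Tendsto (fun t : ℝ => m + t * I) (𝓝[≠] 0) (𝓝[≠] m) :=
      tendsto_nhdsWithin_iff.mpr ⟨(Continuous.tendsto' (by fun_prop) _ _ (by simp)).mono_left
        nhdsWithin_le_nhds, by filter_upwards [self_mem_nhdsWithin] with t ht using by simpa using ht⟩
    refine h1.frequently (Eventually.frequently ?_)
    filter_upwards [h1 (mem_nhdsWithin_of_mem_nhds (hUo.mem_nhds hm0))] with t ht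
    have h0 : (m + t * I).re = 0 := by simp [hm]
    rw [reflect, if_pos h0.ge, extendFrom_eq (mem_closure_rhp h0.ge) (hlim _ ht h0), ofReal_zero]
  have hz := (hd.analyticOnNhd hUo).eqOn_zero_of_preconnected_of_frequently_eq_zero
    ((convex_Ioo a b).linear_preimage imLm).isPreconnected hm0 hfreq (hmU 1)
  have h1 : (0 : ℝ) < ((1 : ℝ) + m).re := by simp [hm]
  rw [reflect, if_pos h1.le, he _ h1] at hz; exact ⟨_, h1, sub_eq_zero.mp hz⟩

namespace IsUniformizer

theorem hasDerivAt_inv (h : IsUniformizer b Ω P) (hb : 0 < b) {W : ℂ} (hW : 0 < W.re) :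
    HasDerivAt (invFunOn P Ω) (deriv P (invFunOn P Ω W))⁻¹ W := by
  have hbij := h.bijOn hb
  have hd := differentiableOn_leftInvOn h.isOpen h.differentiableOn
    (fun z hz => hbij.injOn.leftInvOn_invFunOn hz)
  rw [hbij.image_eq] at hd
  have h1 := (hd.differentiableAt (isOpen_halfPlane.mem_nhds hW)).hasDerivAt
  have h3 : HasDerivAt (fun W => W) _ W := ((h.differentiableOn.differentiableAt
    (h.isOpen.mem_nhds ((hbij.surjOn.mapsTo_invFunOn) hW))).hasDerivAt.comp W
    h1).congr_of_eventuallyEq (by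
    filter_upwards [isOpen_halfPlane.mem_nhds hW] with w hw
      using (hbij.surjOn.rightInvOn_invFunOn hw).symm)
  rwa [eq_inv_of_mul_eq_one_right (h3.unique (hasDerivAt_id' W))] at h1

theorem inv_mem (h : IsUniformizer b Ω P) (hb : 0 < b) {W : ℂ} (hW : 0 < W.re) :
    invFunOn P Ω W ∈ Ω ∧ P (invFunOn P Ω W) = W :=
  ⟨(h.bijOn hb).surjOn.mapsTo_invFunOn hW, (h.bijOn hb).surjOn.rightInvOn_invFunOn hW⟩

/-- Near `p` one has `|P'| > m`, so the inverse has derivative less than `1/m` as long as its values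
stay near `p`. Starting from some `z` near `p` with `P z` near `iy`, follow the inverse along the
segment from `P z` to `W`. A barrier argument shows that it cannot leave the small disk about `p`.
-/
theorem tendsto_inv_of_isRegularPoint (h : IsUniformizer b Ω P) (hb : 0 < b) {p : ℂ} {y : ℝ}
    (hp : p ∈ frontier Ω) (hreg : IsRegularPoint Ω P p y) :
    Tendsto (invFunOn P Ω) (𝓝[rhp] (y * I)) (𝓝 p) := by
  obtain ⟨d1, -, hd, h1, -, h3, -⟩ := hreg; set m := ‖d1‖ / 2 with hm
  have hm0 : 0 < m := by positivity
  obtain ⟨r0, hr0, hb0⟩ := eventually_nhds_iff_ball.mp (eventually_nhdsWithin_iff.mp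
    (h1.norm.eventually_const_lt (show m < ‖d1‖ by linarith)))
  refine Metric.tendsto_nhds.mpr fun ε hε => ?_; set e := min ε r0 with he
  have he0 : 0 < e := lt_min hε hr0
  have : (𝓝[Ω] p).NeBot := mem_closure_iff_nhdsWithin_neBot.mp (frontier_subset_closure hp)
  obtain ⟨z, hz1, hzΩ, hz2⟩ := ((h3.eventually (ball_mem_nhds _
    (show 0 < m * e / 8 by positivity))).and ((eventually_mem_nhdsWithin (a := p)).and
      (nhdsWithin_le_nhds (ball_mem_nhds p (show 0 < e / 4 by positivity))))).exists
  rw [dist_eq_norm] at hz1 hz2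
  filter_upwards [self_mem_nhdsWithin, nhdsWithin_le_nhds (ball_mem_nhds _
    (show 0 < m * e / 8 by positivity))] with W hW hWb
  rw [mem_ball, dist_eq_norm] at hWb; have hzR := h.re_pos hb z hzΩ
  have hseg : ∀ t ∈ Icc (0 : ℝ) 1, 0 < (P z + t * (W - P z)).re := fun t ht => by
    rw [add_re, re_ofReal_mul, sub_re]
    nlinarith [ht.1, ht.2, mul_nonneg ht.1 hW.le, mul_nonneg (sub_nonneg.mpr ht.2) hzR.le]
  have hnW : ‖W - P z‖ < m * e / 4 := by
    have := norm_sub_le_norm_sub_add_norm_sub W (y * I : ℂ) (P z)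
    rw [norm_sub_rev (y * I : ℂ)] at this; linarith
  have hder : ∀ t ∈ Icc (0 : ℝ) 1, HasDerivAt (fun t : ℝ => invFunOn P Ω (P z + t * (W - P z)) - z)
      ((deriv P (invFunOn P Ω (P z + t * (W - P z))))⁻¹ * (1 * (W - P z))) t := fun t ht => by
    exact ((h.hasDerivAt_inv hb (hseg t ht)).comp t (((ofRealCLM.hasDerivAt (x := t)).mul_const
      _).const_add _)).sub_const z
  have key := image_norm_le_of_norm_deriv_right_lt_deriv_boundary
    (fun t ht => (hder t ht).continuousAt.continuousWithinAt)
    (fun t ht => (hder t (Ico_subset_Icc_self ht)).hasDerivWithinAt)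
    (B := fun t => e / 2 * t) (B' := fun _ => e / 2) (by
      simp [(h.bijOn hb).injOn.leftInvOn_invFunOn hzΩ])
    (fun t => by simpa using (hasDerivAt_id t).const_mul (e / 2)) (fun t ht hB => by
      set w := invFunOn P Ω (P z + t * (W - P z)) with hw
      have e1 : ‖w - p‖ < r0 := by
        have := norm_sub_le_norm_sub_add_norm_sub w z p
        have e2 : e / 2 * t ≤ e / 2 := by nlinarith [ht.2]
        grind
      have e2 := hb0 w (by rwa [mem_ball, dist_eq_norm]) ((h.inv_mem hb (hseg t
        (Ico_subset_Icc_self ht))).1)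
      rw [norm_mul, norm_inv, one_mul, inv_mul_lt_iff₀ (by linarith)]
      nlinarith) (right_mem_Icc.mpr zero_le_one)
  simp only [ofReal_one, one_mul, add_sub_cancel, mul_one] at key; rw [dist_eq_norm]
  have := norm_sub_le_norm_sub_add_norm_sub (invFunOn P Ω W) z p; grind

/-- Both claims come from `P (λ W) = W → iy`. An interior limit would contradict `Re P > 0`, and at
a regular point the boundary value of `P` is unique. -/
theorem cluster_inv (h : IsUniformizer b Ω P) (hb : 0 < b) {u : Ultrafilter ℂ} {p : ℂ} {y : ℝ}
    (hu : (u : Filter ℂ) ≤ 𝓝[rhp] (y * I)) (hp : Tendsto (invFunOn P Ω) u (𝓝 p)) :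
    p ∈ frontier Ω ∧ ∀ y' : ℝ, IsRegularPoint Ω P p y' → y' = y := by
  have h1 : ∀ᶠ W : ℂ in (u : Filter ℂ), 0 < W.re := hu self_mem_nhdsWithin
  have hu' : Tendsto (fun W => P (invFunOn P Ω W)) u (𝓝 (y * I)) :=
    Tendsto.congr' (h1.mono fun W hW => (h.inv_mem hb hW).2.symm) (hu.trans nhdsWithin_le_nhds)
  have h2 : Tendsto (invFunOn P Ω) u (𝓝[Ω] p) :=
    tendsto_nhdsWithin_iff.mpr ⟨hp, h1.mono fun W hW => (h.inv_mem hb hW).1⟩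
  refine ⟨?_, fun y' ⟨_, _, _, _, _, h5, _⟩ => ?_⟩
  · rw [h.isOpen.frontier_eq]; refine ⟨mem_closure_iff_nhdsWithin_neBot.mpr h2.neBot, fun hpΩ => ?_⟩
    have := tendsto_nhds_unique hu' ((h.differentiableOn.continuousOn.continuousAt
      (h.isOpen.mem_nhds hpΩ)).tendsto.comp hp)
    have h3 := h.re_pos hb p hpΩ; rw [← this] at h3; simp at h3
  · have := congrArg im (tendsto_nhds_unique (h5.comp h2) hu'); simpa using this

theorem mem_corners (hb : 0 < b) {x : ℝ} {p : ℂ} (h : |p.im| = π * b ∧ p.re = x) :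
    p ∈ ({(x + (π * b : ℝ) * I : ℂ), (x - (π * b : ℝ) * I : ℂ)} : Set ℂ) := by
  rcases abs_eq (by positivity) |>.mp h.1 with h5 | h5
  exacts [Or.inl (Complex.ext (by simp [h.2]) (by simp [h5])),
    Or.inr (Complex.ext (by simp [h.2]) (by simp [h5]))]

/-- If no regular point carries the value `iy`, then all cluster points are among the two corners,
and a finite cluster set along connected neighbourhoods is a single point. The corners thus need no
local analysis. -/
theorem exists_tendsto_inv (h : IsUniformizer b Ω P) (hb : 0 < b) {x : ℝ}
    (hreg : ∀ p ∈ frontier Ω, (|p.im| = π * b ∧ p.re = x) ∨ ∃ y, IsRegularPoint Ω P p y)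
    (y : ℝ) : ∃ p ∈ frontier Ω, Tendsto (invFunOn P Ω) (𝓝[rhp] (y * I)) (𝓝 p) := by
  by_cases hy : ∃ p ∈ frontier Ω, IsRegularPoint Ω P p y
  · obtain ⟨p, hp, hr⟩ := hy; exact ⟨p, hp, h.tendsto_inv_of_isRegularPoint hb hp hr⟩
  obtain ⟨K, hK, hKm⟩ := h.exists_isCompact hb (|y| + 1)
  have hn : ∀ᶠ W : ℂ in 𝓝 (y * I), ‖W‖ < |y| + 1 :=
    continuous_norm.continuousAt.eventually_lt_const (by simp)
  obtain ⟨p, -, hp⟩ := exists_tendsto_of_finite_cluster (l := 𝓝[rhp] (y * I))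
    (h := invFunOn P Ω) (fun s hs => by
      obtain ⟨r, hr, hrs⟩ := Metric.mem_nhdsWithin_iff.mp hs
      exact ⟨_, inter_mem (nhdsWithin_le_nhds (ball_mem_nhds _ hr)) self_mem_nhdsWithin, hrs,
        ((convex_ball _ r).inter convex_halfPlane).isPreconnected, fun W hW =>
        (h.hasDerivAt_inv hb hW.2).continuousAt.continuousWithinAt⟩) hK (by
      filter_upwards [self_mem_nhdsWithin, nhdsWithin_le_nhds hn] with W h1 h2
      obtain ⟨h3, h4⟩ := h.inv_mem hb h1
      grind)
    (S := {(x + (π * b : ℝ) * I : ℂ), (x - (π * b : ℝ) * I : ℂ)}) (by simp)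
    (fun u hu p hp => by
      obtain ⟨h1, h2⟩ := h.cluster_inv hb hu hp; rcases hreg p h1 with h3 | ⟨y', hy'⟩
      · exact mem_corners hb h3
      grind)
  have hle := Ultrafilter.of_le (𝓝[rhp] (y * I : ℂ))
  exact ⟨p, (h.cluster_inv hb hle (hp.mono_left hle)).1, hp⟩

/-- Every open interval of the imaginary axis contains images of boundary points other than the
corners. -/
theorem exists_regular_between (h : IsUniformizer b Ω P) (hb : 0 < b) {x : ℝ}
    (hreg : ∀ p ∈ frontier Ω, (|p.im| = π * b ∧ p.re = x) ∨ ∃ y, IsRegularPoint Ω P p y)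
    {y1 y2 : ℝ} (hy : y1 < y2) : ∃ y ∈ Icc y1 y2, ∃ p ∈ frontier Ω,
      ¬(|p.im| = π * b ∧ p.re = x) ∧ IsRegularPoint Ω P p y := by
  by_contra! hno; set L := extendFrom rhp (invFunOn P Ω) with hL
  have hcl : ∀ y : ℝ, (y * I : ℂ) ∈ closure rhp := fun y => mem_closure_rhp (by simp)
  have hLy : ∀ y : ℝ, L (y * I) ∈ frontier Ω ∧
      Tendsto (invFunOn P Ω) (𝓝[rhp] (y * I)) (𝓝 (L (y * I))) := fun y => by
    obtain ⟨p, hp, ht⟩ := (h.exists_tendsto_inv hb hreg) y; rw [hL, extendFrom_eq (hcl y) ht]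
    exact ⟨hp, ht⟩
  have hcont : ContinuousOn L (range fun y : ℝ => (y * I : ℂ)) :=
    continuousOn_extendFrom (by grind) (by grind)
  -- Otherwise the boundary function takes only corner values on the interval. Being continuous it
  -- is constant there, so the inverse map takes a frontier point as a value, which is impossible.
  have hfin : ((fun y : ℝ => L (y * I)) '' Icc y1 y2) ⊆
      {(x + (π * b : ℝ) * I : ℂ), (x - (π * b : ℝ) * I : ℂ)} := by
    rintro _ ⟨y, hy, rfl⟩; refine mem_corners hb (by_contra fun hc => ?_)
    obtain ⟨y', hy'⟩ := (hreg _ (hLy y).1).resolve_left hc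
    have hle := Ultrafilter.of_le (𝓝[rhp] (y * I : ℂ))
    have := (h.cluster_inv hb hle ((hLy y).2.mono_left hle)).2 y' hy'; grind
  obtain ⟨W, hW, e⟩ := eq_const_of_tendsto_const (f := invFunOn P Ω)
    (fun W hW => (h.hasDerivAt_inv hb hW).differentiableAt.differentiableWithinAt) hy
    (p := L (y1 * I)) fun y hy' => by
      have e : L (y1 * I) = L (y * I) := ((toFinite _).countable.isTotallyDisconnected _ hfin
        (isPreconnected_Icc.image _ (hcont.comp (by fun_prop) fun y _ => ⟨y, rfl⟩))) ⟨y1,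
        left_mem_Icc.mpr hy.le, rfl⟩ ⟨y, hy', rfl⟩
      grind
  have := (hLy y1).1; rw [h.isOpen.frontier_eq, ← e] at this; exact this.2 (h.inv_mem hb hW).1

end IsUniformizer

/-- All points of the imaginary axis but two correspond to regular boundary points. -/
theorem IsWedgeSolution.exists_exceptional {b x c : ℝ} (h : IsWedgeSolution b x c γ Ω Φ P) (hb : 0 <
    b)
    (hγ : MapsTo γ (Ioo 0 1) (logAngle b)) : ∃ A1 A2 : ℝ, A1 < A2 ∧ ∀ y, y ≠ A1 → y ≠ A2 →
      ∃ p ∈ frontier Ω, IsRegularPoint Ω P p y := by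
  have hreg := fun p hp => h.isRegularPoint hb (p := p) hp
  set Good : ℂ → Prop := fun p => p ∈ frontier Ω ∧ ¬(|p.im| = π * b ∧ p.re = x) with hGood
  -- `iY p` is the boundary value of `P` at a regular point `p`. On the regular boundary points `Y`
  -- is continuous and injective, so the open curve and the two open sides go to disjoint intervals
  -- of the axis.
  set Y : ℂ → ℝ := fun p => (extendFrom Ω P p).im with hY
  have hYr : ∀ p y, p ∈ frontier Ω → IsRegularPoint Ω P p y → Y p = y := by
    rintro p y hp ⟨_, _, _, _, _, h5, _⟩; rw [hY]; simp only
    rw [extendFrom_eq (frontier_subset_closure hp) h5]; simp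
  have hg : ∀ p, Good p → IsRegularPoint Ω P p (Y p) := fun p hp => by grind
  have hord : ∀ S : Set ℂ, IsPreconnected S → (∀ p ∈ S, Good p) → (Y '' S).OrdConnected :=
    fun S hS hSG => (hS.image _ (continuous_im.comp_continuousOn (continuousOn_extendFrom
      (fun p hp => frontier_subset_closure (hSG p hp).1) fun p hp => by
        obtain ⟨_, _, _, _, _, h5, _⟩ := hg p (hSG p hp)
        exact ⟨_, h5⟩))).ordConnected
  have hinj : ∀ p q, Good p → Good q → Y p = Y q → p = q := fun p q hp hq e =>
    tendsto_nhds_unique (h.tendsto_inv_of_isRegularPoint hb hp.1 (hg p hp))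
      (e ▸ h.tendsto_inv_of_isRegularPoint hb hq.1 (hg q hq))
  have hπ : 0 < π * b := by positivity
  set S : ℝ → Set ℂ := fun σ => {p | p.re < x ∧ p.im = σ * (π * b)} with hS
  have hside : ∀ σ : ℝ, |σ| = 1 → (∀ p ∈ S σ, Good p) ∧ (Y '' S σ).OrdConnected := by
    intro σ hσ
    have h1 : ∀ p ∈ S σ, Good p := by
      rintro p ⟨h1, h2⟩
      have h3 : |p.im| = π * b := by rw [h2, abs_mul, hσ, one_mul, abs_of_pos hπ]
      obtain ⟨r, hr, hΩ⟩ := h.side p h3 h1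
      exact ⟨(h.isRegularPoint_side hb h3 hr hΩ).1, fun hc => by linarith [hc.2]⟩
    refine ⟨h1, hord _ (Convex.isPreconnected ?_) h1⟩
    exact (convex_halfSpace_re_lt x).inter (convex_hyperplane imLm.isLinear _)
  -- On the side `σ` one has `e^{-p/2b} = -iσ e^{-Re p/2b}`, and `P` is close to it in relative
  -- terms. So `σY` is unbounded below on that side.
  have hunb : ∀ σ : ℝ, |σ| = 1 → ∀ B : ℝ, ∃ p ∈ S σ, σ * Y p < B := by
    intro σ hσ B
    have hσ2 : σ * σ = 1 := by grind
    obtain ⟨R, C, hRC⟩ := h.norm_sub_exp_le hb one_half_pos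
    set s := min (min R x - 1) (-2 * b * (2 * (|C| + |B|))) with hs
    have hs1 : s ≤ min R x - 1 := min_le_left _ _
    have hs2 : s ≤ -2 * b * (2 * (|C| + |B|)) := min_le_right _ _
    set p : ℂ := s + (σ * (π * b) : ℝ) * I with hp
    have hpre : p.re = s := by simp [hp]
    have hpS : p ∈ S σ := ⟨by linarith [min_le_right R x], by simp [hp]⟩
    obtain ⟨_, _, _, _, _, h5, _⟩ := hg p ((hside σ hσ).1 p hpS)
    have : (𝓝[Ω] p).NeBot := mem_closure_iff_nhdsWithin_neBot.mp
      (frontier_subset_closure ((hside σ hσ).1 p hpS).1)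
    have hv : Tendsto (fun l : ℂ => exp (-l / (2 * b))) (𝓝[Ω] p) (𝓝 (exp (-p / (2 * b)))) :=
      (Continuous.tendsto (by fun_prop) p).mono_left nhdsWithin_le_nhds
    have e1 : ‖(Y p : ℂ) * I - exp (-p / (2 * b))‖ ≤ 1 / 2 * ‖exp (-p / (2 * b))‖ + C := by
      refine le_of_tendsto_of_tendsto (h5.sub hv).norm ((hv.norm.const_mul _).add_const C) ?_
      filter_upwards [self_mem_nhdsWithin, nhdsWithin_le_nhds (continuous_re.continuousAt
        (x := p) |>.eventually_lt_const (show p.re < R by grind))]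
        with z h1 h2 using (hRC z (h.subset h1) h2).2
    have e2 : (exp (-p / (2 * b))).im = -σ * rexp (-s / (2 * b)) := by
      have e3 : p.im / (2 * b) = σ * (π / 2) := by grind
      rw [exp_im, div_two_mul_re, div_two_mul_im, neg_re, neg_im, hpre, neg_div (2 * b) p.im, e3, Real.sin_neg]
      rcases ((abs_eq zero_le_one).mp hσ) with rfl | rfl <;> simp
    have e4 := (abs_im_le_norm _).trans e1
    rw [norm_exp_neg_div, hpre, sub_im, e2, im_ofReal_mul, I_im, mul_one] at e4
    have e5 : |σ * Y p + rexp (-s / (2 * b))| ≤ 1 / 2 * rexp (-s / (2 * b)) + C := by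
      rwa [show σ * Y p + rexp (-s / (2 * b)) = σ * (Y p - -σ * rexp (-s / (2 * b))) by grind, abs_mul, hσ, one_mul]
    have e6 : 2 * (|C| + |B|) ≤ -s / (2 * b) := by
      rw [le_div_iff₀ (by linarith)]
      linarith
    have e7 := add_one_le_exp (-s / (2 * b)); have e8 := (abs_le.mp e5).2
    exact ⟨p, hpS, by linarith [le_abs_self C, neg_abs_le B]⟩
  have hΓ : ∀ p ∈ γ '' Ioo 0 1, Good p := by
    rintro _ ⟨t, ht, rfl⟩
    exact ⟨h.frontier_mem t ht, fun hc => (show |(γ t).im| < _ from hγ ht).ne hc.1⟩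
  have hordΓ := hord _ (isPreconnected_Ioo.image γ h.curve.continuousOn) hΓ
  have hm : (1 / 2 : ℝ) ∈ Ioo (0 : ℝ) 1 := by norm_num
  set y0 := Y (γ (1 / 2)) with hy0; have hy₀Γ : y0 ∈ Y '' (γ '' Ioo 0 1) := ⟨_, ⟨_, hm, rfl⟩, rfl⟩
  have hy₀S : ∀ σ : ℝ, |σ| = 1 → y0 ∉ Y '' S σ := by
    rintro σ hσ ⟨p, hp, e⟩; rw [hinj p _ ((hside σ hσ).1 p hp) (hΓ _ ⟨_, hm, rfl⟩) e] at hp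
    refine (show |(γ (1 / 2)).im| < _ from hγ hm).ne ?_
    rw [hp.2, abs_mul, hσ, one_mul, abs_of_pos hπ]
  have hcov : ∀ p, Good p → p ∈ γ '' Ioo 0 1 ∨ p ∈ S 1 ∨ p ∈ S (-1) := by
    rintro p ⟨hp, hpc⟩; rcases h.frontier_cases p hp with h1 | ⟨h1, h2⟩
    · exact Or.inl h1
    · have h3 : p.re < x := h2.lt_of_ne fun h3 => hpc ⟨h1, h3⟩
      rcases (abs_eq hπ.le).mp h1 with h4 | h4
      exacts [Or.inr (Or.inl ⟨h3, by rw [h4, one_mul]⟩), Or.inr (Or.inr ⟨h3, by rw [h4]; ring⟩)]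
  have n1 : |(1 : ℝ)| = 1 := abs_one
  have n2 : |(-1 : ℝ)| = 1 := by simp
  set Bad : ℝ → Prop := fun y => ¬∃ p, Good p ∧ Y p = y with hBad
  -- Two missing values on the same side of `y0`: some regular value lies between them. If it comes
  -- from the curve, then the interval of the curve, which contains `y0`, also contains a missing
  -- value. If it comes from a straight side, the unbounded interval of that side contains `y0` or a
  -- missing value.
  have key : ∀ y1 y2, y1 < y2 → Bad y1 → Bad y2 → y0 < y1 ∨ y2 < y0 → False := by
    intro y1 y2 hlt hb1 hb2 hside'
    obtain ⟨y, hy, p, hp, hpc, hr⟩ := h.exists_regular_between hb hreg hlt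
    obtain rfl := hYr p y hp hr
    have hbad : ∀ T : Set ℂ, (∀ p ∈ T, Good p) → ∀ y, Bad y → y ∉ Y '' T := by
      rintro T hT y hy ⟨q, hq, e⟩; grind
    have hs1 := hside 1 n1; have hs2 := hside (-1) n2; rcases hcov p ⟨hp, hpc⟩ with hT | hT | hT
    · rcases hside' with h' | h'
      · exact hbad _ hΓ y1 hb1 (hordΓ.out hy₀Γ ⟨p, hT, rfl⟩ ⟨h'.le, hy.1⟩)
      · exact hbad _ hΓ y2 hb2 (hordΓ.out ⟨p, hT, rfl⟩ hy₀Γ ⟨hy.2, h'.le⟩)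
    · obtain ⟨q, hq, hlt'⟩ := hunb 1 n1 (min y0 y1); rw [one_mul, lt_min_iff] at hlt'
      rcases hside' with h' | h'
      · exact hy₀S 1 n1 (hs1.2.out ⟨q, hq, rfl⟩ ⟨p, hT, rfl⟩ ⟨hlt'.1.le, h'.le.trans hy.1⟩)
      · exact hbad _ hs1.1 y1 hb1 (hs1.2.out ⟨q, hq, rfl⟩ ⟨p, hT, rfl⟩ ⟨hlt'.2.le, hy.1⟩)
    · obtain ⟨q, hq, hlt'⟩ := hunb (-1) n2 (min (-y0) (-y2))
      rw [neg_one_mul, lt_min_iff, neg_lt_neg_iff, neg_lt_neg_iff] at hlt'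
      rcases hside' with h' | h'
      · exact hbad _ hs2.1 y2 hb2 (hs2.2.out ⟨p, hT, rfl⟩ ⟨q, hq, rfl⟩ ⟨hy.2, hlt'.2.le⟩)
      · exact hy₀S (-1) n2 (hs2.2.out ⟨p, hT, rfl⟩ ⟨q, hq, rfl⟩ ⟨hy.2.trans h'.le, hlt'.1.le⟩)
  -- `A0` is a default in case no value is missing on that side of `y0`. This keeps `A1 < y0 < A2`
  -- in all cases.
  have hone : ∀ (R : ℝ → Prop) (A0 : ℝ), R A0 → (∀ y1 y2, y1 < y2 → Bad y1 → Bad y2 → R y1 → R y2 →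
      False) → ∃ A, R A ∧ ∀ y, R y → Bad y → y = A := fun R A0 h0 hk => by grind
  obtain ⟨A1, h1, h1'⟩ := hone (· < y0) (y0 - 1) (by simp) fun y1 y2 h b1 b2 _ r =>
    key y1 y2 h b1 b2 (Or.inr r)
  obtain ⟨A2, h2, h2'⟩ := hone (y0 < ·) (y0 + 1) (by simp) fun y1 y2 h b1 b2 r _ =>
    key y1 y2 h b1 b2 (Or.inl r)
  refine ⟨A1, A2, h1.trans h2, fun y hn1 hn2 => ?_⟩
  have hyb : ¬Bad y := fun hb' => by
    rcases lt_trichotomy y y0 with h' | h' | h'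
    exacts [hn1 (h1' y h' hb'), (fun hb' => hb' ⟨_, hΓ _ ⟨_, hm, rfl⟩, rfl⟩) (h' ▸ hb'), hn2 (h2' y
      h' hb')]
  obtain ⟨p, hp, rfl⟩ := not_not.mp hyb; grind

/-! ### The rational coefficient of the equation for the inverse map -/

theorem norm_deriv_le_of_abs_im_sub_le {h : ℂ → ℂ} {W : ℂ} {ρ S c : ℝ} (hρ : 0 < ρ)
    (hd : DifferentiableOn ℂ h (ball W ρ))
    (hS : ∀ z ∈ ball W ρ, |(h z).im - c| ≤ S) :
    ‖deriv h W‖ ≤ 8 * S / ρ ∧ ‖deriv (deriv h) W‖ ≤ 64 * S / ρ ^ 2 := by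
  have hg : DifferentiableOn ℂ (fun z => -I * h z - c) (ball W ρ) := (hd.const_mul _).sub_const _
  have hre : ∀ z ∈ ball W ρ, |(-I * h z - c).re| ≤ S := fun z hz => by simpa using hS z hz
  have e1 : ∀ z ∈ ball W ρ, deriv (fun z => -I * h z - c) z = -I * deriv h z := fun z hz =>
    (((hd.differentiableAt (isOpen_ball.mem_nhds hz)).hasDerivAt.const_mul _).sub_const _).deriv
  have e2 : deriv (deriv fun z => -I * h z - c) W = -I * deriv (deriv h) W := by simp
  have h1 := norm_deriv_le_of_abs_re_le hρ hg hre
  have h2 := norm_deriv_deriv_le_of_abs_re_le hρ hg hre; simp_all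

theorem exists_extension_of_tendsto_mul {f : ℂ → ℂ} {s : Set ℂ} {c : ℂ} (hs : s ∈ 𝓝 c)
    (hd : DifferentiableOn ℂ f (s \ {c})) (h0 : Tendsto (fun z => f z * (z - c)) (𝓝[≠] c) (𝓝 0)) :
    ∃ g : ℂ → ℂ, DifferentiableOn ℂ g s ∧ ∀ z, z ≠ c → g z = f z := by
  refine ⟨_, differentiableOn_update_limUnder_of_isLittleO hs hd ?_, fun z hz =>
    Function.update_of_ne hz _ _⟩
  have hne : ∀ᶠ z in 𝓝[≠] c, z ≠ c := self_mem_nhdsWithin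
  refine (isLittleO_iff_tendsto' (hne.mono fun z hz h => (inv_ne_zero (sub_ne_zero.mpr hz)
    h).elim)).mpr ?_
  have h1 : Tendsto (fun z => f c * (z - c)) (𝓝[≠] c) (𝓝 0) := by
    have : Tendsto (fun z => f c * (z - c)) (𝓝 c) (𝓝 (f c * (c - c))) :=
      Continuous.tendsto (by fun_prop) c
    rw [sub_self, mul_zero] at this; exact this.mono_left nhdsWithin_le_nhds
  have h2 := h0.sub h1; grind

/-- The Schwarzian-type coefficient `λ'' + λ'²` of `e^λ`, real on the imaginary axis outside two
points, is determined by the behaviour of `λ` at infinity. -/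
theorem coefficient_eq {b S A1 A2 : ℝ} {lam : ℂ → ℂ} (hA : A1 ≠ A2)
    (hd : DifferentiableOn ℂ lam rhp) (hS : ∀ W ∈ rhp, |(lam W).im| ≤ S)
    (hlim : ∀ y : ℝ, ∃ p, Tendsto lam (𝓝[rhp] (y * I)) (𝓝 p))
    (hreal : ∀ y : ℝ, y ≠ A1 → y ≠ A2 → ∃ a : ℝ,
      Tendsto (fun W => deriv (deriv lam) W + deriv lam W ^ 2) (𝓝[rhp] (y * I)) (𝓝 a))
    (hinf : ∀ ε > 0, ∃ B : ℝ, ∀ W : ℂ, 0 < W.re → B < W.re → ‖lam W + 2 * b * log W‖ ≤ ε) :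
    ∀ W ∈ rhp, (deriv (deriv lam) W + deriv lam W ^ 2) * (W - A1 * I) * (W - A2 * I) =
      2 * b * (2 * b + 1) := by
  have hd1 : DifferentiableOn ℂ (deriv lam) rhp := hd.deriv isOpen_halfPlane
  have hd2 : DifferentiableOn ℂ (deriv (deriv lam)) rhp := hd1.deriv isOpen_halfPlane
  set q : ℂ → ℂ := fun W => deriv (deriv lam) W + deriv lam W ^ 2 with hq
  have hcone : ∀ (W : ℂ) (s : ℝ), ∀ z ∈ ball W s, W.re - s < z.re := fun W s z hz => by
    have := neg_le_of_abs_le (abs_re_le_norm (z - W)); rw [mem_ball, dist_eq_norm] at hz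
    rw [sub_re] at this; linarith
  have hsub : ∀ W : ℂ, ball W W.re ⊆ rhp := fun W z hz => by grind
  -- Cauchy estimates for `q`
  have hqb : ∀ W ∈ rhp, ∀ c T : ℝ, (∀ z ∈ ball W W.re, |(lam z).im - c| ≤ T) →
      ‖q W‖ * W.re ^ 2 ≤ 64 * (T + T ^ 2) := by
    intro W hW c T hT; obtain ⟨h1, h2⟩ := norm_deriv_le_of_abs_im_sub_le hW (hd.mono (hsub W)) hT
    have hW : 0 < W.re := hW; have h4 := norm_add_le (deriv (deriv lam) W) (deriv lam W ^ 2)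
    rw [norm_pow] at h4
    exact (mul_le_mul_of_nonneg_right (h4.trans (add_le_add h2 (pow_le_pow_left₀ (norm_nonneg _) h1
      2))) (sq_nonneg W.re)).trans_eq
      (by field_simp; ring)
  -- the extension of `q` by reflection
  set U : Set ℂ := {(A1 * I : ℂ), (A2 * I : ℂ)}ᶜ with hU
  have hmU : ∀ z, z ∈ U ↔ z ≠ A1 * I ∧ z ≠ A2 * I := fun z => by simp [hU]
  have hUo : IsOpen U := (toFinite _).isClosed.isOpen_compl
  have hFr : ∀ z ∈ U, z.re = 0 → ∃ a : ℝ, Tendsto q (𝓝[rhp] z) (𝓝 a) := by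
    intro z hz h0; rw [eq_im_mul_I h0]
    exact hreal z.im (fun h => ((hmU z).mp hz).1 (h ▸ eq_im_mul_I h0))
      fun h => ((hmU z).mp hz).2 (h ▸ eq_im_mul_I h0)
  set F := extendFrom rhp q with hF; set Q := reflect F with hQ
  obtain ⟨hQd, hFe⟩ : DifferentiableOn ℂ Q U ∧ ∀ W ∈ rhp, F W = q W :=
    differentiableOn_reflect_extendFrom hUo (fun z hz => by
    rw [hmU] at hz ⊢
    have : ∀ A : ℝ, -conj z = A * I → z = A * I := fun A h => by
      rw [← conj_conj z, ← neg_neg (conj z), h]; simp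
    grind) (hd2.add (hd1.pow 2)) hFr
  have hQq : ∀ z : ℂ, z.re ≠ 0 → ∃ w ∈ rhp, ‖Q z‖ = ‖q w‖ ∧ z.re ^ 2 = w.re ^ 2 ∧
      ∀ A : ℝ, ‖w - A * I‖ = ‖z - A * I‖ := by
    intro z hz; rcases hz.lt_or_gt with h | h
    · have hw : -conj z ∈ rhp := by simpa using h
      refine ⟨_, hw, ?_, by simp, fun A => ?_⟩
      · rw [hQ, reflect, if_neg (not_le.mpr h), RCLike.norm_conj, hFe _ hw]
      · rw [← RCLike.norm_conj (z - A * I), ← norm_neg]; simp; ring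
    · exact ⟨z, h, by rw [hQ, reflect, if_pos h.le, hFe z h], rfl, fun A => rfl⟩
  -- vanishing of the double poles
  have hpole : ∀ A : ℝ, (∀ᶠ z : ℂ in 𝓝[≠] (A * I), z ∈ U) →
      Tendsto (fun z => ‖Q z‖ * ‖z - A * I‖ ^ 2) (𝓝[≠] (A * I : ℂ)) (𝓝 0) := by
    intro A hAU; obtain ⟨p, hp⟩ := hlim A
    obtain ⟨δ0, hδ₀, hb0⟩ := eventually_nhds_iff_ball.mp (eventually_nhdsWithin_iff.mp hAU)
    refine Metric.tendsto_nhds.mpr fun ε hε => ?_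
    -- For `T ≤ 1` the quantity is at most `8192 T`, whence `8193`.
    obtain ⟨T, hT0, hT⟩ : ∃ T > 0, 64 * (64 * (T + T ^ 2)) < ε := by
      refine ⟨min 1 (ε / 8193), by positivity, ?_⟩
      have h1 : 0 < min 1 (ε / 8193) := by positivity
      nlinarith [min_le_left 1 (ε / 8193), min_le_right 1 (ε / 8193)]
    obtain ⟨δ1, hδ1, hb1⟩ := eventually_nhds_iff_ball.mp (eventually_nhdsWithin_iff.mp
      (hp.eventually (ball_mem_nhds p hT0)))
    set δ := min δ0 (δ1 / 2) with hδ
    have hδ0 : 0 < δ := lt_min hδ₀ (by linarith)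
    -- `λ` has a limit at `iA`, so its imaginary part oscillates by at most `T` near that point and
    -- the Cauchy estimate for `q` has a small constant. The removal lemma replaces `(Re z)²` by `|z
    -- - iA|²`, and so the coefficient of a double pole vanishes.
    have key := norm_mul_sq_le_of_norm_mul_re_sq_le (q := Q) (a := (A * I : ℂ)) (by simp) (δ := δ)
      (C := 64 * (T + T ^ 2)) (by positivity) (hQd.mono fun z hz => hb0 z
        (ball_subset_ball (min_le_left _ _) hz.1) hz.2) (fun z hz => by
        by_cases h0 : z.re = 0
        · rw [h0]; simp; positivity
        obtain ⟨w, hw, e1, e2, e3⟩ := hQq z h0; rw [e1, e2]; refine hqb w hw p.im T fun ζ hζ => ?_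
        have h1 := hz.1; rw [mem_ball, dist_eq_norm, ← e3 A] at h1
        have h2 := hb1 ζ (by
          rw [mem_ball, dist_eq_norm] at hζ ⊢
          have h3 := norm_sub_le_norm_sub_add_norm_sub ζ w (A * I)
          have h4 : w.re ≤ ‖w - A * I‖ := by simpa using re_le_norm (w - A * I)
          grind) (hsub w hζ)
        rw [dist_eq_norm] at h2
        exact (abs_im_le_norm _).trans h2.le)
    filter_upwards [self_mem_nhdsWithin, nhdsWithin_le_nhds (ball_mem_nhds _ (half_pos hδ0))]
      with z h1 h2
    rw [Real.dist_eq, sub_zero, abs_of_nonneg (by positivity)]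
    grind
  have hUm : ∀ A : ℝ, ∀ᶠ z : ℂ in 𝓝[≠] (A * I), z ∈ U := fun A => by
    have h1 : ∀ B : ℝ, ∀ᶠ z : ℂ in 𝓝[≠] (A * I), z ≠ B * I := fun B => by
      by_cases h : (A * I : ℂ) = B * I
      · rw [← h]; exact self_mem_nhdsWithin
      · exact nhdsWithin_le_nhds (isOpen_ne.mem_nhds h)
    filter_upwards [h1 A1, h1 A2] with z h2 h3 using (hmU z).mpr ⟨h2, h3⟩
  -- the entire function
  set r : ℂ → ℂ := fun W => Q W * (W - A1 * I) * (W - A2 * I) with hr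
  have hrd : DifferentiableOn ℂ r U := (hQd.mul (by fun_prop)).mul (by fun_prop)
  have hlit : ∀ A B : ℝ, Tendsto (fun z => Q z * (z - A * I) * (z - B * I) * (z - A * I))
      (𝓝[≠] (A * I : ℂ)) (𝓝 0) := fun A B => by
    have h1 : Tendsto (fun z : ℂ => ‖z - B * I‖) (𝓝[≠] (A * I : ℂ)) (𝓝 ‖(A * I - B * I : ℂ)‖) :=
      (Continuous.tendsto (by fun_prop) _).mono_left nhdsWithin_le_nhds
    have h2 := (hpole A (hUm A)).mul h1; rw [zero_mul] at h2
    refine tendsto_zero_iff_norm_tendsto_zero.mpr (h2.congr fun z => ?_); simp only [norm_mul]; ring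
  obtain ⟨g, hg, hge⟩ := exists_extension_of_tendsto_mul (f := r) (s := {(A2 * I : ℂ)}ᶜ)
    (c := A1 * I) (isOpen_ne.mem_nhds (fun h => hA (by simpa using h))) (hrd.mono fun z hz =>
      (hmU z).mpr ⟨hz.2, hz.1⟩) (hlit A1 A2)
  obtain ⟨G, hG, hGe⟩ := exists_extension_of_tendsto_mul (f := g) (s := univ) (c := A2 * I) univ_mem
    (hg.mono fun z hz => hz.2) ((hlit A2 A1).congr' (by
      filter_upwards [hUm A2] with z hz
      grind))
  have hGr : ∀ z ∈ U, G z = r z := fun z hz => by grind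
  -- boundedness at infinity
  have hS0 : 0 ≤ S := (abs_nonneg _).trans (hS 1 (by simp))
  set C0 := 64 * (S + S ^ 2) with hC₀
  have hC0 : 0 ≤ C0 := by positivity
  have hQ2 : ∀ z : ℂ, ‖Q z‖ * z.re ^ 2 ≤ C0 := fun z => by
    by_cases h0 : z.re = 0
    · rw [h0]; simpa using hC0
    obtain ⟨w, hw, e1, e2, -⟩ := hQq z h0; rw [e1, e2]
    exact hqb w hw 0 S fun ζ hζ => by grind
  set R := |A1| + |A2| + 1 with hR
  have hR0 : 0 < R := by positivity
  have hUR : ∀ w : ℂ, R < ‖w‖ → w ∈ U := fun w hw => by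
    rw [hmU]
    constructor <;> rintro rfl <;> simp at hw <;> grind
  have hinv : ∀ ζ ∈ ball (0 : ℂ) R⁻¹ \ {0}, R < ‖ζ⁻¹‖ := fun ζ hζ => by
    have h1 := hζ.1; rw [mem_ball_zero_iff] at h1; rw [norm_inv]
    exact (lt_inv_comm₀ hR0 (norm_pos_iff.mpr hζ.2)).mpr h1
  have hQinf : ∀ W : ℂ, 2 * R < ‖W‖ → ‖Q W‖ * ‖W‖ ^ 2 ≤ 64 * C0 := by
    intro W hW
    have hW0 : W ≠ 0 := fun h => by rw [h, norm_zero] at hW; linarith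
    -- The same lemma at infinity, by inversion: as `Re ζ⁻¹ = Re ζ/|ζ|²`, the weight `ζ⁻⁴` turns the
    -- bound for `|Q|(Re W)²` into the hypothesis at `0`.
    have := norm_mul_sq_le_of_norm_mul_re_sq_le (q := fun ζ => Q ζ⁻¹ * ζ⁻¹ ^ 4) (a := 0) (δ := R⁻¹)
      zero_re hC0 (fun ζ hζ => (((hQd.differentiableAt (hUo.mem_nhds (hUR _ (hinv ζ hζ)))).comp ζ
        (differentiableAt_inv hζ.2)).mul ((differentiableAt_inv hζ.2).pow 4)).differentiableWithinAt)
      (fun ζ hζ => by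
        refine le_of_eq_of_le ?_ (hQ2 ζ⁻¹); have h0 : ζ ≠ 0 := hζ.2
        rw [norm_mul, norm_pow, norm_inv, inv_re, normSq_eq_norm_sq]
        field_simp) W⁻¹ ⟨by
        rw [mem_ball_zero_iff, norm_inv, inv_lt_comm₀ (norm_pos_iff.mpr hW0) (by positivity)]
        field_simp
        linarith, inv_ne_zero hW0⟩
    refine le_of_eq_of_le ?_ this; rw [inv_inv, norm_mul, norm_pow, sub_zero, norm_inv]; field_simp
  have hbdd : Bornology.IsBounded (range G) := by
    refine (((isCompact_closedBall (0 : ℂ) (2 * R)).image_of_continuousOn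
      (hG.continuousOn.mono (subset_univ _))).isBounded.union
        (Metric.isBounded_closedBall (x := (0 : ℂ)) (r := 4 * (64 * C0)))).subset ?_
    rintro _ ⟨W, rfl⟩
    by_cases hW : ‖W‖ ≤ 2 * R
    · exact Or.inl ⟨W, mem_closedBall_zero_iff.mpr hW, rfl⟩
    · rw [not_le] at hW; refine Or.inr (mem_closedBall_zero_iff.mpr ?_)
      have h1 : ∀ A : ℝ, |A| ≤ R → ‖W - A * I‖ ≤ 2 * ‖W‖ := fun A hA => by
        have := norm_sub_le W (A * I)
        rw [norm_mul, norm_I, mul_one, norm_real, norm_eq_abs] at this; linarith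
      rw [hGr W (hUR W (by linarith)), hr]
      simp only [norm_mul]
      calc ‖Q W‖ * ‖W - A1 * I‖ * ‖W - A2 * I‖ ≤ ‖Q W‖ * (2 * ‖W‖) * (2 * ‖W‖) := by
            gcongr
            · exact h1 A1 (by linarith [abs_nonneg A2])
            · exact h1 A2 (by linarith [abs_nonneg A1])
        _ = 4 * (‖Q W‖ * ‖W‖ ^ 2) := by ring
        _ ≤ _ := by linarith [hQinf W hW]
  -- Liouville: the numerator is entire and bounded, so its value can be computed along the positive
  -- real axis.
  have hconst := fun W => (differentiableOn_univ.mp hG).apply_eq_apply_of_bounded hbdd W 1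
  have hrhpU : ∀ W ∈ rhp, W ∈ U := fun W hW => by
    rw [hmU]
    constructor <;> rintro rfl <;> simp at hW
  have hGq : ∀ W ∈ rhp, G W = q W * (W - A1 * I) * (W - A2 * I) := fun W hW => by
    rw [hGr W (hrhpU W hW), hr, hQ]
    simp only [reflect, if_pos (show 0 ≤ W.re from le_of_lt hW), hFe W hW]
  -- the value at infinity
  set κ : ℂ → ℂ := fun W => lam W + 2 * b * log W with hκ
  have hlog : ∀ W ∈ rhp, HasDerivAt (fun W => 2 * b * log W) (2 * b * W⁻¹) W := fun W hW =>
    (hasDerivAt_log (Or.inl hW)).const_mul _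
  have hld : ∀ W ∈ rhp, HasDerivAt lam (deriv lam W) W := fun W hW =>
    (hd.differentiableAt (isOpen_halfPlane.mem_nhds hW)).hasDerivAt
  have hκ1 : ∀ W ∈ rhp, deriv κ W = deriv lam W + 2 * b * W⁻¹ := fun W hW =>
    ((hld W hW).add (hlog W hW)).deriv
  have hκ2 : ∀ W ∈ rhp, deriv (deriv κ) W = deriv (deriv lam) W - 2 * b * (W⁻¹) ^ 2 := fun W hW => by
    rw [EventuallyEq.deriv_eq (f := fun W => deriv lam W + 2 * b * W⁻¹) (by
      filter_upwards [isOpen_halfPlane.mem_nhds hW] with z hz using hκ1 z hz)]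
    refine ((hd1.differentiableAt (isOpen_halfPlane.mem_nhds hW)).hasDerivAt.add
      ((hasDerivAt_inv (fun h => by simp [h] at hW)).const_mul (2 * b : ℂ))).deriv.trans ?_
    ring
  have hest : ∀ ε > 0, ∀ᶠ x : ℝ in atTop, ‖(x : ℂ) * deriv κ x‖ ≤ 16 * ε ∧
      ‖(x : ℂ) ^ 2 * deriv (deriv κ) x‖ ≤ 256 * ε := by
    intro ε hε; obtain ⟨B, hB⟩ := hinf ε hε
    filter_upwards [eventually_gt_atTop 0, eventually_gt_atTop (2 * B)] with x hx hxB
    have hb : ∀ z ∈ ball (x : ℂ) (x / 2), x / 2 < z.re := fun z hz => by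
      have := hcone x _ z hz; rw [ofReal_re] at this; linarith
    obtain ⟨h1, h2⟩ := norm_deriv_le_of_abs_im_sub_le (h := κ) (W := x) (c := 0) (S := ε) (half_pos hx)
      (fun z hz => have hz : 0 < z.re := by linarith [hb z hz]
        ((hld z hz).add (hlog z hz)).differentiableAt.differentiableWithinAt)
      (fun z hz => by
        rw [sub_zero]
        exact (abs_im_le_norm _).trans (hB z (by linarith [hb z hz]) (by linarith [hb z hz])))
    rw [norm_mul, norm_mul, norm_pow, norm_real, norm_eq_abs, abs_of_pos hx]
    exact ⟨(mul_le_mul_of_nonneg_left h1 hx.le).trans_eq (by field_simp; ring),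
      (mul_le_mul_of_nonneg_left h2 (sq_nonneg x)).trans_eq (by field_simp; ring)⟩
  have hsmall : ∀ u : ℝ → ℂ, (∀ ε > 0, ∀ᶠ x in atTop, ‖u x‖ ≤ 256 * ε) → Tendsto u atTop (𝓝 0) :=
    fun u hu => Metric.tendsto_nhds.mpr fun ε hε => by
      filter_upwards [hu (ε / 512) (by positivity)] with x hx
      rw [dist_zero_right]; linarith
  have hT1 := hsmall (fun x => (x : ℂ) * deriv κ x) fun ε hε => (hest ε hε).mono fun x hx => by
    linarith [hx.1]
  have hTA : ∀ A : ℝ, Tendsto (fun x : ℝ => 1 - A * I * (x : ℂ)⁻¹) atTop (𝓝 (1 - A * I * 0)) :=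
    fun A => (((continuous_ofReal.tendsto 0).comp tendsto_inv_atTop_zero).congr fun x => by
      simp).const_mul _ |>.const_sub _
  have hval : G 1 = (0 + 2 * b + (0 - 2 * b) ^ 2) * (1 - A1 * I * 0) * (1 - A2 * I * 0) := by
    refine tendsto_nhds_unique (tendsto_const_nhds (f := atTop (α := ℝ))) ((((((hsmall (fun x => (x
      : ℂ) ^ 2 * deriv (deriv κ) x) fun ε hε => (hest ε hε).mono fun x hx => hx.2).add_const (2 * b
      : ℂ)).add ((hT1.sub_const (2 * b : ℂ)).pow 2)).mul (hTA A1)).mul (hTA A2)).congr' ?_)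
    filter_upwards [eventually_gt_atTop 0] with x hx
    have hxr : (x : ℂ) ∈ rhp := by simpa using hx
    have hx0 : (x : ℂ) ≠ 0 := ofReal_ne_zero.mpr hx.ne'; grind
  grind

/-! ### Uniqueness of the solution -/

/-- For `W = P ℓ` and `v = e^{-ℓ/2b}` one has `W/v → 1` and `ℓ = -2b log v`. In the right half-plane
the principal logarithm of `(W/v) · v` splits. -/
theorem IsUniformizer.norm_inv_add_log_le (h : IsUniformizer b Ω P)
    (hb : 0 < b) {ε : ℝ} (hε : 0 < ε) : ∃ B : ℝ, ∀ W : ℂ, 0 < W.re → B < W.re →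
      ‖invFunOn P Ω W + 2 * b * log W‖ ≤ ε := by
  have hl : ∀ᶠ w in 𝓝 (1 : ℂ), ‖log w‖ < ε / (2 * b) ∧ 0 < w.re := by
    refine (((continuousAt_clog (by simp)).norm.eventually_lt_const ?_)).and
      (isOpen_halfPlane.mem_nhds (by simp))
    simp_all
  obtain ⟨η, hη, hη'⟩ := eventually_nhds_iff_ball.mp hl
  obtain ⟨R, C, hRC⟩ := h.norm_sub_exp_le hb (half_pos hη)
  obtain ⟨B, hB⟩ := h.exists_re_bound (max (rexp (-R / (2 * b))) (2 * |C| / η))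
  refine ⟨B, fun W hW hWB => ?_⟩; obtain ⟨h1, h2⟩ := h.inv_mem hb hW
  have h3 := hB _ h1 (by rwa [h2])
  have hA := h.subset h1; set ℓ := invFunOn P Ω W with hℓ; have hv0 := re_exp_neg_div_pos hb hA
  have hℓv := log_chart_symm hb hA; have hn := h3.trans_le (re_le_norm _)
  have h4 : ℓ.re < R := by
    have := (le_max_left _ _).trans_lt hn
    rw [norm_exp_neg_div, exp_lt_exp, div_lt_div_iff_of_pos_right (by linarith)] at this
    linarith
  have h5 := (hRC ℓ hA h4).2; set v := exp (-ℓ / (2 * b)) with hv; have hvn : v ≠ 0 := exp_ne_zero _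
  have h6 : |C| < η / 2 * ‖v‖ := by
    have := (le_max_right _ _).trans_lt hn; rw [div_lt_iff₀ hη] at this; linarith
  rw [h2] at h5
  obtain ⟨h7, h8⟩ := hη' (W / v) (by
    rw [mem_ball, dist_eq_norm, div_sub_one hvn, norm_div, div_lt_iff₀ (norm_pos_iff.mpr hvn)]
    linarith [le_abs_self C])
  have a1 := abs_lt.mp (abs_arg_lt_pi_div_two_iff.mpr (Or.inl h8))
  have a2 := abs_lt.mp (abs_arg_lt_pi_div_two_iff.mpr (Or.inl hv0))
  have hlog : log W = log (W / v) + log v := by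
    rw [← (log_mul_eq_add_log_iff (fun h0 => by simp [h0] at h8) hvn).mpr
      ⟨by linarith [a1.1, a2.1], by linarith [a1.2, a2.2]⟩, div_mul_cancel₀ _ hvn]
  rw [← hℓv, hlog, show -2 * b * log v + 2 * b * (log (W / v) + log v) = (2 * b : ℝ) * log (W / v) by
    push_cast; ring, norm_mul, norm_real, norm_eq_abs, abs_of_pos (by linarith)]
  rw [lt_div_iff₀ (by linarith)] at h7
  linarith

include hb

theorem riccati_logWedgeMap (h : l ∈ logSector b) :
    deriv (deriv (logWedgeMap b)) l + deriv (logWedgeMap b) l ^ 2 +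
      1 / (2 * b) * ((1 - exp (l / b)) / (1 + exp (l / b))) * deriv (logWedgeMap b) l =
      1 + 1 / (2 * b) := by
  have hd := differentiableOn_logWedgeMap hb; have ho := isOpen_logSector b
  have h0 : ∀ z ∈ logSector b, (fun l => exp l * hypFactor b (exp (l / b))) z =
      exp (logWedgeMap b z) := fun z hz =>
    (exp_logWedgeMap hb (subset_closedLogSector b hz)).symm
  have hD : ∀ z ∈ logSector b, HasDerivAt (logWedgeMap b) (deriv (logWedgeMap b) z) z := fun z hz =>
    (hd.differentiableAt (ho.mem_nhds hz)).hasDerivAt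
  have h1 : ∀ z ∈ logSector b, deriv (fun l => exp l * hypFactor b (exp (l / b))) z =
      exp (logWedgeMap b z) * deriv (logWedgeMap b) z := fun z hz => by
    rw [(eventuallyEq_of_mem (ho.mem_nhds hz) h0).deriv_eq, (hD z hz).cexp.deriv]
  have h2 : deriv (deriv fun l => exp l * hypFactor b (exp (l / b))) l =
      exp (logWedgeMap b l) * deriv (logWedgeMap b) l * deriv (logWedgeMap b) l +
        exp (logWedgeMap b l) * deriv (deriv (logWedgeMap b)) l := by
    rw [(eventuallyEq_of_mem (ho.mem_nhds h) h1).deriv_eq]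
    exact ((hD l h).cexp.mul ((hd.deriv ho).differentiableAt (ho.mem_nhds h)).hasDerivAt).deriv
  have := satisfiesLogWedgeODE_hypFactor hb l h; rw [h2, h1 l h, h0 l h] at this
  refine mul_left_cancel₀ (exp_ne_zero (logWedgeMap b l)) ?_; linear_combination this

omit hb

namespace IsWedgeSolution

variable {x c : ℝ}

/-- From `λ' = 1/P'` and `λ'' = -P''/P'³` one gets `λ'' + λ'² = (P' - P'')/P'³`, the quantity whose
limit is real at regular boundary points. -/
theorem exists_coefficient (h : IsWedgeSolution b x c γ Ω Φ P) (hb : 0 < b)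
    (hγ : MapsTo γ (Ioo 0 1) (logAngle b)) : ∃ A1 A2 : ℝ, A1 < A2 ∧ ∀ W ∈ rhp,
      (deriv (deriv (invFunOn P Ω)) W + deriv (invFunOn P Ω) W ^ 2) *
        (W - A1 * I) * (W - A2 * I) = 2 * b * (2 * b + 1) := by
  obtain ⟨A1, A2, hA, hreg⟩ := h.exists_exceptional hb hγ; set lam := invFunOn P Ω with hlam
  have hd : ∀ W ∈ rhp, HasDerivAt lam (deriv P (lam W))⁻¹ W := fun W hW => h.hasDerivAt_inv hb hW
  refine ⟨A1, A2, hA, coefficient_eq hA.ne (S := π * b)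
    (fun W hW => (hd W hW).differentiableAt.differentiableWithinAt)
    (fun W hW => (show |(lam W).im| < _ from h.subset (h.inv_mem hb hW).1).le)
    (fun y => (h.exists_tendsto_inv hb (fun p hp => h.isRegularPoint hb hp) y).imp fun p hp => hp.2)
    (fun y h1 h2 => ?_) (fun ε hε => h.norm_inv_add_log_le hb hε)⟩
  obtain ⟨p, hp, hr⟩ := hreg y h1 h2
  have hlim : Tendsto lam (𝓝[rhp] (y * I)) (𝓝[Ω] p) := tendsto_nhdsWithin_iff.mpr
    ⟨h.tendsto_inv_of_isRegularPoint hb hp hr, by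
      filter_upwards [self_mem_nhdsWithin] with W hW using (h.inv_mem hb hW).1⟩
  obtain ⟨d1, d2, hd0, t1, t2, -, him⟩ := hr; refine ⟨((d1 - d2) / d1 ^ 3).re, ?_⟩
  rw [show ((((d1 - d2) / d1 ^ 3).re : ℝ) : ℂ) = (d1 - d2) / d1 ^ 3 from
    Complex.ext rfl (by rw [ofReal_im, him])]
  refine (((t1.comp hlim).sub (t2.comp hlim)).div ((t1.comp hlim).pow 3)
    (pow_ne_zero 3 hd0)).congr' ?_
  filter_upwards [self_mem_nhdsWithin] with W hW; have hm := h.isOpen.mem_nhds (h.inv_mem hb hW).1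
  have hP0 : deriv P (lam W) ≠ 0 := deriv_ne_zero_of_injOn h.isOpen h.differentiableOn
    (h.bijOn hb).injOn (h.inv_mem hb hW).1
  have hdd : deriv (deriv lam) W =
      -(deriv (deriv P) (lam W) * (deriv P (lam W))⁻¹) / deriv P (lam W) ^ 2 := by
    rw [(eventuallyEq_of_mem (isOpen_halfPlane.mem_nhds hW) fun w hw => (hd w hw).deriv).deriv_eq]
    exact ((((h.differentiableOn.deriv h.isOpen).differentiableAt hm).hasDerivAt.comp W
      (hd W hW)).inv hP0).deriv
  rw [hdd, (hd W hW).deriv]; simp only [Pi.div_apply, comp_apply]; field_simp; ring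

/-- The region of a solution is the explicit one. -/
theorem exists_eq_image (h : IsWedgeSolution b x c γ Ω Φ P) (hb : 0 < b)
    (hγ : MapsTo γ (Ioo 0 1) (logAngle b)) : ∃ μ : ℝ, Ω = scaledMap b μ '' logSector b := by
  obtain ⟨A1, A2, hA, hq⟩ := h.exists_coefficient hb hγ
  have hb0 : (b : ℂ) ≠ 0 := ofReal_ne_zero.mpr hb.ne'; set lam := invFunOn P Ω with hlam
  have hlamd : DifferentiableOn ℂ lam rhp := fun W hW =>
    (h.hasDerivAt_inv hb hW).differentiableAt.differentiableWithinAt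
  -- With this `k` and the `τ` below, the affine map `W ↦ iτ + kW` takes the values `∓2i` of the
  -- model map at the corners to `iA1` and `iA2`.
  set k := (A2 - A1) / 4 with hk
  have hk0 : 0 < k := by linarith
  set τ := (A1 + A2) / 2 with hτ; set Z : ℂ → ℂ := fun l => τ * I + k * modelMap b l with hZ
  have hZre : ∀ l, (Z l).re = k * (modelMap b l).re := fun l => by
    rw [hZ]; simp only [add_re, re_ofReal_mul, I_re, mul_zero, zero_add]
  have hZm : ∀ l ∈ logSector b, Z l ∈ rhp := fun l hl => by
    show 0 < (Z l).re; rw [hZre]; exact mul_pos hk0 (re_modelMap_pos hb hl)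
  set T1 : ℂ → ℂ := fun l => -(1 / (2 * b)) * (exp (-l / (2 * b)) + exp (l / (2 * b))) with hT₁
  have hT1 : ∀ l, HasDerivAt (modelMap b) (T1 l) l := fun l => hasDerivAt_modelMap b l
  have hT2 : ∀ l, HasDerivAt T1 (modelMap b l / (2 * b) ^ 2) l := fun l => by
    have h1 := ((hasDerivAt_neg l).div_const (2 * b : ℂ)).cexp
    have h2 := ((hasDerivAt_id' l).div_const (2 * b : ℂ)).cexp
    convert! (h1.add h2).const_mul (-(1 / (2 * b : ℂ))) using 1
    simp only [modelMap]; field_simp; ring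
  have ho := isOpen_logSector b; set M : ℂ → ℂ := fun l => lam (Z l) with hM
  have hZd : ∀ l, HasDerivAt Z (k * T1 l) l := fun l => ((hT1 l).const_mul _).const_add _
  set M1 : ℂ → ℂ := fun l => deriv lam (Z l) * (k * T1 l) with hM1
  have hMd : ∀ l ∈ logSector b, HasDerivAt M (M1 l) l := fun l hl =>
    (hlamd.differentiableAt (isOpen_halfPlane.mem_nhds (hZm l hl))).hasDerivAt.comp l (hZd l)
  have hM1d : ∀ l ∈ logSector b, HasDerivAt M1 (deriv (deriv lam) (Z l) * (k * T1 l) * (k * T1 l) +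
      deriv lam (Z l) * (k * (modelMap b l / (2 * b) ^ 2))) l := fun l hl =>
    (((hlamd.deriv isOpen_halfPlane).differentiableAt (isOpen_halfPlane.mem_nhds
      (hZm l hl))).hasDerivAt.comp l (hZd l)).mul ((hT2 l).const_mul _)
  set a : ℂ → ℂ := fun l => 1 / (2 * b) * ((1 - exp (l / b)) / (1 + exp (l / b))) with ha
  have he12 : ∀ l, exp (-l / (2 * b)) * exp (l / (2 * b)) = 1 := fun l => by
    rw [← exp_add, neg_div, neg_add_cancel, exp_zero]
  have hee : ∀ l, exp (l / b) = exp (l / (2 * b)) ^ 2 := fun l => by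
    rw [← exp_nat_mul]; congr 1; push_cast; field_simp
  have haT : ∀ l ∈ logSector b, a l * T1 l = -(modelMap b l / (2 * b) ^ 2) := fun l hl => by
    have h1 := one_add_exp_ne_zero hb (Or.inl hl.1); simp only [ha, hT₁, modelMap]; rw [hee] at h1 ⊢
    have h2 := he12 l; set e₁ := exp (-l / (2 * b)); set e₂ := exp (l / (2 * b)); field_simp
    linear_combination (2 * e₂) * h2
  have hT0 : ∀ l ∈ logSector b, T1 l ≠ 0 := fun l hl h0 => by
    have h1 := one_add_exp_ne_zero hb (Or.inl hl.1); rw [hee] at h1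
    have h2 : exp (-l / (2 * b)) + exp (l / (2 * b)) = 0 :=
      (mul_eq_zero.mp h0).resolve_left (by simp [hb0])
    exact h1 (by linear_combination exp (l / (2 * b)) * h2 - he12 l)
  have hric : ∀ l ∈ logSector b, (deriv (deriv lam) (Z l) * (k * T1 l) * (k * T1 l) +
      deriv lam (Z l) * (k * (modelMap b l / (2 * b) ^ 2))) + M1 l ^ 2 + a l * M1 l =
      1 + 1 / (2 * b) := fun l hl => by
    have h1 := hq (Z l) (hZm l hl); have h2 := haT l hl
    -- The model map `m` satisfies `m² + 4 = (2b m')²`, because `(v - 1/v)² + 4 = (v + 1/v)²`. So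
    -- the denominator of the coefficient cancels against the chain rule factor.
    have h3 : (Z l - A1 * I) * (Z l - A2 * I) = (k * T1 l) ^ 2 * (2 * b) ^ 2 := by
      have e1 : (A1 : ℂ) = τ - 2 * k := by rw [hτ, hk]; push_cast; ring
      have e2 : (A2 : ℂ) = τ + 2 * k := by rw [hτ, hk]; push_cast; ring
      simp only [e1, e2, hZ, hT₁, modelMap]; have h5 := he12 l; set e₁ := exp (-l / (2 * b))
      set e₂ := exp (l / (2 * b)); field_simp
      linear_combination (-4 * (k : ℂ) ^ 2) * h5 - 4 * k ^ 2 * I_sq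
    rw [mul_assoc, h3] at h1
    have h4 : (deriv (deriv lam) (Z l) + deriv lam (Z l) ^ 2) * (k * T1 l) ^ 2 = 1 + 1 / (2 * b) := by
      refine mul_right_cancel₀ (pow_ne_zero 2 (mul_ne_zero two_ne_zero hb0)) ?_; rw [mul_assoc, h1]
      field_simp
    simp only [hM1]; linear_combination h4 + deriv lam (Z l) * k * h2
  -- the Wronskian
  set L := logWedgeMap b with hL
  have hLd : ∀ l ∈ logSector b, HasDerivAt L (deriv L l) l := fun l hl =>
    ((differentiableOn_logWedgeMap hb).differentiableAt (ho.mem_nhds hl)).hasDerivAt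
  have hL1d : ∀ l ∈ logSector b, HasDerivAt (deriv L) (deriv (deriv L) l) l := fun l hl =>
    (((differentiableOn_logWedgeMap hb).deriv ho).differentiableAt (ho.mem_nhds hl)).hasDerivAt
  -- The Wronskian of the solutions `e^M` and `e^L` of one linear equation with first order
  -- coefficient `a`. Since `T1' = -a T1`, Abel's formula makes its quotient by `T1` constant.
  set N : ℂ → ℂ := fun l => (M1 l - deriv L l) * exp (M l + L l) / T1 l with hN
  have hNd : ∀ l ∈ logSector b, HasDerivAt N 0 l := fun l hl => by
    have h1 := (((hM1d l hl).sub (hL1d l hl)).mul ((hMd l hl).add (hLd l hl)).cexp).div (hT2 l)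
      (hT0 l hl)
    convert! h1 using 1
    have h2 := hric l hl; have h3 : _ = _ := riccati_logWedgeMap hb hl; have h4 := haT l hl
    have h5 := hT0 l hl; rw [eq_comm, div_eq_zero_iff]; left
    simp only [Pi.add_apply, Pi.sub_apply, Pi.mul_apply]
    linear_combination (exp (M l + L l) * T1 l) * (h2 - h3) -
      (M1 l - deriv L l) * exp (M l + L l) * h4
  have hcst : ∀ f : ℂ → ℂ, (∀ z ∈ logSector b, HasDerivAt f 0 z) → ∀ l ∈ logSector b,
      ∀ l' ∈ logSector b, f l = f l' := fun f hf l hl l' hl' =>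
    ho.is_const_of_deriv_eq_zero (convex_logSector b).isPreconnected
      (fun z hz => (hf z hz).differentiableAt.differentiableWithinAt) (fun z hz => (hf z hz).deriv)
      hl hl'
  have hMΩ : ∀ l ∈ logSector b, M l ∈ Ω := fun l hl => (h.inv_mem hb (hZm l hl)).1
  have hπ : 0 < π * b := by positivity
  obtain ⟨B, hB⟩ := h.bounded; obtain ⟨C, hC⟩ := exists_norm_logWedgeMap_sub_self_le hb
  -- A disk of radius `πb` about `s` fits in the half-strip, and `M`, `L` have imaginary parts at
  -- most `πb`, so each derivative at `s` is at most `8`. As `Re M` is bounded above, `Re L ≤ s + C`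
  -- and `|T1| ≥ 1/b`, the quotient is `O(e^s)`.
  have hNb : ∀ s : ℝ, s < -(π * b) → ‖N s‖ ≤ 16 * rexp (B + C + s) * b := by
    intro s hs
    have hball : ball (s : ℂ) (π * b) ⊆ logSector b := fun z hz => by
      rw [mem_ball, dist_eq_norm] at hz; have e1 := (abs_re_le_norm (z - s)).trans_lt hz
      have e2 := (abs_im_le_norm (z - s)).trans_lt hz; rw [sub_im, ofReal_im, sub_zero] at e2
      rw [sub_re, ofReal_re, abs_lt] at e1
      exact ⟨by linarith [e1.2], e2⟩
    have hs' : (s : ℂ) ∈ logSector b := hball (mem_ball_self hπ)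
    have hbd : ∀ f f' : ℂ → ℂ, (∀ z ∈ logSector b, HasDerivAt f (f' z) z ∧ |(f z).im| ≤ π * b) →
        ‖f' s‖ ≤ 8 := fun f f' hf => by
      have := (norm_deriv_le_of_abs_im_sub_le (c := 0) hπ
        (fun z hz => (hf z (hball hz)).1.differentiableAt.differentiableWithinAt)
        fun z hz => by rw [sub_zero]; exact (hf z (hball hz)).2).1
      rwa [(hf s hs').1.deriv, mul_div_assoc, div_self hπ.ne', mul_one] at this
    have h1 := hbd M M1 fun z hz => ⟨hMd z hz, (show |(M z).im| < _ from h.subset (hMΩ z hz)).le⟩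
    have h2 := hbd L _ fun z hz =>
      ⟨hLd z hz, (abs_im_logWedgeMap_lt hb (subset_closedLogSector b hz) hz.2).le⟩
    have h3 : ‖exp (M s + L s)‖ ≤ rexp (B + C + s) := by
      rw [norm_exp, exp_le_exp, add_re]; have e1 := hB _ (hMΩ s hs')
      have e2 := (re_le_norm _).trans (hC s (subset_closedLogSector b hs'))
      rw [sub_re, ofReal_re] at e2; linarith
    have h4 : b⁻¹ ≤ ‖T1 s‖ := by
      have e1 : T1 s = ((-(1 / (2 * b)) * (rexp (-(s / (2 * b))) + rexp (s / (2 * b))) : ℝ) :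
          ℂ) := by
        simp only [hT₁]; push_cast; rw [neg_div]
      rw [e1, norm_real, norm_mul, norm_neg, norm_eq_abs, norm_eq_abs,
        abs_of_pos (by positivity), abs_of_pos (by positivity)]
      have := mul_le_mul_of_nonneg_left (two_le_exp_neg_add_exp (s / (2 * b)))
        (show 0 ≤ 1 / (2 * b) by positivity)
      refine le_of_eq_of_le ?_ this; field_simp
    simp only [hN]; rw [norm_div, norm_mul, div_le_iff₀ (norm_pos_iff.mpr (hT0 s hs'))]
    calc ‖M1 s - deriv L s‖ * ‖exp (M s + L s)‖ ≤ 16 * rexp (B + C + s) :=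
          mul_le_mul (by linarith [norm_sub_le (M1 s) (deriv L s)]) h3 (norm_nonneg _) (by norm_num)
      _ = 16 * rexp (B + C + s) * b * b⁻¹ := by field_simp
      _ ≤ _ := mul_le_mul_of_nonneg_left h4 (by positivity)
  have hN0 : ∀ l ∈ logSector b, N l = 0 := fun l hl => by
    refine norm_le_zero_iff.mp (ge_of_tendsto (f := fun s : ℝ => 16 * rexp (B + C + s) * b)
      (x := atBot) ?_ ?_)
    · have := ((tendsto_exp_atBot.comp (tendsto_atBot_add_const_left atBot (B + C)
        tendsto_id)).const_mul 16).mul_const b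
      simpa using this
    · filter_upwards [eventually_lt_atBot (-(π * b))] with s hs
      rw [hcst N hNd l hl s ⟨by rw [ofReal_re]; linarith, by simpa using hπ⟩]
      exact hNb s hs
  have hML : ∀ l ∈ logSector b, M1 l = deriv L l := fun l hl => by
    have := hN0 l hl
    simp only [hN, div_eq_zero_iff, mul_eq_zero, exp_ne_zero, hT0 l hl, or_false] at this
    exact sub_eq_zero.mp this
  set m := M (-1) - L (-1) with hm
  have hMLc : ∀ l ∈ logSector b, M l = L l + m := fun l hl => by
    have := hcst (fun z => M z - L z) (fun z hz => by
      have := (hMd z hz).sub (hLd z hz)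
      rwa [hML z hz, sub_self] at this) l hl _ (neg_one_mem_logSector hb)
    rw [hm, ← this, add_sub_cancel]
  have himg : Ω = M '' logSector b := by
    refine Subset.antisymm (fun z hz => ?_) (image_subset_iff.mpr hMΩ)
    have hw : 0 < ((P z - τ * I) / k).re := by
      rw [div_ofReal_re, sub_re, re_ofReal_mul, I_re, mul_zero, sub_zero]
      exact div_pos (h.re_pos hb z hz) hk0
    refine ⟨_, modelInv_mem_logSector hb hw, ?_⟩
    have hk' : (k : ℂ) ≠ 0 := ofReal_ne_zero.mpr hk0.ne'; simp only [hM, hZ]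
    rw [(modelInv_mem hb hw.le).2, mul_div_cancel₀ _ hk', add_sub_cancel]
    exact (h.bijOn hb).injOn.leftInvOn_invFunOn hz
  -- Near the vertex both regions fill the whole strip, so the translation carrying one to the other
  -- has no vertical component: a point of `Ω` close to the appropriate side would come from outside
  -- the strip.
  have hmi : m.im = 0 := by
    obtain ⟨R, hR⟩ := h.vertex
    have key : ∀ σ : ℝ, |σ| = 1 → ¬0 < σ * m.im := by
      intro σ hσ hpos
      have hσ2 : σ * σ = 1 := by rw [← abs_mul_abs_self, hσ, one_mul]
      set η := min (σ * m.im / 2) (π * b) with hη; have hη0 : 0 < η := lt_min (half_pos hpos) hπ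
      have e1 := min_le_left (σ * m.im / 2) (π * b); have e2 := min_le_right (σ * m.im / 2) (π * b)
      have hz : (⟨R - 1, -σ * (π * b - η)⟩ : ℂ) ∈ Ω := hR _ (by
        show |-σ * (π * b - η)| < _
        rw [abs_mul, abs_neg, hσ, one_mul, abs_of_nonneg (by linarith)]
        linarith) (by show R - 1 < R; linarith)
      rw [himg] at hz; obtain ⟨l, hl, e⟩ := hz
      have e3 := abs_im_logWedgeMap_lt hb (subset_closedLogSector b hl) hl.2; rw [hMLc l hl] at e
      have e4 : (L l).im + m.im = -σ * (π * b - η) := by rw [← add_im, e]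
      rw [show (logWedgeMap b l).im = -σ * (π * b - η) - m.im by linarith,
        ← one_mul |_|, ← hσ, ← abs_mul, show σ * (-σ * (π * b - η) - m.im) =
        -(σ * σ * (π * b - η) + σ * m.im) by ring, hσ2, abs_neg, one_mul] at e3
      linarith [le_abs_self (π * b - η + σ * m.im)]
    have k1 := key 1 abs_one
    have k2 := key (-1) (by simp)
    linarith
  refine ⟨m.re, himg.trans (image_congr fun l hl => ?_)⟩
  rw [hMLc l hl, scaledMap, show ((m.re : ℝ) : ℂ) = m from Complex.ext rfl (by simp [hmi])]

end IsWedgeSolution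

/-! ### Solutions of the problem are wedge solutions -/

theorem deriv_eq_of_re_eq {W : ℂ → ℂ} {z : ℂ} (hW : DifferentiableAt ℂ W z)
    (h : ∀ᶠ w in 𝓝 z, (W w).re = Φ w) : deriv W z = fderiv ℝ Φ z 1 - I * fderiv ℝ Φ z I := by
  rw [((reCLM.hasFDerivAt.comp z (hW.hasDerivAt.hasFDerivAt.restrictScalars
    ℝ)).congr_of_eventuallyEq (h.mono fun w hw => hw.symm)).fderiv]
  apply Complex.ext <;> simp

theorem notMem_closure_image_diff (hc : ContinuousOn γ (Icc 0 1))
    (hi : InjOn γ (Ioo 0 1)) {t : ℝ} (ht : t ∈ Ioo (0 : ℝ) 1) (h0 : γ t ≠ γ 0) (h1 : γ t ≠ γ 1)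
    {J : Set ℝ} (hJ : J ∈ 𝓝 t) : γ t ∉ closure (γ '' (Ioo 0 1 \ J)) := by
  have hcl : IsCompact (γ '' (Icc 0 1 \ interior J)) :=
    (isCompact_Icc.diff isOpen_interior).image_of_continuousOn (hc.mono sdiff_subset)
  intro h
  obtain ⟨s, ⟨hs, hsJ⟩, e⟩ := closure_minimal (image_mono (sdiff_subset_sdiff Ioo_subset_Icc_self
    interior_subset)) hcl.isClosed h
  rcases hs.1.eq_or_lt with rfl | hs0
  · exact h0 e.symm
  rcases hs.2.eq_or_lt with rfl | hs1
  · exact h1 e.symm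
  rw [hi ⟨hs0, hs1⟩ ht e] at hsJ; exact hsJ (mem_interior_iff_mem_nhds.mpr hJ)

/-- The common core for the surface and the plane. It uses the open curve only, with the corners
entering through `hend` and `hfc`, so it does not matter that for `b = 1` the planar curve pulled
back by the logarithm has no continuous end at the cut. -/
theorem exists_eq_image_of_curve {b x c : ℝ} (hb : 0 < b) {W : ℂ → ℂ} (ho : IsOpen Ω) (hpre :
    IsPreconnected Ω) (hsub : Ω ⊆ logAngle b)
    (hbd : ∃ M, ∀ l ∈ Ω, l.re ≤ M) (hleft : ∀ R, ∃ l ∈ Ω, l.re < R)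
    (hγ : MapsTo γ (Ioo 0 1) (logAngle b)) (hγ2 : ContDiffOn ℝ 2 γ (Ioo 0 1))
    (hreg : ∀ t ∈ Ioo (0 : ℝ) 1, deriv γ t ≠ 0) (hlow : ∃ R, ∀ t ∈ Ioo (0 : ℝ) 1, R ≤ (γ t).re)
    (hend : ∀ p ∈ closure (γ '' Ioo 0 1), |p.im| = π * b → p.re = x)
    (hcl : ∀ t ∈ Ioo (0 : ℝ) 1, ∀ J ∈ 𝓝 t, γ t ∉ closure (γ '' (Ioo 0 1 \ J)))
    (hfr : ∀ t ∈ Ioo (0 : ℝ) 1, γ t ∈ frontier Ω)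
    (hfc : ∀ p ∈ frontier Ω, (∃ t ∈ Ioo (0 : ℝ) 1, γ t = p) ∨ (|p.im| = π * b ∧ p.re ≤ x))
    (hW : DifferentiableOn ℂ W Ω) (hWΦ : ∀ z ∈ Ω, (W z).re = Φ z)
    (hΦ : ContDiffOn ℝ 2 Φ (Ω ∪ γ '' Ioo 0 1)) (h0 : ∀ t ∈ Ioo (0 : ℝ) 1, Φ (γ t) = 0)
    (hlim : ∀ p ∈ frontier Ω, Tendsto Φ (𝓝[Ω] p) (𝓝 0))
    (hnear : IsEquivalent (comap re atBot ⊓ 𝓟 Ω) Φ (fun l => -(exp (-l / (2 * b))).re))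
    (hn : ∀ t ∈ Ioo (0 : ℝ) 1, ∃ ν : ℂ, ‖ν‖ = 1 ∧ inner ℝ (deriv γ t) ν = 0 ∧
      (∃ p : ℝ → ℂ, ∃ m : ℝ, 0 < m ∧ HasDerivAt p (m * ν) 0 ∧ p 0 = γ t ∧
        ∀ᶠ ε : ℝ in 𝓝[>] 0, p (-ε) ∈ Ω ∧ p ε ∉ Ω) ∧
      ∃ A : ℂ →L[ℝ] ℝ, HasFDerivWithinAt Φ A (Ω ∪ γ '' Ioo 0 1) (γ t) ∧
        A ν = c * rexp (2 * (γ t).re) * ν.re) :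
    ∃ μ : ℝ, Ω = scaledMap b μ '' logSector b := by
  -- To the left of the curve the strip is connected and contains no frontier point, so it lies in
  -- `Ω` as soon as it meets `Ω`.
  have hvertex : ∃ R, ∀ l ∈ logAngle b, l.re < R → l ∈ Ω := by
    obtain ⟨R, hR⟩ := hlow
    refine ⟨R, fun l h1 h2 => subset_of_disjoint_frontier (s := logAngle b ∩ {l | l.re < R}) ho
      ((convex_logAngle b).inter (convex_halfSpace_re_lt R)).isPreconnected ?_ ?_ ⟨h1, h2⟩⟩
    · obtain ⟨l, h3, h4⟩ := hleft R; exact ⟨l, ⟨hsub h3, h4⟩, h3⟩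
    · rintro p ⟨h3, h4 : p.re < R⟩ hp; rcases hfc p hp with ⟨t, ht, rfl⟩ | hp
      · grind
      · exact (show |p.im| < _ from h3).ne hp.1
  obtain ⟨M, hM⟩ := hbd
  refine IsWedgeSolution.exists_eq_image (P := fun z => -W z) ⟨⟨ho, hpre, hsub, ⟨M, hM⟩, hvertex,
    hW.neg, fun p hp => ?_, fun ε hε => ?_⟩, fun z hz => ?_, hΦ, h0, hγ2, hreg, hfr,
    fun t ht J hJ => ?_, hn, hfc, fun p hp hpx => ?_⟩ hb hγ
  · rw [← neg_zero]; refine (hlim p hp).neg.congr' ?_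
    filter_upwards [self_mem_nhdsWithin] with z hz; rw [neg_re, hWΦ z hz]
  · have h1 := hnear.isLittleO.def hε; rw [eventually_inf_principal, eventually_comap] at h1
    obtain ⟨R1, h1⟩ := eventually_atBot.mp h1; obtain ⟨R, hR⟩ := hvertex
    refine ⟨min R R1, fun l hl hlt => ?_⟩; have hm := hR l hl (hlt.trans_le (min_le_left _ _))
    have h2 := h1 _ (hlt.trans_le (min_le_right _ _)).le l rfl hm
    rw [Pi.sub_apply, norm_neg, norm_eq_abs, norm_eq_abs, sub_neg_eq_add,
      abs_of_pos (re_exp_neg_div_pos hb hl), ← hWΦ l hm] at h2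
    rwa [neg_re, ← abs_neg, neg_sub, sub_neg_eq_add, add_comm]
  · rw [deriv.fun_neg, deriv_eq_of_re_eq (hW.differentiableAt (ho.mem_nhds hz))
      (by filter_upwards [ho.mem_nhds hz] with w hw using hWΦ w hw)]
  · filter_upwards [isClosed_closure.isOpen_compl.mem_nhds (hcl t ht J hJ),
      (isOpen_lt continuous_im.abs continuous_const).mem_nhds (hγ ht)] with p h1 h2 hp
    rcases hfc p hp with ⟨s, hs, rfl⟩ | h3
    · by_contra h4; exact h1 (subset_closure ⟨s, ⟨hs, fun h5 => h4 ⟨s, h5, rfl⟩⟩, rfl⟩)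
    linarith
  · obtain ⟨R, hR⟩ := hlow
    have hK : IsCompact (closure (γ '' Ioo 0 1)) := by
      refine (isCompact_Icc (a := R) (b := M)).reProdIm (isCompact_Icc (a := -(π * b))
        (b := π * b)) |>.of_isClosed_subset isClosed_closure (closure_minimal ?_
        (isClosed_Icc.reProdIm isClosed_Icc))
      rintro _ ⟨t, ht, rfl⟩; have h1 := frontier_subset_closure (hfr t ht)
      exact ⟨⟨hR t ht, closure_minimal (t := {l : ℂ | l.re ≤ M}) hM
        (isClosed_le continuous_re continuous_const) h1⟩, abs_le.mp (abs_im_le_of_mem_closure hsub _ h1)⟩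
    have hAc : Convex ℝ {l : ℂ | l.re ≤ p.re ∧ l.im = p.im} :=
      (convex_halfSpace_re_le _).inter (convex_hyperplane imCLM.isLinear _)
    -- The part of the side to the left of `p` is disjoint from the compact closure of the curve,
    -- hence at positive distance. Its thickening within the strip is connected, reaches the vertex
    -- and misses the frontier.
    obtain ⟨δ, hδ, hdis⟩ := Disjoint.exists_thickenings (disjoint_left.mpr fun l h1 h2 =>
      (hend l h1 (by rw [h2.2, hp])).not_lt (h2.1.trans_lt hpx)) hK ((isClosed_le continuous_re
        continuous_const).inter (isClosed_eq continuous_im continuous_const))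
    refine ⟨δ, hδ, (inter_subset_inter_left _ (Metric.ball_subset_thickening
      (show p ∈ {l : ℂ | l.re ≤ p.re ∧ l.im = p.im} from ⟨le_rfl, rfl⟩) δ)).trans
      (subset_of_disjoint_frontier ho ((hAc.thickening δ).inter (convex_logAngle b)).isPreconnected ?_ ?_)⟩
    · obtain ⟨R', hR'⟩ := hvertex
      have hπ : 0 < π * b := by positivity
      have hc : Tendsto (fun κ : ℝ => ((min p.re (R' - 1) : ℝ) + (κ * p.im : ℝ) * I : ℂ)) (𝓝[<] 1)
          (𝓝 ((min p.re (R' - 1) : ℝ) + p.im * I)) :=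
        (Continuous.tendsto' (by fun_prop) _ _ (by simp)).mono_left nhdsWithin_le_nhds
      obtain ⟨κ, k1, k2⟩ := ((eventually_mem_set.mpr (Ioo_mem_nhdsLT zero_lt_one)).and
        (hc.eventually (ball_mem_nhds _ hδ))).exists
      have hm : ((min p.re (R' - 1) : ℝ) + (κ * p.im : ℝ) * I : ℂ) ∈ logAngle b := by
        show |Complex.im _| < _
        rw [add_im, ofReal_im, zero_add, im_ofReal_mul, I_im, mul_one, abs_mul, hp, abs_of_pos k1.1]
        nlinarith [k1.2]
      exact ⟨_, ⟨Metric.mem_thickening_iff.mpr ⟨_, ⟨by simp, by simp⟩, k2⟩, hm⟩, hR' _ hm (by simp)⟩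
    · rintro q ⟨h1, h2⟩ hq; rcases hfc q hq with ⟨t, ht, rfl⟩ | h3
      · exact disjoint_left.mp hdis (Metric.self_subset_thickening hδ _
          (subset_closure ⟨t, ht, rfl⟩)) h1
      · exact (show |q.im| < _ from h2).ne h3.1

include hb

theorem exists_eq_image_of_solvesLogKillingProblem (h : SolvesLogKillingProblem b Ω) : ∃ μ : ℝ, Ω =
    scaledMap b μ '' logSector b := by
  obtain ⟨γ, Φ, c, hR, hP, hc⟩ := h
  obtain ⟨W, hW, hWΦ, -⟩ := exists_re_eq_of_harmonicOnNhd hR.isOpen hR.isSimplyConnected hP.harmonic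
  obtain ⟨x, e0, e1, hf⟩ := hR.boundary
  have hπ : 0 < π * b := by positivity
  have hin : ∀ t ∈ Icc (0 : ℝ) 1, t ∈ Ioo (0 : ℝ) 1 ∨ (|(γ t).im| = π * b ∧ (γ t).re = x) := by
    intro t ht; rcases ht.1.eq_or_lt with rfl | h0
    · exact Or.inr (by rw [e0]; simp [abs_of_pos hπ])
    rcases ht.2.eq_or_lt with rfl | h1
    · exact Or.inr (by rw [e1]; simp [abs_of_pos hπ])
    grind
  have hfr : ∀ t ∈ Icc (0 : ℝ) 1, γ t ∈ frontier Ω := fun t ht => by grind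
  have him : ∀ t ∈ Ioo (0 : ℝ) 1, |(γ t).im| < π * b := fun t ht => hR.mapsTo ht
  obtain ⟨M, hM⟩ := hR.isBounded
  obtain ⟨C, hC⟩ := isCompact_Icc.exists_bound_of_continuousOn hR.continuousOn
  refine exists_eq_image_of_curve (x := x) (c := c) hb hR.isOpen
    hR.isSimplyConnected.isPathConnected.isConnected.isPreconnected hR.subset
    ⟨Real.log M, fun l hl => ?_⟩ (fun R => ?_) hR.mapsTo hR.contDiffOn hR.regular
    ⟨-C, fun t ht => ?_⟩ (fun p hp hpi => ?_) (fun t ht J hJ => ?_)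
    (fun t ht => hfr t (Ioo_subset_Icc_self ht)) (fun p hp => ?_) hW hWΦ hP.contDiffOn
    (fun t ht => hP.eq_zero _ (hfr t (Ioo_subset_Icc_self ht))) (fun p hp => ?_) hP.near_vertex
    (fun t ht => ?_)
  · rw [← Real.log_exp l.re, ← norm_exp]
    exact log_le_log (norm_pos_iff.mpr (exp_ne_zero _)) (hM l hl)
  · have : (⟨min x (R - 1), π * b⟩ : ℂ) ∈ closure Ω := frontier_subset_closure (by grind)
    obtain ⟨l, h1, h2⟩ := mem_closure_iff.mp this {l | l.re < R}
      (isOpen_lt continuous_re continuous_const) (show min x (R - 1) < R from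
        (min_le_right _ _).trans_lt (sub_one_lt R))
    exact ⟨l, h2, h1⟩
  · exact (abs_le.mp ((abs_re_le_norm _).trans (hC t (Ioo_subset_Icc_self ht)))).1
  · obtain ⟨t, ht, rfl⟩ := closure_minimal (image_mono Ioo_subset_Icc_self)
      (isCompact_Icc.image_of_continuousOn hR.continuousOn).isClosed hp
    grind
  · refine notMem_closure_image_diff hR.continuousOn hR.injOn ht (fun h1 => ?_) (fun h1 => ?_) hJ
    · grind
    grind
  · grind
  · have := (hP.continuousOn p (frontier_subset_closure hp)).mono subset_closure
    rwa [ContinuousWithinAt, hP.eq_zero p hp] at this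
  · obtain ⟨ν, ⟨h1, h2, h3⟩, h4⟩ := hc t ht
    refine ⟨ν, h1, h2, ⟨fun s => γ t + s * ν, 1, one_pos, ?_, by simp, ?_⟩, _,
      ((hP.contDiffOn.differentiableOn two_ne_zero) _ (Or.inr ⟨t, ht, rfl⟩)).hasFDerivWithinAt, ?_⟩
    · exact (ofRealCLM.hasDerivAt.mul_const ν).const_add _
    · filter_upwards [h3] with ε hε; rwa [ofReal_neg, neg_mul, ← sub_eq_add_neg]
    · have hE : ‖exp (γ t)‖ ≠ 0 := norm_ne_zero_iff.mpr (exp_ne_zero _)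
      rw [inv_mul_eq_iff_eq_mul₀ hE, inner_eq_re_conj_mul, show ∀ E : ℂ,
        conj E * (E / ‖exp (γ t)‖ * ν) = (conj E * E / ‖exp (γ t)‖) * ν
        from fun E => by
          ring, conj_mul', sq, mul_div_assoc, div_self (ofReal_ne_zero.mpr hE), mul_one,
        re_ofReal_mul] at h4
      rw [h4, two_mul, Real.exp_add, ← norm_exp]; ring

omit hb in
theorem mem_logAngle_of_exp_mem (hb1 : b ≤ 1) {p : ℂ} (hp : |p.im| ≤ π * b)
    (h : exp p ∈ openAngle b) : p ∈ logAngle b :=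
  exp_mem_image_iff hb1 subset_rfl hp ⟨log (exp p), log_mem_logAngle h, exp_log h.1⟩

/-- The region is pulled back by the principal logarithm, an inverse of `exp` on the open strip.
Frontier points of the pull-back are only projected by `exp`, never lifted continuously, so the cut
causes no trouble. -/
theorem exists_eq_image_of_solvesKillingProblem (hb1 : b ≤ 1) (h : SolvesKillingProblem b Ω) : ∃ μ :
    ℝ, Ω = exp '' (scaledMap b μ '' logSector b) := by
  obtain ⟨γ, Φ, c, hR, hP, hc⟩ := h
  obtain ⟨W, hW, hWΦ, -⟩ := exists_re_eq_of_harmonicOnNhd hR.isOpen hR.isSimplyConnected hP.harmonic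
  obtain ⟨a, ha, e0, e1, hf⟩ := hR.boundary
  have hπ : 0 < π * b := by positivity
  have hside : ∀ r : ℝ, 0 ≤ r → ∀ θ : ℝ, |θ| = π * b →
      (r : ℂ) * exp (θ * I) ∉ openAngle b ∧ ‖(r : ℂ) * exp (θ * I)‖ = r := fun r hr θ hθ => by
    refine ⟨fun hz => ?_, by simp_all⟩
    rw [← Real.exp_log (hr.lt_of_ne fun h0 => hz.1 (by simp_all)), ofReal_exp, ← exp_add] at hz
    have e : ((Real.log r : ℂ) + θ * I).im = θ := by simp
    have h1 : |((Real.log r : ℂ) + θ * I).im| < _ := mem_logAngle_of_exp_mem hb1 (by rw [e, hθ]) hz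
    grind
  have hθ : |-(π * b)| = π * b ∧ |π * b| = π * b := by grind
  have hin : ∀ t ∈ Icc (0 : ℝ) 1, t ∈ Ioo (0 : ℝ) 1 ∨ (γ t ∉ openAngle b ∧ ‖γ t‖ = a) := by
    intro t ht; rcases ht.1.eq_or_lt with rfl | h0
    · grind
    grind
  have hcase : ∀ z ∈ frontier Ω, (∃ t ∈ Ioo (0 : ℝ) 1, γ t = z) ∨ (z ∉ openAngle b ∧ ‖z‖ ≤ a) := by
    intro z hz; rw [hf] at hz; rcases hz with ⟨t, ht, rfl⟩ | ⟨r, hr, hra, rfl | rfl⟩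
    · grind
    · grind
    grind
  have hfr : ∀ t ∈ Ioo (0 : ℝ) 1, γ t ∈ frontier Ω := fun t ht => by grind
  have hnot : ∀ z ∈ frontier Ω, z ∉ Ω := fun z hz h1 => by
    rw [hR.isOpen.frontier_eq] at hz; exact hz.2 h1
  have hel : ∀ t ∈ Ioo (0 : ℝ) 1, exp (log (γ t)) = γ t := fun t ht => exp_log (hR.mapsTo ht).1
  have hdlog : ∀ z ∈ openAngle b, HasDerivAt log z⁻¹ z := fun z hz =>
    hasDerivAt_log (openAngle_subset_slitPlane hb1 hz)
  have hdγ : ∀ t ∈ Ioo (0 : ℝ) 1, HasDerivAt γ (deriv γ t) t := fun t ht =>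
    ((hR.contDiffOn.contDiffAt (Ioo_mem_nhds ht.1 ht.2)).differentiableAt two_ne_zero).hasDerivAt
  have hdg : ∀ t ∈ Ioo (0 : ℝ) 1, deriv (fun t => log (γ t)) t = (γ t)⁻¹ * deriv γ t := fun t ht =>
    ((hdlog _ (hR.mapsTo ht)).comp t (hdγ t ht)).deriv
  set O := log '' Ω with hO
  have hsub : O ⊆ logAngle b := image_subset_iff.mpr fun z hz => log_mem_logAngle (hR.subset hz)
  have hexp : ∀ l ∈ O, exp l ∈ Ω := by
    rintro _ ⟨z, hz, rfl⟩; rwa [exp_log (hR.subset hz).1]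
  have hOe : O = logAngle b ∩ exp ⁻¹' Ω := Subset.antisymm (fun l hl => ⟨hsub hl, hexp l hl⟩)
    fun l hl => ⟨exp l, hl.2, log_exp_of_mem hb1 hl.1⟩
  have hoO : IsOpen O := by
    rw [hOe]
    exact (isOpen_lt continuous_im.abs continuous_const).inter (hR.isOpen.preimage continuous_exp)
  have hfO : ∀ p ∈ frontier O, |p.im| ≤ π * b ∧ exp p ∈ frontier Ω := fun p hp => by
    rw [hoO.frontier_eq] at hp; have h1 := abs_im_le_of_mem_closure hsub _ hp.1; refine ⟨h1, ?_⟩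
    rw [hR.isOpen.frontier_eq]; refine ⟨map_mem_closure continuous_exp hp.1 hexp, fun h2 => hp.2 ?_⟩
    rw [hOe]; exact ⟨mem_logAngle_of_exp_mem hb1 h1 (hR.subset h2), h2⟩
  have hexpS : MapsTo exp (O ∪ (fun t => log (γ t)) '' Ioo 0 1) (Ω ∪ γ '' Ioo 0 1) := by
    rintro _ (hl | ⟨t, ht, rfl⟩)
    · grind
    grind
  have hcle : ∀ S ⊆ Ioo (0 : ℝ) 1, ∀ p ∈ closure ((fun t => log (γ t)) '' S),
      exp p ∈ closure (γ '' S) := fun S hS p hp => map_mem_closure continuous_exp hp (by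
    rintro _ ⟨t, ht, rfl⟩
    grind)
  have hlogn : ∀ p : ℂ, p.re = Real.log ‖exp p‖ := fun p => by rw [norm_exp, Real.log_exp]
  have hne0 : ∀ t ∈ Icc (0 : ℝ) 1, ‖γ t‖ ≠ 0 := fun t ht => by
    rcases hin t ht with h1 | h1
    · exact norm_ne_zero_iff.mpr (hR.mapsTo h1).1
    linarith
  obtain ⟨M, hM⟩ := isBounded_iff_forall_norm_le.mp hR.isBounded
  obtain ⟨C, hC⟩ := isCompact_Icc.exists_bound_of_continuousOn (hR.continuousOn.norm.log hne0)
  suffices hs : ∃ μ : ℝ, O = scaledMap b μ '' logSector b by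
    obtain ⟨μ, hμ⟩ := hs; refine ⟨μ, ?_⟩
    rw [← hμ, hO, image_image, image_congr fun z hz => exp_log (hR.subset hz).1, image_id']
  refine exists_eq_image_of_curve (x := Real.log a) (c := c) (γ := fun t => log (γ t))
    (Φ := fun l => Φ (exp l)) (W := fun l => W (exp l)) hb hoO
    (hR.isSimplyConnected.isPathConnected.isConnected.isPreconnected.image _ fun z hz =>
      (hdlog z (hR.subset hz)).continuousAt.continuousWithinAt) hsub
    ⟨Real.log M, fun l hl => ?_⟩ (fun R => ?_) (fun t ht => log_mem_logAngle (hR.mapsTo ht))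
    (fun t ht => ?_) (fun t ht => ?_) ⟨-C, fun t ht => ?_⟩ (fun p hp hpi => ?_) (fun t ht J hJ => ?_)
    (fun t ht => ?_) (fun p hp => ?_) (hW.comp differentiable_exp.differentiableOn hexp)
    (fun z hz => hWΦ _ (hexp z hz)) (hP.contDiffOn.comp contDiff_exp.contDiffOn hexpS)
    (fun t ht => ?_) (fun p hp => ?_) ?_ (fun t ht => ?_)
  · rw [hlogn]; exact log_le_log (norm_pos_iff.mpr (exp_ne_zero _)) (hM _ (hexp l hl))
  · have : (0 : ℂ) ∈ closure Ω := frontier_subset_closure (by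
      rw [hf]
      exact Or.inr ⟨0, le_rfl, ha.le, Or.inl (by simp)⟩)
    obtain ⟨z, h1, h2⟩ := Metric.mem_closure_iff.mp this _ (exp_pos R); rw [dist_zero_left] at h2
    refine ⟨log z, ⟨z, h1, rfl⟩, ?_⟩
    rwa [log_re, log_lt_iff_lt_exp (norm_pos_iff.mpr (hR.subset h1).1)]
  · exact ((contDiffAt_log (openAngle_subset_slitPlane hb1 (hR.mapsTo ht))).restrict_scalars
      ℝ).comp_contDiffWithinAt t (hR.contDiffOn t ht)
  · rw [hdg t ht]; exact mul_ne_zero (inv_ne_zero (hR.mapsTo ht).1) (hR.regular t ht)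
  · rw [log_re]; exact (abs_le.mp (hC t (Ioo_subset_Icc_self ht))).1
  · obtain ⟨t, ht, e⟩ := closure_minimal (image_mono Ioo_subset_Icc_self)
      (isCompact_Icc.image_of_continuousOn hR.continuousOn).isClosed (hcle _ subset_rfl p hp)
    rcases hin t ht with h1 | h1
    · have h2 : |p.im| < _ := mem_logAngle_of_exp_mem hb1 hpi.le (by rw [← e]; exact hR.mapsTo h1)
      exact absurd hpi h2.ne
    grind
  · intro h1; have h2 := hcle _ sdiff_subset _ h1; rw [hel t ht] at h2
    refine notMem_closure_image_diff hR.continuousOn hR.injOn ht (fun h3 => ?_) (fun h3 => ?_) hJ h2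
    · exact (hside a ha.le _ hθ.1).1 (e0 ▸ h3 ▸ hR.mapsTo ht)
    · exact (hside a ha.le _ hθ.2).1 (e1 ▸ h3 ▸ hR.mapsTo ht)
  · rw [hoO.frontier_eq]
    refine ⟨ContinuousWithinAt.mem_closure_image
      (hdlog _ (hR.mapsTo ht)).continuousAt.continuousWithinAt
      (frontier_subset_closure (hfr t ht)), fun h1 => hnot _ (hfr t ht) ?_⟩
    grind
  · obtain ⟨h1, h2⟩ := hfO p hp; rcases hcase _ h2 with ⟨t, ht, e⟩ | ⟨h3, h4⟩
    · exact Or.inl ⟨t, ht, by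
        simp only [e]
        exact log_exp_of_mem hb1 (mem_logAngle_of_exp_mem hb1 h1 (e ▸ hR.mapsTo ht))⟩
    · refine Or.inr ⟨h1.eq_or_lt.resolve_right fun h5 => h3 (exp_mem_openAngle hb1 h5), ?_⟩
      rw [hlogn]; exact log_le_log (norm_pos_iff.mpr (exp_ne_zero _)) h4
  · simp only [hel t ht]; exact hP.eq_zero _ (hfr t ht) (hR.mapsTo ht).1
  · have h1 := (hfO p hp).2
    have h2 := (hP.continuousOn _ ⟨frontier_subset_closure h1, exp_ne_zero p⟩).mono
      (show Ω ⊆ closure Ω \ {0} from fun z hz => ⟨subset_closure hz, (hR.subset hz).1⟩)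
    rw [ContinuousWithinAt, hP.eq_zero _ h1 (exp_ne_zero p)] at h2
    exact h2.comp (continuous_exp.continuousWithinAt.tendsto_nhdsWithin hexp)
  · have h1 : Tendsto exp (comap re atBot ⊓ 𝓟 O) (𝓝[Ω] 0) := by
      refine tendsto_nhdsWithin_iff.mpr ⟨tendsto_exp_comap_re_atBot.mono_left inf_le_left, ?_⟩
      filter_upwards [mem_inf_of_right (mem_principal_self O)] with l hl using hexp l hl
    refine (hP.near_vertex.comp_tendsto h1).congr_right ?_
    filter_upwards [mem_inf_of_right (mem_principal_self O)] with l hl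
    rw [comp_apply, cpow_def_of_ne_zero (exp_ne_zero l),
      log_exp_of_mem hb1 (hsub hl), mul_div_assoc', mul_neg_one]
  · obtain ⟨n, ⟨h1, h2, h3⟩, h4⟩ := hc t ht; have hz := (hR.mapsTo ht).1; simp only [hdg t ht]
    set z := γ t with hzd; have hr : 0 < ‖z‖ := norm_pos_iff.mpr hz
    have hr' : (‖z‖ : ℂ) ≠ 0 := ofReal_ne_zero.mpr hr.ne'
    have hzz : conj z * z = ‖z‖ ^ 2 := conj_mul' z
    -- The normal `n` is rotated by the argument of `1/z`. The straight transversal becomes the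
    -- curved path `log(z + sn)` with velocity `ν/|z|`, where `ν` is the rotated normal. For this
    -- reason the general hypothesis allows any differentiable path in the direction of the normal.
    refine ⟨n * (‖z‖ / z), ?_, ?_, ⟨fun s => log (z + s * n), ‖z‖⁻¹, inv_pos.mpr hr, ?_, by simp, ?_⟩,
      _, HasFDerivWithinAt.comp (log z) (g := Φ) (g' := fderivWithin ℝ Φ (Ω ∪ γ '' Ioo 0 1) z) ?_
      (((hasDerivAt_exp (log z)).hasFDerivAt.restrictScalars ℝ).hasFDerivWithinAt) hexpS, ?_⟩
    · rw [norm_mul, norm_div, norm_real, norm_norm, div_self hr.ne', h1, mul_one]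
    · rw [inner_eq_re_conj_mul] at h2 ⊢
      rw [show conj (z⁻¹ * deriv γ t) * (n * (‖z‖ / z)) = (‖z‖⁻¹ : ℝ) * (conj (deriv γ t) * n) by
          have hc0 : conj z ≠ 0 := (map_ne_zero _).mpr hz; rw [map_mul, map_inv₀, ofReal_inv]
          grind, re_ofReal_mul, h2, mul_zero]
    · have e1 : HasDerivAt (fun s : ℝ => z + s * n) n 0 := by
        simpa using (ofRealCLM.hasDerivAt.mul_const n).const_add z
      have e2 : HasDerivAt log z⁻¹ (z + ((0 : ℝ) : ℂ) * n) := by simpa using hdlog z (hR.mapsTo ht)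
      convert! e2.comp (0 : ℝ) e1 using 1
      push_cast; field_simp
    · have e1 : Tendsto (fun s : ℝ => z + s * n) (𝓝[>] 0) (𝓝 z) :=
        (Continuous.tendsto' (by fun_prop) _ _ (by simp)).mono_left nhdsWithin_le_nhds
      filter_upwards [h3, e1.eventually_ne hz] with ε hε h0
      refine ⟨⟨_, hε.1, by push_cast; ring_nf⟩, fun h5 => hε.2 ?_⟩
      have h6 := hexp _ h5; rwa [exp_log h0] at h6
    · rw [hel t ht]
      exact ((hP.contDiffOn.differentiableOn two_ne_zero) _ (Or.inr ⟨t, ht, rfl⟩)).hasFDerivWithinAt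
    · have e1 : exp (log z) * (n * (‖z‖ / z)) = ‖z‖ • n := by
        rw [exp_log hz, real_smul]; field_simp
      have e2 : (n * (‖z‖ / z)).re = ‖z‖⁻¹ * inner ℝ z n := by
        rw [inner_eq_re_conj_mul, ← re_ofReal_mul]; congr 1; push_cast; grind
      have e3 : rexp (2 * (log z).re) = ‖z‖ ^ 2 := by
        rw [two_mul, Real.exp_add, log_re, Real.exp_log hr, sq]
      rw [e3, e2]
      have e4 : ∀ L : ℂ →L[ℝ] ℝ, (L.comp ((ContinuousLinearMap.toSpanSingleton ℂ
          (exp (log z))).restrictScalars ℝ)) (n * (‖z‖ / z)) = ‖z‖ * L n := fun L => by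
        rw [ContinuousLinearMap.comp_apply, ← smul_eq_mul ‖z‖, ← L.map_smul, ← e1]; simp [mul_comm]
      grind

end

theorem proposition2 (b : ℝ) (hb : 0 < b) :
    -- the problem in the plane
    (b ≤ 1 →
      SatisfiesWedgeODE b (wedgeMap b) ∧
      (∀ r : ℝ, 0 < r →
        SolvesKillingProblem b ((fun ζ => (r : ℂ) * wedgeMap b ζ) '' openSector b)) ∧
      (∀ Ω : Set ℂ, SolvesKillingProblem b Ω → ∃ r : ℝ, 0 < r ∧
        ∀ φ : ℂ → ℂ, IsSectorConformalMap b φ Ω ↔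
          EqOn φ (fun ζ => (r : ℂ) * wedgeMap b ζ) (closedSector b))) ∧
    -- the problem on the helical Riemann surface
    (∀ ℓ ∈ closedLogSector b,
      exp (logWedgeMap b ℓ) = exp ℓ * hypFactor b (exp (ℓ / b))) ∧
    (∀ μ : ℝ,
      SolvesLogKillingProblem b ((fun ℓ => logWedgeMap b ℓ + (μ : ℂ)) '' logSector b)) ∧
    (∀ Ω : Set ℂ, SolvesLogKillingProblem b Ω → ∃ μ : ℝ,
      ∀ φ : ℂ → ℂ, IsLogSectorConformalMap b φ Ω ↔
        EqOn φ (fun ℓ => logWedgeMap b ℓ + (μ : ℂ)) (closedLogSector b)) ∧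
    -- the differential equation and its solution by power series
    (∀ g : ℂ → ℂ, DifferentiableOn ℂ g (Metric.ball 0 1) →
      ((g 0 = 1 ∧ SatisfiesLogWedgeODE b (fun ℓ => exp ℓ * g (exp (ℓ / b)))) ↔
        EqOn g (hypFactor b) (Metric.ball 0 1))) := by
  refine ⟨fun hb1 => ⟨satisfiesWedgeODE_wedgeMap hb hb1, fun r hr => ?_, fun Ω h => ?_⟩,
    fun ℓ hℓ => exp_logWedgeMap hb hℓ, fun μ => solvesLogKillingProblem_image hb μ,
    fun Ω h => ?_, fun g hg => satisfiesLogWedgeODE_iff_eqOn hb hg⟩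
  · rw [image_wedgeMap hb hb1 hr]
    exact solvesKillingProblem_image hb hb1 _
  · obtain ⟨μ, rfl⟩ := exists_eq_image_of_solvesKillingProblem hb hb1 h
    exact ⟨Real.exp μ, Real.exp_pos μ, isSectorConformalMap_iff hb hb1 μ⟩
  · obtain ⟨μ, rfl⟩ := exists_eq_image_of_solvesLogKillingProblem hb h
    exact ⟨μ, isLogSectorConformalMap_iff hb μ⟩
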